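/- **Conventions.** $M$ is a finite-dimensional smooth manifold without boundary, and $(G,H,t,m)$ is a Lie crossed module of finite-dimensional real Lie groups: $t:H\to G$ is a smooth homomorphism and $m$ is a smooth action of $G$ on $H$ by automorphisms, with $t(m(a)(A))=a\,t(A)\,a^{-1}$ and $m(t(A))(B)=ABA^{-1}$. Write $\dot t:\mathfrak h\to\mathfrak g$ and $\dot m(a):\mathfrak h\to\mathfrak h$ for the differentials at the unit of $t$ and of $m(a)$. A $(G,H)$-connection doublet on $M$ is a pair of smooth forms $(\theta,\Upsilon)\in\Omega^1(M,\mathfrak g)\times\Omega^2(M,\mathfrak h)$ with $d\theta+\tfrac12[\theta,\theta]-\dot t(\Upsilon)=0$. A *curve* $\gamma:p_0\to p_1$ is a smooth map $\mathbb R\to M$ for which there is $0<\epsilon<\tfrac12$ with $\gamma(x)=p_0$ for $x<\epsilon$ and $\gamma(x)=p_1$ for $x>1-\epsilon$. For curves $\gamma_0,\gamma_1:p_0\to p_1$, a *surface* $\Sigma:\gamma_0\Rightarrow\gamma_1$ is a smooth map $\mathbb R^2\to M$ for which there is $0<\epsilon<\frac12$ with $\Sigma(x,y)=p_0$ for $x<\epsilon$,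 $=p_1$ for $x>1-\epsilon$, $=\gamma_0(x)$ for $y<\epsilon$, $=\gamma_1(x)$ for $y>1-\epsilon$. Put $\iota_p(x)=p$, $\gamma^{-1_\circ}(x)=\gamma(1-x)$, $I_\gamma(x,y)=\gamma(x)$, $\Sigma^{-1_\bullet}(x,y)=\Sigma(x,1-y)$, $\Sigma^{-1_\circ}(x,y)=\Sigma(1-x,y)$. The composites $\gamma_2\circ\gamma_1$ and $\Sigma_2\circ\Sigma_1$ (horizontal) are obtained by running first the map with index $1$ and then the map with index $2$ at double speed in $x$; $\Sigma_2\bullet\Sigma_1$ (vertical) is obtained in the same way in $y$. A *thin homotopy* of curves $\gamma_0,\gamma_1:p_0\to p_1$ is a surface $h:\gamma_0\Rightarrow\gamma_1$ with $\operatorname{rank}dh\le1$ everywhere. A *thin homotopy* of surfaces $\Sigma_0:\gamma_0\Rightarrow\gamma_1$, $\Sigma_1:\gamma_2\Rightarrow\gamma_3$ (all curves $p_0\to p_1$) is a smooth map $K:\mathbb R^3\to M$ for which there is $0<\epsilon<\frac12$ with $K(x,y,z)=p_0$ for $x<\epsilon$, $=p_1$ for $x>1-\epsilon$, $=K(x,0,z)$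 for $y<\epsilon$, $=K(x,1,z)$ for $y>1-\epsilon$, $=\Sigma_0(x,y)$ for $z<\epsilon$, $=\Sigma_1(x,y)$ for $z>1-\epsilon$, and with $\operatorname{rank}dK\le2$ everywhere and $\operatorname{rank}dK\le1$ at all points $(x,0,z)$ and $(x,1,z)$. $P_1M$ and $P_2M$ are the sets of thin homotopy classes of curves and of surfaces. A *$(G,H)$-cocycle* is a triple of smooth maps $f(x',x;y)\in G$, $g(x;y',y)\in G$, $W(x',x;y',y)\in H$ of real variables with $$t(W(x',x;y',y))=g(x;y',y)^{-1}f(x',x;y')^{-1}g(x';y',y)f(x',x;y),$$ $$f(x'',x;y)=f(x'',x';y)f(x',x;y),\qquad g(x;y'',y)=g(x;y'',y')g(x;y',y),$$ $$W(x'',x;y',y)=W(x',x;y',y)\,m(f(x',x;y)^{-1})(W(x'',x';y',y)),$$ $$W(x',x;y'',y)=m(g(x;y',y)^{-1})(W(x',x;y'',y'))\,W(x',x;y',y).$$ The cocycle $(f,g,W)$ *associated* with a doublet $(a,B)$ on $\mathbb R^2$, $a=a_xdx+a_ydy$, $B=B_{xy}dx\wedge dy$, is the smooth solution of $$\partial_xf(x,x_0;y)\,f(x,x_0;y)^{-1}=-a_x(x,y),\qquad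 \partial_yg(x;y,y_0)\,g(x;y,y_0)^{-1}=-a_y(x,y),$$ $$\partial_x\big(\partial_yW(x,x_0;y,y_0)\,W(x,x_0;y,y_0)^{-1}\big)=-\dot m\big(g(x_0;y,y_0)^{-1}f(x,x_0;y)^{-1}\big)(B_{xy}(x,y)),$$ with $f(x_0,x_0;y)=g(x;y_0,y_0)=1$ and $W(x_0,x_0;y,y_0)=W(x,x_0;y_0,y_0)=1$. $B_0(G,H)$ is the strict 2-group with one 0-cell, 1-cells the elements of $G$, and 2-cells $X:a\Rightarrow t(X)a$ ($a\in G$, $X\in H$). The composite of 1-cells is the product in $G$; the vertical composite of $X:a\Rightarrow t(X)a$ and $Y:t(X)a\Rightarrow t(Y)t(X)a$ is $YX$; the horizontal composite of $X_1:a_1\Rightarrow t(X_1)a_1$ and $X_2:a_2\Rightarrow t(X_2)a_2$ is $X_2\,m(a_2)(X_1):a_2a_1\Rightarrow t(X_2)a_2t(X_1)a_1$. **Statement.** Let $(\theta,\Upsilon)$ be a $(G,H)$-connection doublet on $M$. 1. For every surface $\Sigma:\gamma_0\Rightarrow\gamma_1$ the pair $(\Sigma^*\theta,\Sigma^*\Upsilon)$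 is a $(G,H)$-connection doublet on $\mathbb R^2$; the differential problem above for this pair has a unique solution $(f_\Sigma,g_\Sigma,W_\Sigma)$, and this solution is a $(G,H)$-cocycle. Define $$F(\gamma)=f_{I_\gamma}(1,0;0),\qquad F(\Sigma)=W_\Sigma(0,1;1,0).$$ Then $f_{I_\gamma}(1,0;y)=F(\gamma)$ for all $y$; for every $\Sigma:\gamma_0\Rightarrow\gamma_1$ one has $f_\Sigma(1,0;0)=F(\gamma_0)$, $f_\Sigma(1,0;1)=F(\gamma_1)$ and $F(\gamma_1)=t(F(\Sigma))F(\gamma_0)$. 2. For all points, curves and surfaces for which the expressions make sense, $$F(\iota_p)=1,\quad F(\gamma^{-1_\circ})=F(\gamma)^{-1},\quad F(\gamma_2\circ\gamma_1)=F(\gamma_2)F(\gamma_1),$$ $$F(I_\gamma)=1,\quad F(\Sigma^{-1_\bullet})=F(\Sigma)^{-1},\quad F(\Sigma_2\bullet\Sigma_1)=F(\Sigma_2)F(\Sigma_1),$$ $$F(\Sigma^{-1_\circ})=m(F(\gamma_0)^{-1})(F(\Sigma)^{-1})\quad\text{for }\Sigma:\gamma_0\Rightarrow\gamma_1,$$ $$F(\Sigma_2\circ\Sigma_1)=F(\Sigma_2)\,m(F(\gamma_2))(F(\Sigma_1))\quad\text{for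 }\Sigma_1:\gamma_0\Rightarrow\gamma_1,\ \Sigma_2:\gamma_2\Rightarrow\gamma_3 .$$ 3. There is exactly one strict 2-groupoid $(M,P_1M,P_2M)$ with 0-cells the points of $M$, 1-cells the elements of $P_1M$ and 2-cells the elements of $P_2M$ whose sources, targets, units, inverses and composites are those induced by the operations above on curves and surfaces. $F$ is constant on thin homotopy classes, and the induced maps $[\gamma]\mapsto F(\gamma)$ and $[\Sigma:\gamma_0\Rightarrow\gamma_1]\mapsto\big(F(\Sigma):F(\gamma_0)\Rightarrow F(\gamma_1)\big)$ define a (unique) strict 2-functor $\bar F:(M,P_1M,P_2M)\to B_0(G,H)$. -/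

import Mathlib

open scoped Manifold ContDiff

namespace TwoTransport

/-! ## Strict 2-groupoids and strict 2-functors -/

/-- A strict 2-groupoid with 0-cells `Ob`, 1-cells `p → q` the type `C₁ p q`, and `C₂ p q` the type
of all 2-cells between 1-cells `p → q` (the source and target 1-cells are given by `src`, `tgt`).
Composites are written in the order of maps: `comp₁ b a` is "first `a`, then `b`". -/
@[ext]
structure StrictTwoGroupoid (Ob : Type*) (C₁ : Ob → Ob → Type*) (C₂ : Ob → Ob → Type*) where
  src : ∀ {p q : Ob}, C₂ p q → C₁ p q
  tgt : ∀ {p q : Ob}, C₂ p q → C₁ p q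
  id₁ : ∀ p : Ob, C₁ p p
  comp₁ : ∀ {p q r : Ob}, C₁ q r → C₁ p q → C₁ p r
  inv₁ : ∀ {p q : Ob}, C₁ p q → C₁ q p
  id₂ : ∀ {p q : Ob}, C₁ p q → C₂ p q
  vcomp : ∀ {p q : Ob} (τ σ : C₂ p q), tgt σ = src τ → C₂ p q
  vinv : ∀ {p q : Ob}, C₂ p q → C₂ p q
  hcomp : ∀ {p q r : Ob}, C₂ q r → C₂ p q → C₂ p r
  hinv : ∀ {p q : Ob}, C₂ p q → C₂ q p
  -- the 1-cells form a groupoid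
  comp₁_assoc : ∀ {p q r s : Ob} (c : C₁ r s) (b : C₁ q r) (a : C₁ p q),
    comp₁ (comp₁ c b) a = comp₁ c (comp₁ b a)
  comp₁_id₁ : ∀ {p q : Ob} (a : C₁ p q), comp₁ a (id₁ p) = a
  id₁_comp₁ : ∀ {p q : Ob} (a : C₁ p q), comp₁ (id₁ q) a = a
  inv₁_comp₁ : ∀ {p q : Ob} (a : C₁ p q), comp₁ (inv₁ a) a = id₁ p
  comp₁_inv₁ : ∀ {p q : Ob} (a : C₁ p q), comp₁ a (inv₁ a) = id₁ q
  -- sources and targets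
  src_id₂ : ∀ {p q : Ob} (a : C₁ p q), src (id₂ a) = a
  tgt_id₂ : ∀ {p q : Ob} (a : C₁ p q), tgt (id₂ a) = a
  src_vcomp : ∀ {p q : Ob} (τ σ : C₂ p q) (h : tgt σ = src τ), src (vcomp τ σ h) = src σ
  tgt_vcomp : ∀ {p q : Ob} (τ σ : C₂ p q) (h : tgt σ = src τ), tgt (vcomp τ σ h) = tgt τ
  src_vinv : ∀ {p q : Ob} (σ : C₂ p q), src (vinv σ) = tgt σ
  tgt_vinv : ∀ {p q : Ob} (σ : C₂ p q), tgt (vinv σ) = src σ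
  src_hcomp : ∀ {p q r : Ob} (τ : C₂ q r) (σ : C₂ p q),
    src (hcomp τ σ) = comp₁ (src τ) (src σ)
  tgt_hcomp : ∀ {p q r : Ob} (τ : C₂ q r) (σ : C₂ p q),
    tgt (hcomp τ σ) = comp₁ (tgt τ) (tgt σ)
  src_hinv : ∀ {p q : Ob} (σ : C₂ p q), src (hinv σ) = inv₁ (src σ)
  tgt_hinv : ∀ {p q : Ob} (σ : C₂ p q), tgt (hinv σ) = inv₁ (tgt σ)
  -- vertical composition
  vcomp_assoc : ∀ {p q : Ob} (υ τ σ : C₂ p q) (h₁ : tgt σ = src τ) (h₂ : tgt τ = src υ),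
    vcomp (vcomp υ τ h₂) σ (h₁.trans (src_vcomp υ τ h₂).symm) =
      vcomp υ (vcomp τ σ h₁) ((tgt_vcomp τ σ h₁).trans h₂)
  vcomp_id₂ : ∀ {p q : Ob} (σ : C₂ p q), vcomp σ (id₂ (src σ)) (tgt_id₂ _) = σ
  id₂_vcomp : ∀ {p q : Ob} (σ : C₂ p q), vcomp (id₂ (tgt σ)) σ (src_id₂ _).symm = σ
  vinv_vcomp : ∀ {p q : Ob} (σ : C₂ p q),
    vcomp (vinv σ) σ (src_vinv σ).symm = id₂ (src σ)
  vcomp_vinv : ∀ {p q : Ob} (σ : C₂ p q),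
    vcomp σ (vinv σ) (tgt_vinv σ) = id₂ (tgt σ)
  -- horizontal composition
  hcomp_assoc : ∀ {p q r s : Ob} (υ : C₂ r s) (τ : C₂ q r) (σ : C₂ p q),
    hcomp (hcomp υ τ) σ = hcomp υ (hcomp τ σ)
  hcomp_id₂ : ∀ {p q : Ob} (σ : C₂ p q), hcomp σ (id₂ (id₁ p)) = σ
  id₂_hcomp : ∀ {p q : Ob} (σ : C₂ p q), hcomp (id₂ (id₁ q)) σ = σ
  hinv_hcomp : ∀ {p q : Ob} (σ : C₂ p q), hcomp (hinv σ) σ = id₂ (id₁ p)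
  hcomp_hinv : ∀ {p q : Ob} (σ : C₂ p q), hcomp σ (hinv σ) = id₂ (id₁ q)
  -- compatibility of the two compositions
  hcomp_id₂_id₂ : ∀ {p q r : Ob} (b : C₁ q r) (a : C₁ p q),
    hcomp (id₂ b) (id₂ a) = id₂ (comp₁ b a)
  exchange : ∀ {p q r : Ob} (τ' τ : C₂ q r) (σ' σ : C₂ p q)
    (hτ : tgt τ = src τ') (hσ : tgt σ = src σ'),
    hcomp (vcomp τ' τ hτ) (vcomp σ' σ hσ) =
      vcomp (hcomp τ' σ') (hcomp τ σ) (by rw [tgt_hcomp, src_hcomp, hτ, hσ])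

/-- A strict 2-functor between strict 2-groupoids. -/
@[ext]
structure StrictTwoFunctor {Ob Ob' : Type*} {C₁ C₂ : Ob → Ob → Type*} {D₁ D₂ : Ob' → Ob' → Type*}
    (P : StrictTwoGroupoid Ob C₁ C₂) (Q : StrictTwoGroupoid Ob' D₁ D₂) where
  obj : Ob → Ob'
  map₁ : ∀ {p q : Ob}, C₁ p q → D₁ (obj p) (obj q)
  map₂ : ∀ {p q : Ob}, C₂ p q → D₂ (obj p) (obj q)
  map_src : ∀ {p q : Ob} (σ : C₂ p q), Q.src (map₂ σ) = map₁ (P.src σ)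
  map_tgt : ∀ {p q : Ob} (σ : C₂ p q), Q.tgt (map₂ σ) = map₁ (P.tgt σ)
  map_id₁ : ∀ p : Ob, map₁ (P.id₁ p) = Q.id₁ (obj p)
  map_comp₁ : ∀ {p q r : Ob} (b : C₁ q r) (a : C₁ p q),
    map₁ (P.comp₁ b a) = Q.comp₁ (map₁ b) (map₁ a)
  map_inv₁ : ∀ {p q : Ob} (a : C₁ p q), map₁ (P.inv₁ a) = Q.inv₁ (map₁ a)
  map_id₂ : ∀ {p q : Ob} (a : C₁ p q), map₂ (P.id₂ a) = Q.id₂ (map₁ a)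
  map_vcomp : ∀ {p q : Ob} (τ σ : C₂ p q) (h : P.tgt σ = P.src τ),
    map₂ (P.vcomp τ σ h) = Q.vcomp (map₂ τ) (map₂ σ) (by rw [map_tgt, map_src, h])
  map_vinv : ∀ {p q : Ob} (σ : C₂ p q), map₂ (P.vinv σ) = Q.vinv (map₂ σ)
  map_hcomp : ∀ {p q r : Ob} (τ : C₂ q r) (σ : C₂ p q),
    map₂ (P.hcomp τ σ) = Q.hcomp (map₂ τ) (map₂ σ)
  map_hinv : ∀ {p q : Ob} (σ : C₂ p q), map₂ (P.hinv σ) = Q.hinv (map₂ σ)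

/-! ## Lie crossed modules -/

/-- A Lie crossed module `(G, H, t, m)`. -/
structure LieCrossedModule (EG G EH H : Type*)
    [NormedAddCommGroup EG] [NormedSpace ℝ EG] [TopologicalSpace G] [ChartedSpace EG G] [Group G]
    [NormedAddCommGroup EH] [NormedSpace ℝ EH] [TopologicalSpace H] [ChartedSpace EH H]
    [Group H] where
  t : H →* G
  m : G →* MulAut H
  t_smooth : ContMDiff 𝓘(ℝ, EH) 𝓘(ℝ, EG) ∞ t
  m_smooth : ContMDiff (𝓘(ℝ, EG).prod 𝓘(ℝ, EH)) 𝓘(ℝ, EH) ∞ (fun z : G × H => m z.1 z.2)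
  t_m : ∀ (a : G) (A : H), t (m a A) = a * t A * a⁻¹
  m_t : ∀ A B : H, m (t A) B = A * B * A⁻¹

section Lie

variable {EG G EH H : Type*}
  [NormedAddCommGroup EG] [NormedSpace ℝ EG] [TopologicalSpace G] [ChartedSpace EG G] [Group G]
  [NormedAddCommGroup EH] [NormedSpace ℝ EH] [TopologicalSpace H] [ChartedSpace EH H] [Group H]

/-- The strict 2-group `B₀(G, H)`: one 0-cell; the 1-cells are the elements of `G`; the 2-cells are
the pairs `(a, X)`, regarded as `X : a ⇒ t(X) a`. -/
def LieCrossedModule.delooping (C : LieCrossedModule EG G EH H) :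
    StrictTwoGroupoid Unit (fun _ _ => G) (fun _ _ => G × H) where
  src σ := σ.1
  tgt σ := C.t σ.2 * σ.1
  id₁ _ := 1
  comp₁ b a := b * a
  inv₁ a := a⁻¹
  id₂ a := (a, 1)
  vcomp τ σ _ := (σ.1, τ.2 * σ.2)
  vinv σ := (C.t σ.2 * σ.1, σ.2⁻¹)
  hcomp τ σ := (τ.1 * σ.1, τ.2 * C.m τ.1 σ.2)
  hinv σ := (σ.1⁻¹, C.m σ.1⁻¹ σ.2⁻¹)
  comp₁_assoc c b a := mul_assoc c b a
  comp₁_id₁ a := mul_one a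
  id₁_comp₁ a := one_mul a
  inv₁_comp₁ a := inv_mul_cancel a
  comp₁_inv₁ a := mul_inv_cancel a
  src_id₂ _ := rfl
  tgt_id₂ a := by simp
  src_vcomp _ _ _ := rfl
  tgt_vcomp τ σ h := by simp only [map_mul, mul_assoc]; rw [h]
  src_vinv _ := rfl
  tgt_vinv σ := by simp
  src_hcomp _ _ := rfl
  tgt_hcomp τ σ := by simp [C.t_m, mul_assoc]
  src_hinv _ := rfl
  tgt_hinv σ := by
    change C.t (C.m σ.1⁻¹ σ.2⁻¹) * σ.1⁻¹ = (C.t σ.2 * σ.1)⁻¹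
    rw [C.t_m, map_inv]
    group
  vcomp_assoc υ τ σ _ _ := by simp [mul_assoc]
  vcomp_id₂ σ := by simp
  id₂_vcomp σ := by simp
  vinv_vcomp σ := by simp
  vcomp_vinv σ := by simp
  hcomp_assoc υ τ σ := by simp [mul_assoc]
  hcomp_id₂ σ := by simp
  id₂_hcomp σ := by simp
  hinv_hcomp σ := by ext <;> simp
  hcomp_hinv σ := by ext <;> simp
  hcomp_id₂_id₂ b a := by simp
  exchange τ' τ σ' σ hτ hσ := by
    ext
    · rfl
    · have h : C.m τ'.1 σ'.2 = τ.2 * C.m τ.1 σ'.2 * τ.2⁻¹ := by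
        rw [← hτ, map_mul, MulAut.mul_apply, C.m_t]
      simp [h, mul_assoc]

/-- The bracket of the Lie algebra `𝔤 = T₁G`; in Mathlib the vector space `T₁G` is by definition the
model space `EG`. -/
noncomputable def lieBr (EG G : Type*) [NormedAddCommGroup EG] [NormedSpace ℝ EG]
    [TopologicalSpace G] [ChartedSpace EG G] [Group G] (x y : EG) : EG :=
  Bracket.bracket (L := GroupLieAlgebra 𝓘(ℝ, EG) G) (M := GroupLieAlgebra 𝓘(ℝ, EG) G) x y

/-- The differential `𝔥 → 𝔤` of `t` at the unit. -/
noncomputable def LieCrossedModule.tDot (C : LieCrossedModule EG G EH H) : EH →L[ℝ] EG :=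
  mfderiv 𝓘(ℝ, EH) 𝓘(ℝ, EG) C.t (1 : H)

/-- The differential `𝔥 → 𝔥` of the automorphism `m(a)` at the unit. -/
noncomputable def LieCrossedModule.mDot (C : LieCrossedModule EG G EH H) (a : G) : EH →L[ℝ] EH :=
  mfderiv 𝓘(ℝ, EH) 𝓘(ℝ, EH) (C.m a) (1 : H)

/-- The right logarithmic derivative `u'(x) u(x)⁻¹ ∈ 𝔤` of a curve `u` in a Lie group. -/
noncomputable def rlogDeriv {EG G : Type*} [NormedAddCommGroup EG] [NormedSpace ℝ EG]
    [TopologicalSpace G] [ChartedSpace EG G] [Group G] (u : ℝ → G) (x : ℝ) : EG :=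
  mfderiv 𝓘(ℝ, ℝ) 𝓘(ℝ, EG) (fun s => u s * (u x)⁻¹) x (1 : ℝ)

end Lie

/-! ## Differential forms on manifolds -/

section Forms

variable {E M E' M' : Type*}
  [NormedAddCommGroup E] [NormedSpace ℝ E] [TopologicalSpace M] [ChartedSpace E M]
  [NormedAddCommGroup E'] [NormedSpace ℝ E'] [TopologicalSpace M'] [ChartedSpace E' M']
  {V : Type*} [NormedAddCommGroup V] [NormedSpace ℝ V] {k : ℕ}

/-- `V`-valued `k`-forms on `M` (fields of alternating maps, not necessarily smooth). -/
abbrev DForm (E M : Type*) [NormedAddCommGroup E] [NormedSpace ℝ E] [TopologicalSpace M]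
    [ChartedSpace E M] (k : ℕ) (V : Type*) [NormedAddCommGroup V] [NormedSpace ℝ V] :=
  ∀ p : M, TangentSpace 𝓘(ℝ, E) p [⋀^Fin k]→L[ℝ] V

/-- The pull-back of a form along a map. -/
noncomputable def pullback (F : M' → M) (η : DForm E M k V) : DForm E' M' k V :=
  fun p => (η (F p)).compContinuousLinearMap (mfderiv 𝓘(ℝ, E') 𝓘(ℝ, E) F p)

/-- The expression of a form in the preferred chart at `p`. -/
noncomputable def inChart (η : DForm E M k V) (p : M) : E → E [⋀^Fin k]→L[ℝ] V :=
  fun e => (η ((extChartAt 𝓘(ℝ, E) p).symm e)).compContinuousLinearMap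
    (mfderiv 𝓘(ℝ, E) 𝓘(ℝ, E) (extChartAt 𝓘(ℝ, E) p).symm e)

/-- A form is smooth if it is smooth in charts. -/
def SmoothForm (η : DForm E M k V) : Prop :=
  ∀ p : M, ContDiffOn ℝ ∞ (inChart η p) (extChartAt 𝓘(ℝ, E) p).target

/-- The exterior derivative, computed in the preferred chart at each point. -/
noncomputable def dForm (η : DForm E M k V) : DForm E M (k + 1) V :=
  fun p => (extDeriv (inChart η p) (extChartAt 𝓘(ℝ, E) p p)).compContinuousLinearMap
    (mfderiv 𝓘(ℝ, E) 𝓘(ℝ, E) (extChartAt 𝓘(ℝ, E) p) p)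

end Forms

/-! ## Connection doublets and cocycles -/

section Cocycles

variable {EG G EH H : Type*}
  [NormedAddCommGroup EG] [NormedSpace ℝ EG] [TopologicalSpace G] [ChartedSpace EG G] [Group G]
  [NormedAddCommGroup EH] [NormedSpace ℝ EH] [TopologicalSpace H] [ChartedSpace EH H] [Group H]

/-- `(θ, Υ) ∈ Ω¹(M, 𝔤) × Ω²(M, 𝔥)` is a `(G, H)`-connection doublet: both forms are smooth and
`dθ + ½[θ, θ] - ṫ(Υ) = 0`. Here `½[θ, θ](v, w) = [θ(v), θ(w)]`. -/
structure IsConnectionDoublet {E M : Type*} [NormedAddCommGroup E] [NormedSpace ℝ E]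
    [TopologicalSpace M] [ChartedSpace E M] (C : LieCrossedModule EG G EH H)
    (θ : DForm E M 1 EG) (Υ : DForm E M 2 EH) : Prop where
  smooth_one : SmoothForm θ
  smooth_two : SmoothForm Υ
  fake_flat : ∀ (p : M) (v w : TangentSpace 𝓘(ℝ, E) p),
    dForm θ p ![v, w] + lieBr EG G (θ p ![v]) (θ p ![w]) - C.tDot (Υ p ![v, w]) = 0

/-- Three maps `f(x', x; y)`, `g(x; y', y)` and `W(x', x; y', y)`. -/
@[ext]
structure CocycleData (G H : Type*) where
  f : ℝ → ℝ → ℝ → G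
  g : ℝ → ℝ → ℝ → G
  W : ℝ → ℝ → ℝ → ℝ → H

/-- Smoothness of the three maps. -/
structure CocycleData.Smooth (EG EH : Type*) {G H : Type*}
    [NormedAddCommGroup EG] [NormedSpace ℝ EG] [TopologicalSpace G] [ChartedSpace EG G]
    [NormedAddCommGroup EH] [NormedSpace ℝ EH] [TopologicalSpace H] [ChartedSpace EH H]
    (c : CocycleData G H) : Prop where
  f_smooth : ContMDiff 𝓘(ℝ, ℝ × ℝ × ℝ) 𝓘(ℝ, EG) ∞
    (fun z : ℝ × ℝ × ℝ => c.f z.1 z.2.1 z.2.2)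
  g_smooth : ContMDiff 𝓘(ℝ, ℝ × ℝ × ℝ) 𝓘(ℝ, EG) ∞
    (fun z : ℝ × ℝ × ℝ => c.g z.1 z.2.1 z.2.2)
  W_smooth : ContMDiff 𝓘(ℝ, ℝ × ℝ × ℝ × ℝ) 𝓘(ℝ, EH) ∞
    (fun z : ℝ × ℝ × ℝ × ℝ => c.W z.1 z.2.1 z.2.2.1 z.2.2.2)

/-- `(G, H)`-cocycles. -/
structure IsCocycle (C : LieCrossedModule EG G EH H) (c : CocycleData G H) : Prop where
  smooth : c.Smooth EG EH
  target : ∀ x' x y' y, C.t (c.W x' x y' y) =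
    (c.g x y' y)⁻¹ * (c.f x' x y')⁻¹ * c.g x' y' y * c.f x' x y
  f_comp : ∀ x'' x' x y, c.f x'' x y = c.f x'' x' y * c.f x' x y
  g_comp : ∀ x y'' y' y, c.g x y'' y = c.g x y'' y' * c.g x y' y
  W_comp_x : ∀ x'' x' x y' y,
    c.W x'' x y' y = c.W x' x y' y * C.m (c.f x' x y)⁻¹ (c.W x'' x' y' y)
  W_comp_y : ∀ x' x y'' y' y,
    c.W x' x y'' y = C.m (c.g x y' y)⁻¹ (c.W x' x y'' y') * c.W x' x y' y

/-- The differential problem that defines the cocycle `(f, g, W)` of a pair `(a, B)` of forms on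
`ℝ²`, where `a = a_x dx + a_y dy` and `B = B_xy dx ∧ dy`:
`∂ₓf f⁻¹ = -a_x`, `∂_y g g⁻¹ = -a_y`, `∂ₓ(∂_y W W⁻¹) = -ṁ(g⁻¹ f⁻¹)(B_xy)`, with value `1` at
the base points. -/
structure SolvesProblem (C : LieCrossedModule EG G EH H)
    (a : DForm (ℝ × ℝ) (ℝ × ℝ) 1 EG) (B : DForm (ℝ × ℝ) (ℝ × ℝ) 2 EH)
    (c : CocycleData G H) : Prop where
  smooth : c.Smooth EG EH
  f_eq : ∀ x₀ x y : ℝ,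
    rlogDeriv (fun s => c.f s x₀ y) x = -(a (x, y) ![((1, 0) : ℝ × ℝ)])
  f_init : ∀ x₀ y : ℝ, c.f x₀ x₀ y = 1
  g_eq : ∀ x y₀ y : ℝ,
    rlogDeriv (fun s => c.g x s y₀) y = -(a (x, y) ![((0, 1) : ℝ × ℝ)])
  g_init : ∀ x y₀ : ℝ, c.g x y₀ y₀ = 1
  W_eq : ∀ x₀ y₀ x y : ℝ,
    HasDerivAt (fun s => rlogDeriv (EG := EH) (fun r => c.W s x₀ r y₀) y)
      (-(C.mDot ((c.g x₀ y y₀)⁻¹ * (c.f x x₀ y)⁻¹)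
        (B (x, y) ![((1, 0) : ℝ × ℝ), ((0, 1) : ℝ × ℝ)]))) x
  W_init_x : ∀ x₀ y y₀ : ℝ, c.W x₀ x₀ y y₀ = 1
  W_init_y : ∀ x x₀ y₀ : ℝ, c.W x x₀ y₀ y₀ = 1

open Classical in
/-- The cocycle `(f_{a,B}, g_{a,B}, W_{a,B})` associated with a pair of forms on `ℝ²`: the solution
of the differential problem (trivial if there is none). -/
noncomputable def cocycleOf (C : LieCrossedModule EG G EH H)
    (a : DForm (ℝ × ℝ) (ℝ × ℝ) 1 EG) (B : DForm (ℝ × ℝ) (ℝ × ℝ) 2 EH) : CocycleData G H :=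
  if h : ∃ c : CocycleData G H, SolvesProblem C a B c then h.choose else ⟨1, 1, 1⟩

end Cocycles

/-! ## Curves and surfaces with sitting instants -/

section Paths

/-- Two smooth maps that agree near the level set `φ = c` may be glued along it. -/
theorem glue_smooth {N E M : Type*} [NormedAddCommGroup N] [NormedSpace ℝ N]
    [NormedAddCommGroup E] [NormedSpace ℝ E] [TopologicalSpace M] [ChartedSpace E M]
    {f g : N → M} (hf : ContMDiff 𝓘(ℝ, N) 𝓘(ℝ, E) ∞ f) (hg : ContMDiff 𝓘(ℝ, N) 𝓘(ℝ, E) ∞ g)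
    {φ : N → ℝ} (hφ : Continuous φ) {c δ : ℝ} (hδ : 0 < δ)
    (h : ∀ n, |φ n - c| < δ → f n = g n) :
    ContMDiff 𝓘(ℝ, N) 𝓘(ℝ, E) ∞ (fun n => if φ n ≤ c then f n else g n) := by
  intro n
  rcases lt_trichotomy (φ n) c with hn | hn | hn
  · refine (hf n).congr_of_eventuallyEq ?_
    filter_upwards [hφ.continuousAt.eventually_lt continuousAt_const hn] with z hz
    simp [hz.le]
  · refine (hf n).congr_of_eventuallyEq ?_
    have h1 : ContinuousAt (fun z => |φ z - c|) n :=
      ((hφ.sub continuous_const).abs).continuousAt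
    filter_upwards [h1.eventually_lt continuousAt_const (by simpa [hn] using hδ)] with z hz
    by_cases hc : φ z ≤ c
    · simp [hc]
    · simp [hc, h z hz]
  · refine (hg n).congr_of_eventuallyEq ?_
    filter_upwards [continuousAt_const.eventually_lt hφ.continuousAt hn] with z hz
    simp [not_le.mpr hz]

variable (E : Type*) {M : Type*} [NormedAddCommGroup E] [NormedSpace ℝ E] [TopologicalSpace M]
  [ChartedSpace E M]

/-- Curves `p → q` with sitting instants. -/
structure Curve (p q : M) where
  toFun : ℝ → M
  smooth : ContMDiff 𝓘(ℝ, ℝ) 𝓘(ℝ, E) ∞ toFun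
  sitting : ∃ ε : ℝ, 0 < ε ∧ ε < 1 / 2 ∧ (∀ x, x < ε → toFun x = p) ∧
    (∀ x, 1 - ε < x → toFun x = q)

variable {E}

/-- Surfaces `γ₀ ⇒ γ₁` with sitting instants. -/
structure Surface {p q : M} (γ₀ γ₁ : Curve E p q) where
  toFun : ℝ × ℝ → M
  smooth : ContMDiff 𝓘(ℝ, ℝ × ℝ) 𝓘(ℝ, E) ∞ toFun
  sitting : ∃ ε : ℝ, 0 < ε ∧ ε < 1 / 2 ∧
    (∀ x y, x < ε → toFun (x, y) = p) ∧ (∀ x y, 1 - ε < x → toFun (x, y) = q) ∧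
    (∀ x y, y < ε → toFun (x, y) = γ₀.toFun x) ∧ (∀ x y, 1 - ε < y → toFun (x, y) = γ₁.toFun x)

/-- The unit curve `ι_p`. -/
def Curve.unit (p : M) : Curve E p p where
  toFun _ := p
  smooth := contMDiff_const
  sitting := ⟨1 / 4, by norm_num, by norm_num, fun _ _ => rfl, fun _ _ => rfl⟩

/-- The inverse curve. -/
def Curve.inv {p q : M} (γ : Curve E p q) : Curve E q p where
  toFun x := γ.toFun (1 - x)
  smooth := γ.smooth.comp (by rw [contMDiff_iff_contDiff]; fun_prop)
  sitting := by
    obtain ⟨ε, h0, h1, h2, h3⟩ := γ.sitting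
    exact ⟨ε, h0, h1, fun x hx => h3 _ (by linarith), fun x hx => h2 _ (by linarith)⟩

/-- The composite `γ₂ ∘ γ₁` (first `γ₁`, then `γ₂`). -/
noncomputable def Curve.comp {p q r : M} (γ₂ : Curve E q r) (γ₁ : Curve E p q) : Curve E p r where
  toFun x := if x ≤ 1 / 2 then γ₁.toFun (2 * x) else γ₂.toFun (2 * x - 1)
  smooth := by
    obtain ⟨ε, h0, h1, h2, h3⟩ := γ₁.sitting
    obtain ⟨ε', h0', h1', h2', h3'⟩ := γ₂.sitting
    refine glue_smooth (φ := fun x => x) (c := 1 / 2) (δ := min ε ε' / 2)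
      (γ₁.smooth.comp (by rw [contMDiff_iff_contDiff]; fun_prop))
      (γ₂.smooth.comp (by rw [contMDiff_iff_contDiff]; fun_prop))
      continuous_id (half_pos (lt_min h0 h0')) ?_
    intro x hx
    have ha := min_le_left ε ε'
    have hb := min_le_right ε ε'
    rw [abs_lt] at hx
    change γ₁.toFun (2 * x) = γ₂.toFun (2 * x - 1)
    rw [h3 _ (by linarith), h2' _ (by linarith)]
  sitting := by
    obtain ⟨ε, h0, h1, h2, h3⟩ := γ₁.sitting
    obtain ⟨ε', h0', h1', h2', h3'⟩ := γ₂.sitting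
    have ha := min_le_left ε ε'
    have hb := min_le_right ε ε'
    refine ⟨min ε ε' / 2, half_pos (lt_min h0 h0'), by linarith, fun x hx => ?_, fun x hx => ?_⟩
    · rw [if_pos (by linarith)]
      exact h2 _ (by linarith)
    · rw [if_neg (by linarith)]
      exact h3' _ (by linarith)

/-- The unit surface `I_γ`. -/
def Surface.unit {p q : M} (γ : Curve E p q) : Surface γ γ where
  toFun z := γ.toFun z.1
  smooth := γ.smooth.comp (by rw [contMDiff_iff_contDiff]; fun_prop)
  sitting := by
    obtain ⟨ε, h0, h1, h2, h3⟩ := γ.sitting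
    exact ⟨ε, h0, h1, fun x _ hx => h2 x hx, fun x _ hx => h3 x hx, fun _ _ _ => rfl,
      fun _ _ _ => rfl⟩

/-- The vertical inverse. -/
def Surface.vinv {p q : M} {γ₀ γ₁ : Curve E p q} (S : Surface γ₀ γ₁) : Surface γ₁ γ₀ where
  toFun z := S.toFun (z.1, 1 - z.2)
  smooth := S.smooth.comp (by rw [contMDiff_iff_contDiff]; fun_prop)
  sitting := by
    obtain ⟨ε, h0, h1, h2, h3, h4, h5⟩ := S.sitting
    exact ⟨ε, h0, h1, fun x y hx => h2 x _ hx, fun x y hx => h3 x _ hx,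
      fun x y hy => h5 x _ (by dsimp only; linarith),
      fun x y hy => h4 x _ (by dsimp only; linarith)⟩

/-- The vertical composite `S₂ • S₁` (first `S₁`, then `S₂`). -/
noncomputable def Surface.vcomp {p q : M} {γ₀ γ₁ γ₂ : Curve E p q} (S₂ : Surface γ₁ γ₂)
    (S₁ : Surface γ₀ γ₁) : Surface γ₀ γ₂ where
  toFun z := if z.2 ≤ 1 / 2 then S₁.toFun (z.1, 2 * z.2) else S₂.toFun (z.1, 2 * z.2 - 1)
  smooth := by
    obtain ⟨ε, h0, h1, h2, h3, h4, h5⟩ := S₁.sitting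
    obtain ⟨ε', h0', h1', h2', h3', h4', h5'⟩ := S₂.sitting
    refine glue_smooth (φ := fun z : ℝ × ℝ => z.2) (c := 1 / 2) (δ := min ε ε' / 2)
      (S₁.smooth.comp (by rw [contMDiff_iff_contDiff]; fun_prop))
      (S₂.smooth.comp (by rw [contMDiff_iff_contDiff]; fun_prop))
      continuous_snd (half_pos (lt_min h0 h0')) ?_
    rintro ⟨x, y⟩ hx
    have ha := min_le_left ε ε'
    have hb := min_le_right ε ε'
    rw [abs_lt] at hx
    dsimp only at hx
    change S₁.toFun (x, 2 * y) = S₂.toFun (x, 2 * y - 1)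
    rw [h5 _ _ (by linarith), h4' _ _ (by linarith)]
  sitting := by
    obtain ⟨ε, h0, h1, h2, h3, h4, h5⟩ := S₁.sitting
    obtain ⟨ε', h0', h1', h2', h3', h4', h5'⟩ := S₂.sitting
    have ha := min_le_left ε ε'
    have hb := min_le_right ε ε'
    have hp := lt_min h0 h0'
    refine ⟨min ε ε' / 2, half_pos hp, by linarith, fun x y hx => ?_, fun x y hx => ?_,
      fun x y hy => ?_, fun x y hy => ?_⟩
    · dsimp only
      split_ifs
      · exact h2 _ _ (by linarith)
      · exact h2' _ _ (by linarith)
    · dsimp only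
      split_ifs
      · exact h3 _ _ (by linarith)
      · exact h3' _ _ (by linarith)
    · dsimp only
      rw [if_pos (by linarith)]
      exact h4 _ _ (by linarith)
    · dsimp only
      rw [if_neg (by linarith)]
      exact h5' _ _ (by linarith)

/-- The horizontal inverse. -/
def Surface.hinv {p q : M} {γ₀ γ₁ : Curve E p q} (S : Surface γ₀ γ₁) :
    Surface γ₀.inv γ₁.inv where
  toFun z := S.toFun (1 - z.1, z.2)
  smooth := S.smooth.comp (by rw [contMDiff_iff_contDiff]; fun_prop)
  sitting := by
    obtain ⟨ε, h0, h1, h2, h3, h4, h5⟩ := S.sitting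
    exact ⟨ε, h0, h1, fun x y hx => h3 _ y (by dsimp only; linarith),
      fun x y hx => h2 _ y (by dsimp only; linarith), fun x y hy => h4 _ y hy,
      fun x y hy => h5 _ y hy⟩

/-- The horizontal composite `S₂ ∘ S₁` (first `S₁`, then `S₂`). -/
noncomputable def Surface.hcomp {p q r : M} {γ₀ γ₁ : Curve E p q} {γ₂ γ₃ : Curve E q r}
    (S₂ : Surface γ₂ γ₃) (S₁ : Surface γ₀ γ₁) : Surface (γ₂.comp γ₀) (γ₃.comp γ₁) where
  toFun z := if z.1 ≤ 1 / 2 then S₁.toFun (2 * z.1, z.2) else S₂.toFun (2 * z.1 - 1, z.2)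
  smooth := by
    obtain ⟨ε, h0, h1, h2, h3, h4, h5⟩ := S₁.sitting
    obtain ⟨ε', h0', h1', h2', h3', h4', h5'⟩ := S₂.sitting
    refine glue_smooth (φ := fun z : ℝ × ℝ => z.1) (c := 1 / 2) (δ := min ε ε' / 2)
      (S₁.smooth.comp (by rw [contMDiff_iff_contDiff]; fun_prop))
      (S₂.smooth.comp (by rw [contMDiff_iff_contDiff]; fun_prop))
      continuous_fst (half_pos (lt_min h0 h0')) ?_
    rintro ⟨x, y⟩ hx
    have ha := min_le_left ε ε'
    have hb := min_le_right ε ε'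
    rw [abs_lt] at hx
    dsimp only at hx
    change S₁.toFun (2 * x, y) = S₂.toFun (2 * x - 1, y)
    rw [h3 _ _ (by linarith), h2' _ _ (by linarith)]
  sitting := by
    obtain ⟨ε, h0, h1, h2, h3, h4, h5⟩ := S₁.sitting
    obtain ⟨ε', h0', h1', h2', h3', h4', h5'⟩ := S₂.sitting
    have ha := min_le_left ε ε'
    have hb := min_le_right ε ε'
    have hp := lt_min h0 h0'
    refine ⟨min ε ε' / 2, half_pos hp, by linarith, fun x y hx => ?_, fun x y hx => ?_,
      fun x y hy => ?_, fun x y hy => ?_⟩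
    · dsimp only
      rw [if_pos (by linarith)]
      exact h2 _ _ (by linarith)
    · dsimp only
      rw [if_neg (by linarith)]
      exact h3' _ _ (by linarith)
    · dsimp only [Curve.comp]
      rw [h4 _ _ (by linarith), h4' _ _ (by linarith)]
    · dsimp only [Curve.comp]
      rw [h5 _ _ (by linarith), h5' _ _ (by linarith)]

/-- Thin homotopy of curves. -/
def ThinHomotopic₁ {p q : M} (γ₀ γ₁ : Curve E p q) : Prop :=
  ∃ h : ℝ × ℝ → M, ContMDiff 𝓘(ℝ, ℝ × ℝ) 𝓘(ℝ, E) ∞ h ∧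
    (∃ ε : ℝ, 0 < ε ∧ ε < 1 / 2 ∧
      (∀ x y, x < ε → h (x, y) = p) ∧ (∀ x y, 1 - ε < x → h (x, y) = q) ∧
      (∀ x y, y < ε → h (x, y) = γ₀.toFun x) ∧ (∀ x y, 1 - ε < y → h (x, y) = γ₁.toFun x)) ∧
    ∀ z, (mfderiv 𝓘(ℝ, ℝ × ℝ) 𝓘(ℝ, E) h z).toLinearMap.rank ≤ 1

/-- Thin homotopy of surfaces; the boundary curves may move by thin homotopies. -/
def ThinHomotopic₂ {p q : M} {γ₀ γ₁ γ₂ γ₃ : Curve E p q} (S₀ : Surface γ₀ γ₁)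
    (S₁ : Surface γ₂ γ₃) : Prop :=
  ∃ K : ℝ × ℝ × ℝ → M, ContMDiff 𝓘(ℝ, ℝ × ℝ × ℝ) 𝓘(ℝ, E) ∞ K ∧
    (∃ ε : ℝ, 0 < ε ∧ ε < 1 / 2 ∧
      (∀ x y z, x < ε → K (x, y, z) = p) ∧ (∀ x y z, 1 - ε < x → K (x, y, z) = q) ∧
      (∀ x y z, y < ε → K (x, y, z) = K (x, 0, z)) ∧
      (∀ x y z, 1 - ε < y → K (x, y, z) = K (x, 1, z)) ∧
      (∀ x y z, z < ε → K (x, y, z) = S₀.toFun (x, y)) ∧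
      (∀ x y z, 1 - ε < z → K (x, y, z) = S₁.toFun (x, y))) ∧
    (∀ x z, (mfderiv 𝓘(ℝ, ℝ × ℝ × ℝ) 𝓘(ℝ, E) K (x, 0, z)).toLinearMap.rank ≤ 1) ∧
    (∀ x z, (mfderiv 𝓘(ℝ, ℝ × ℝ × ℝ) 𝓘(ℝ, E) K (x, 1, z)).toLinearMap.rank ≤ 1) ∧
    ∀ w, (mfderiv 𝓘(ℝ, ℝ × ℝ × ℝ) 𝓘(ℝ, E) K w).toLinearMap.rank ≤ 2

variable (E)

/-- Thin homotopy classes of curves `p → q`. -/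
def P₁ (p q : M) : Type _ := Quot (ThinHomotopic₁ (E := E) (p := p) (q := q))

/-- All surfaces between curves `p → q`. -/
abbrev AnySurface (p q : M) : Type _ := Σ γ : Curve E p q × Curve E p q, Surface γ.1 γ.2

/-- Thin homotopy classes of surfaces between curves `p → q`. -/
def P₂ (p q : M) : Type _ :=
  Quot (fun S T : AnySurface E p q => ThinHomotopic₂ S.2 T.2)

variable {E}

/-- The thin homotopy class of a curve. -/
def Curve.cls {p q : M} (γ : Curve E p q) : P₁ E p q := Quot.mk _ γ

/-- The thin homotopy class of a surface. -/
def Surface.cls {p q : M} {γ₀ γ₁ : Curve E p q} (S : Surface γ₀ γ₁) : P₂ E p q :=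
  Quot.mk _ ⟨(γ₀, γ₁), S⟩

/-- `P` is the path 2-groupoid `(M, P₁M, P₂M)`: its operations are those induced on thin homotopy
classes by the operations on curves and surfaces. -/
structure IsPathTwoGroupoid (P : StrictTwoGroupoid M (P₁ E) (P₂ E)) : Prop where
  src_cls : ∀ {p q : M} {γ₀ γ₁ : Curve E p q} (S : Surface γ₀ γ₁), P.src S.cls = γ₀.cls
  tgt_cls : ∀ {p q : M} {γ₀ γ₁ : Curve E p q} (S : Surface γ₀ γ₁), P.tgt S.cls = γ₁.cls
  id₁_eq : ∀ p : M, P.id₁ p = (Curve.unit p).cls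
  comp₁_cls : ∀ {p q r : M} (γ₂ : Curve E q r) (γ₁ : Curve E p q),
    P.comp₁ γ₂.cls γ₁.cls = (γ₂.comp γ₁).cls
  inv₁_cls : ∀ {p q : M} (γ : Curve E p q), P.inv₁ γ.cls = γ.inv.cls
  id₂_cls : ∀ {p q : M} (γ : Curve E p q), P.id₂ γ.cls = (Surface.unit γ).cls
  vcomp_cls : ∀ {p q : M} {γ₀ γ₁ γ₂ : Curve E p q} (S₂ : Surface γ₁ γ₂) (S₁ : Surface γ₀ γ₁),
    P.vcomp S₂.cls S₁.cls ((tgt_cls S₁).trans (src_cls S₂).symm) = (S₂.vcomp S₁).cls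
  vinv_cls : ∀ {p q : M} {γ₀ γ₁ : Curve E p q} (S : Surface γ₀ γ₁), P.vinv S.cls = S.vinv.cls
  hcomp_cls : ∀ {p q r : M} {γ₀ γ₁ : Curve E p q} {γ₂ γ₃ : Curve E q r} (S₂ : Surface γ₂ γ₃)
    (S₁ : Surface γ₀ γ₁), P.hcomp S₂.cls S₁.cls = (S₂.hcomp S₁).cls
  hinv_cls : ∀ {p q : M} {γ₀ γ₁ : Curve E p q} (S : Surface γ₀ γ₁), P.hinv S.cls = S.hinv.cls

end Paths

/-! ## Parallel transport -/

section Transport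

variable {EG G EH H E M : Type*}
  [NormedAddCommGroup EG] [NormedSpace ℝ EG] [TopologicalSpace G] [ChartedSpace EG G] [Group G]
  [NormedAddCommGroup EH] [NormedSpace ℝ EH] [TopologicalSpace H] [ChartedSpace EH H] [Group H]
  [NormedAddCommGroup E] [NormedSpace ℝ E] [TopologicalSpace M] [ChartedSpace E M]

/-- The cocycle associated with the pull-backs `(Σ^*θ, Σ^*Υ)` along a surface `Σ`. -/
noncomputable def surfaceCocycle (C : LieCrossedModule EG G EH H) (θ : DForm E M 1 EG)
    (Υ : DForm E M 2 EH) {p q : M} {γ₀ γ₁ : Curve E p q} (S : Surface γ₀ γ₁) : CocycleData G H :=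
  cocycleOf C (pullback S.toFun θ) (pullback S.toFun Υ)

/-- The 1-parallel transport `F_{θ,Υ}(γ)`, from the cocycle of the unit surface of `γ`. -/
noncomputable def transport₁ (C : LieCrossedModule EG G EH H) (θ : DForm E M 1 EG)
    (Υ : DForm E M 2 EH) {p q : M} (γ : Curve E p q) : G :=
  (surfaceCocycle C θ Υ (Surface.unit γ)).f 1 0 0

/-- The 2-parallel transport `F_{θ,Υ}(Σ) = W_{Σ^*θ,Σ^*Υ}(0, 1; 1, 0)`. -/
noncomputable def transport₂ (C : LieCrossedModule EG G EH H) (θ : DForm E M 1 EG)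
    (Υ : DForm E M 2 EH) {p q : M} {γ₀ γ₁ : Curve E p q} (S : Surface γ₀ γ₁) : H :=
  (surfaceCocycle C θ Υ S).W 0 1 1 0

end Transport

end TwoTransport

open TwoTransport

open Set Filter Topology
set_option linter.unusedSectionVars false

/-! All transport data solve ordinary differential equations, and the identities between them come
from uniqueness. Two maps into a Lie group with the same right logarithmic derivative and one common
value agree, because `u⁻¹ v` then has logarithmic derivative zero and is locally constant
(`eqOn_of_rlogDeriv_eq`). One further integration in x gives uniqueness for `∂ₓ(∂_y W W⁻¹) = d`
(`eq_of_hasDerivAt_rlogDeriv`). Existence with smooth dependence on parameters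
(`exists_lieSolution`) rests on a smooth local flow, obtained from the inverse function theorem in
the Banach space of continuous curves, and on right invariance, which allows local solutions to be
translated and continued for all times.

The target formula for `W` is where `dθ + ½[θ,θ] = ṫ(Υ)` enters: in the gauge that is parallel in x,
the x-derivative of the transformed `a_y` is the curvature, hence `ṫ` of the transported `B`
(`hasFDerivAt_Ad_inv_gauge`, `SolvesProblem.target`). The cocycle laws then follow from uniqueness.
The laws for units, inverses and composites use `SolvesProblem.locality`: on an open rectangle,
solutions are compatible with affine changes of the variables, including constant ones. Sitting
instants make the vertical edges of a surface contribute `g = 1`, and turn composites into cocycle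
laws at the point 1/2.

Thin invariance is a nonabelian Stokes theorem for the pull-back to `ℝ³`. Let `k` be the parallel
transport along x from the face `x = 1`, and let `β`, `ζ` be the x-primitives of the transported
components `B(∂ₓ,∂_y)`, `B(∂ₓ,∂_z)`. The 3-curvature vanishes for maps of rank at most two
(`threeCurv_pullback_eq_zero`), so the curvature of `β`, `ζ` equals the transported `B(∂_y,∂_z)`
(`twoForm_gauge_eq`), which is zero on `x = 0`. Hence the solution `V(y,z)` of `∂_y V V⁻¹ = β` also
satisfies `∂_z V V⁻¹ = ζ` on that face (`rd_eq_of_flat`). Rank at most one on `y = 0` and `y = 1`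
forces `ζ = 0` there, so `V(1,z)`, the 2-transport of the slice at height z, does not depend on z.

In the path 2-groupoid, units, inverses and associativity are reparametrizations, and the exchange
law holds on the nose. The difficulty is the vertical composite of classes. Its factors share an
intermediate curve only up to thin homotopy, and homotopies of the two factors may move this curve
along two different thin homotopies. Those must be joined through maps of rank at most two, which
reduces to the statement that a thin loop of curves is homotopic to a unit surface
(`Surface.rel_unit_of_rankLE`). To prove it, the loop is factored as `r ∘ u` through a vector space,
with `u` smooth and with parallel partial derivatives (`Surface.exists_factorization`). There `u` is
shrunk by rescaling its x-velocity. Since the partial derivatives of `u` are parallel, the rescaled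
curves obey the same equation in y, so the whole contraction has rank at most two and its end point
does not depend on y (`exists_contraction`). -/

namespace TwoTransport

/-! ### Smoothness of superposition operators on spaces of continuous maps. -/

section Superposition

/-- Pointwise evaluation of a continuous family of continuous linear maps. -/
noncomputable def pointwiseApply (X : Type*) [TopologicalSpace X] [CompactSpace X]
    (E F : Type*) [NormedAddCommGroup E] [NormedSpace ℝ E] [NormedAddCommGroup F]
    [NormedSpace ℝ F] : C(X, E →L[ℝ] F) →L[ℝ] C(X, E) →L[ℝ] C(X, F) :=
  LinearMap.mkContinuous₂
    (LinearMap.mk₂ ℝ (fun (A : C(X, E →L[ℝ] F)) (h : C(X, E)) => (⟨fun x => A x (h x), by fun_prop⟩ : C(X, F)))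
      (fun _ _ _ => by ext; simp) (fun _ _ _ => by ext; simp)
      (fun _ _ _ => by ext; simp) (fun _ _ _ => by ext; simp)) 1
    (fun A h => by
      rw [ContinuousMap.norm_le _ (by positivity)]
      intro x
      simp only [LinearMap.mk₂_apply, ContinuousMap.coe_mk, one_mul]
      exact (ContinuousLinearMap.le_opNorm _ _).trans
        (mul_le_mul (A.norm_coe_le_norm x) (h.norm_coe_le_norm x) (norm_nonneg _)
          (norm_nonneg A)))

variable {X : Type*} [TopologicalSpace X] [CompactSpace X]

@[simp]
theorem pointwiseApply_apply {E F : Type*} [NormedAddCommGroup E] [NormedSpace ℝ E]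
    [NormedAddCommGroup F] [NormedSpace ℝ F] (A : C(X, E →L[ℝ] F)) (h : C(X, E)) (x : X) :
    pointwiseApply X E F A h x = A x (h x) := rfl

/-- By compactness, `f'` varies by at most `ε` on all segments from `w x` to `w x + k x`
simultaneously; this is the continuity of postcomposition with `f'` at `w`. The mean value
inequality on each segment then bounds the remainder uniformly in `x`. -/
theorem hasFDerivAt_superposition {E F : Type*} [NormedAddCommGroup E] [NormedSpace ℝ E]
    [NormedAddCommGroup F] [NormedSpace ℝ F] {f : E → F} {f' : E → E →L[ℝ] F}
    (hf : ∀ x, HasFDerivAt f (f' x) x) (hf' : Continuous f') (hfc : Continuous f) (w : C(X, E)) :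
    HasFDerivAt (fun w : C(X, E) => (⟨f, hfc⟩ : C(E, F)).comp w)
      (pointwiseApply X E F ((⟨f', hf'⟩ : C(E, E →L[ℝ] F)).comp w)) w := by
  rw [hasFDerivAt_iff_isLittleO_nhds_zero, Asymptotics.isLittleO_iff]
  intro ε hε
  have hc : Continuous (fun w : C(X, E) => (⟨f', hf'⟩ : C(E, E →L[ℝ] F)).comp w) :=
    ContinuousMap.continuous_postcomp _
  obtain ⟨δ, hδ, h⟩ := (Metric.continuous_iff (α := C(X, E))
    (β := C(X, E →L[ℝ] F))).mp hc w ε hε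
  filter_upwards [Metric.ball_mem_nhds (0 : C(X, E)) hδ] with k hk
  rw [ContinuousMap.norm_le _ (by positivity)]
  intro x
  have hseg : ∀ y ∈ segment ℝ (w x) (w x + k x), ‖f' y - f' (w x)‖ ≤ ε := by
    intro y hy
    rw [segment_eq_image'] at hy
    obtain ⟨t, ht, rfl⟩ := hy
    have h1 : dist (w + t • k) w < δ := by
      rw [dist_eq_norm, add_sub_cancel_left, norm_smul, Real.norm_eq_abs, abs_of_nonneg ht.1]
      calc t * ‖k‖ ≤ 1 * ‖k‖ := by gcongr; exact ht.2
        _ < δ := by simpa using hk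
    have h2 := ContinuousMap.dist_apply_le_dist
      (f := (⟨f', hf'⟩ : C(E, E →L[ℝ] F)).comp (w + t • k))
      (g := (⟨f', hf'⟩ : C(E, E →L[ℝ] F)).comp w) x
    have h3 := (h2.trans_lt (h _ h1)).le
    rw [dist_eq_norm] at h3
    simpa using h3
  have := (convex_segment (w x) (w x + k x)).norm_image_sub_le_of_norm_hasFDerivWithin_le'
    (fun y _ => (hf y).hasFDerivWithinAt) hseg (left_mem_segment ℝ _ _) (right_mem_segment ℝ _ _)
  simp only [add_sub_cancel_left] at this
  refine le_trans ?_ (this.trans (by gcongr; exact k.norm_coe_le_norm x))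
  simp

universe u v

/-- Induction on the order: the derivative is the superposition operator of `fderiv ℝ f` followed by
the bounded linear map `pointwiseApply`. The universe of `F` dominates that of `E`, so that `E →L[ℝ]
F` is again an admissible target. -/
theorem contDiff_superposition {E : Type u} {F : Type (max u v)} [NormedAddCommGroup E]
    [NormedSpace ℝ E] [NormedAddCommGroup F] [NormedSpace ℝ F] {f : E → F}
    (hf : ContDiff ℝ ∞ f) :
    ContDiff ℝ ∞ (fun w : C(X, E) => (⟨f, hf.continuous⟩ : C(E, F)).comp w) := by
  rw [contDiff_infty]
  intro n
  induction n generalizing F with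
  | zero =>
    rw [Nat.cast_zero, contDiff_zero]
    exact ContinuousMap.continuous_postcomp _
  | succ n ih =>
    have hf' : ContDiff ℝ ∞ (fderiv ℝ f) := hf.fderiv_right (by simp)
    rw [Nat.cast_succ, contDiff_succ_iff_hasFDerivAt]
    refine ⟨fun w => pointwiseApply X E F
      ((⟨fderiv ℝ f, hf'.continuous⟩ : C(E, E →L[ℝ] F)).comp w), ?_, fun w => ?_⟩
    · exact (pointwiseApply X E F).contDiff.comp (ih hf')
    · exact hasFDerivAt_superposition
        (fun x => (hf.differentiable (by simp) x).hasFDerivAt) hf'.continuous hf.continuous w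

end Superposition

/-! ### The primitive as a bounded operator on continuous curves. -/

section Primitive

variable {E : Type*} [NormedAddCommGroup E] [NormedSpace ℝ E]

/-- The interval `[-1, 1]`. -/
abbrev SymmIcc : Type := Icc (-1 : ℝ) 1

/-- The continuous extension of a function on `[-1, 1]` that is constant outside. -/
noncomputable def symmExtend (h : C(SymmIcc, E)) : ℝ → E := IccExtend (by norm_num) h

theorem continuous_symmExtend (h : C(SymmIcc, E)) : Continuous (symmExtend h) :=
  h.continuous.Icc_extend'

theorem symmExtend_coe (h : C(SymmIcc, E)) (τ : SymmIcc) : symmExtend h τ = h τ :=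
  IccExtend_val _ _ _

theorem norm_symmExtend_le (h : C(SymmIcc, E)) (τ : ℝ) : ‖symmExtend h τ‖ ≤ ‖h‖ :=
  h.norm_coe_le_norm _

/-- The primitive that vanishes at `0`, as an operator on `C([-1, 1], E)`. -/
noncomputable def primitiveCLM (E : Type*) [NormedAddCommGroup E] [NormedSpace ℝ E] :
    C(SymmIcc, E) →L[ℝ] C(SymmIcc, E) :=
  LinearMap.mkContinuous
    { toFun := fun h => ⟨fun τ => ∫ σ in (0 : ℝ)..τ, symmExtend h σ,
        (intervalIntegral.continuous_primitive
          (fun _ _ => (continuous_symmExtend h).intervalIntegrable _ _) 0).comp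
          continuous_subtype_val⟩
      map_add' := fun h k => by
        ext τ
        exact intervalIntegral.integral_add ((continuous_symmExtend h).intervalIntegrable _ _)
          ((continuous_symmExtend k).intervalIntegrable _ _)
      map_smul' := fun c h => by
        ext τ
        exact intervalIntegral.integral_smul c (symmExtend h) } 1
    (fun h => by
      rw [ContinuousMap.norm_le _ (by positivity)]
      intro τ
      refine (intervalIntegral.norm_integral_le_of_norm_le_const
        (fun x _ => norm_symmExtend_le h x)).trans ?_
      rw [one_mul, sub_zero]
      exact mul_le_of_le_one_right (norm_nonneg _) (abs_le.mpr τ.2))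

theorem primitiveCLM_apply (h : C(SymmIcc, E)) (τ : SymmIcc) :
    primitiveCLM E h τ = ∫ σ in (0 : ℝ)..τ, symmExtend h σ := rfl

end Primitive

/-! ### Smooth local flows from the inverse function theorem. -/

section Flow

universe u
variable {E : Type u} [NormedAddCommGroup E] [NormedSpace ℝ E] [CompleteSpace E]

/-- The operator whose zeros are the rescaled orbits of the vector field `F`. -/
noncomputable def orbitOp {F : E → E} (hF : ContDiff ℝ ∞ F) (q : ℝ × E × C(SymmIcc, E)) :
    C(SymmIcc, E) :=
  q.2.2 - q.1 • primitiveCLM E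
    ((⟨F, hF.continuous⟩ : C(E, E)).comp (ContinuousMap.const _ q.2.1 + q.2.2))

theorem contDiff_orbitOp {F : E → E} (hF : ContDiff ℝ ∞ F) : ContDiff ℝ ∞ (orbitOp hF) := by
  have h1 : ContDiff ℝ ∞ (fun e : E => ContinuousMap.const SymmIcc e) :=
    (ContinuousLinearMap.const ℝ SymmIcc : E →L[ℝ] C(SymmIcc, E)).contDiff
  have h2 : ContDiff ℝ ∞ (fun q : ℝ × E × C(SymmIcc, E) =>
      ContinuousMap.const SymmIcc q.2.1 + q.2.2) :=
    (h1.comp (contDiff_fst.comp contDiff_snd)).add (contDiff_snd.comp contDiff_snd)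
  exact (contDiff_snd.comp contDiff_snd).sub
    (contDiff_fst.smul ((primitiveCLM E).contDiff.comp ((contDiff_superposition hF).comp h2)))

/-- The integral carries the factor `t`, which is zero at the base point. The product rule therefore
leaves only its value there, and the partial derivative in `w` is the identity. -/
theorem hasStrictFDerivAt_orbitOp {F : E → E} (hF : ContDiff ℝ ∞ F) (e₀ : E) :
    HasFDerivAt (orbitOp hF)
      (ContinuousLinearMap.snd ℝ E C(SymmIcc, E) ∘L ContinuousLinearMap.snd ℝ ℝ _ -
        (ContinuousLinearMap.fst ℝ ℝ (E × C(SymmIcc, E))).smulRight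
          (primitiveCLM E (ContinuousMap.const _ (F e₀)))) (0, e₀, 0) := by
  have h1 : ContDiff ℝ ∞ (fun e : E => ContinuousMap.const SymmIcc e) :=
    (ContinuousLinearMap.const ℝ SymmIcc : E →L[ℝ] C(SymmIcc, E)).contDiff
  have h2 : ContDiff ℝ ∞ (fun q : ℝ × E × C(SymmIcc, E) =>
      ContinuousMap.const SymmIcc q.2.1 + q.2.2) :=
    (h1.comp (contDiff_fst.comp contDiff_snd)).add (contDiff_snd.comp contDiff_snd)
  have h3 : ContDiff ℝ ∞ (fun q : ℝ × E × C(SymmIcc, E) => primitiveCLM E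
    ((⟨F, hF.continuous⟩ : C(E, E)).comp (ContinuousMap.const _ q.2.1 + q.2.2))) :=
    (primitiveCLM E).contDiff.comp ((contDiff_superposition hF).comp h2)
  have h4 := (hasFDerivAt_fst (𝕜 := ℝ) (p := ((0 : ℝ), e₀, (0 : C(SymmIcc, E))))).smul
    (h3.differentiable (by simp) (0, e₀, 0)).hasFDerivAt
  have h5 := ((hasFDerivAt_snd (𝕜 := ℝ) (p := (e₀, (0 : C(SymmIcc, E))))).comp
    ((0 : ℝ), e₀, (0 : C(SymmIcc, E))) hasFDerivAt_snd).sub h4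
  refine h5.congr_fderiv ?_
  ext q <;> simp [ContinuousMap.comp_const]

/-- The orbit operator together with its parameters, whose local inverse yields the orbits. -/
noncomputable def orbitMap {F : E → E} (hF : ContDiff ℝ ∞ F) (q : ℝ × E × C(SymmIcc, E)) :
    ℝ × E × C(SymmIcc, E) := (q.1, q.2.1, orbitOp hF q)

theorem contDiff_orbitMap {F : E → E} (hF : ContDiff ℝ ∞ F) : ContDiff ℝ ∞ (orbitMap hF) :=
  contDiff_fst.prodMk ((contDiff_fst.comp contDiff_snd).prodMk (contDiff_orbitOp hF))

/-- The differential is unipotent, `(t, e, w) ↦ (t, e, w - t c)`, so its inverse arises by a change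
of sign. -/
theorem hasFDerivAt_orbitMap {F : E → E} (hF : ContDiff ℝ ∞ F) (e₀ : E) :
    ∃ A : (ℝ × E × C(SymmIcc, E)) ≃L[ℝ] (ℝ × E × C(SymmIcc, E)),
      HasFDerivAt (orbitMap hF) (A : (ℝ × E × C(SymmIcc, E)) →L[ℝ] _) (0, e₀, 0) := by
  set c := primitiveCLM E (ContinuousMap.const _ (F e₀)) with hc
  let f₁ : (ℝ × E × C(SymmIcc, E)) →L[ℝ] (ℝ × E × C(SymmIcc, E)) :=
    (ContinuousLinearMap.fst ℝ ℝ _).prod ((ContinuousLinearMap.fst ℝ _ _ ∘L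
      ContinuousLinearMap.snd ℝ ℝ _).prod (ContinuousLinearMap.snd ℝ E C(SymmIcc, E) ∘L
      ContinuousLinearMap.snd ℝ ℝ _ - (ContinuousLinearMap.fst ℝ ℝ _).smulRight c))
  let f₂ : (ℝ × E × C(SymmIcc, E)) →L[ℝ] (ℝ × E × C(SymmIcc, E)) :=
    (ContinuousLinearMap.fst ℝ ℝ _).prod ((ContinuousLinearMap.fst ℝ _ _ ∘L
      ContinuousLinearMap.snd ℝ ℝ _).prod (ContinuousLinearMap.snd ℝ E C(SymmIcc, E) ∘L
      ContinuousLinearMap.snd ℝ ℝ _ + (ContinuousLinearMap.fst ℝ ℝ _).smulRight c))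
  refine ⟨ContinuousLinearEquiv.equivOfInverse f₁ f₂ (fun q => by simp [f₁, f₂])
    (fun q => by simp [f₁, f₂]), ?_⟩
  have h := (hasFDerivAt_fst (𝕜 := ℝ) (p := ((0 : ℝ), e₀, (0 : C(SymmIcc, E))))).prodMk
    (((hasFDerivAt_fst (𝕜 := ℝ) (p := (e₀, (0 : C(SymmIcc, E))))).comp
      ((0 : ℝ), e₀, (0 : C(SymmIcc, E))) hasFDerivAt_snd).prodMk (hasStrictFDerivAt_orbitOp hF e₀))
  exact h

/-- Rescaling of a function on `[-1, 1]`. -/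
noncomputable def rescale (l : SymmIcc) (w : C(SymmIcc, E)) : C(SymmIcc, E) :=
  ⟨fun τ => symmExtend w (l * τ), (continuous_symmExtend w).comp (by fun_prop)⟩

theorem norm_rescale_le (l : SymmIcc) (w : C(SymmIcc, E)) : ‖rescale l w‖ ≤ ‖w‖ := by
  rw [ContinuousMap.norm_le _ (by positivity)]
  exact fun τ => norm_symmExtend_le _ _

theorem mul_mem_symmIcc {a b : ℝ} (ha : a ∈ Icc (-1 : ℝ) 1) (hb : b ∈ Icc (-1 : ℝ) 1) :
    a * b ∈ Icc (-1 : ℝ) 1 := by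
  rw [mem_Icc, ← abs_le] at *
  rw [abs_mul]
  exact mul_le_one₀ ha (abs_nonneg _) hb

theorem orbitOp_eq_zero_iff {F : E → E} (hF : ContDiff ℝ ∞ F) (t : ℝ) (e : E)
    (w : C(SymmIcc, E)) : orbitOp hF (t, e, w) = 0 ↔
      ∀ τ ∈ Icc (-1 : ℝ) 1, symmExtend w τ = t • ∫ σ in (0 : ℝ)..τ, F (e + symmExtend w σ) := by
  have key : ∀ σ, symmExtend ((⟨F, hF.continuous⟩ : C(E, E)).comp
      (ContinuousMap.const _ e + w)) σ = F (e + symmExtend w σ) := fun _ => rfl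
  constructor
  · intro h τ hτ
    have := congrArg (fun k : C(SymmIcc, E) => k ⟨τ, hτ⟩) h
    simp only [orbitOp, ContinuousMap.sub_apply, ContinuousMap.smul_apply, primitiveCLM_apply, key,
      ContinuousMap.zero_apply, sub_eq_zero] at this
    rw [← this]
    exact symmExtend_coe w ⟨τ, hτ⟩
  · intro h
    ext τ
    simp only [orbitOp, ContinuousMap.sub_apply, ContinuousMap.smul_apply, primitiveCLM_apply, key,
      ContinuousMap.zero_apply, sub_eq_zero]
    rw [← h τ τ.2]
    exact (symmExtend_coe w τ).symm

/-- The substitution `σ ↦ l σ` in the integral: an orbit over time `t` run at speed `l` is an orbit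
over time `l t`. -/
theorem orbitOp_rescale {F : E → E} (hF : ContDiff ℝ ∞ F) {t : ℝ} {e : E} {w : C(SymmIcc, E)}
    (h : orbitOp hF (t, e, w) = 0) (l : SymmIcc) :
    orbitOp hF (l * t, e, rescale l w) = 0 := by
  rw [orbitOp_eq_zero_iff] at h ⊢
  have hr : ∀ σ ∈ Icc (-1 : ℝ) 1, symmExtend (rescale l w) σ = symmExtend w (l * σ) :=
    fun σ hσ => symmExtend_coe (rescale l w) ⟨σ, hσ⟩
  intro τ hτ
  rw [hr τ hτ, h _ (mul_mem_symmIcc l.2 hτ), mul_comm (l : ℝ) t, mul_smul]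
  congr 1
  have : ∫ σ in (0 : ℝ)..τ, F (e + symmExtend (rescale l w) σ) =
      ∫ σ in (0 : ℝ)..τ, F (e + symmExtend w (l * σ)) := by
    refine intervalIntegral.integral_congr fun σ hσ => ?_
    have hσ' : σ ∈ Icc (-1 : ℝ) 1 :=
      (convex_Icc (-1 : ℝ) 1).ordConnected.uIcc_subset (by norm_num) hτ hσ
    simp only [hr σ hσ']
  rw [this, intervalIntegral.smul_integral_comp_mul_left (fun σ => F (e + symmExtend w σ)) l]
  simp

/-- **Smooth local flow** of a smooth vector field on a Banach space. -/
theorem exists_smooth_local_flow {F : E → E} (hF : ContDiff ℝ ∞ F) (e₀ : E) :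
    ∃ δ > 0, ∃ φ : ℝ × E → E, ∀ e, ‖e - e₀‖ < δ → φ (0, e) = e ∧ ∀ t, |t| < δ →
      ContDiffAt ℝ ∞ φ (t, e) ∧ HasDerivAt (fun s => φ (s, e)) (F (φ (t, e))) t := by
  obtain ⟨A, hA⟩ := hasFDerivAt_orbitMap hF e₀
  have hsm := contDiff_orbitMap hF
  set q₀ : ℝ × E × C(SymmIcc, E) := (0, e₀, 0) with hq₀
  have h0 : orbitMap hF q₀ = q₀ := by simp [orbitMap, orbitOp, hq₀]
  let P := (hsm.contDiffAt (x := q₀)).toOpenPartialHomeomorph (orbitMap hF) hA (by simp)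
  have hP : ∀ q, P q = orbitMap hF q := fun _ => rfl
  have hPs : q₀ ∈ P.source :=
    (hsm.contDiffAt (x := q₀)).mem_toOpenPartialHomeomorph_source hA (by simp)
  -- Smoothness of the local inverse is needed at all nearby points, not only at `q₀`; invertibility
  -- of the differential is an open condition.
  have hinv : {q | ∃ B : (ℝ × E × C(SymmIcc, E)) ≃L[ℝ] (ℝ × E × C(SymmIcc, E)),
      (B : (ℝ × E × C(SymmIcc, E)) →L[ℝ] _) = fderiv ℝ (orbitMap hF) q} ∈ 𝓝 q₀ := by
    have hc : Continuous (fderiv ℝ (orbitMap hF)) := hsm.continuous_fderiv (by simp)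
    have := A.nhds
    rw [← hA.fderiv] at this
    exact hc.continuousAt.preimage_mem_nhds this
  obtain ⟨ε, hε, hball⟩ := Metric.mem_nhds_iff.mp
    (Filter.inter_mem (P.open_source.mem_nhds hPs) hinv)
  have hmem : ∀ t e w, |t| < ε → ‖e - e₀‖ < ε → ‖w‖ < ε → (t, e, w) ∈ Metric.ball q₀ ε := by
    intro t e w ht he hw
    simp only [hq₀, mem_ball_iff_norm, Prod.mk_sub_mk, Prod.norm_mk, sub_zero, max_lt_iff,
      Real.norm_eq_abs]
    exact ⟨ht, he, hw⟩
  have hPq : P q₀ = q₀ := h0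
  have hcont : ContinuousAt P.symm q₀ := by
    have := P.continuousAt_symm (P.map_source hPs)
    rwa [hPq] at this
  have hsymm : P.symm q₀ = q₀ := by
    conv_lhs => rw [← hPq]
    exact P.left_inv hPs
  obtain ⟨δ, hδ, hδb⟩ := Metric.mem_nhds_iff.mp (Filter.inter_mem
    (P.open_target.mem_nhds (by rw [← hPq]; exact P.map_source hPs))
    (hcont.preimage_mem_nhds (by rw [hsymm]; exact Metric.ball_mem_nhds q₀ hε)))
  have hgood : ∀ t e, |t| < δ → ‖e - e₀‖ < δ → (t, e, (0 : C(SymmIcc, E))) ∈ P.target ∧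
      P.symm (t, e, 0) ∈ Metric.ball q₀ ε := by
    intro t e ht he
    apply hδb
    simp only [hq₀, mem_ball_iff_norm, Prod.mk_sub_mk, Prod.norm_mk, sub_zero, max_lt_iff,
      norm_zero, Real.norm_eq_abs]
    exact ⟨ht, he, hδ⟩
  let w : ℝ → E → C(SymmIcc, E) := fun t e => (P.symm (t, e, 0)).2.2
  have hw : ∀ t e, |t| < δ → ‖e - e₀‖ < δ →
      P.symm (t, e, 0) = (t, e, w t e) ∧ orbitOp hF (t, e, w t e) = 0 := by
    intro t e ht he
    have h1 := P.right_inv (hgood t e ht he).1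
    rw [hP] at h1
    have h2 : P.symm (t, e, 0) = (t, e, w t e) :=
      Prod.ext (congrArg (fun q => q.1) h1 :)
        (Prod.ext (congrArg (fun q => q.2.1) h1 :) rfl)
    refine ⟨h2, ?_⟩
    have h3 := congrArg (fun q => q.2.2) h1
    rw [h2] at h3
    exact h3
  have hwb : ∀ t e, |t| < δ → ‖e - e₀‖ < δ → |t| < ε ∧ ‖e - e₀‖ < ε ∧ ‖w t e‖ < ε := by
    intro t e ht he
    have h1 := (hgood t e ht he).2
    rw [(hw t e ht he).1] at h1
    simpa only [hq₀, mem_ball_iff_norm, Prod.mk_sub_mk, Prod.norm_mk, sub_zero, max_lt_iff,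
      Real.norm_eq_abs] using h1
  -- Both sides are zeros of `orbitOp` for the same parameters inside the ball on which `orbitMap`
  -- is injective.
  have hscale : ∀ t e, |t| < δ → ‖e - e₀‖ < δ → ∀ l : SymmIcc,
      w (l * t) e = rescale l (w t e) := by
    intro t e ht he l
    have hl : |(l : ℝ) * t| ≤ |t| := by
      rw [abs_mul]
      exact mul_le_of_le_one_left (abs_nonneg _) (abs_le.mpr l.2)
    have hlt := hl.trans_lt ht
    have h1 := hwb _ _ hlt he
    have h2 := hwb _ _ ht he
    have := P.injOn (hball (hmem _ _ _ h1.1 h1.2.1 h1.2.2)).1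
      (hball (hmem _ _ _ h1.1 h1.2.1 ((norm_rescale_le l (w t e)).trans_lt h2.2.2))).1 (by
        rw [hP, hP]
        simp only [orbitMap]
        rw [(hw _ _ hlt he).2, orbitOp_rescale hF (hw _ _ ht he).2 l])
    exact congrArg (fun q => q.2.2) this
  have h1mem : (1 : ℝ) ∈ Icc (-1 : ℝ) 1 := by norm_num
  -- The zero `w t e` represents `τ ↦ φ(tτ, e) - e`, so the flow is read off at `τ = 1`.
  refine ⟨δ, hδ, fun q => q.2 + w q.1 q.2 ⟨1, h1mem⟩, fun e he => ⟨?_, fun t ht => ⟨?_, ?_⟩⟩⟩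
  · have := (hw 0 e (by simpa using hδ) he).2
    simp only [orbitOp, zero_smul, sub_zero] at this
    simp [this]
  · have hg := hgood t e ht he
    obtain ⟨B, hB⟩ := (hball hg.2).2
    have hs : ContDiffAt ℝ ∞ P.symm (t, e, 0) := by
      refine P.contDiffAt_symm (f₀' := B) hg.1 ?_ hsm.contDiffAt
      rw [hB]
      exact (hsm.differentiable (by simp) _).hasFDerivAt
    have hin : ContDiff ℝ ∞ (fun q : ℝ × E => (q.1, q.2, (0 : C(SymmIcc, E)))) := by fun_prop
    have hs' : ContDiffAt ℝ ∞ (fun q : ℝ × E => P.symm (q.1, q.2, (0 : C(SymmIcc, E)))) (t, e) :=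
      ContDiffAt.comp (g := P.symm) (t, e) hs hin.contDiffAt
    have hev : ContDiff ℝ ∞ (fun k : C(SymmIcc, E) => k ⟨1, h1mem⟩) :=
      (ContinuousMap.evalCLM ℝ (⟨1, h1mem⟩ : SymmIcc) : C(SymmIcc, E) →L[ℝ] E).contDiff
    exact contDiffAt_snd.add (hev.contDiffAt.comp _ (hs'.snd.snd))
  -- A time between `|t|` and `δ`. By rescaling, the single curve `w t₁ e` describes the orbit for
  -- all `|s| ≤ t₁`, and the time derivative becomes the fundamental theorem of calculus.
  · set t₁ := (|t| + δ) / 2 with ht₁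
    have ht₁pos : 0 < t₁ := by positivity
    have ht₁δ : |t₁| < δ := by rw [abs_of_pos ht₁pos]; linarith
    have htt : |t| < t₁ := by linarith
    have hrep : ∀ s, |s| ≤ t₁ → e + w s e ⟨1, h1mem⟩ = e + symmExtend (w t₁ e) (s / t₁) := by
      intro s hs
      have hl : s / t₁ ∈ Icc (-1 : ℝ) 1 := by
        rw [mem_Icc, ← abs_le, abs_div, abs_of_pos ht₁pos]
        exact (div_le_one ht₁pos).mpr hs
      have := hscale t₁ e ht₁δ he ⟨s / t₁, hl⟩
      rw [div_mul_cancel₀ _ ht₁pos.ne'] at this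
      rw [this]
      simp [rescale]
    have hz := (orbitOp_eq_zero_iff hF _ _ _).mp (hw t₁ e ht₁δ he).2
    have hcF : Continuous (fun σ => F (e + symmExtend (w t₁ e) σ)) :=
      hF.continuous.comp (continuous_const.add (continuous_symmExtend _))
    have hd : HasDerivAt (fun s => e + t₁ • ∫ σ in (0 : ℝ)..(s / t₁),
        F (e + symmExtend (w t₁ e) σ)) (F (e + symmExtend (w t₁ e) (t / t₁))) t := by
      have ha := (hcF.integral_hasStrictDerivAt 0 (t / t₁)).hasDerivAt
      have hb := ha.scomp t ((hasDerivAt_id t).div_const t₁)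
      have hc := (hb.const_smul t₁).const_add e
      rw [smul_smul, mul_one_div_cancel ht₁pos.ne', one_smul] at hc
      exact hc
    simp only
    rw [hrep t htt.le]
    refine hd.congr_of_eventuallyEq ?_
    have : ∀ᶠ s in 𝓝 t, |s| < t₁ := continuous_abs.continuousAt.eventually_lt continuousAt_const htt
    filter_upwards [this] with s hs
    rw [hrep s hs.le, hz _ (by
      rw [mem_Icc, ← abs_le, abs_div, abs_of_pos ht₁pos]
      exact (div_le_one ht₁pos).mpr hs.le)]

end Flow

end TwoTransport

namespace TwoTransport

/-! ### Logarithmic differentials in the chart at the unit. -/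

section LieCalculus

variable {G : Type*} {EG : Type*} [NormedAddCommGroup EG] [NormedSpace ℝ EG]
  [TopologicalSpace G] [ChartedSpace EG G] [Group G] [LieGroup 𝓘(ℝ, EG) ∞ G]
  {H : Type*} {EH : Type*} [NormedAddCommGroup EH] [NormedSpace ℝ EH]
  [TopologicalSpace H] [ChartedSpace EH H] [Group H] [LieGroup 𝓘(ℝ, EH) ∞ H]
  {N : Type*} [NormedAddCommGroup N] [NormedSpace ℝ N]

/-- The preferred chart at the unit. -/
noncomputable def unitChart (EG G : Type*) [NormedAddCommGroup EG] [NormedSpace ℝ EG]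
    [TopologicalSpace G] [ChartedSpace EG G] [Group G] : PartialEquiv G EG :=
  extChartAt 𝓘(ℝ, EG) (1 : G)

/-- The coordinates of the unit. -/
noncomputable def unitPt (EG G : Type*) [NormedAddCommGroup EG] [NormedSpace ℝ EG]
    [TopologicalSpace G] [ChartedSpace EG G] [Group G] : EG := unitChart EG G 1

theorem isOpen_unitChart_source : IsOpen (unitChart EG G).source := isOpen_extChartAt_source _

theorem isOpen_unitChart_target : IsOpen (unitChart EG G).target := isOpen_extChartAt_target _

theorem one_mem_unitChart_source : (1 : G) ∈ (unitChart EG G).source := mem_extChartAt_source _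

theorem unitPt_mem_target : unitPt EG G ∈ (unitChart EG G).target := mem_extChartAt_target _

theorem unitChart_symm_unitPt : (unitChart EG G).symm (unitPt EG G) = (1 : G) :=
  extChartAt_to_inv _

theorem contMDiffAt_unitChart {g : G} (hg : g ∈ (unitChart EG G).source) :
    ContMDiffAt 𝓘(ℝ, EG) 𝓘(ℝ, EG) ∞ (unitChart EG G) g := by
  refine contMDiffAt_extChartAt' ?_
  simpa [unitChart] using hg

theorem contMDiffAt_unitChart_symm {e : EG} (he : e ∈ (unitChart EG G).target) :
    ContMDiffAt 𝓘(ℝ, EG) 𝓘(ℝ, EG) ∞ (unitChart EG G).symm e :=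
  (contMDiffOn_extChartAt_symm (1 : G)).contMDiffAt (isOpen_unitChart_target.mem_nhds he)

theorem contDiffAt_unitChart_comp {p : N → G} {z : N} (hp : ContMDiffAt 𝓘(ℝ, N) 𝓘(ℝ, EG) ∞ p z)
    (h : p z ∈ (unitChart EG G).source) :
    ContDiffAt ℝ ∞ (fun w => unitChart EG G (p w)) z := by
  rw [← contMDiffAt_iff_contDiffAt]
  exact (contMDiffAt_unitChart h).comp z hp

theorem eventually_mem_source {p : N → G} {z : N} (hp : ContinuousAt p z)
    (h : p z ∈ (unitChart EG G).source) : ∀ᶠ w in 𝓝 z, p w ∈ (unitChart EG G).source :=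
  hp.preimage_mem_nhds (isOpen_unitChart_source.mem_nhds h)

/-- For maps from a normed space into `G` the derivative at a point with value `1`, in the
preferred chart. -/
theorem mfderiv_eq_of_map_one {p : N → G} {z : N} (hp : MDifferentiableAt 𝓘(ℝ, N) 𝓘(ℝ, EG) p z)
    (h : p z = 1) : (mfderiv 𝓘(ℝ, N) 𝓘(ℝ, EG) p z : N →L[ℝ] EG) =
      fderiv ℝ (fun w => unitChart EG G (p w)) z := by
  refine (hp.mfderiv).trans ?_
  simp only [writtenInExtChartAt, h, extChartAt_model_space_eq_id, modelWithCornersSelf_coe,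
    range_id, fderivWithin_univ]
  rfl

/-- The differential at the unit of a map of Lie groups. -/
noncomputable def dHom (EG EH : Type*) {G H : Type*} [NormedAddCommGroup EG] [NormedSpace ℝ EG]
    [TopologicalSpace G] [ChartedSpace EG G] [Group G] [NormedAddCommGroup EH] [NormedSpace ℝ EH]
    [TopologicalSpace H] [ChartedSpace EH H] [Group H] (Θ : G → H) : EG →L[ℝ] EH :=
  mfderiv 𝓘(ℝ, EG) 𝓘(ℝ, EH) Θ 1

/-- The differential at the unit of a map with `Θ 1 = 1`, in the preferred charts. -/
theorem mfderiv_hom_eq {Θ : G → H} (hΘ : MDifferentiableAt 𝓘(ℝ, EG) 𝓘(ℝ, EH) Θ 1)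
    (h : Θ 1 = 1) : dHom EG EH Θ =
      fderiv ℝ (fun e => unitChart EH H (Θ ((unitChart EG G).symm e))) (unitPt EG G) := by
  refine (hΘ.mfderiv).trans ?_
  simp only [writtenInExtChartAt, h, modelWithCornersSelf_coe, range_id, fderivWithin_univ]
  rfl

/-- The right logarithmic differential `du u⁻¹` of a map into a Lie group. -/
noncomputable def rd (EG : Type*) {G : Type*} [NormedAddCommGroup EG] [NormedSpace ℝ EG]
    [TopologicalSpace G] [ChartedSpace EG G] [Group G] {N : Type*} [NormedAddCommGroup N]
    [NormedSpace ℝ N] (u : N → G) (z : N) : N →L[ℝ] EG :=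
  mfderiv 𝓘(ℝ, N) 𝓘(ℝ, EG) (fun w => u w * (u z)⁻¹) z

theorem rlogDeriv_eq_rd (u : ℝ → G) (x : ℝ) : rlogDeriv (EG := EG) u x = rd EG u x 1 := rfl

theorem contMDiffAt_mul_right {p : N → G} {z : N} (hp : ContMDiffAt 𝓘(ℝ, N) 𝓘(ℝ, EG) ∞ p z)
    (c : G) : ContMDiffAt 𝓘(ℝ, N) 𝓘(ℝ, EG) ∞ (fun w => p w * c) z := hp.mul contMDiffAt_const

theorem rd_eq {u : N → G} {z : N} (hu : ContMDiffAt 𝓘(ℝ, N) 𝓘(ℝ, EG) ∞ u z) :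
    rd EG u z = fderiv ℝ (fun w => unitChart EG G (u w * (u z)⁻¹)) z :=
  mfderiv_eq_of_map_one ((contMDiffAt_mul_right hu _).mdifferentiableAt (by simp)) (by simp)

theorem contDiffAt_rdChart {u : N → G} {z : N} (hu : ContMDiffAt 𝓘(ℝ, N) 𝓘(ℝ, EG) ∞ u z) :
    ContDiffAt ℝ ∞ (fun w => unitChart EG G (u w * (u z)⁻¹)) z :=
  contDiffAt_unitChart_comp (contMDiffAt_mul_right hu _) (by simp [one_mem_unitChart_source])

theorem hasFDerivAt_rdChart {u : N → G} {z : N} (hu : ContMDiffAt 𝓘(ℝ, N) 𝓘(ℝ, EG) ∞ u z) :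
    HasFDerivAt (fun w => unitChart EG G (u w * (u z)⁻¹)) (rd EG u z) z := by
  rw [rd_eq hu]
  exact ((contDiffAt_rdChart hu).differentiableAt (by simp)).hasFDerivAt

/-- The constant cancels in `u w c (u z c)⁻¹`. This right invariance is what permits changing
initial values and gluing solutions. -/
theorem rd_mul_const (u : N → G) (c : G) (z : N) : rd EG (fun w => u w * c) z = rd EG u z := by
  unfold rd
  congr 1
  funext w
  group

theorem rd_congr {u v : N → G} {z : N} (h : u =ᶠ[𝓝 z] v) : rd EG u z = rd EG v z := by
  unfold rd
  rw [h.eq_of_nhds]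
  exact Filter.EventuallyEq.mfderiv_eq (by filter_upwards [h] with w hw; rw [hw])

theorem rd_const (c : G) (z : N) : rd EG (fun _ : N => c) z = 0 := by
  rw [rd_eq contMDiffAt_const]
  simp

/-- Multiplication in the preferred chart at the unit. -/
noncomputable def mulChart (EG G : Type*) [NormedAddCommGroup EG] [NormedSpace ℝ EG]
    [TopologicalSpace G] [ChartedSpace EG G] [Group G] (a c : EG) : EG :=
  unitChart EG G ((unitChart EG G).symm a * (unitChart EG G).symm c)

theorem contDiffAt_mulChart {a c : EG} (ha : a ∈ (unitChart EG G).target)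
    (hc : c ∈ (unitChart EG G).target)
    (hac : (unitChart EG G).symm a * (unitChart EG G).symm c ∈ (unitChart EG G).source) :
    ContDiffAt ℝ ∞ (fun z : EG × EG => mulChart EG G z.1 z.2) (a, c) := by
  refine contDiffAt_unitChart_comp (p := fun z : EG × EG =>
    (unitChart EG G).symm z.1 * (unitChart EG G).symm z.2) ?_ hac
  have h1 : ContMDiffAt 𝓘(ℝ, EG × EG) 𝓘(ℝ, EG) ∞ (fun z : EG × EG => z.1) (a, c) :=
    contDiffAt_fst.contMDiffAt
  have h2 : ContMDiffAt 𝓘(ℝ, EG × EG) 𝓘(ℝ, EG) ∞ (fun z : EG × EG => z.2) (a, c) :=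
    contDiffAt_snd.contMDiffAt
  exact (ContMDiffAt.comp (a, c) (contMDiffAt_unitChart_symm ha) h1).mul
    (ContMDiffAt.comp (a, c) (contMDiffAt_unitChart_symm hc) h2)

theorem contDiffAt_mulChart_unitPt_left {a : EG} (ha : a ∈ (unitChart EG G).target) :
    ContDiffAt ℝ ∞ (fun z : EG × EG => mulChart EG G z.1 z.2) (unitPt EG G, a) :=
  contDiffAt_mulChart unitPt_mem_target ha (by
    rw [unitChart_symm_unitPt, one_mul]; exact (unitChart EG G).map_target ha)

theorem contDiffAt_mulChart_unitPt_right {a : EG} (ha : a ∈ (unitChart EG G).target) :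
    ContDiffAt ℝ ∞ (fun z : EG × EG => mulChart EG G z.1 z.2) (a, unitPt EG G) :=
  contDiffAt_mulChart ha unitPt_mem_target (by
    rw [unitChart_symm_unitPt, mul_one]; exact (unitChart EG G).map_target ha)

theorem mulChart_chart {g h : G} (hg : g ∈ (unitChart EG G).source)
    (hh : h ∈ (unitChart EG G).source) :
    mulChart EG G (unitChart EG G g) (unitChart EG G h) = unitChart EG G (g * h) := by
  rw [mulChart, (unitChart EG G).left_inv hg, (unitChart EG G).left_inv hh]

/-- The differential at the unit of the right translation by `a`, in the chart. -/
noncomputable def rightDiff (EG G : Type*) [NormedAddCommGroup EG] [NormedSpace ℝ EG]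
    [TopologicalSpace G] [ChartedSpace EG G] [Group G] (a : EG) : EG →L[ℝ] EG :=
  fderiv ℝ (fun h => mulChart EG G h a) (unitPt EG G)

/-- The differential at the unit of the left translation by `a`, in the chart. -/
noncomputable def leftDiff (EG G : Type*) [NormedAddCommGroup EG] [NormedSpace ℝ EG]
    [TopologicalSpace G] [ChartedSpace EG G] [Group G] (a : EG) : EG →L[ℝ] EG :=
  fderiv ℝ (fun h => mulChart EG G a h) (unitPt EG G)

theorem rightDiff_eq {a : EG} (ha : a ∈ (unitChart EG G).target) :
    HasFDerivAt (fun h => mulChart EG G h a) (rightDiff EG G a) (unitPt EG G) ∧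
    rightDiff EG G a = fderiv ℝ (fun z : EG × EG => mulChart EG G z.1 z.2) (unitPt EG G, a) ∘L
      ContinuousLinearMap.inl ℝ EG EG := by
  have h1 := ((contDiffAt_mulChart_unitPt_left ha).differentiableAt (by simp)).hasFDerivAt.comp
    (unitPt EG G) (hasFDerivAt_prodMk_left (𝕜 := ℝ) (unitPt EG G) a)
  have h2 : rightDiff EG G a = _ := h1.fderiv
  rw [h2]
  exact ⟨h1, rfl⟩

theorem leftDiff_eq {a : EG} (ha : a ∈ (unitChart EG G).target) :
    HasFDerivAt (fun h => mulChart EG G a h) (leftDiff EG G a) (unitPt EG G) ∧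
    leftDiff EG G a = fderiv ℝ (fun z : EG × EG => mulChart EG G z.1 z.2) (a, unitPt EG G) ∘L
      ContinuousLinearMap.inr ℝ EG EG := by
  have h1 := ((contDiffAt_mulChart_unitPt_right ha).differentiableAt (by simp)).hasFDerivAt.comp
    (unitPt EG G) (hasFDerivAt_prodMk_right (𝕜 := ℝ) a (unitPt EG G))
  have h2 : leftDiff EG G a = _ := h1.fderiv
  rw [h2]
  exact ⟨h1, rfl⟩

theorem eventually_mem_target :
    ∀ᶠ a in 𝓝 (unitPt EG G), a ∈ (unitChart EG G).target :=
  isOpen_unitChart_target.mem_nhds unitPt_mem_target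

theorem rightDiff_unitPt : rightDiff EG G (unitPt EG G) = ContinuousLinearMap.id ℝ EG := by
  rw [rightDiff, ← fderiv_id (x := unitPt EG G)]
  apply Filter.EventuallyEq.fderiv_eq
  filter_upwards [eventually_mem_target (G := G)] with a ha
  rw [mulChart, unitChart_symm_unitPt, mul_one, (unitChart EG G).right_inv ha, id]

theorem leftDiff_unitPt : leftDiff EG G (unitPt EG G) = ContinuousLinearMap.id ℝ EG := by
  rw [leftDiff, ← fderiv_id (x := unitPt EG G)]
  apply Filter.EventuallyEq.fderiv_eq
  filter_upwards [eventually_mem_target (G := G)] with a ha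
  rw [mulChart, unitChart_symm_unitPt, one_mul, (unitChart EG G).right_inv ha, id]

theorem contDiffAt_fderiv_mulChart :
    ContDiffAt ℝ ∞ (fderiv ℝ (fun z : EG × EG => mulChart EG G z.1 z.2))
      (unitPt EG G, unitPt EG G) :=
  (contDiffAt_mulChart_unitPt_left unitPt_mem_target).fderiv_right (by simp)

theorem hasFDerivAt_leftDiff : HasFDerivAt (leftDiff EG G)
    (fderiv ℝ (leftDiff EG G) (unitPt EG G)) (unitPt EG G) ∧ ∀ x y,
    fderiv ℝ (leftDiff EG G) (unitPt EG G) x y =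
      fderiv ℝ (fderiv ℝ (fun z : EG × EG => mulChart EG G z.1 z.2))
        (unitPt EG G, unitPt EG G) (x, 0) (0, y) := by
  have h1 := HasFDerivAt.comp (g := fderiv ℝ (fun z : EG × EG => mulChart EG G z.1 z.2))
    (unitPt EG G) ((contDiffAt_fderiv_mulChart (EG := EG) (G := G)).differentiableAt
    (by simp)).hasFDerivAt (f := fun e => (e, unitPt EG G))
    (hasFDerivAt_prodMk_left (𝕜 := ℝ) (unitPt EG G) (unitPt EG G))
  have h2 := h1.clm_comp (hasFDerivAt_const (ContinuousLinearMap.inr ℝ EG EG) (unitPt EG G))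
  have h3 := h2.congr_of_eventuallyEq (f₁ := leftDiff EG G) (by
    filter_upwards [eventually_mem_target (G := G)] with a ha
    exact (leftDiff_eq ha).2)
  rw [h3.fderiv]
  exact ⟨h3, fun x y => by simp⟩

theorem hasFDerivAt_rightDiff : HasFDerivAt (rightDiff EG G)
    (fderiv ℝ (rightDiff EG G) (unitPt EG G)) (unitPt EG G) ∧ ∀ x y,
    fderiv ℝ (rightDiff EG G) (unitPt EG G) x y =
      fderiv ℝ (fderiv ℝ (fun z : EG × EG => mulChart EG G z.1 z.2))
        (unitPt EG G, unitPt EG G) (0, x) (y, 0) := by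
  have h1 := HasFDerivAt.comp (g := fderiv ℝ (fun z : EG × EG => mulChart EG G z.1 z.2))
    (unitPt EG G) ((contDiffAt_fderiv_mulChart (EG := EG) (G := G)).differentiableAt
    (by simp)).hasFDerivAt (hasFDerivAt_prodMk_right (𝕜 := ℝ) (unitPt EG G) (unitPt EG G))
  have h2 := h1.clm_comp (hasFDerivAt_const (ContinuousLinearMap.inl ℝ EG EG) (unitPt EG G))
  have h3 := h2.congr_of_eventuallyEq (f₁ := rightDiff EG G) (by
    filter_upwards [eventually_mem_target (G := G)] with a ha
    exact (rightDiff_eq ha).2)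
  rw [h3.fderiv]
  exact ⟨h3, fun x y => by simp⟩

/-- Both sides are mixed second derivatives of the multiplication at the unit, and second
derivatives are symmetric. -/
theorem fderiv_rightDiff_apply (x y : EG) : fderiv ℝ (rightDiff EG G) (unitPt EG G) x y =
    fderiv ℝ (leftDiff EG G) (unitPt EG G) y x := by
  rw [hasFDerivAt_leftDiff.2, hasFDerivAt_rightDiff.2]
  exact ((contDiffAt_mulChart_unitPt_left unitPt_mem_target).isSymmSndFDerivAt
    (by simp only [minSmoothness_of_isRCLikeNormedField]; exact ENat.LEInfty.out)).eq _ _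

/-- The derivative of a product of two maps with value `1`. -/
theorem fderiv_chart_mul {p q : N → G} {z : N} (hp : ContMDiffAt 𝓘(ℝ, N) 𝓘(ℝ, EG) ∞ p z)
    (hq : ContMDiffAt 𝓘(ℝ, N) 𝓘(ℝ, EG) ∞ q z) (hp1 : p z = 1) (hq1 : q z = 1) :
    fderiv ℝ (fun w => unitChart EG G (p w * q w)) z =
      fderiv ℝ (fun w => unitChart EG G (p w)) z + fderiv ℝ (fun w => unitChart EG G (q w)) z := by
  have hps : p z ∈ (unitChart EG G).source := by rw [hp1]; exact one_mem_unitChart_source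
  have hqs : q z ∈ (unitChart EG G).source := by rw [hq1]; exact one_mem_unitChart_source
  have hP := ((contDiffAt_unitChart_comp hp hps).differentiableAt (by simp)).hasFDerivAt
  have hQ := ((contDiffAt_unitChart_comp hq hqs).differentiableAt (by simp)).hasFDerivAt
  have hm : HasFDerivAt (fun z : EG × EG => mulChart EG G z.1 z.2)
      (ContinuousLinearMap.fst ℝ EG EG + ContinuousLinearMap.snd ℝ EG EG)
      (unitChart EG G (p z), unitChart EG G (q z)) := by
    rw [hp1, hq1]
    have h1 := ((contDiffAt_mulChart_unitPt_left (G := G) (EG := EG)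
      unitPt_mem_target).differentiableAt (by simp)).hasFDerivAt
    refine h1.congr_fderiv ?_
    have hl := (leftDiff_eq (G := G) (EG := EG) unitPt_mem_target).2
    have hr := (rightDiff_eq (G := G) (EG := EG) unitPt_mem_target).2
    rw [leftDiff_unitPt] at hl
    rw [rightDiff_unitPt] at hr
    ext v
    · simpa using (DFunLike.congr_fun hr v).symm
    · simpa using (DFunLike.congr_fun hl v).symm
  have hc := hm.comp z (hP.prodMk hQ)
  have hc' : HasFDerivAt (fun w => unitChart EG G (p w * q w)) _ z :=
    hc.congr_of_eventuallyEq (by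
      filter_upwards [eventually_mem_source hp.continuousAt hps,
        eventually_mem_source hq.continuousAt hqs] with w h1 h2
      exact (mulChart_chart h1 h2).symm)
  rw [hc'.fderiv]
  ext v
  simp

/-- The differential of `p` in terms of its logarithmic differential. -/
theorem fderiv_chart_eq_rightDiff {p : N → G} {z : N} (hp : ContMDiffAt 𝓘(ℝ, N) 𝓘(ℝ, EG) ∞ p z)
    (h : p z ∈ (unitChart EG G).source) :
    fderiv ℝ (fun w => unitChart EG G (p w)) z =
      rightDiff EG G (unitChart EG G (p z)) ∘L rd EG p z := by
  have h1 := (rightDiff_eq ((unitChart EG G).map_source h)).1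
  have h2 : HasFDerivAt (fun h => mulChart EG G h (unitChart EG G (p z)))
      (rightDiff EG G (unitChart EG G (p z))) (unitChart EG G (p z * (p z)⁻¹)) := by
    rw [mul_inv_cancel]; exact h1
  have h3 := HasFDerivAt.comp (f := fun w => unitChart EG G (p w * (p z)⁻¹)) z h2
    (hasFDerivAt_rdChart hp)
  refine (h3.congr_of_eventuallyEq ?_).fderiv
  filter_upwards [eventually_mem_source (contMDiffAt_mul_right hp (p z)⁻¹).continuousAt
    (by rw [mul_inv_cancel]; exact one_mem_unitChart_source (EG := EG))] with w hw
  simp only [Function.comp]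
  rw [mulChart_chart hw h, inv_mul_cancel_right]

/-- The logarithmic differential of a smooth map is smooth. -/
theorem contDiffAt_rd {u : N → G} {z : N} (hu : ∀ᶠ w in 𝓝 z, ContMDiffAt 𝓘(ℝ, N) 𝓘(ℝ, EG) ∞ u w) :
    ContDiffAt ℝ ∞ (rd EG u) z := by
  have huz := hu.self_of_nhds
  have h1 : ContMDiffAt 𝓘(ℝ, N × N) 𝓘(ℝ, EG) ∞ (fun q : N × N => u q.2 * (u q.1)⁻¹) (z, z) := by
    have ha : ContMDiffAt 𝓘(ℝ, N × N) 𝓘(ℝ, N) ∞ (fun q : N × N => q.1) (z, z) :=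
      contDiffAt_fst.contMDiffAt
    have hb : ContMDiffAt 𝓘(ℝ, N × N) 𝓘(ℝ, N) ∞ (fun q : N × N => q.2) (z, z) :=
      contDiffAt_snd.contMDiffAt
    exact (ContMDiffAt.comp (z, z) (g := u) huz hb).mul
      (ContMDiffAt.comp (z, z) (g := u) huz ha).inv
  have h2 := contDiffAt_unitChart_comp h1 (by
    simp only [mul_inv_cancel]; exact one_mem_unitChart_source)
  have h3 : ContDiffAt ℝ ∞ (fun w => fderiv ℝ (fun v => unitChart EG G (u v * (u w)⁻¹)) w) z :=
    ContDiffAt.fderiv (f := fun w v => unitChart EG G (u v * (u w)⁻¹)) (g := id) h2 contDiffAt_id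
      (by simp)
  refine h3.congr_of_eventuallyEq ?_
  filter_upwards [hu] with w hw
  exact rd_eq hw

/-- The differential at the unit of a map `Θ`, in the charts. -/
theorem hasFDerivAt_hom {Θ : G → H} (hΘ : ContMDiffAt 𝓘(ℝ, EG) 𝓘(ℝ, EH) ∞ Θ 1)
    (h : Θ 1 = 1) : HasFDerivAt (fun e => unitChart EH H (Θ ((unitChart EG G).symm e)))
      (dHom EG EH Θ) (unitPt EG G) := by
  rw [mfderiv_hom_eq (hΘ.mdifferentiableAt (by simp)) h]
  refine (ContDiffAt.differentiableAt (n := ∞) (contDiffAt_unitChart_comp ?_ ?_)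
    (by simp)).hasFDerivAt
  · refine ContMDiffAt.comp _ ?_ (contMDiffAt_unitChart_symm unitPt_mem_target)
    rw [unitChart_symm_unitPt]
    exact hΘ
  · rw [unitChart_symm_unitPt, h]
    exact one_mem_unitChart_source

theorem fderiv_chart_hom {Θ : G → H} (hΘ : ContMDiffAt 𝓘(ℝ, EG) 𝓘(ℝ, EH) ∞ Θ 1)
    (h : Θ 1 = 1) {p : N → G} {z : N} (hp : ContMDiffAt 𝓘(ℝ, N) 𝓘(ℝ, EG) ∞ p z) (hp1 : p z = 1) :
    fderiv ℝ (fun w => unitChart EH H (Θ (p w))) z =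
      dHom EG EH Θ ∘L
        fderiv ℝ (fun w => unitChart EG G (p w)) z := by
  have hps : p z ∈ (unitChart EG G).source := by rw [hp1]; exact one_mem_unitChart_source
  have h1 := ((contDiffAt_unitChart_comp hp hps).differentiableAt (by simp)).hasFDerivAt
  have h2 : HasFDerivAt (fun e => unitChart EH H (Θ ((unitChart EG G).symm e)))
      (dHom EG EH Θ) (unitChart EG G (p z)) := by
    rw [hp1]; exact hasFDerivAt_hom hΘ h
  have h3 := HasFDerivAt.comp (f := fun w => unitChart EG G (p w)) z h2 h1
  refine (h3.congr_of_eventuallyEq ?_).fderiv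
  filter_upwards [eventually_mem_source hp.continuousAt hps] with w hw
  simp only [Function.comp, (unitChart EG G).left_inv hw]

theorem rd_hom {Θ : G →* H} (hΘ : ContMDiffAt 𝓘(ℝ, EG) 𝓘(ℝ, EH) ∞ Θ 1) {u : N → G} {z : N}
    (hu : ContMDiffAt 𝓘(ℝ, N) 𝓘(ℝ, EG) ∞ u z)
    (hΘu : ContMDiffAt 𝓘(ℝ, N) 𝓘(ℝ, EH) ∞ (fun w => Θ (u w)) z) :
    rd EH (fun w => Θ (u w)) z =
      dHom EG EH Θ ∘L rd EG u z := by
  rw [rd_eq hΘu, rd_eq hu, ← fderiv_chart_hom hΘ (map_one Θ) (contMDiffAt_mul_right hu _) (by simp)]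
  simp only [map_mul, map_inv]

theorem mfderiv_hom_comp {K EK : Type*} [NormedAddCommGroup EK] [NormedSpace ℝ EK]
    [TopologicalSpace K] [ChartedSpace EK K] [Group K] [LieGroup 𝓘(ℝ, EK) ∞ K]
    {Θ : G → H} {Ξ : H → K} (hΘ : ContMDiffAt 𝓘(ℝ, EG) 𝓘(ℝ, EH) ∞ Θ 1)
    (hΞ : ContMDiffAt 𝓘(ℝ, EH) 𝓘(ℝ, EK) ∞ Ξ 1) (h : Θ 1 = 1) (h' : Ξ 1 = 1) :
    dHom EG EK (fun g => Ξ (Θ g)) =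
      dHom EH EK Ξ ∘L
        dHom EG EH Θ := by
  have hc : ContMDiffAt 𝓘(ℝ, EG) 𝓘(ℝ, EK) ∞ (fun g => Ξ (Θ g)) 1 :=
    ContMDiffAt.comp (g := Ξ) _ (by rw [h]; exact hΞ) hΘ
  rw [mfderiv_hom_eq (hc.mdifferentiableAt (by simp)) (by simp [h, h']),
    mfderiv_hom_eq (hΘ.mdifferentiableAt (by simp)) h]
  refine fderiv_chart_hom hΞ h' (p := fun e => Θ ((unitChart EG G).symm e)) ?_ ?_
  · refine ContMDiffAt.comp _ ?_ (contMDiffAt_unitChart_symm unitPt_mem_target)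
    rw [unitChart_symm_unitPt]
    exact hΘ
  · rw [unitChart_symm_unitPt, h]

end LieCalculus

/-! ### Differentiated crossed module laws, Maurer-Cartan equation and Lie bracket. -/

section Modules

variable {G : Type*} {EG : Type*} [NormedAddCommGroup EG] [NormedSpace ℝ EG]
  [TopologicalSpace G] [ChartedSpace EG G] [Group G] [LieGroup 𝓘(ℝ, EG) ∞ G]
  {H : Type*} {EH : Type*} [NormedAddCommGroup EH] [NormedSpace ℝ EH]
  [TopologicalSpace H] [ChartedSpace EH H] [Group H] [LieGroup 𝓘(ℝ, EH) ∞ H]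
  {N : Type*} [NormedAddCommGroup N] [NormedSpace ℝ N]

/-- The crossed module of a Lie group acting on itself by conjugation. -/
def conjModule (EG G : Type*) [NormedAddCommGroup EG] [NormedSpace ℝ EG]
    [TopologicalSpace G] [ChartedSpace EG G] [Group G] [LieGroup 𝓘(ℝ, EG) ∞ G] :
    LieCrossedModule EG G EG G where
  t := MonoidHom.id G
  m := MulAut.conj
  t_smooth := contMDiff_id
  m_smooth := (contMDiff_fst.mul contMDiff_snd).mul contMDiff_fst.inv
  t_m _ _ := rfl
  m_t _ _ := rfl

/-- The adjoint representation. -/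
noncomputable def Ad (EG : Type*) {G : Type*} [NormedAddCommGroup EG] [NormedSpace ℝ EG]
    [TopologicalSpace G] [ChartedSpace EG G] [Group G] [LieGroup 𝓘(ℝ, EG) ∞ G] (a : G) :
    EG →L[ℝ] EG := (conjModule EG G).mDot a

namespace LieCrossedModule

variable (C : LieCrossedModule EG G EH H)

theorem contMDiff_m (a : G) : ContMDiff 𝓘(ℝ, EH) 𝓘(ℝ, EH) ∞ (C.m a) :=
  C.m_smooth.comp (contMDiff_const.prodMk contMDiff_id)

theorem mDot_mul (a b : G) : C.mDot (a * b) = C.mDot a ∘L C.mDot b := by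
  refine Eq.trans ?_ (mfderiv_hom_comp (C.contMDiff_m b).contMDiffAt (C.contMDiff_m a).contMDiffAt
    (map_one _) (map_one _))
  unfold mDot
  congr 1
  rw [map_mul]
  rfl

theorem mDot_mul_apply (a b : G) (v : EH) : C.mDot (a * b) v = C.mDot a (C.mDot b v) := by
  rw [mDot_mul]; rfl

theorem mDot_one : C.mDot 1 = ContinuousLinearMap.id ℝ EH := by
  unfold mDot
  rw [map_one]
  exact mfderiv_id

theorem mDot_mDot_inv (a : G) (v : EH) : C.mDot a (C.mDot a⁻¹ v) = v := by
  rw [← mDot_mul_apply, mul_inv_cancel, mDot_one]; rfl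

/-- The chain rule applied to `t(m(a)(A)) = a t(A) a⁻¹`, with conjugation viewed as the action in
`conjModule`. -/
theorem tDot_mDot (a : G) (v : EH) : C.tDot (C.mDot a v) = Ad EG a (C.tDot v) := by
  have h1 := mfderiv_hom_comp (C.contMDiff_m a).contMDiffAt C.t_smooth.contMDiffAt
    (map_one _) (map_one _)
  have h2 := mfderiv_hom_comp C.t_smooth.contMDiffAt
    ((conjModule EG G).contMDiff_m a).contMDiffAt (map_one _) (map_one _)
  have h3 : (fun g => C.t (C.m a g)) = fun g => (conjModule EG G).m a (C.t g) := by
    funext g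
    rw [C.t_m]
    rfl
  rw [h3] at h1
  exact DFunLike.congr_fun (h1.symm.trans h2) v

theorem mDot_t (A : H) : C.mDot (C.t A) = Ad EH A := by
  have : C.m (C.t A) = (conjModule EH H).m A := by
    ext B
    rw [C.m_t]
    rfl
  unfold Ad mDot
  rw [this]

theorem contMDiffAt_m_comp {u : N → G} {v : N → H} {z : N}
    (hu : ContMDiffAt 𝓘(ℝ, N) 𝓘(ℝ, EG) ∞ u z) (hv : ContMDiffAt 𝓘(ℝ, N) 𝓘(ℝ, EH) ∞ v z) :
    ContMDiffAt 𝓘(ℝ, N) 𝓘(ℝ, EH) ∞ (fun w => C.m (u w) (v w)) z :=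
  C.m_smooth.contMDiffAt.comp z (hu.prodMk hv)

theorem contDiffAt_mDot {u : N → G} {z : N} (hu : ContMDiffAt 𝓘(ℝ, N) 𝓘(ℝ, EG) ∞ u z) :
    ContDiffAt ℝ ∞ (fun w => C.mDot (u w)) z := by
  have h0 : ContMDiffAt 𝓘(ℝ, N × EH) 𝓘(ℝ, EH) ∞
      (fun q : N × EH => C.m (u q.1) ((unitChart EH H).symm q.2)) (z, unitPt EH H) := by
    have ha : ContMDiffAt 𝓘(ℝ, N × EH) 𝓘(ℝ, N) ∞ (fun q : N × EH => q.1) (z, unitPt EH H) :=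
      contDiffAt_fst.contMDiffAt
    have hb : ContMDiffAt 𝓘(ℝ, N × EH) 𝓘(ℝ, EH) ∞ (fun q : N × EH => q.2) (z, unitPt EH H) :=
      contDiffAt_snd.contMDiffAt
    exact C.contMDiffAt_m_comp (ContMDiffAt.comp (z, unitPt EH H) (g := u) hu ha)
      (ContMDiffAt.comp (z, unitPt EH H) (contMDiffAt_unitChart_symm unitPt_mem_target) hb)
  have h2 := contDiffAt_unitChart_comp h0 (by
    simp only [unitChart_symm_unitPt, map_one]; exact one_mem_unitChart_source)
  have h3 : ContDiffAt ℝ ∞ (fun w => fderiv ℝ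
      (fun e => unitChart EH H (C.m (u w) ((unitChart EH H).symm e))) (unitPt EH H)) z :=
    ContDiffAt.fderiv (f := fun w e => unitChart EH H (C.m (u w) ((unitChart EH H).symm e)))
      (g := fun _ => unitPt EH H) h2 contDiffAt_const (by simp)
  refine h3.congr_of_eventuallyEq (Filter.Eventually.of_forall fun w => ?_)
  exact mfderiv_hom_eq ((C.contMDiff_m _).contMDiffAt.mdifferentiableAt (by simp)) (map_one _)

/-- The infinitesimal action `𝔤 × 𝔥 → 𝔥`. -/
noncomputable def act : EG →L[ℝ] EH →L[ℝ] EH :=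
  fderiv ℝ (fun e => C.mDot ((unitChart EG G).symm e)) (unitPt EG G)

theorem hasFDerivAt_mDot_chart : HasFDerivAt (fun e => C.mDot ((unitChart EG G).symm e)) C.act
    (unitPt EG G) :=
  ((C.contDiffAt_mDot (contMDiffAt_unitChart_symm unitPt_mem_target)).differentiableAt
    (by simp)).hasFDerivAt

theorem hasFDerivAt_mDot_of_one {u : N → G} {z : N} (hu : ContMDiffAt 𝓘(ℝ, N) 𝓘(ℝ, EG) ∞ u z)
    (h1 : u z = 1) : HasFDerivAt (fun w => C.mDot (u w)) (C.act ∘L rd EG u z) z := by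
  have h2 : HasFDerivAt (fun e => C.mDot ((unitChart EG G).symm e)) C.act
      (unitChart EG G (u z * (u z)⁻¹)) := by
    rw [mul_inv_cancel]; exact C.hasFDerivAt_mDot_chart
  have h3 := HasFDerivAt.comp (f := fun w => unitChart EG G (u w * (u z)⁻¹)) z h2
    (hasFDerivAt_rdChart hu)
  refine h3.congr_of_eventuallyEq ?_
  filter_upwards [eventually_mem_source hu.continuousAt
    (by rw [h1]; exact one_mem_unitChart_source (EG := EG))] with w hw
  simp only [Function.comp, h1, inv_one, mul_one, (unitChart EG G).left_inv hw]

/-- The factorization `ṁ(u w) = ṁ(u w (u z)⁻¹) ṁ(u z)` reduces the derivative to that of a map with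
value `1` at `z`. -/
theorem hasFDerivAt_mDot {u : N → G} {z : N} (hu : ContMDiffAt 𝓘(ℝ, N) 𝓘(ℝ, EG) ∞ u z) :
    HasFDerivAt (fun w => C.mDot (u w))
      ((ContinuousLinearMap.compL ℝ EH EH EH).flip (C.mDot (u z)) ∘L C.act ∘L rd EG u z) z := by
  have h1 := C.hasFDerivAt_mDot_of_one (contMDiffAt_mul_right hu (u z)⁻¹) (by simp)
  rw [rd_mul_const] at h1
  have h2 := ((ContinuousLinearMap.compL ℝ EH EH EH).flip (C.mDot (u z))).hasFDerivAt.comp z h1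
  refine h2.congr_of_eventuallyEq (Filter.Eventually.of_forall fun w => ?_)
  simp only [Function.comp, ContinuousLinearMap.flip_apply, ContinuousLinearMap.compL_apply]
  rw [← mDot_mul, inv_mul_cancel_right]

/-- The infinitesimal Peiffer identity: `mDot_t` differentiated at the unit. -/
theorem act_tDot (b : EH) (v : EH) : C.act (C.tDot b) v = (conjModule EH H).act b v := by
  have h1 := (conjModule EH H).hasFDerivAt_mDot_chart
  have hu : ContMDiffAt 𝓘(ℝ, EH) 𝓘(ℝ, EG) ∞ (fun e => C.t ((unitChart EH H).symm e))
      (unitPt EH H) :=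
    C.t_smooth.contMDiffAt.comp _ (contMDiffAt_unitChart_symm unitPt_mem_target)
  have h2 := C.hasFDerivAt_mDot_of_one hu (by simp [unitChart_symm_unitPt])
  have h3 : rd EG (fun e => C.t ((unitChart EH H).symm e)) (unitPt EH H) = C.tDot := by
    rw [rd_eq hu]
    simp only [unitChart_symm_unitPt, map_one, inv_one, mul_one]
    exact (hasFDerivAt_hom C.t_smooth.contMDiffAt (map_one _)).fderiv
  have h4 : (fun e => C.mDot (C.t ((unitChart EH H).symm e))) =
      fun e => (conjModule EH H).mDot ((unitChart EH H).symm e) := by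
    funext e
    rw [mDot_t]
    rfl
  rw [h4, h3] at h2
  exact (DFunLike.congr_fun (DFunLike.congr_fun (h2.unique h1) b) v)

/-- Equivariance of the infinitesimal action. -/
theorem mDot_act (a : G) (x : EG) (v : EH) :
    C.mDot a (C.act x v) = C.act (Ad EG a x) (C.mDot a v) := by
  have h0 := C.hasFDerivAt_mDot_chart.clm_apply (hasFDerivAt_const v (unitPt EG G))
  have h1 := HasFDerivAt.comp (f := fun e => C.mDot ((unitChart EG G).symm e) v) (unitPt EG G)
    (C.mDot a).hasFDerivAt h0
  have hs := contMDiffAt_unitChart_symm (unitPt_mem_target (EG := EG) (G := G))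
  have hu : ContMDiffAt 𝓘(ℝ, EG) 𝓘(ℝ, EG) ∞
      (fun e => (conjModule EG G).m a ((unitChart EG G).symm e)) (unitPt EG G) :=
    ((conjModule EG G).contMDiff_m a).contMDiffAt.comp _ hs
  have h2 := C.hasFDerivAt_mDot_of_one hu (by simp [unitChart_symm_unitPt])
  have h3 : rd EG (fun e => (conjModule EG G).m a ((unitChart EG G).symm e)) (unitPt EG G) =
      Ad EG a := by
    rw [rd_eq hu]
    simp only [unitChart_symm_unitPt, map_one, inv_one, mul_one]
    exact (hasFDerivAt_hom ((conjModule EG G).contMDiff_m a).contMDiffAt (map_one _)).fderiv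
  rw [h3] at h2
  have h5 := h2.clm_apply (hasFDerivAt_const (C.mDot a v) (unitPt EG G))
  have h4 : (C.mDot a ∘ fun e => C.mDot ((unitChart EG G).symm e) v) =
      fun e => C.mDot ((conjModule EG G).m a ((unitChart EG G).symm e)) (C.mDot a v) := by
    funext e
    simp only [Function.comp, ← mDot_mul_apply]
    congr 2
    change a * _ = (a * _ * a⁻¹) * a
    group
  rw [h4] at h1
  simpa using DFunLike.congr_fun (h1.unique h5) x

end LieCrossedModule

theorem Ad_mul_apply (a b : G) (v : EG) : Ad EG (a * b) v = Ad EG a (Ad EG b v) :=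
  (conjModule EG G).mDot_mul_apply a b v

theorem Ad_Ad_inv (a : G) (v : EG) : Ad EG a (Ad EG a⁻¹ v) = v :=
  (conjModule EG G).mDot_mDot_inv a v

/-- The adjoint action of the Lie algebra. -/
noncomputable def ad (EG G : Type*) [NormedAddCommGroup EG] [NormedSpace ℝ EG]
    [TopologicalSpace G] [ChartedSpace EG G] [Group G] [LieGroup 𝓘(ℝ, EG) ∞ G] :
    EG →L[ℝ] EG →L[ℝ] EG := (conjModule EG G).act

/-- The logarithmic differential of a product. -/
theorem rd_mul {u v : N → G} {z : N} (hu : ContMDiffAt 𝓘(ℝ, N) 𝓘(ℝ, EG) ∞ u z)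
    (hv : ContMDiffAt 𝓘(ℝ, N) 𝓘(ℝ, EG) ∞ v z) :
    rd EG (fun w => u w * v w) z = rd EG u z + Ad EG (u z) ∘L rd EG v z := by
  have hc := ((conjModule EG G).contMDiff_m (u z)).contMDiffAt (x := v z * (v z)⁻¹)
  have h1 := fderiv_chart_mul (contMDiffAt_mul_right hu (u z)⁻¹)
    (ContMDiffAt.comp z hc (contMDiffAt_mul_right hv (v z)⁻¹)) (by simp) (by simp)
  have h2 := fderiv_chart_hom ((conjModule EG G).contMDiff_m (u z)).contMDiffAt (map_one _)
    (contMDiffAt_mul_right hv (v z)⁻¹) (by simp)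
  have huv : ContMDiffAt 𝓘(ℝ, N) 𝓘(ℝ, EG) ∞ (fun w => u w * v w) z := hu.mul hv
  change _ = _ + dHom EG EG ((conjModule EG G).m (u z)) ∘L _
  rw [rd_eq hu, rd_eq hv, rd_eq huv, ← h2]
  refine Eq.trans ?_ h1
  congr 1
  funext w
  congr 1
  change _ = u w * (u z)⁻¹ * (u z * (v w * (v z)⁻¹) * (u z)⁻¹)
  group

theorem rd_inv {u : N → G} {z : N} (hu : ContMDiffAt 𝓘(ℝ, N) 𝓘(ℝ, EG) ∞ u z) :
    rd EG (fun w => (u w)⁻¹) z = -(Ad EG (u z)⁻¹ ∘L rd EG u z) := by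
  have h := rd_mul hu.inv hu
  simp only [inv_mul_cancel, rd_const] at h
  exact eq_neg_of_add_eq_zero_left h.symm

theorem rd_comp {N' : Type*} [NormedAddCommGroup N'] [NormedSpace ℝ N'] {u : N → G} {c : N' → N}
    {z : N'} (hu : ContMDiffAt 𝓘(ℝ, N) 𝓘(ℝ, EG) ∞ u (c z)) {c' : N' →L[ℝ] N}
    (hc : HasFDerivAt c c' z) :
    rd EG (fun w => u (c w)) z = rd EG u (c z) ∘L c' := by
  have h1 := contMDiffAt_mul_right hu (u (c z))⁻¹
  have h2 : MDifferentiableAt 𝓘(ℝ, N') 𝓘(ℝ, EG) (fun w => u (c w) * (u (c z))⁻¹) z :=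
    MDifferentiableAt.comp z (h1.mdifferentiableAt (by simp))
      hc.differentiableAt.mdifferentiableAt
  refine (mfderiv_eq_of_map_one h2 (by simp)).trans ?_
  exact (HasFDerivAt.comp z (hasFDerivAt_rdChart hu) hc).fderiv

/-- The identity `a h = (a h a⁻¹) a`, differentiated at `h = 1`. -/
theorem leftDiff_eq_rightDiff_comp {a : EG} (ha : a ∈ (unitChart EG G).target) :
    leftDiff EG G a = rightDiff EG G a ∘L Ad EG ((unitChart EG G).symm a) := by
  have hm := ((conjModule EG G).contMDiff_m ((unitChart EG G).symm a)).contMDiffAt (x := 1)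
  have h1 := hasFDerivAt_hom hm (map_one _)
  have h2 : HasFDerivAt (fun h => mulChart EG G h a) (rightDiff EG G a)
      (unitChart EG G ((conjModule EG G).m ((unitChart EG G).symm a)
        ((unitChart EG G).symm (unitPt EG G)))) := by
    rw [unitChart_symm_unitPt, map_one]
    exact (rightDiff_eq ha).1
  have h3 := HasFDerivAt.comp (unitPt EG G) h2 h1
  refine (h3.congr_of_eventuallyEq ?_).fderiv
  have hc : ContinuousAt (fun e => (conjModule EG G).m ((unitChart EG G).symm a)
      ((unitChart EG G).symm e)) (unitPt EG G) :=
    ContinuousAt.comp (by rw [unitChart_symm_unitPt]; exact hm.continuousAt)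
      (contMDiffAt_unitChart_symm unitPt_mem_target).continuousAt
  filter_upwards [eventually_mem_source hc (by
    rw [unitChart_symm_unitPt, map_one]; exact one_mem_unitChart_source (EG := EG))] with e he
  simp only [Function.comp]
  rw [mulChart, mulChart, (unitChart EG G).left_inv he]
  congr 1
  change (unitChart EG G).symm a * (unitChart EG G).symm e = ((unitChart EG G).symm a *
    (unitChart EG G).symm e * ((unitChart EG G).symm a)⁻¹) * (unitChart EG G).symm a
  group

/-- Differentiating `leftDiff = rightDiff ∘ Ad` at the unit expresses `ad` through derivatives of
the two translations; symmetry of the second derivative turns the right one into a left one with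
exchanged arguments. -/
theorem ad_apply (x y : EG) : ad EG G x y = fderiv ℝ (leftDiff EG G) (unitPt EG G) x y -
    fderiv ℝ (leftDiff EG G) (unitPt EG G) y x := by
  have h1 := (hasFDerivAt_leftDiff (EG := EG) (G := G)).1
  have h2 := (hasFDerivAt_rightDiff (EG := EG) (G := G)).1.clm_comp
    (conjModule EG G).hasFDerivAt_mDot_chart
  have h3 := h2.congr_of_eventuallyEq (f₁ := leftDiff EG G) (by
    filter_upwards [eventually_mem_target (G := G)] with a ha
    exact leftDiff_eq_rightDiff_comp ha)
  have h4 := DFunLike.congr_fun (DFunLike.congr_fun (h1.unique h3) x) y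
  have h5 : (conjModule EG G).mDot (1 : G) = _ := (conjModule EG G).mDot_one
  simp only [add_apply, ContinuousLinearMap.comp_apply,
    ContinuousLinearMap.compL_apply, ContinuousLinearMap.flip_apply, unitChart_symm_unitPt,
    h5, rightDiff_unitPt, ContinuousLinearMap.id_apply, fderiv_rightDiff_apply] at h4
  rw [h4]
  simp [ad]

/-- The Maurer-Cartan equation. -/
theorem fderiv_rd_sub {u : N → G} {z : N} (hu : ∀ᶠ w in 𝓝 z, ContMDiffAt 𝓘(ℝ, N) 𝓘(ℝ, EG) ∞ u w)
    (k l : N) : fderiv ℝ (rd EG u) z k l - fderiv ℝ (rd EG u) z l k =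
      ad EG G (rd EG u z k) (rd EG u z l) := by
  set p : N → G := fun w => u w * (u z)⁻¹ with hp
  have hps : ∀ᶠ w in 𝓝 z, ContMDiffAt 𝓘(ℝ, N) 𝓘(ℝ, EG) ∞ p w := by
    filter_upwards [hu] with w hw
    exact contMDiffAt_mul_right hw _
  have hrd : rd EG p = rd EG u := funext fun w => rd_mul_const u _ w
  have hpz : p z = 1 := mul_inv_cancel _
  rw [← hrd]
  have h1s : p z ∈ (unitChart EG G).source := by rw [hpz]; exact one_mem_unitChart_source
  have hπ : ContDiffAt ℝ ∞ (fun w => unitChart EG G (p w)) z :=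
    contDiffAt_unitChart_comp hps.self_of_nhds h1s
  have hr : HasFDerivAt (rd EG p) (fderiv ℝ (rd EG p) z) z :=
    ((contDiffAt_rd hps).differentiableAt (by simp)).hasFDerivAt
  -- The chart expression of `p` has differential `rightDiff(p) ∘ rd p`. Its second derivative is
  -- symmetric, so antisymmetrization leaves only the derivative of `rightDiff`, which is the
  -- bracket by `ad_apply`.
  have hev : fderiv ℝ (fun w => unitChart EG G (p w)) =ᶠ[𝓝 z]
      fun w => rightDiff EG G (unitChart EG G (p w)) ∘L rd EG p w := by
    filter_upwards [hps, eventually_mem_source hps.self_of_nhds.continuousAt h1s] with w hw hw'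
    exact fderiv_chart_eq_rightDiff hw hw'
  have hR : HasFDerivAt (rightDiff EG G) (fderiv ℝ (rightDiff EG G) (unitPt EG G))
      (unitChart EG G (p z)) := by
    rw [hpz]; exact hasFDerivAt_rightDiff.1
  have hc := (HasFDerivAt.comp z hR (hπ.differentiableAt (by simp)).hasFDerivAt).clm_comp hr
  have hc' := hc.congr_of_eventuallyEq hev
  have hsym := (hπ.isSymmSndFDerivAt (by
    simp only [minSmoothness_of_isRCLikeNormedField]; exact ENat.LEInfty.out)).eq k l
  have hpt : unitChart EG G (p z) = unitPt EG G := by rw [hpz]; rfl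
  have hD : fderiv ℝ (fun w => unitChart EG G (p w)) z = rd EG p z := by
    have h := hev.self_of_nhds
    simp only [hpt, rightDiff_unitPt] at h
    exact h
  rw [hc'.fderiv, hD] at hsym
  simp only [Function.comp, hpt, rightDiff_unitPt, add_apply,
    ContinuousLinearMap.comp_apply, ContinuousLinearMap.compL_apply,
    ContinuousLinearMap.flip_apply, ContinuousLinearMap.id_apply, fderiv_rightDiff_apply] at hsym
  rw [ad_apply, sub_eq_sub_iff_add_eq_add, hsym, add_comm]

/-- The left invariant vector fields in the preferred chart at the unit. -/
theorem mpullbackWithin_mulInvariantVectorField (v e : EG) (he : e ∈ (unitChart EG G).target) :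
    VectorField.mpullbackWithin 𝓘(ℝ, EG) 𝓘(ℝ, EG) (unitChart EG G).symm
        (mulInvariantVectorField (I := 𝓘(ℝ, EG)) (G := G) v) (range 𝓘(ℝ, EG)) e =
      leftDiff EG G e v := by
  have hr : range (𝓘(ℝ, EG) : EG → EG) = univ := by simp
  set g := (unitChart EG G).symm e with hg
  have hgs : g ∈ (unitChart EG G).source := (unitChart EG G).map_target he
  have hφ := (contMDiffAt_unitChart hgs).mdifferentiableAt (n := ∞) (by simp)
  have hψ := (contMDiffAt_unitChart_symm he).mdifferentiableAt (n := ∞) (by simp)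
  have e1 := mfderiv_extChartAt_comp_mfderivWithin_extChartAt_symm (I := 𝓘(ℝ, EG)) (x := (1 : G))
    (y := e) he
  have e2 := mfderivWithin_extChartAt_symm_comp_mfderiv_extChartAt (I := 𝓘(ℝ, EG)) (x := (1 : G))
    (y := e) he
  have hinv : (mfderivWithin 𝓘(ℝ, EG) 𝓘(ℝ, EG) (unitChart EG G).symm (range 𝓘(ℝ, EG)) e).inverse
      = mfderiv 𝓘(ℝ, EG) 𝓘(ℝ, EG) (unitChart EG G) g :=
    ContinuousLinearMap.inverse_eq e2 e1
  rw [VectorField.mpullbackWithin_apply, hinv]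
  have hmul : MDifferentiableAt 𝓘(ℝ, EG) 𝓘(ℝ, EG) (g * ·) (1 : G) :=
    (contMDiff_mul_left (I := 𝓘(ℝ, EG)) (n := ∞)).contMDiffAt.mdifferentiableAt (by simp)
  have hφ' : MDifferentiableAt 𝓘(ℝ, EG) 𝓘(ℝ, EG) (unitChart EG G) (g * 1) := by
    rw [mul_one]; exact hφ
  have hcomp := mfderiv_comp (1 : G) hφ' hmul
  have hc' := (hφ'.comp (1 : G) hmul).mfderiv
  simp only [writtenInExtChartAt, hr, fderivWithin_univ] at hc'
  have key := DFunLike.congr_fun (hcomp.symm.trans hc') v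
  -- The base points `g * 1` and `g` are only propositionally equal; the comparison is made for
  -- variable points because the tangent space depends on them.
  have hcongr : ∀ a b : G, a = b → ∀ w : EG,
      (mfderiv 𝓘(ℝ, EG) 𝓘(ℝ, EG) (unitChart EG G) a : EG →L[ℝ] EG) w =
      (mfderiv 𝓘(ℝ, EG) 𝓘(ℝ, EG) (unitChart EG G) b : EG →L[ℝ] EG) w := by
    rintro a _ rfl w; rfl
  exact (hcongr _ _ (mul_one g).symm _).trans key

/-- At the unit `leftDiff` is the identity, so the bracket of the two fields is the antisymmetrized
derivative of `leftDiff`, as in `ad_apply`. Fields and domain are variables here to match the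
unfolded definition of the bracket on `T₁G`. -/
theorem lieBracketWithin_leftDiff (x y : EG) (V W : EG → EG)
    (h1 : V =ᶠ[𝓝 (unitPt EG G)] fun e => leftDiff EG G e x)
    (h2 : W =ᶠ[𝓝 (unitPt EG G)] fun e => leftDiff EG G e y) (s : Set EG) (hs : s = univ) :
    VectorField.lieBracketWithin ℝ V W s (unitPt EG G) = ad EG G x y := by
  subst hs
  have hL := (hasFDerivAt_leftDiff (EG := EG) (G := G)).1
  have hLv : ∀ v : EG, fderiv ℝ (fun e => leftDiff EG G e v) (unitPt EG G) =
      (fderiv ℝ (leftDiff EG G) (unitPt EG G)).flip v := fun v => by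
    rw [(hL.clm_apply (hasFDerivAt_const v _)).fderiv]
    ext w
    simp
  rw [VectorField.lieBracketWithin_univ]
  refine (h1.lieBracket_vectorField_eq h2).trans ?_
  rw [VectorField.lieBracket_eq]
  simp only [hLv, leftDiff_unitPt, ad_apply]
  simp

/-- A left invariant vector field in the preferred chart at the unit. -/
noncomputable def leftFieldChart (v : EG) : EG → EG := VectorField.mpullbackWithin 𝓘(ℝ, EG) 𝓘(ℝ, EG) (unitChart EG G).symm
        (mulInvariantVectorField (I := 𝓘(ℝ, EG)) (G := G) v) (range 𝓘(ℝ, EG))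

theorem leftFieldChart_eventuallyEq (v : EG) : leftFieldChart (G := G) v =ᶠ[𝓝 (unitPt EG G)]
        fun e => leftDiff EG G e v := by
    filter_upwards [eventually_mem_target (EG := EG) (G := G)] with e he
    exact mpullbackWithin_mulInvariantVectorField v e he

theorem inverse_apply_of_eq_id (A : EG →L[ℝ] EG) (hA : A = ContinuousLinearMap.id ℝ EG) (v : EG) :
    A.inverse v = v := by
  rw [hA, ContinuousLinearMap.inverse_id]; rfl

/-- The differential at the unit of the preferred chart. -/
noncomputable def unitChartDiff (EG G : Type*) [NormedAddCommGroup EG] [NormedSpace ℝ EG]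
    [TopologicalSpace G] [ChartedSpace EG G] [Group G] : EG →L[ℝ] EG := mfderiv 𝓘(ℝ, EG) 𝓘(ℝ, EG) (extChartAt 𝓘(ℝ, EG) (1 : G)) 1

theorem unitChartDiff_eq_id : unitChartDiff EG G = ContinuousLinearMap.id ℝ EG := mfderiv_extChartAt_self

/-- The bracket of left invariant vector fields in the preferred chart. -/
noncomputable def leftBracketChart (x y : EG) : EG := (VectorField.lieBracketWithin ℝ (leftFieldChart (G := G) x) (leftFieldChart (G := G) y) ((unitChart EG G).symm ⁻¹' univ ∩ range 𝓘(ℝ, EG)) (unitPt EG G))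

theorem lieBr_eq_leftBracketChart (x y : EG) : lieBr EG G x y = (unitChartDiff EG G).inverse (leftBracketChart (G := G) x y) := rfl

/-- The Lie bracket of Mathlib is the adjoint action. -/
theorem lieBr_eq_ad (x y : EG) : lieBr EG G x y = ad EG G x y :=
  (lieBr_eq_leftBracketChart x y).trans ((inverse_apply_of_eq_id _ unitChartDiff_eq_id _).trans (lieBracketWithin_leftDiff x y _ _ (leftFieldChart_eventuallyEq x) (leftFieldChart_eventuallyEq y) _ (by rw [preimage_univ, univ_inter]; simp)))
end Modules
end TwoTransport

namespace TwoTransport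

/-! ### Existence and uniqueness for `∂ₜu u⁻¹ = α` with parameters. -/

section LieODE

variable {G : Type*} {EG : Type*} [NormedAddCommGroup EG] [NormedSpace ℝ EG]
  [TopologicalSpace G] [ChartedSpace EG G] [Group G] [LieGroup 𝓘(ℝ, EG) ∞ G]
  {P : Type*} [NormedAddCommGroup P] [NormedSpace ℝ P]

/-- A curve with vanishing logarithmic derivative is locally constant. -/
theorem eventually_eq_of_rlogDeriv_eq_zero {w : ℝ → G} {t : ℝ}
    (hw : ∀ᶠ s in 𝓝 t, ContMDiffAt 𝓘(ℝ, ℝ) 𝓘(ℝ, EG) ∞ w s)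
    (h0 : ∀ᶠ s in 𝓝 t, rlogDeriv (EG := EG) w s = 0) : ∀ᶠ s in 𝓝 t, w s = w t := by
  set p : ℝ → G := fun s => w s * (w t)⁻¹ with hp
  have hpt : p t = 1 := mul_inv_cancel _
  have h1 : p t ∈ (unitChart EG G).source := by rw [hpt]; exact one_mem_unitChart_source
  have hps : ∀ᶠ s in 𝓝 t, ContMDiffAt 𝓘(ℝ, ℝ) 𝓘(ℝ, EG) ∞ p s := by
    filter_upwards [hw] with s hs
    exact contMDiffAt_mul_right hs _
  obtain ⟨δ, hδ, hb⟩ := Metric.eventually_nhds_iff_ball.1 (hps.and (h0.and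
    (eventually_mem_source hps.self_of_nhds.continuousAt h1)))
  have hd : ∀ s ∈ Metric.ball t δ, HasFDerivAt (fun s => unitChart EG G (p s)) (0 : ℝ →L[ℝ] EG) s := by
    intro s hs
    obtain ⟨a, b, c⟩ := hb s hs
    have h2 := fderiv_chart_eq_rightDiff a c
    have h3 : rd EG p s = 0 := by
      rw [hp, rd_mul_const]
      ext
      simpa [rlogDeriv_eq_rd] using b
    rw [h3, ContinuousLinearMap.comp_zero] at h2
    rw [← h2]
    exact ((contDiffAt_unitChart_comp a c).differentiableAt (by simp)).hasFDerivAt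
  filter_upwards [Metric.ball_mem_nhds t hδ] with s hs
  have h4 := (convex_ball t δ).is_const_of_fderivWithin_eq_zero (𝕜 := ℝ)
    (fun x hx => (hd x hx).differentiableAt.differentiableWithinAt)
    (fun x hx => by
      rw [fderivWithin_of_isOpen Metric.isOpen_ball hx]; exact (hd x hx).fderiv)
    hs (Metric.mem_ball_self hδ)
  have h5 := (unitChart EG G).injOn (hb s hs).2.2 h1 h4
  rw [hpt] at h5
  exact mul_inv_eq_one.1 h5

/-- No structure on `Y` is involved, so `w` may also take propositions as values; in this form the
lemma replaces open-and-closed arguments. -/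
theorem eqOn_of_eventually_eq {X Y : Type*} [TopologicalSpace X] {I : Set X} (hI : IsPreconnected I)
    {w : X → Y} (h : ∀ t ∈ I, ∀ᶠ s in 𝓝 t, w s = w t) {a b : X} (ha : a ∈ I)
    (hb : b ∈ I) : w b = w a := by
  have : PreconnectedSpace I := isPreconnected_iff_preconnectedSpace.1 hI
  have hl : IsLocallyConstant (fun x : I => w x) := by
    rw [IsLocallyConstant.iff_eventually_eq]
    intro x
    exact continuous_subtype_val.continuousAt.eventually (h x x.2)
  exact hl.apply_eq_of_preconnectedSpace ⟨b, hb⟩ ⟨a, ha⟩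

theorem rlogDeriv_inv_mul {u v : ℝ → G} {t : ℝ} (hu : ContMDiffAt 𝓘(ℝ, ℝ) 𝓘(ℝ, EG) ∞ u t)
    (hv : ContMDiffAt 𝓘(ℝ, ℝ) 𝓘(ℝ, EG) ∞ v t) : rlogDeriv (EG := EG) (fun s => (u s)⁻¹ * v s) t =
      Ad EG (u t)⁻¹ (rlogDeriv (EG := EG) v t - rlogDeriv (EG := EG) u t) := by
  simp only [rlogDeriv_eq_rd]
  rw [rd_mul hu.inv hv, rd_inv hu]
  simp only [add_apply, neg_apply, ContinuousLinearMap.comp_apply,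
    map_sub]
  abel

/-- Uniqueness for the logarithmic derivative. -/
theorem eqOn_of_rlogDeriv_eq {I : Set ℝ} (hI : IsPreconnected I) (hIo : IsOpen I) {u v : ℝ → G}
    (hu : ∀ t ∈ I, ContMDiffAt 𝓘(ℝ, ℝ) 𝓘(ℝ, EG) ∞ u t)
    (hv : ∀ t ∈ I, ContMDiffAt 𝓘(ℝ, ℝ) 𝓘(ℝ, EG) ∞ v t)
    (h : ∀ t ∈ I, rlogDeriv (EG := EG) u t = rlogDeriv (EG := EG) v t) {t₀ : ℝ} (ht₀ : t₀ ∈ I)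
    (h0 : u t₀ = v t₀) : ∀ t ∈ I, u t = v t := by
  intro t ht
  -- The logarithmic derivative of `u⁻¹ v` is `Ad(u⁻¹)` of the difference of those of `v` and `u`,
  -- hence zero.
  have := eqOn_of_eventually_eq hI (w := fun s => (u s)⁻¹ * v s) (fun t ht => by
    refine eventually_eq_of_rlogDeriv_eq_zero (EG := EG) ?_ ?_
    · filter_upwards [hIo.mem_nhds ht] with s hs
      exact (hu s hs).inv.mul (hv s hs)
    · filter_upwards [hIo.mem_nhds ht] with s hs
      rw [rlogDeriv_inv_mul (hu s hs) (hv s hs), h s hs, sub_self, map_zero]) ht₀ ht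
  simp only [h0, inv_mul_cancel] at this
  exact inv_mul_eq_one.1 this

/-- Right translation by the inverse group element provides a left inverse of the differential. -/
theorem rightDiff_injective {a : EG} (ha : a ∈ (unitChart EG G).target) {v w : EG}
    (h : rightDiff EG G a v = rightDiff EG G a w) : v = w := by
  set g := (unitChart EG G).symm a with hg
  have hone : (unitChart EG G).symm a * g⁻¹ = 1 := mul_inv_cancel _
  have h1 : ContDiffAt ℝ ∞ (fun e => unitChart EG G ((unitChart EG G).symm e * g⁻¹)) a :=
    contDiffAt_unitChart_comp (contMDiffAt_mul_right (contMDiffAt_unitChart_symm ha) _)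
      (by rw [hone]; exact one_mem_unitChart_source)
  have h2 := (h1.differentiableAt (by simp)).hasFDerivAt
  have h3 := (rightDiff_eq (G := G) ha).1
  have hao : mulChart EG G (unitPt EG G) a = a := by
    rw [mulChart, unitChart_symm_unitPt, one_mul, (unitChart EG G).right_inv ha]
  rw [← hao] at h2
  have h4 := HasFDerivAt.comp (unitPt EG G) (f := fun h => mulChart EG G h a) h2 h3
  have h5 : HasFDerivAt (id : EG → EG) _ (unitPt EG G) := h4.congr_of_eventuallyEq (by
    have hc : ContinuousAt (fun e => (unitChart EG G).symm e * g) (unitPt EG G) :=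
      (contMDiffAt_mul_right (contMDiffAt_unitChart_symm unitPt_mem_target) g).continuousAt
    filter_upwards [eventually_mem_target (EG := EG) (G := G), eventually_mem_source (N := EG) hc (by
      rw [unitChart_symm_unitPt, one_mul]; exact (unitChart EG G).map_target ha)] with e he he'
    simp only [Function.comp, mulChart, id]
    rw [(unitChart EG G).left_inv he', mul_inv_cancel_right, (unitChart EG G).right_inv he])
  have h6 := h5.unique (hasFDerivAt_id _)
  have h7 : ∀ x : EG, (fderiv ℝ (fun e => unitChart EG G ((unitChart EG G).symm e * g⁻¹))
      (mulChart EG G (unitPt EG G) a)) (rightDiff EG G a x) = x := fun x => DFunLike.congr_fun h6 x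
  rw [← h7 v, h, h7 w]

theorem contDiffAt_rightDiff {a : EG} (ha : a ∈ (unitChart EG G).target) :
    ContDiffAt ℝ ∞ (rightDiff EG G) a := by
  have h1 : ContDiffAt ℝ ∞ (fun b : EG => fderiv ℝ (fun h => mulChart EG G h b) (unitPt EG G)) a := by
    refine ContDiffAt.fderiv (f := fun b h => mulChart EG G h b) (g := fun _ => unitPt EG G)
      (n := ∞) ?_ contDiffAt_const (by simp)
    exact (contDiffAt_mulChart_unitPt_left ha).comp (a, unitPt EG G)
      (f := fun z : EG × EG => (z.2, z.1)) (contDiffAt_snd.prodMk contDiffAt_fst)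
  exact h1

/-- The field of the equation `u' u⁻¹ = α`, cut off outside of a neighbourhood of the unit. -/
theorem exists_cutoff_rightDiff [FiniteDimensional ℝ EG] : ∃ R : EG → EG →L[ℝ] EG,
    ContDiff ℝ ∞ R ∧ ∀ᶠ a in 𝓝 (unitPt EG G), R a = rightDiff EG G a := by
  obtain ⟨r, hr, hb⟩ := Metric.isOpen_iff.1 (isOpen_unitChart_target (EG := EG) (G := G)) _
    unitPt_mem_target
  -- The outer radius `r / 2` is less than `r`, so `χ` vanishes near every point outside the chart
  -- target and the product extends smoothly by zero.
  let χ : ContDiffBump (unitPt EG G) := ⟨r / 4, r / 2, by positivity, by linarith⟩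
  refine ⟨fun a => χ a • rightDiff EG G a, ?_, ?_⟩
  · rw [contDiff_iff_contDiffAt]
    intro a
    by_cases ha : a ∈ (unitChart EG G).target
    · exact χ.contDiffAt.smul (contDiffAt_rightDiff ha)
    · have : ∀ᶠ b in 𝓝 a, χ b = 0 := by
        have hd : r / 2 < dist a (unitPt EG G) := by
          by_contra! hc
          exact ha (hb (lt_of_le_of_lt hc (by linarith)))
        filter_upwards [(continuous_id.dist continuous_const).continuousAt.eventually_const_lt hd]
          with b hb
        exact χ.zero_of_le_dist hb.le
      refine (contDiffAt_const (c := (0 : EG →L[ℝ] EG))).congr_of_eventuallyEq ?_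
      filter_upwards [this] with b hb
      rw [hb, zero_smul]
  · filter_upwards [χ.eventuallyEq_one] with a ha
    rw [ha]; simp

/-- `u` solves `∂ₜu u⁻¹ = α` on `I × U`. -/
def IsLieSolution (u : ℝ × P → G) (α : ℝ × P → EG) (I : Set ℝ) (U : Set P) : Prop :=
  ∀ t ∈ I, ∀ p ∈ U, ContMDiffAt 𝓘(ℝ, ℝ × P) 𝓘(ℝ, EG) ∞ u (t, p) ∧
    rlogDeriv (EG := EG) (fun s => u (s, p)) t = α (t, p)

theorem contMDiffAt_slice {u : ℝ × P → G} {t : ℝ} {p : P}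
    (hu : ContMDiffAt 𝓘(ℝ, ℝ × P) 𝓘(ℝ, EG) ∞ u (t, p)) :
    ContMDiffAt 𝓘(ℝ, ℝ) 𝓘(ℝ, EG) ∞ (fun s => u (s, p)) t := by
  have : ContMDiffAt 𝓘(ℝ, ℝ) 𝓘(ℝ, ℝ × P) ∞ (fun s : ℝ => (s, p)) t :=
    (contDiffAt_id.prodMk contDiffAt_const).contMDiffAt
  exact ContMDiffAt.comp t (g := u) hu this

/-- Time and parameters are made part of the state: the field `(1, 0, R(a) α)` is autonomous, and
smoothness of its flow in the initial value is smoothness in the parameters. Solutions start at the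
unit, near which the cut-off `R` is the true coefficient. -/
theorem exists_local_lieSolution [FiniteDimensional ℝ EG] [CompleteSpace P] {α : ℝ × P → EG}
    (hα : ContDiff ℝ ∞ α) (t₀ : ℝ) (p₀ : P) : ∃ δ > 0, ∃ u : ℝ × P → G,
      IsLieSolution u α (Metric.ball t₀ δ) (Metric.ball p₀ δ) := by
  obtain ⟨R, hR, hRe⟩ := exists_cutoff_rightDiff (EG := EG) (G := G)
  have : CompleteSpace EG := FiniteDimensional.complete ℝ EG
  let F : ℝ × P × EG → ℝ × P × EG := fun z => (1, 0, R z.2.2 (α (z.1, z.2.1)))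
  have hF : ContDiff ℝ ∞ F := by
    refine contDiff_const.prodMk (contDiff_const.prodMk ?_)
    exact (hR.comp (contDiff_snd.comp contDiff_snd)).clm_apply
      (hα.comp (contDiff_fst.prodMk (contDiff_fst.comp contDiff_snd)))
  set o := unitPt EG G
  obtain ⟨δ, hδ, φ, hφ⟩ := exists_smooth_local_flow hF (t₀, p₀, o)
  let c : ℝ × P → ℝ × ℝ × P × EG := fun z => (z.1 - t₀, t₀, z.2, o)
  have hc : ContDiff ℝ ∞ c := by fun_prop
  have hsm : ∀ t, |t - t₀| < δ → ∀ p, ‖p - p₀‖ < δ → ContDiffAt ℝ ∞ (fun z => φ (c z)) (t, p) ∧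
      φ (c (t, p)) = (t, p, (φ (c (t, p))).2.2) ∧
      HasDerivAt (fun s => φ (c (s, p))) (F (φ (c (t, p)))) t := by
    intro t ht p hp
    have hn : ‖((t₀, p, o) : ℝ × P × EG) - (t₀, p₀, o)‖ < δ := by
      simp [Prod.norm_def, hp]
    obtain ⟨h1, h2⟩ := hφ _ hn
    have h3 : ∀ t, |t - t₀| < δ → HasDerivAt (fun s => φ (c (s, p))) (F (φ (c (t, p)))) t := by
      intro t ht
      have := (h2 _ ht).2.scomp t ((hasDerivAt_id t).sub_const t₀)
      simpa [Function.comp_def, c] using this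
    refine ⟨(h2 _ ht).1.comp (t, p) hc.contDiffAt, ?_, h3 t ht⟩
    -- The field has components `1` and `0` in the directions of time and parameters, so the orbit
    -- stays over `(s, p)`.
    have h4 : ∀ s ∈ Metric.ball t₀ δ, HasDerivWithinAt (fun s => ((φ (c (s, p))).1 - s, (φ (c (s, p))).2.1))
        (0 : ℝ × P) (Metric.ball t₀ δ) s := by
      intro s hs
      have h5 := (h3 s hs).hasFDerivAt
      have h6 := (h5.fst.hasDerivAt.sub (hasDerivAt_id s)).prodMk h5.snd.fst.hasDerivAt
      refine HasDerivAt.hasDerivWithinAt (h6.congr_deriv ?_)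
      simp [F]
    have h7 := (convex_ball t₀ δ).is_const_of_fderivWithin_eq_zero (𝕜 := ℝ)
      (fun x hx => (h4 x hx).differentiableWithinAt)
      (fun x hx => by
        rw [(h4 x hx).hasFDerivWithinAt.fderivWithin
          (Metric.isOpen_ball.uniqueDiffOn x hx)]
        exact ContinuousLinearMap.ext fun v => by simp) (x := t) (y := t₀) ht
      (Metric.mem_ball_self hδ)
    have h8 : φ (c (t₀, p)) = (t₀, p, o) := by simpa [c] using h1
    rw [h8] at h7
    simp only [Prod.mk.injEq, sub_self, sub_eq_zero] at h7
    ext <;> simp [h7.1, h7.2]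
  have hcont : ContinuousAt (fun z => (φ (c z)).2.2) (t₀, p₀) :=
    continuousAt_snd.comp (continuousAt_snd.comp
      (hsm t₀ (by simpa using hδ) p₀ (by simpa using hδ)).1.continuousAt)
  have hval : (φ (c (t₀, p₀))).2.2 = o := by
    have := (hφ (t₀, p₀, o) (by simpa using hδ)).1
    simp [c, this]
  have hev : ∀ᶠ z in 𝓝 (t₀, p₀), R (φ (c z)).2.2 = rightDiff EG G (φ (c z)).2.2 ∧
      (φ (c z)).2.2 ∈ (unitChart EG G).target :=
    hcont.eventually (by beta_reduce; rw [hval]; exact hRe.and eventually_mem_target)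
  obtain ⟨η, hη, hb⟩ := Metric.eventually_nhds_iff_ball.1 hev
  refine ⟨min δ η, lt_min hδ hη, fun z => (unitChart EG G).symm (φ (c z)).2.2, ?_⟩
  intro t ht p hp
  have ht' : |t - t₀| < min δ η := ht
  have hp' : ‖p - p₀‖ < min δ η := by rwa [← dist_eq_norm]
  obtain ⟨h1, h2, h3⟩ := hsm t (ht'.trans_le (min_le_left _ _)) p (hp'.trans_le (min_le_left _ _))
  have hmem : ∀ s ∈ Metric.ball t₀ (min δ η), (s, p) ∈ Metric.ball (t₀, p₀) η := by
    intro s hs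
    rw [← ball_prod_same]
    exact ⟨Metric.ball_subset_ball (min_le_right _ _) hs, Metric.ball_subset_ball (min_le_right _ _) hp⟩
  obtain ⟨h4, h5⟩ := hb _ (hmem t ht)
  have hu : ContMDiffAt 𝓘(ℝ, ℝ × P) 𝓘(ℝ, EG) ∞
      (fun z => (unitChart EG G).symm (φ (c z)).2.2) (t, p) :=
    ContMDiffAt.comp (t, p) (contMDiffAt_unitChart_symm h5)
      (contDiffAt_snd.comp _ (contDiffAt_snd.comp _ h1)).contMDiffAt
  refine ⟨hu, ?_⟩
  have hus := contMDiffAt_slice hu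
  have h6 := fderiv_chart_eq_rightDiff hus ((unitChart EG G).map_target h5)
  have h7 : HasDerivAt (fun s => unitChart EG G ((unitChart EG G).symm (φ (c (s, p))).2.2))
      (rightDiff EG G (φ (c (t, p))).2.2 (α (t, p))) t := by
    have h8 := h3.hasFDerivAt.snd.snd.hasDerivAt
    have h9 := h8.congr_of_eventuallyEq (f₁ := fun s => unitChart EG G
      ((unitChart EG G).symm (φ (c (s, p))).2.2)) (by
        filter_upwards [Metric.isOpen_ball.mem_nhds ht] with s hs
        exact (unitChart EG G).right_inv (hb _ (hmem s hs)).2)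
    refine h9.congr_deriv ?_
    rw [h2] at h4 ⊢
    simp [F, h4]
  have h10 := DFunLike.congr_fun h6 1
  rw [h7.hasFDerivAt.fderiv, (unitChart EG G).right_inv h5] at h10
  rw [rlogDeriv_eq_rd]
  refine (rightDiff_injective h5 ?_).symm
  simpa using h10

theorem IsLieSolution.unique {α : ℝ × P → EG} {u v : ℝ × P → G} {I J : Set ℝ} {U V : Set P}
    (hu : IsLieSolution u α I U) (hv : IsLieSolution v α J V) (hI : I.OrdConnected)
    (hJ : J.OrdConnected) (hIo : IsOpen I) (hJo : IsOpen J) {p : P} (hpU : p ∈ U) (hpV : p ∈ V)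
    {t₀ t : ℝ} (h0 : t₀ ∈ I ∩ J) (ht : t ∈ I ∩ J) (h : u (t₀, p) = v (t₀, p)) :
    u (t, p) = v (t, p) :=
  eqOn_of_rlogDeriv_eq (EG := EG) (u := fun s => u (s, p)) (v := fun s => v (s, p))
    (hI.inter hJ).isPreconnected (hIo.inter hJo)
    (fun s hs => contMDiffAt_slice (hu s hs.1 p hpU).1)
    (fun s hs => contMDiffAt_slice (hv s hs.2 p hpV).1)
    (fun s hs => (hu s hs.1 p hpU).2.trans (hv s hs.2 p hpV).2.symm) h0 h t ht

theorem IsLieSolution.mono {α : ℝ × P → EG} {u : ℝ × P → G} {I J : Set ℝ} {U V : Set P}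
    (hu : IsLieSolution u α I U) (hI : J ⊆ I) (hU : V ⊆ U) : IsLieSolution u α J V :=
  fun t ht p hp => hu t (hI ht) p (hU hp)

theorem IsLieSolution.congr {α : ℝ × P → EG} {u v : ℝ × P → G} {I : Set ℝ} {U : Set P}
    (hu : IsLieSolution u α I U) (hI : IsOpen I) (hU : IsOpen U)
    (h : ∀ t ∈ I, ∀ p ∈ U, v (t, p) = u (t, p)) : IsLieSolution v α I U := by
  intro t ht p hp
  have h1 : v =ᶠ[𝓝 (t, p)] u := by
    filter_upwards [(hI.prod hU).mem_nhds (mk_mem_prod ht hp)] with z hz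
    exact h z.1 hz.1 z.2 hz.2
  refine ⟨(hu t ht p hp).1.congr_of_eventuallyEq h1, ?_⟩
  rw [← (hu t ht p hp).2, rlogDeriv_eq_rd, rlogDeriv_eq_rd]
  congr 1
  refine rd_congr ?_
  filter_upwards [hI.mem_nhds ht] with s hs
  exact h s hs p hp

/-- By right invariance initial values can be prescribed as smooth functions of the parameter. -/
theorem IsLieSolution.mul_const {α : ℝ × P → EG} {u : ℝ × P → G} {I : Set ℝ} {U : Set P}
    (hu : IsLieSolution u α I U) {c : P → G} (hc : ∀ p ∈ U, ContMDiffAt 𝓘(ℝ, P) 𝓘(ℝ, EG) ∞ c p) :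
    IsLieSolution (fun z => u z * c z.2) α I U := by
  intro t ht p hp
  refine ⟨(hu t ht p hp).1.mul ?_, ?_⟩
  · have : ContMDiffAt 𝓘(ℝ, ℝ × P) 𝓘(ℝ, P) ∞ (fun z : ℝ × P => z.2) (t, p) :=
      contDiffAt_snd.contMDiffAt
    exact ContMDiffAt.comp (t, p) (g := c) (hc p hp) this
  · rw [← (hu t ht p hp).2, rlogDeriv_eq_rd, rlogDeriv_eq_rd]
    exact DFunLike.congr_fun (rd_mul_const (fun s => u (s, p)) (c p) t) 1

theorem contMDiffAt_slice_right {u : ℝ × P → G} {t : ℝ} {p : P}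
    (hu : ContMDiffAt 𝓘(ℝ, ℝ × P) 𝓘(ℝ, EG) ∞ u (t, p)) :
    ContMDiffAt 𝓘(ℝ, P) 𝓘(ℝ, EG) ∞ (fun q => u (t, q)) p := by
  have : ContMDiffAt 𝓘(ℝ, P) 𝓘(ℝ, ℝ × P) ∞ (fun q : P => (t, q)) p :=
    (contDiffAt_const.prodMk contDiffAt_id).contMDiffAt
  exact ContMDiffAt.comp p (g := u) hu this

/-- The times up to which the equation can be solved near a parameter. -/
def lieTimes (G : Type*) {EG : Type*} [NormedAddCommGroup EG] [NormedSpace ℝ EG]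
    [TopologicalSpace G] [ChartedSpace EG G] [Group G] {P : Type*} [NormedAddCommGroup P]
    [NormedSpace ℝ P] (α : ℝ × P → EG) (p₀ : P) : Set ℝ :=
  {T | ∃ I : Set ℝ, I.OrdConnected ∧ IsOpen I ∧ (0 : ℝ) ∈ I ∧ T ∈ I ∧ ∃ δ > 0, ∃ u : ℝ × P → G,
    IsLieSolution u α I (Metric.ball p₀ δ) ∧ ∀ p ∈ Metric.ball p₀ δ, u (0, p) = 1}

/-- Continuation by connectedness of the line. For closedness, a local solution around a limit time
`T` is right translated so that it continues a solution already known at some `T'` near `T`. The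
length of its interval does not depend on the value to be continued, so no blow-up can occur. -/
theorem lieTimes_eq_univ [FiniteDimensional ℝ EG] [CompleteSpace P] {α : ℝ × P → EG}
    (hα : ContDiff ℝ ∞ α) (p₀ : P) : lieTimes G α p₀ = univ := by
  refine IsClopen.eq_univ ⟨?_, ?_⟩ ?_
  · refine isClosed_of_closure_subset fun T hT => ?_
    obtain ⟨δ, hδ, v, hv⟩ := exists_local_lieSolution (G := G) hα T p₀
    obtain ⟨T', ⟨I, hI, hIo, h0, hT', η, hη, u, hu, hu0⟩, hTT'⟩ := Metric.mem_closure_iff.1 hT δ hδ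
    have hT'J : T' ∈ Metric.ball T δ := by rwa [Metric.mem_ball, dist_comm]
    have hJ : (Metric.ball T δ).OrdConnected := (convex_ball T δ).ordConnected
    set ε := min δ η with hε
    have hB1 : Metric.ball p₀ ε ⊆ Metric.ball p₀ δ := Metric.ball_subset_ball (min_le_left _ _)
    have hB2 : Metric.ball p₀ ε ⊆ Metric.ball p₀ η := Metric.ball_subset_ball (min_le_right _ _)
    have hv' : IsLieSolution (fun z => v z * ((v (T', z.2))⁻¹ * u (T', z.2))) α (Metric.ball T δ)
        (Metric.ball p₀ ε) := by
      refine (hv.mono subset_rfl hB1).mul_const (c := fun p => (v (T', p))⁻¹ * u (T', p)) ?_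
      intro p hp
      exact (contMDiffAt_slice_right (hv T' hT'J p (hB1 hp)).1).inv.mul
        (contMDiffAt_slice_right (hu T' hT' p (hB2 hp)).1)
    have hu' := hu.mono (J := I) subset_rfl hB2
    classical
    refine ⟨I ∪ Metric.ball T δ, ?_, hIo.union Metric.isOpen_ball, Or.inl h0,
      Or.inr (Metric.mem_ball_self hδ), ε, lt_min hδ hη,
      fun z => if z.1 ∈ I then u z else v z * ((v (T', z.2))⁻¹ * u (T', z.2)), ?_, ?_⟩
    · exact (IsPreconnected.union T' hT' hT'J hI.isPreconnected hJ.isPreconnected).ordConnected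
    · intro t ht p hp
      by_cases htI : t ∈ I
      · refine IsLieSolution.congr hu' hIo Metric.isOpen_ball ?_ t htI p hp
        intro s hs q hq
        exact if_pos hs
      · have htJ := ht.resolve_left htI
        refine IsLieSolution.congr hv' Metric.isOpen_ball Metric.isOpen_ball ?_ t htJ p hp
        intro s hs q hq
        dsimp only
        split_ifs with h
        · exact IsLieSolution.unique hu' hv' hI hJ hIo Metric.isOpen_ball hq hq ⟨hT', hT'J⟩ ⟨h, hs⟩
            (by simp)
        · rfl
    · intro p hp
      simp only [h0, if_true]
      exact hu0 p (hB2 hp)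
  · refine isOpen_iff_mem_nhds.2 fun T ⟨I, hI, hIo, h0, hT, h⟩ => ?_
    filter_upwards [hIo.mem_nhds hT] with s hs
    exact ⟨I, hI, hIo, h0, hs, h⟩
  · obtain ⟨δ, hδ, v, hv⟩ := exists_local_lieSolution (G := G) hα 0 p₀
    refine ⟨0, Metric.ball 0 δ, (convex_ball _ δ).ordConnected, Metric.isOpen_ball,
      Metric.mem_ball_self hδ, Metric.mem_ball_self hδ, δ, hδ, fun z => v z * (v (0, z.2))⁻¹,
      hv.mul_const (c := fun p => (v (0, p))⁻¹) fun p hp =>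
        (contMDiffAt_slice_right (hv 0 (Metric.mem_ball_self hδ) p hp).1).inv, fun p _ => by simp⟩

/-- Global solutions of `∂ₜu u⁻¹ = α`, smooth in the parameters. -/
theorem exists_lieSolution (G : Type*) {EG : Type*} [NormedAddCommGroup EG] [NormedSpace ℝ EG]
    [TopologicalSpace G] [ChartedSpace EG G] [Group G] [LieGroup 𝓘(ℝ, EG) ∞ G]
    [FiniteDimensional ℝ EG] [CompleteSpace P] {α : ℝ × P → EG}
    (hα : ContDiff ℝ ∞ α) : ∃ u : ℝ × P → G, ContMDiff 𝓘(ℝ, ℝ × P) 𝓘(ℝ, EG) ∞ u ∧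
      (∀ p, u (0, p) = 1) ∧ ∀ t p, rlogDeriv (EG := EG) (fun s => u (s, p)) t = α (t, p) := by
  have h : ∀ z : ℝ × P, z.1 ∈ lieTimes G α z.2 := fun z => by
    rw [lieTimes_eq_univ hα]; trivial
  choose I hI hIo h0 hT δ hδ u hu hu0 using h
  have hmem : ∀ z : ℝ × P, z.2 ∈ Metric.ball z.2 (δ z) := fun z => Metric.mem_ball_self (hδ z)
  -- Solutions chosen at different points agree by uniqueness, so the diagonal choice coincides near
  -- `z` with the single smooth solution `u z`.
  have hs : ∀ z : ℝ × P, IsLieSolution (fun w => u w w) α (I z) (Metric.ball z.2 (δ z)) := by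
    intro z
    refine (hu z).congr (hIo z) Metric.isOpen_ball ?_
    intro t ht p hp
    exact IsLieSolution.unique (hu (t, p)) (hu z) (hI _) (hI z) (hIo _) (hIo z) (hmem (t, p)) hp
      ⟨h0 _, h0 z⟩ ⟨hT (t, p), ht⟩ ((hu0 _ p (hmem (t, p))).trans (hu0 z p hp).symm)
  refine ⟨fun w => u w w, fun z => (hs z z.1 (hT z) z.2 (hmem z)).1,
    fun p => hu0 _ p (hmem (0, p)), fun t p => (hs (t, p) t (hT (t, p)) p (hmem (t, p))).2⟩

end LieODE

end TwoTransport

namespace TwoTransport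

/-! ### Smoothness of pull-backs and naturality of the exterior derivative. -/

section Forms

variable {E M N V : Type*} [NormedAddCommGroup E] [NormedSpace ℝ E]
  [TopologicalSpace M] [ChartedSpace E M]
  [NormedAddCommGroup N] [NormedSpace ℝ N] [NormedAddCommGroup V] [NormedSpace ℝ V] {k : ℕ}

set_option maxSynthPendingDepth 5 in
set_option synthInstance.maxHeartbeats 200000 in
/-- The pull-back of alternating forms depends smoothly on the linear map. -/
theorem contDiff_compContinuousLinearMapCLM (k : ℕ) : ContDiff ℝ ∞
    (ContinuousAlternatingMap.compContinuousLinearMapCLM :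
      (N →L[ℝ] E) → (E [⋀^Fin k]→L[ℝ] V) →L[ℝ] (N [⋀^Fin k]→L[ℝ] V)) := by
  induction k with
  | zero =>
    have h : (ContinuousAlternatingMap.compContinuousLinearMapCLM :
      (N →L[ℝ] E) → (E [⋀^Fin 0]→L[ℝ] V) →L[ℝ] (N [⋀^Fin 0]→L[ℝ] V)) =
        fun _ => ContinuousAlternatingMap.compContinuousLinearMapCLM 0 := by
      funext L
      ext A v
      change A _ = A _
      congr 1
      exact Subsingleton.elim _ _
    rw [h]
    exact contDiff_const
  | succ k ih =>
    -- The form `(k+1) L*A` is the alternatization of `w ↦ L*(A(L w, ·))`; here `L` enters only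
    -- linearly and through the pull-back in degree `k`.
    have h : ∀ L : N →L[ℝ] E, (ContinuousAlternatingMap.compContinuousLinearMapCLM L :
        (E [⋀^Fin (k + 1)]→L[ℝ] V) →L[ℝ] (N [⋀^Fin (k + 1)]→L[ℝ] V)) =
        ((k + 1 : ℝ)⁻¹) • (ContinuousAlternatingMap.alternatizeUncurryFinCLM ℝ N V ∘L
          (ContinuousLinearMap.compL ℝ N _ _
            (ContinuousAlternatingMap.compContinuousLinearMapCLM L)) ∘L
          ((ContinuousLinearMap.compL ℝ N E (E [⋀^Fin k]→L[ℝ] V)).flip L) ∘L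
          (ContinuousAlternatingMap.curryLeftLI.toContinuousLinearMap)) := by
      intro L
      have hk : (k + 1 : ℝ) ≠ 0 := by positivity
      rw [eq_inv_smul_iff₀ hk]
      ext A v
      have h1 := ContinuousAlternatingMap.alternatizeUncurryFin_curryLeft
        (A.compContinuousLinearMap L)
      have h2 := DFunLike.congr_fun h1 v
      simp only [smul_apply] at h2 ⊢
      rw [ContinuousAlternatingMap.compContinuousLinearMapCLM_apply]
      rw [← Nat.cast_smul_eq_nsmul ℝ] at h2
      push_cast at h2
      rw [← h2]
      have h3 : (A.compContinuousLinearMap L).curryLeft =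
          ContinuousAlternatingMap.compContinuousLinearMapCLM L ∘L A.curryLeft ∘L L := by
        ext w u
        change A _ = A _
        congr 1
        funext i
        refine Fin.cases ?_ (fun j => ?_) i <;> simp
      rw [h3]
      rfl
    rw [show (ContinuousAlternatingMap.compContinuousLinearMapCLM :
      (N →L[ℝ] E) → (E [⋀^Fin (k + 1)]→L[ℝ] V) →L[ℝ] (N [⋀^Fin (k + 1)]→L[ℝ] V)) = _ from funext h]
    have h1 : ContDiff ℝ ∞ (fun L : N →L[ℝ] E => ContinuousLinearMap.compL ℝ N (E [⋀^Fin k]→L[ℝ] V)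
        (N [⋀^Fin k]→L[ℝ] V) (ContinuousAlternatingMap.compContinuousLinearMapCLM L)) :=
      (ContinuousLinearMap.compL ℝ N (E [⋀^Fin k]→L[ℝ] V)
        (N [⋀^Fin k]→L[ℝ] V)).contDiff.comp ih
    have h2 := (ContinuousLinearMap.compL ℝ N E (E [⋀^Fin k]→L[ℝ] V)).flip.contDiff (n := ∞)
    have h3 := h2.clm_comp (contDiff_const (c := (ContinuousAlternatingMap.curryLeftLI :
      (E [⋀^Fin (k + 1)]→L[ℝ] V) →ₗᵢ[ℝ] _).toContinuousLinearMap))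
    have h4 := (contDiff_const (c := ContinuousAlternatingMap.alternatizeUncurryFinCLM
      ℝ N V)).clm_comp (h1.clm_comp h3)
    exact h4.const_smul _

theorem contDiffAt_compContinuousLinearMap {P : Type*} [NormedAddCommGroup P] [NormedSpace ℝ P]
    {A : P → E [⋀^Fin k]→L[ℝ] V} {L : P → N →L[ℝ] E} {z : P} (hA : ContDiffAt ℝ ∞ A z)
    (hL : ContDiffAt ℝ ∞ L z) : ContDiffAt ℝ ∞ (fun w => (A w).compContinuousLinearMap (L w)) z := by
  have h : ContDiffAt ℝ ∞ (fun w => (ContinuousAlternatingMap.compContinuousLinearMapCLM (L w) :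
      (E [⋀^Fin k]→L[ℝ] V) →L[ℝ] (N [⋀^Fin k]→L[ℝ] V))) z :=
    (contDiff_compContinuousLinearMapCLM k).contDiffAt.comp z hL
  exact h.clm_apply hA

/-- A form on a normed space as a map into the space of alternating maps. -/
def modelForm (σ : DForm N N k V) : N → N [⋀^Fin k]→L[ℝ] V := σ

theorem inChart_model (σ : DForm N N k V) (p : N) : inChart σ p = σ := by
  funext e
  have h1 : (mfderiv 𝓘(ℝ, N) 𝓘(ℝ, N) (extChartAt 𝓘(ℝ, N) p).symm e : N →L[ℝ] N) =
      ContinuousLinearMap.id ℝ N := by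
    rw [extChartAt_model_space_eq_id]
    exact mfderiv_id
  refine ContinuousAlternatingMap.ext fun v => ?_
  -- Points and vectors are varied together, since rewriting the point alone would change the type
  -- of the tangent vectors.
  have h2 : ∀ e' : N, e' = e → ∀ w : Fin k → N, w = v →
      (σ e' : N [⋀^Fin k]→L[ℝ] V) w = (σ e : N [⋀^Fin k]→L[ℝ] V) v := by
    rintro _ rfl _ rfl; rfl
  refine h2 _ (by rw [extChartAt_model_space_eq_id]; rfl) _ ?_
  funext i
  exact DFunLike.congr_fun h1 (v i)

theorem smoothForm_model_iff (σ : DForm N N k V) :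
    SmoothForm σ ↔ ContDiff ℝ ∞ (modelForm σ) := by
  unfold SmoothForm
  simp only [inChart_model, extChartAt_model_space_eq_id, PartialEquiv.refl_target]
  exact ⟨fun h => contDiffOn_univ.1 (h 0), fun h _ => contDiffOn_univ.2 h⟩

theorem dForm_model (σ : DForm N N k V) (z : N) (v : Fin (k + 1) → N) :
    (dForm σ z : N [⋀^Fin (k + 1)]→L[ℝ] V) v =
      extDeriv (modelForm σ) z v := by
  have h1 : (mfderiv 𝓘(ℝ, N) 𝓘(ℝ, N) (extChartAt 𝓘(ℝ, N) z) z : N →L[ℝ] N) =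
      ContinuousLinearMap.id ℝ N := by
    rw [extChartAt_model_space_eq_id]
    exact mfderiv_id
  have h2 : ∀ w : Fin (k + 1) → N, w = v → ∀ σ' : N → N [⋀^Fin k]→L[ℝ] V,
      σ' = (modelForm σ) → ∀ e, e = z →
      extDeriv σ' e w = extDeriv (modelForm σ) z v := by
    rintro _ rfl _ rfl _ rfl; rfl
  refine h2 _ ?_ _ (inChart_model σ z) _ (by rw [extChartAt_model_space_eq_id]; rfl)
  funext i
  exact DFunLike.congr_fun h1 (v i)

variable [IsManifold 𝓘(ℝ, E) ∞ M]

/-- The pull-back of a form along a map from a normed space, in a chart. -/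
theorem pullback_eventuallyEq {F : N → M} (hF : ContMDiff 𝓘(ℝ, N) 𝓘(ℝ, E) ∞ F)
    (η : DForm E M k V) (z₀ : N) : modelForm (pullback F η : DForm N N k V) =ᶠ[𝓝 z₀]
      fun z => (inChart η (F z₀) (extChartAt 𝓘(ℝ, E) (F z₀) (F z))).compContinuousLinearMap
        (fderiv ℝ (fun w => extChartAt 𝓘(ℝ, E) (F z₀) (F w)) z) := by
  set φ := extChartAt 𝓘(ℝ, E) (F z₀)
  have hev : ∀ᶠ z in 𝓝 z₀, F z ∈ φ.source :=
    hF.continuous.continuousAt.preimage_mem_nhds (extChartAt_source_mem_nhds _)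
  filter_upwards [hev.eventually_nhds] with z hz
  have hz0 := hz.self_of_nhds
  have hφF : ContMDiffAt 𝓘(ℝ, N) 𝓘(ℝ, E) ∞ (fun w => φ (F w)) z :=
    (contMDiffAt_extChartAt' (by simpa [φ] using hz0)).comp z hF.contMDiffAt
  have hφs : ContMDiffAt 𝓘(ℝ, E) 𝓘(ℝ, E) ∞ φ.symm (φ (F z)) :=
    (contMDiffOn_extChartAt_symm (F z₀)).contMDiffAt
      ((isOpen_extChartAt_target (F z₀)).mem_nhds (φ.map_source hz0))
  have hEq : F =ᶠ[𝓝 z] φ.symm ∘ fun w => φ (F w) := by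
    filter_upwards [hz] with w hw
    exact (φ.left_inv hw).symm
  have h1 := hEq.mfderiv_eq (I := 𝓘(ℝ, N)) (I' := 𝓘(ℝ, E))
  have h2 := mfderiv_comp z (hφs.mdifferentiableAt (by simp)) (hφF.mdifferentiableAt (by simp))
  have h3 : ∀ w : N, (mfderiv 𝓘(ℝ, N) 𝓘(ℝ, E) F z : N →L[ℝ] E) w =
      (mfderiv 𝓘(ℝ, E) 𝓘(ℝ, E) φ.symm (φ (F z)) : E →L[ℝ] E)
        (fderiv ℝ (fun w => φ (F w)) z w) := by
    intro w
    have h4 := DFunLike.congr_fun (h1.trans h2) w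
    rw [mfderiv_eq_fderiv] at h4
    exact h4
  refine ContinuousAlternatingMap.ext fun v => ?_
  have h5 : ∀ m : M, m = F z → ∀ w w' : Fin k → E, w = w' →
      (η (F z) : E [⋀^Fin k]→L[ℝ] V) w = (η m : E [⋀^Fin k]→L[ℝ] V) w' := by
    rintro _ rfl _ _ rfl; rfl
  exact h5 _ (φ.left_inv hz0) _ _ (funext fun i => h3 (v i))

theorem contDiffAt_inChart {η : DForm E M k V} (hη : SmoothForm η) (m : M) :
    ContDiffAt ℝ ∞ (inChart η m) (extChartAt 𝓘(ℝ, E) m m) :=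
  (hη m).contDiffAt ((isOpen_extChartAt_target m).mem_nhds (mem_extChartAt_target m))

theorem contDiffAt_chart_comp {F : N → M} (hF : ContMDiff 𝓘(ℝ, N) 𝓘(ℝ, E) ∞ F) (z : N) :
    ContDiffAt ℝ ∞ (fun w => extChartAt 𝓘(ℝ, E) (F z) (F w)) z := by
  rw [← contMDiffAt_iff_contDiffAt]
  exact (contMDiffAt_extChartAt' (by simp)).comp z hF.contMDiffAt

theorem contDiff_pullback {F : N → M} (hF : ContMDiff 𝓘(ℝ, N) 𝓘(ℝ, E) ∞ F) {η : DForm E M k V}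
    (hη : SmoothForm η) : ContDiff ℝ ∞ (modelForm (pullback F η : DForm N N k V)) := by
  rw [contDiff_iff_contDiffAt]
  intro z
  refine ContDiffAt.congr_of_eventuallyEq ?_ (pullback_eventuallyEq hF η z)
  refine contDiffAt_compContinuousLinearMap ?_ ?_
  · exact ContDiffAt.comp z (contDiffAt_inChart hη (F z)) (contDiffAt_chart_comp hF z)
  · exact (contDiffAt_chart_comp hF z).fderiv_right (by simp)

/-- In the chart at `F z`, the one used by `dForm η (F z)`, this is naturality of `extDeriv` for the
chart expression of `F`, followed by the chain rule. -/
theorem dForm_pullback {F : N → M} (hF : ContMDiff 𝓘(ℝ, N) 𝓘(ℝ, E) ∞ F) {η : DForm E M k V}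
    (hη : SmoothForm η) (z : N) (v : Fin (k + 1) → N) :
    (dForm (pullback F η : DForm N N k V) z : N [⋀^Fin (k + 1)]→L[ℝ] V) v =
      (dForm η (F z) : E [⋀^Fin (k + 1)]→L[ℝ] V)
        (fun i => (mfderiv 𝓘(ℝ, N) 𝓘(ℝ, E) F z : N →L[ℝ] E) (v i)) := by
  rw [dForm_model, (pullback_eventuallyEq hF η z).extDeriv_eq]
  have h1 := extDeriv_pullback (f := fun w => extChartAt 𝓘(ℝ, E) (F z) (F w)) (x := z) (r := ∞)
    ((contDiffAt_inChart hη (F z)).differentiableAt (by simp)) (contDiffAt_chart_comp hF z)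
    (by simp only [minSmoothness_of_isRCLikeNormedField]; exact ENat.LEInfty.out)
  rw [h1]
  have h2 := mfderiv_comp z (g := extChartAt 𝓘(ℝ, E) (F z)) (I' := 𝓘(ℝ, E)) (I'' := 𝓘(ℝ, E))
    ((contMDiffAt_extChartAt' (n := ∞) (by simp)).mdifferentiableAt (by simp))
    (hF.contMDiffAt.mdifferentiableAt (x := z) (by simp))
  have h3 : ∀ w : N, fderiv ℝ (fun w => extChartAt 𝓘(ℝ, E) (F z) (F w)) z w =
      (mfderiv 𝓘(ℝ, E) 𝓘(ℝ, E) (extChartAt 𝓘(ℝ, E) (F z)) (F z) : E →L[ℝ] E)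
        ((mfderiv 𝓘(ℝ, N) 𝓘(ℝ, E) F z : N →L[ℝ] E) w) := by
    intro w
    rw [← mfderiv_eq_fderiv]
    exact DFunLike.congr_fun h2 w
  change extDeriv (inChart η (F z)) _ (fun i => _) = extDeriv (inChart η (F z)) _ (fun i => _)
  congr 1
  funext i
  exact h3 (v i)

end Forms

/-! ### Pull-back of connection doublets and coordinate form of their equation. -/

section Doublets

variable {EG G EH H E M N : Type*}
  [NormedAddCommGroup EG] [NormedSpace ℝ EG]
  [TopologicalSpace G] [ChartedSpace EG G] [Group G] [LieGroup 𝓘(ℝ, EG) ∞ G]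
  [NormedAddCommGroup EH] [NormedSpace ℝ EH]
  [TopologicalSpace H] [ChartedSpace EH H] [Group H] [LieGroup 𝓘(ℝ, EH) ∞ H]
  [NormedAddCommGroup E] [NormedSpace ℝ E]
  [TopologicalSpace M] [ChartedSpace E M] [IsManifold 𝓘(ℝ, E) ∞ M]
  [NormedAddCommGroup N] [NormedSpace ℝ N]
  {C : LieCrossedModule EG G EH H}

theorem IsConnectionDoublet.pullback {θ : DForm E M 1 EG} {Υ : DForm E M 2 EH}
    (h : IsConnectionDoublet C θ Υ) {F : N → M} (hF : ContMDiff 𝓘(ℝ, N) 𝓘(ℝ, E) ∞ F) :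
    IsConnectionDoublet C (TwoTransport.pullback F θ : DForm N N 1 EG)
      (TwoTransport.pullback F Υ : DForm N N 2 EH) where
  smooth_one := (smoothForm_model_iff _).2 (contDiff_pullback hF h.smooth_one)
  smooth_two := (smoothForm_model_iff _).2 (contDiff_pullback hF h.smooth_two)
  fake_flat z v w := by
    have h1 := dForm_pullback hF h.smooth_one z ![v, w]
    have h2 := h.fake_flat (F z) ((mfderiv 𝓘(ℝ, N) 𝓘(ℝ, E) F z : N →L[ℝ] E) v)
      ((mfderiv 𝓘(ℝ, N) 𝓘(ℝ, E) F z : N →L[ℝ] E) w)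
    have e1 : ∀ v : N, (fun i => (mfderiv 𝓘(ℝ, N) 𝓘(ℝ, E) F z : N →L[ℝ] E)
        ((![v] : Fin 1 → N) i)) =
        ![(mfderiv 𝓘(ℝ, N) 𝓘(ℝ, E) F z : N →L[ℝ] E) v] := fun v => by
      funext i; fin_cases i; rfl
    have e2 : (fun i => (mfderiv 𝓘(ℝ, N) 𝓘(ℝ, E) F z : N →L[ℝ] E) ((![v, w] : Fin 2 → N) i)) =
        ![(mfderiv 𝓘(ℝ, N) 𝓘(ℝ, E) F z : N →L[ℝ] E) v,
          (mfderiv 𝓘(ℝ, N) 𝓘(ℝ, E) F z : N →L[ℝ] E) w] := by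
      funext i; fin_cases i <;> rfl
    have h3 : (dForm (TwoTransport.pullback F θ : DForm N N 1 EG) z : N [⋀^Fin 2]→L[ℝ] EG) ![v, w] =
        (dForm θ (F z) : E [⋀^Fin 2]→L[ℝ] EG) ![(mfderiv 𝓘(ℝ, N) 𝓘(ℝ, E) F z : N →L[ℝ] E) v,
          (mfderiv 𝓘(ℝ, N) 𝓘(ℝ, E) F z : N →L[ℝ] E) w] :=
      h1.trans (congrArg (dForm θ (F z) : E [⋀^Fin 2]→L[ℝ] EG) e2)
    have h4 : ∀ v : N, (modelForm (TwoTransport.pullback F θ : DForm N N 1 EG) z) ![v] =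
        (θ (F z) : E [⋀^Fin 1]→L[ℝ] EG) ![(mfderiv 𝓘(ℝ, N) 𝓘(ℝ, E) F z : N →L[ℝ] E) v] := fun v =>
      congrArg (θ (F z) : E [⋀^Fin 1]→L[ℝ] EG) (e1 v)
    have h5 : (modelForm (TwoTransport.pullback F Υ : DForm N N 2 EH) z) ![v, w] =
        (Υ (F z) : E [⋀^Fin 2]→L[ℝ] EH) ![(mfderiv 𝓘(ℝ, N) 𝓘(ℝ, E) F z : N →L[ℝ] E) v,
          (mfderiv 𝓘(ℝ, N) 𝓘(ℝ, E) F z : N →L[ℝ] E) w] :=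
      congrArg (Υ (F z) : E [⋀^Fin 2]→L[ℝ] EH) e2
    change (dForm (TwoTransport.pullback F θ : DForm N N 1 EG) z : N [⋀^Fin 2]→L[ℝ] EG) ![v, w] +
      lieBr EG G (modelForm (TwoTransport.pullback F θ : DForm N N 1 EG) z ![v])
        (modelForm (TwoTransport.pullback F θ : DForm N N 1 EG) z ![w]) -
      C.tDot (modelForm (TwoTransport.pullback F Υ : DForm N N 2 EH) z ![v, w]) = 0
    have h6 : ∀ (d d' a a' b b' : EG) (e e' : EH), d = d' → a = a' → b = b' → e = e' →
        d' + lieBr EG G a' b' - C.tDot e' = 0 → d + lieBr EG G a b - C.tDot e = 0 := by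
      rintro _ _ _ _ _ _ _ _ rfl rfl rfl rfl h
      exact h
    exact h6 _ _ _ _ _ _ _ _ h3 (h4 v) (h4 w) h5 h2

/-- A 1-form on a normed space as a field of linear maps. -/
noncomputable def oneForm {V : Type*} [NormedAddCommGroup V] [NormedSpace ℝ V] (a : DForm N N 1 V) (z : N) : N →L[ℝ] V :=
  (ContinuousAlternatingMap.ofSubsingletonLIE (𝕜 := ℝ) (E := N) (F := V) (0 : Fin 1)).symm
    (modelForm a z)

/-- A 2-form on a normed space as a field of bilinear maps. -/
noncomputable def twoForm {V : Type*} [NormedAddCommGroup V] [NormedSpace ℝ V] (B : DForm N N 2 V) (z : N) : N →L[ℝ] N →L[ℝ] V :=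
  (ContinuousAlternatingMap.ofSubsingletonLIE (𝕜 := ℝ) (E := N) (F := V)
    (0 : Fin 1)).symm.toLinearIsometry.toContinuousLinearMap ∘L (modelForm B z).curryLeft

theorem oneForm_apply {V : Type*} [NormedAddCommGroup V] [NormedSpace ℝ V] (a : DForm N N 1 V)
    (z v : N) : oneForm a z v = modelForm a z ![v] := by
  change modelForm a z _ = _
  congr 1
  funext i
  fin_cases i
  rfl

theorem twoForm_apply {V : Type*} [NormedAddCommGroup V] [NormedSpace ℝ V] (B : DForm N N 2 V)
    (z v w : N) : twoForm B z v w = modelForm B z ![v, w] := by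
  change modelForm B z _ = _
  congr 1
  funext i
  fin_cases i <;> rfl

theorem twoForm_swap {V : Type*} [NormedAddCommGroup V] [NormedSpace ℝ V] (B : DForm N N 2 V)
    (z v w : N) : twoForm B z v w = -twoForm B z w v := by
  rw [twoForm_apply, twoForm_apply]
  have h := (modelForm B z).map_swap ![w, v] (show (0 : Fin 2) ≠ 1 by decide)
  refine Eq.trans ?_ h
  change modelForm B z _ = modelForm B z _
  congr 1
  funext i
  fin_cases i <;> rfl

theorem contDiff_oneForm {V : Type*} [NormedAddCommGroup V] [NormedSpace ℝ V] {a : DForm N N 1 V}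
    (ha : SmoothForm a) : ContDiff ℝ ∞ (oneForm a) :=
  (LinearIsometryEquiv.contDiff _).comp ((smoothForm_model_iff _).1 ha)

set_option maxSynthPendingDepth 5 in
theorem contDiff_twoForm {V : Type*} [NormedAddCommGroup V] [NormedSpace ℝ V] {B : DForm N N 2 V}
    (hB : SmoothForm B) : ContDiff ℝ ∞ (twoForm B) := by
  have h1 : ContDiff ℝ ∞ (ContinuousAlternatingMap.curryLeftLI (𝕜 := ℝ) (E := N) (F := V)
    (n := 1)) := LinearIsometry.contDiff _
  have h2 : ContDiff ℝ ∞ (fun z => (modelForm B z).curryLeft) :=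
    h1.comp ((smoothForm_model_iff _).1 hB)
  exact contDiff_const.clm_comp h2

/-- The equation `da + ½[a, a] = ṫ(B)` in coordinates. -/
theorem IsConnectionDoublet.fderiv_oneForm {a : DForm N N 1 EG} {B : DForm N N 2 EH}
    (h : IsConnectionDoublet C a B) (z v w : N) :
    fderiv ℝ (oneForm a) z v w - fderiv ℝ (oneForm a) z w v +
      ad EG G (oneForm a z v) (oneForm a z w) = C.tDot (twoForm B z v w) := by
  have h1 := h.fake_flat z v w
  have hd : DifferentiableAt ℝ (oneForm a) z :=
    (contDiff_oneForm h.smooth_one).contDiffAt.differentiableAt (by simp)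
  have hm : DifferentiableAt ℝ (modelForm a) z :=
    ((smoothForm_model_iff _).1 h.smooth_one).contDiffAt.differentiableAt (by simp)
  have h3 : ∀ v w : N, fderiv ℝ (fun z => modelForm a z ![w]) z v =
      fderiv ℝ (oneForm a) z v w := by
    intro v w
    have := (hd.hasFDerivAt.clm_apply (hasFDerivAt_const w z)).fderiv
    simp only [oneForm_apply] at this
    rw [this]
    simp
  have e0 : Fin.removeNth 0 ![v, w] = ![w] := by funext i; fin_cases i; rfl
  have e1 : Fin.removeNth 1 ![v, w] = ![v] := by funext i; fin_cases i; rfl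
  have h2 : extDeriv (modelForm a) z ![v, w] = fderiv ℝ (oneForm a) z v w -
      fderiv ℝ (oneForm a) z w v := by
    rw [extDeriv_apply hm, Fin.sum_univ_two, e0, e1, h3, h3]
    simp [sub_eq_add_neg]
  rw [oneForm_apply, oneForm_apply, twoForm_apply, ← lieBr_eq_ad]
  have h4 : ∀ (d d' x y : EG) (e : EH), d = d' → d + lieBr EG G x y - C.tDot e = 0 →
      d' + lieBr EG G x y = C.tDot e := by
    rintro _ _ _ _ _ rfl h
    exact sub_eq_zero.1 h
  exact h4 _ _ _ _ _ ((dForm_model a z ![v, w]).trans h2) h1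

/-- The exterior derivative of a 2-form in coordinates. -/
theorem dForm_twoForm {V : Type*} [NormedAddCommGroup V] [NormedSpace ℝ V] {B : DForm N N 2 V}
    (hB : SmoothForm B) (z u v w : N) :
    modelForm (dForm B) z ![u, v, w] = fderiv ℝ (twoForm B) z u v w -
      fderiv ℝ (twoForm B) z v u w + fderiv ℝ (twoForm B) z w u v := by
  have hd : DifferentiableAt ℝ (twoForm B) z :=
    (contDiff_twoForm hB).contDiffAt.differentiableAt (by simp)
  have hm : DifferentiableAt ℝ (modelForm B) z :=
    ((smoothForm_model_iff _).1 hB).contDiffAt.differentiableAt (by simp)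
  have h3 : ∀ u v w : N, fderiv ℝ (fun z => modelForm B z ![v, w]) z u =
      fderiv ℝ (twoForm B) z u v w := by
    intro u v w
    have := ((hd.hasFDerivAt.clm_apply (hasFDerivAt_const v z)).clm_apply
      (hasFDerivAt_const w z)).fderiv
    simp only [twoForm_apply] at this
    rw [this]
    simp
  have e0 : Fin.removeNth 0 ![u, v, w] = ![v, w] := by funext i; fin_cases i <;> rfl
  have e1 : Fin.removeNth 1 ![u, v, w] = ![u, w] := by funext i; fin_cases i <;> rfl
  have e2 : Fin.removeNth 2 ![u, v, w] = ![u, v] := by funext i; fin_cases i <;> rfl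
  refine (dForm_model B z ![u, v, w]).trans ?_
  rw [extDeriv_apply hm, Fin.sum_univ_three, e0, e1, e2, h3, h3, h3]
  simp [sub_eq_add_neg]

/-- A pulled-back form vanishes on vectors in the kernel of the differential. -/
theorem modelForm_pullback_eq_zero {V : Type*} [NormedAddCommGroup V] [NormedSpace ℝ V] {k : ℕ}
    {F : N → M} (η : DForm E M k V) {z : N} {v : Fin k → N} {i : Fin k}
    (hv : (mfderiv 𝓘(ℝ, N) 𝓘(ℝ, E) F z : N →L[ℝ] E) (v i) = 0) :
    modelForm (TwoTransport.pullback F η : DForm N N k V) z v = 0 :=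
  (η (F z) : E [⋀^Fin k]→L[ℝ] V).map_coord_zero i hv

end Doublets

end TwoTransport

namespace TwoTransport

/-! ### Primitives that depend smoothly on parameters. -/

section Primitive

variable {P : Type} [NormedAddCommGroup P] [NormedSpace ℝ P] {V : Type*} [NormedAddCommGroup V]
  [NormedSpace ℝ V] [CompleteSpace V]

/-- The curve `τ ↦ (τ t, p)` in `ℝ × P`, as a linear function of `(t, p)`. -/
noncomputable def rayCLM (P : Type) [NormedAddCommGroup P] [NormedSpace ℝ P] :
    ℝ × P →L[ℝ] C(Icc (0 : ℝ) 1, ℝ × P) :=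
  LinearMap.mkContinuous
    { toFun := fun q => (⟨fun τ => ((τ : ℝ) * q.1, q.2), by fun_prop⟩ : C(Icc (0 : ℝ) 1, ℝ × P))
      map_add' := fun q r => by ext τ <;> simp [mul_add]
      map_smul' := fun c q => by ext τ <;> simp [mul_left_comm] } 1 (fun q => by
    rw [one_mul]
    refine (ContinuousMap.norm_le _ (norm_nonneg _)).2 fun τ => ?_
    change ‖((τ : ℝ) * q.1, q.2)‖ ≤ ‖q‖
    rw [Prod.norm_def, Prod.norm_def]
    refine max_le_max ?_ le_rfl
    rw [norm_mul, Real.norm_eq_abs, abs_of_nonneg τ.2.1]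
    exact mul_le_of_le_one_left (norm_nonneg _) τ.2.2)

/-- The integral over the unit interval. -/
noncomputable def integralCLM (V : Type*) [NormedAddCommGroup V] [NormedSpace ℝ V]
    [CompleteSpace V] : C(Icc (0 : ℝ) 1, V) →L[ℝ] V :=
  LinearMap.mkContinuous
    { toFun := fun h => ∫ s in (0 : ℝ)..1, IccExtend zero_le_one h s
      map_add' := fun h k => by
        rw [← intervalIntegral.integral_add]
        · rfl
        · exact (h.continuous.Icc_extend').intervalIntegrable _ _
        · exact (k.continuous.Icc_extend').intervalIntegrable _ _
      map_smul' := fun c h => by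
        rw [← intervalIntegral.integral_smul]
        rfl } 1 (fun h => by
    have := intervalIntegral.norm_integral_le_of_norm_le_const (a := (0 : ℝ)) (b := 1)
      (f := IccExtend zero_le_one h) (C := ‖h‖) (fun s _ => h.norm_coe_le_norm _)
    simpa using this)

/-- Primitives depend smoothly on parameters. -/
theorem exists_smooth_primitive {h : ℝ × P → V} (hh : ContDiff ℝ ∞ h) : ∃ K : ℝ × P → V,
    ContDiff ℝ ∞ K ∧ (∀ p, K (0, p) = 0) ∧
      ∀ t p, HasDerivAt (fun s => K (s, p)) (h (t, p)) t := by
  -- The formula `K(t, p) = t ∫₀¹ h(rt, p) dr` has a fixed interval of integration, so smoothness is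
  -- that of a superposition operator between bounded linear maps.
  refine ⟨fun q => q.1 • integralCLM V ((⟨h, hh.continuous⟩ : C(ℝ × P, V)).comp (rayCLM P q)),
    ?_, fun p => zero_smul _ _, fun t p => ?_⟩
  · exact contDiff_fst.smul ((integralCLM V).contDiff.comp
      ((contDiff_superposition hh).comp (rayCLM P).contDiff))
  · have hc : Continuous fun s => h (s, p) := hh.continuous.comp (by fun_prop)
    have he : (fun s : ℝ => s • integralCLM V ((⟨h, hh.continuous⟩ : C(ℝ × P, V)).comp
        (rayCLM P (s, p)))) = fun s => ∫ r in (0 : ℝ)..s, h (r, p) := by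
      funext s
      have h1 : integralCLM V ((⟨h, hh.continuous⟩ : C(ℝ × P, V)).comp (rayCLM P (s, p))) =
          ∫ r in (0 : ℝ)..1, h (r * s, p) := by
        refine intervalIntegral.integral_congr fun r hr => ?_
        rw [uIcc_of_le zero_le_one] at hr
        rw [IccExtend_of_mem _ _ hr]
        rfl
      rw [h1, intervalIntegral.smul_integral_comp_mul_right (fun r => h (r, p))]
      simp
    change HasDerivAt (fun s : ℝ => s • integralCLM V ((⟨h, hh.continuous⟩ : C(ℝ × P, V)).comp
        (rayCLM P (s, p)))) _ _
    rw [he]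
    exact intervalIntegral.integral_hasDerivAt_right (hc.intervalIntegrable _ _)
      (hc.stronglyMeasurableAtFilter _ _) hc.continuousAt

end Primitive

/-! ### Uniqueness for the second order problem, and variation of a gauge transform. -/

section Calculus

variable {G : Type*} {EG : Type*} [NormedAddCommGroup EG] [NormedSpace ℝ EG]
  [TopologicalSpace G] [ChartedSpace EG G] [Group G] [LieGroup 𝓘(ℝ, EG) ∞ G]
  {H : Type*} {EH : Type*} [NormedAddCommGroup EH] [NormedSpace ℝ EH]
  [TopologicalSpace H] [ChartedSpace EH H] [Group H] [LieGroup 𝓘(ℝ, EH) ∞ H]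
  {N : Type*} [NormedAddCommGroup N] [NormedSpace ℝ N]

theorem eq_of_hasDerivAt_eq {V : Type*} [NormedAddCommGroup V] [NormedSpace ℝ V] {I : Set ℝ}
    (hI : I.OrdConnected) (hIo : IsOpen I) {u v d : ℝ → V}
    (hu : ∀ s ∈ I, HasDerivAt u (d s) s) (hv : ∀ s ∈ I, HasDerivAt v (d s) s) {s₀ : ℝ}
    (hs₀ : s₀ ∈ I) (h : u s₀ = v s₀) : ∀ s ∈ I, u s = v s := by
  intro s hs
  have h4 : ∀ s ∈ I, HasDerivAt (fun s => u s - v s) 0 s := fun s hs => by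
    exact ((hu s hs).sub (hv s hs)).congr_deriv (sub_self _)
  have h7 := hI.convex.is_const_of_fderivWithin_eq_zero (𝕜 := ℝ) (f := fun s => u s - v s)
    (fun x hx => (h4 x hx).differentiableAt.differentiableWithinAt)
    (fun x hx => by
      rw [fderivWithin_of_isOpen hIo hx, (h4 x hx).hasFDerivAt.fderiv]
      exact ContinuousLinearMap.ext fun v => by simp) hs hs₀
  simp only [h, sub_self] at h7
  exact sub_eq_zero.1 h7

/-- Uniqueness for the equation `∂ₛ(∂ᵣW W⁻¹) = d`. -/
theorem eq_of_hasDerivAt_rlogDeriv {I J : Set ℝ} (hI : I.OrdConnected) (hIo : IsOpen I)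
    (hJ : J.OrdConnected) (hJo : IsOpen J) {W W' : ℝ → ℝ → H} {d : ℝ → ℝ → EH}
    (hW : ∀ s ∈ I, ∀ r ∈ J, ContMDiffAt 𝓘(ℝ, ℝ) 𝓘(ℝ, EH) ∞ (W s) r)
    (hW' : ∀ s ∈ I, ∀ r ∈ J, ContMDiffAt 𝓘(ℝ, ℝ) 𝓘(ℝ, EH) ∞ (W' s) r)
    (hd : ∀ s ∈ I, ∀ r ∈ J, HasDerivAt (fun s => rlogDeriv (EG := EH) (W s) r) (d s r) s)
    (hd' : ∀ s ∈ I, ∀ r ∈ J, HasDerivAt (fun s => rlogDeriv (EG := EH) (W' s) r) (d s r) s)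
    {s₀ r₀ : ℝ} (hs₀ : s₀ ∈ I) (hr₀ : r₀ ∈ J)
    (h : ∀ r ∈ J, rlogDeriv (EG := EH) (W s₀) r = rlogDeriv (EG := EH) (W' s₀) r)
    (h' : ∀ s ∈ I, W s r₀ = W' s r₀) : ∀ s ∈ I, ∀ r ∈ J, W s r = W' s r := by
  intro s hs
  refine eqOn_of_rlogDeriv_eq (EG := EH) hJ.isPreconnected hJo (hW s hs) (hW' s hs) ?_ hr₀
    (h' s hs)
  intro r hr
  exact eq_of_hasDerivAt_eq hI hIo (fun s hs => hd s hs r hr) (fun s hs => hd' s hs r hr) hs₀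
    (h r hr) s hs

theorem rlogDeriv_one (x : ℝ) : rlogDeriv (EG := EG) (fun _ : ℝ => (1 : G)) x = 0 := by
  rw [rlogDeriv_eq_rd, rd_const]; rfl

/-- Change of variables in the logarithmic derivative. -/
theorem rlogDeriv_comp {u : ℝ → G} {c : ℝ → ℝ} {c' x : ℝ}
    (hu : ContMDiffAt 𝓘(ℝ, ℝ) 𝓘(ℝ, EG) ∞ u (c x)) (hc : HasDerivAt c c' x) :
    rlogDeriv (EG := EG) (fun s => u (c s)) x = c' • rlogDeriv (EG := EG) u (c x) := by
  rw [rlogDeriv_eq_rd, rlogDeriv_eq_rd, rd_comp hu hc.hasFDerivAt, ← map_smul]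
  simp

/-- The variation of `Ad(u⁻¹)(A + du u⁻¹)` along a direction in which it vanishes. -/
theorem hasFDerivAt_Ad_inv_gauge {A : N → N →L[ℝ] EG} (hA : ContDiff ℝ ∞ A) {u : N → G}
    (hu : ContMDiff 𝓘(ℝ, N) 𝓘(ℝ, EG) ∞ u) {X Y : N} (hX : ∀ z, rd EG u z X = -A z X) (z : N) :
    ∃ L : N →L[ℝ] EG, HasFDerivAt (fun z => Ad EG (u z)⁻¹ (A z Y + rd EG u z Y)) L z ∧
      L X = Ad EG (u z)⁻¹ (fderiv ℝ A z X Y - fderiv ℝ A z Y X + ad EG G (A z X) (A z Y)) := by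
  have hA' := (hA.contDiffAt (x := z)).differentiableAt (by simp) |>.hasFDerivAt
  have hr' := (contDiffAt_rd (Eventually.of_forall fun w => hu w) :
    ContDiffAt ℝ ∞ (rd EG u) z).differentiableAt (by simp) |>.hasFDerivAt
  have h1 := (hA'.clm_apply (hasFDerivAt_const Y z)).add (hr'.clm_apply (hasFDerivAt_const Y z))
  have h2 := (conjModule EG G).hasFDerivAt_mDot (hu.contMDiffAt (x := z)).inv
  have h3 := h2.clm_apply h1
  refine ⟨_, h3, ?_⟩
  -- The Maurer-Cartan equation exchanges the derivative of `rd u · Y` along `X` for that of `rd u ·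
  -- X = -A X` along `Y`. Together with the variation of `Ad(u⁻¹)` the terms assemble to the
  -- curvature.
  have hmc := fderiv_rd_sub (z := z) (Eventually.of_forall fun w => hu w) X Y
  have h5 : fderiv ℝ (rd EG u) z Y X = -fderiv ℝ A z Y X := by
    have e1 := (hr'.clm_apply (hasFDerivAt_const X z)).fderiv
    have e2 := (hA'.clm_apply (hasFDerivAt_const X z)).neg.fderiv
    have e3 : (fun z => rd EG u z X) = -fun z => A z X := funext fun z => hX z
    rw [e3] at e1
    have := DFunLike.congr_fun (e1.symm.trans e2) Y
    simpa using this
  rw [h5, hX z] at hmc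
  have hAd : ∀ v, (conjModule EG G).mDot (u z)⁻¹ v = Ad EG (u z)⁻¹ v := fun _ => rfl
  have hact : ∀ v w, (conjModule EG G).act v w = ad EG G v w := fun _ _ => rfl
  have hri : rd EG (fun w => (u w)⁻¹) z X = Ad EG (u z)⁻¹ (A z X) := by
    rw [rd_inv hu.contMDiffAt]
    simp [hX]
  have hae : ∀ a b, ad EG G (Ad EG (u z)⁻¹ a) (Ad EG (u z)⁻¹ b) = Ad EG (u z)⁻¹ (ad EG G a b) :=
    fun a b => ((conjModule EG G).mDot_act _ _ _).symm
  have h6 : fderiv ℝ (rd EG u) z X Y = -fderiv ℝ A z Y X - ad EG G (A z X) (rd EG u z Y) := by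
    rw [map_neg, neg_apply, sub_neg_eq_add] at hmc
    rw [eq_sub_of_add_eq hmc]; abel
  simp [hAd, hact, hri, hae, h6]
  abel

end Calculus

end TwoTransport

namespace TwoTransport

/-! ### The differential problem: existence, locality, uniqueness and the cocycle laws. -/

section Cocycles

variable {EG G EH H N : Type*}
  [NormedAddCommGroup EG] [NormedSpace ℝ EG]
  [TopologicalSpace G] [ChartedSpace EG G] [Group G] [LieGroup 𝓘(ℝ, EG) ∞ G]
  [NormedAddCommGroup EH] [NormedSpace ℝ EH]
  [TopologicalSpace H] [ChartedSpace EH H] [Group H] [LieGroup 𝓘(ℝ, EH) ∞ H]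
  [NormedAddCommGroup N] [NormedSpace ℝ N]
  {C : LieCrossedModule EG G EH H} {a : DForm (ℝ × ℝ) (ℝ × ℝ) 1 EG}
  {B : DForm (ℝ × ℝ) (ℝ × ℝ) 2 EH} {c : CocycleData G H}

theorem CocycleData.Smooth.contMDiff_f (h : c.Smooth EG EH) {p q r : N → ℝ} (hp : ContDiff ℝ ∞ p)
    (hq : ContDiff ℝ ∞ q) (hr : ContDiff ℝ ∞ r) :
    ContMDiff 𝓘(ℝ, N) 𝓘(ℝ, EG) ∞ (fun n => c.f (p n) (q n) (r n)) :=
  h.f_smooth.comp (hp.prodMk (hq.prodMk hr)).contMDiff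

theorem CocycleData.Smooth.contMDiff_g (h : c.Smooth EG EH) {p q r : N → ℝ} (hp : ContDiff ℝ ∞ p)
    (hq : ContDiff ℝ ∞ q) (hr : ContDiff ℝ ∞ r) :
    ContMDiff 𝓘(ℝ, N) 𝓘(ℝ, EG) ∞ (fun n => c.g (p n) (q n) (r n)) :=
  h.g_smooth.comp (hp.prodMk (hq.prodMk hr)).contMDiff

theorem CocycleData.Smooth.contMDiff_W (h : c.Smooth EG EH) {p q r s : N → ℝ}
    (hp : ContDiff ℝ ∞ p) (hq : ContDiff ℝ ∞ q) (hr : ContDiff ℝ ∞ r) (hs : ContDiff ℝ ∞ s) :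
    ContMDiff 𝓘(ℝ, N) 𝓘(ℝ, EH) ∞ (fun n => c.W (p n) (q n) (r n) (s n)) :=
  h.W_smooth.comp (hp.prodMk (hq.prodMk (hr.prodMk hs))).contMDiff

theorem SolvesProblem.rlogDeriv_f (h : SolvesProblem C a B c) (x₀ x y : ℝ) :
    rlogDeriv (EG := EG) (fun s => c.f s x₀ y) x = -oneForm a (x, y) (1, 0) := by
  rw [h.f_eq, oneForm_apply]; rfl

theorem SolvesProblem.rlogDeriv_g (h : SolvesProblem C a B c) (x y₀ y : ℝ) :
    rlogDeriv (EG := EG) (fun s => c.g x s y₀) y = -oneForm a (x, y) (0, 1) := by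
  rw [h.g_eq, oneForm_apply]; rfl

theorem SolvesProblem.hasDerivAt_rlogDeriv_W (h : SolvesProblem C a B c) (x₀ y₀ x y : ℝ) :
    HasDerivAt (fun s => rlogDeriv (EG := EH) (fun r => c.W s x₀ r y₀) y)
      (-(C.mDot ((c.g x₀ y y₀)⁻¹ * (c.f x x₀ y)⁻¹) (twoForm B (x, y) (1, 0) (0, 1)))) x := by
  rw [twoForm_apply]; exact h.W_eq x₀ y₀ x y

theorem SolvesProblem.rlogDeriv_W_self (h : SolvesProblem C a B c) (x₀ y₀ y : ℝ) :
    rlogDeriv (EG := EH) (fun r => c.W x₀ x₀ r y₀) y = 0 := by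
  simp only [h.W_init_x]
  exact rlogDeriv_one y

/-- The differential problem is solvable. -/
theorem exists_solvesProblem [FiniteDimensional ℝ EG] [FiniteDimensional ℝ EH]
    (C : LieCrossedModule EG G EH H) (ha : SmoothForm a) (hB : SmoothForm B) :
    ∃ c : CocycleData G H, SolvesProblem C a B c := by
  have : CompleteSpace EH := FiniteDimensional.complete ℝ EH
  have hA := contDiff_oneForm ha
  have hB' := contDiff_twoForm hB
  obtain ⟨U, hU, hU0, hU1⟩ := exists_lieSolution G
    (α := fun z : ℝ × ℝ => -oneForm a (z.1, z.2) (1, 0)) (hA.clm_apply contDiff_const).neg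
  -- The evolution variable of `exists_lieSolution` comes first, so `V` has its arguments in the
  -- order `(y, x)`.
  obtain ⟨V, hV, hV0, hV1⟩ := exists_lieSolution G
    (α := fun z : ℝ × ℝ => -oneForm a (z.2, z.1) (0, 1))
    ((hA.comp (contDiff_snd.prodMk contDiff_fst)).clm_apply contDiff_const).neg
  let f : ℝ → ℝ → ℝ → G := fun x x₀ y => U (x, y) * (U (x₀, y))⁻¹
  let g : ℝ → ℝ → ℝ → G := fun x y y₀ => V (y, x) * (V (y₀, x))⁻¹
  have hf : ∀ {N : Type} [NormedAddCommGroup N] [NormedSpace ℝ N] {p q r : N → ℝ},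
      ContDiff ℝ ∞ p → ContDiff ℝ ∞ q → ContDiff ℝ ∞ r →
      ContMDiff 𝓘(ℝ, N) 𝓘(ℝ, EG) ∞ (fun n => f (p n) (q n) (r n)) := fun hp hq hr =>
    (hU.comp (hp.prodMk hr).contMDiff).mul (hU.comp (hq.prodMk hr).contMDiff).inv
  have hg : ∀ {N : Type} [NormedAddCommGroup N] [NormedSpace ℝ N] {p q r : N → ℝ},
      ContDiff ℝ ∞ p → ContDiff ℝ ∞ q → ContDiff ℝ ∞ r →
      ContMDiff 𝓘(ℝ, N) 𝓘(ℝ, EG) ∞ (fun n => g (p n) (q n) (r n)) := fun hp hq hr =>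
    (hV.comp (hq.prodMk hp).contMDiff).mul (hV.comp (hr.prodMk hp).contMDiff).inv
  let κ : ℝ × ℝ × ℝ × ℝ → EH := fun z =>
    -C.mDot ((g z.2.1 z.2.2.1 z.2.2.2)⁻¹ * (f z.1 z.2.1 z.2.2.1)⁻¹)
      (twoForm B (z.1, z.2.2.1) (1, 0) (0, 1))
  have hκ : ContDiff ℝ ∞ κ := by
    refine ContDiff.neg (ContDiff.clm_apply ?_ (((hB'.comp ?_).clm_apply contDiff_const).clm_apply
      contDiff_const))
    · rw [contDiff_iff_contDiffAt]
      intro z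
      refine C.contDiffAt_mDot (ContMDiffAt.mul ?_ ?_)
      · exact (hg (by fun_prop) (by fun_prop) (by fun_prop)).contMDiffAt.inv
      · exact (hf (by fun_prop) (by fun_prop) (by fun_prop)).contMDiffAt.inv
    · fun_prop
  obtain ⟨K, hK, hK0, hK1⟩ := exists_smooth_primitive hκ
  -- The difference `K(x) - K(x₀)` has the prescribed x-derivative and vanishes at `x = x₀`; it
  -- serves as `∂_y W W⁻¹`. Here y is the evolution variable, with parameters `(x, x₀, y₀)`.
  obtain ⟨w, hw, hw0, hw1⟩ := exists_lieSolution H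
    (α := fun z : ℝ × ℝ × ℝ × ℝ => K (z.2.1, z.2.2.1, z.1, z.2.2.2) -
      K (z.2.2.1, z.2.2.1, z.1, z.2.2.2))
    ((hK.comp (by fun_prop)).sub (hK.comp (by fun_prop)))
  let W : ℝ → ℝ → ℝ → ℝ → H := fun x x₀ y y₀ => w (y, x, x₀, y₀) * (w (y₀, x, x₀, y₀))⁻¹
  have hWr : ∀ x x₀ y y₀, rlogDeriv (EG := EH) (fun r => W x x₀ r y₀) y =
      K (x, x₀, y, y₀) - K (x₀, x₀, y, y₀) := by
    intro x x₀ y y₀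
    rw [← hw1 y (x, x₀, y₀)]
    exact DFunLike.congr_fun (rd_mul_const (EG := EH) (fun s => w (s, x, x₀, y₀)) _ y) 1
  have hWs : ContMDiff 𝓘(ℝ, ℝ × ℝ × ℝ × ℝ) 𝓘(ℝ, EH) ∞
      (fun z : ℝ × ℝ × ℝ × ℝ => W z.1 z.2.1 z.2.2.1 z.2.2.2) :=
    (hw.comp (ContDiff.contMDiff (by fun_prop))).mul
      (hw.comp (ContDiff.contMDiff (by fun_prop))).inv
  refine ⟨⟨f, g, W⟩, ⟨hf (by fun_prop) (by fun_prop) (by fun_prop),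
    hg (by fun_prop) (by fun_prop) (by fun_prop), hWs⟩, fun x₀ x y => ?_, fun x₀ y => ?_,
    fun x y₀ y => ?_, fun x y₀ => ?_, fun x₀ y₀ x y => ?_, fun x₀ y y₀ => ?_, fun x x₀ y₀ => ?_⟩
  · refine Eq.trans ?_ ((hU1 x y).trans (congrArg Neg.neg (oneForm_apply a _ _)))
    exact DFunLike.congr_fun (rd_mul_const (EG := EG) (fun s => U (s, y)) _ x) 1
  · exact mul_inv_cancel _
  · refine Eq.trans ?_ ((hV1 y x).trans (congrArg Neg.neg (oneForm_apply a _ _)))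
    exact DFunLike.congr_fun (rd_mul_const (EG := EG) (fun s => V (s, x)) _ y) 1
  · exact mul_inv_cancel _
  · simp only [hWr]
    have h1 := (hK1 x (x₀, y, y₀)).sub_const (K (x₀, x₀, y, y₀))
    refine h1.congr_deriv ?_
    simp only [κ, twoForm_apply]
    rfl
  · have h1 := eqOn_of_rlogDeriv_eq (EG := EH) (I := univ) isPreconnected_univ isOpen_univ
      (u := fun r => W x₀ x₀ r y₀) (v := fun _ => 1)
      (fun t _ => (hWs.comp (ContDiff.contMDiff (f := fun t => (x₀, x₀, t, y₀))
        (by fun_prop))).contMDiffAt) (fun t _ => contMDiffAt_const)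
      (fun t _ => by rw [hWr, sub_self, rlogDeriv_one]) (mem_univ y₀) (mul_inv_cancel _) y trivial
    exact h1
  · exact mul_inv_cancel _

/-- A constant derivative forces `p` to be affine, so the changes of variables below can be
specified by their derivative alone. -/
theorem contMDiffAt_of_hasDerivAt_const {p : ℝ → ℝ} {α : ℝ} (hp : ∀ x, HasDerivAt p α x) (x : ℝ) :
    ContMDiffAt 𝓘(ℝ, ℝ) 𝓘(ℝ, ℝ) ∞ p x := by
  have : p = fun x => p 0 + α * x := by
    funext x
    exact eq_of_hasDerivAt_eq ordConnected_univ isOpen_univ (v := fun x => p 0 + α * x)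
      (d := fun _ => α) (fun s _ => hp s)
      (fun s _ => by simpa using ((hasDerivAt_id s).const_mul α).const_add (p 0)) (mem_univ 0)
      (by simp) x trivial
  rw [this]
  exact ContDiffAt.contMDiffAt (by fun_prop)

/-- Solutions of the differential problem are determined locally, and transform under affine
changes of the variables. -/
theorem SolvesProblem.locality {a' : DForm (ℝ × ℝ) (ℝ × ℝ) 1 EG} {B' : DForm (ℝ × ℝ) (ℝ × ℝ) 2 EH}
    {c' : CocycleData G H} (h : SolvesProblem C a B c) (h' : SolvesProblem C a' B' c')
    {I J : Set ℝ} (hI : I.OrdConnected) (hIo : IsOpen I) (hJ : J.OrdConnected) (hJo : IsOpen J)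
    {p q : ℝ → ℝ} {α κ : ℝ} (hp : ∀ x, HasDerivAt p α x) (hq : ∀ y, HasDerivAt q κ y)
    (hx : ∀ x ∈ I, ∀ y ∈ J, oneForm a (x, y) (1, 0) = α • oneForm a' (p x, q y) (1, 0))
    (hy : ∀ x ∈ I, ∀ y ∈ J, oneForm a (x, y) (0, 1) = κ • oneForm a' (p x, q y) (0, 1))
    (hxy : ∀ x ∈ I, ∀ y ∈ J, twoForm B (x, y) (1, 0) (0, 1) =
      (α * κ) • twoForm B' (p x, q y) (1, 0) (0, 1)) :
    (∀ x₀ ∈ I, ∀ x ∈ I, ∀ y ∈ J, c.f x x₀ y = c'.f (p x) (p x₀) (q y)) ∧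
    (∀ x ∈ I, ∀ y₀ ∈ J, ∀ y ∈ J, c.g x y y₀ = c'.g (p x) (q y) (q y₀)) ∧
    (∀ x₀ ∈ I, ∀ x ∈ I, ∀ y₀ ∈ J, ∀ y ∈ J, c.W x x₀ y y₀ = c'.W (p x) (p x₀) (q y) (q y₀)) := by
  have hps := contMDiffAt_of_hasDerivAt_const hp
  have hqs := contMDiffAt_of_hasDerivAt_const hq
  have hf' : ∀ x₀ y x, ContMDiffAt 𝓘(ℝ, ℝ) 𝓘(ℝ, EG) ∞ (fun s => c'.f s x₀ y) x :=
    fun _ _ x => (h'.smooth.contMDiff_f contDiff_id contDiff_const contDiff_const).contMDiffAt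
  have hg' : ∀ y₀ x y, ContMDiffAt 𝓘(ℝ, ℝ) 𝓘(ℝ, EG) ∞ (fun s => c'.g x s y₀) y :=
    fun _ _ x => (h'.smooth.contMDiff_g contDiff_const contDiff_id contDiff_const).contMDiffAt
  have hW' : ∀ x x₀ y₀ y, ContMDiffAt 𝓘(ℝ, ℝ) 𝓘(ℝ, EH) ∞ (fun s => c'.W x x₀ s y₀) y :=
    fun _ _ _ x => (h'.smooth.contMDiff_W contDiff_const contDiff_const contDiff_id
      contDiff_const).contMDiffAt
  -- The substitution `p` multiplies the logarithmic derivative by `α`, as it does the form. The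
  -- case `α = 0` of a constant `p` is included and used later to express independence of a
  -- variable.
  have key_f : ∀ x₀ ∈ I, ∀ x ∈ I, ∀ y ∈ J, c.f x x₀ y = c'.f (p x) (p x₀) (q y) := by
    intro x₀ hx₀ x hxI y hyJ
    refine eqOn_of_rlogDeriv_eq (EG := EG) hI.isPreconnected hIo (u := fun s => c.f s x₀ y)
      (v := fun s => c'.f (p s) (p x₀) (q y)) (fun t _ => ?_) (fun t _ => ?_) (fun t ht => ?_) hx₀
      (by rw [h.f_init, h'.f_init]) x hxI
    · exact (h.smooth.contMDiff_f contDiff_id contDiff_const contDiff_const).contMDiffAt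
    · exact ContMDiffAt.comp (g := fun s => c'.f s (p x₀) (q y)) t (hf' _ _ _) (hps t)
    · rw [rlogDeriv_comp (u := fun s => c'.f s (p x₀) (q y)) (hf' _ _ _) (hp t), h.rlogDeriv_f,
        h'.rlogDeriv_f, hx t ht y hyJ, smul_neg]
  have key_g : ∀ x ∈ I, ∀ y₀ ∈ J, ∀ y ∈ J, c.g x y y₀ = c'.g (p x) (q y) (q y₀) := by
    intro x hxI y₀ hy₀ y hyJ
    refine eqOn_of_rlogDeriv_eq (EG := EG) hJ.isPreconnected hJo (u := fun s => c.g x s y₀)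
      (v := fun s => c'.g (p x) (q s) (q y₀)) (fun t _ => ?_) (fun t _ => ?_) (fun t ht => ?_) hy₀
      (by rw [h.g_init, h'.g_init]) y hyJ
    · exact (h.smooth.contMDiff_g contDiff_const contDiff_id contDiff_const).contMDiffAt
    · exact ContMDiffAt.comp (g := fun s => c'.g (p x) s (q y₀)) t (hg' _ _ _) (hqs t)
    · rw [rlogDeriv_comp (u := fun s => c'.g (p x) s (q y₀)) (hg' _ _ _) (hq t), h.rlogDeriv_g,
        h'.rlogDeriv_g, hy x hxI t ht, smul_neg]
  refine ⟨key_f, key_g, ?_⟩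
  intro x₀ hx₀ x hxI y₀ hy₀ y hyJ
  have hr : ∀ s r, rlogDeriv (EG := EH) (fun r => c'.W (p s) (p x₀) (q r) (q y₀)) r =
      κ • rlogDeriv (EG := EH) (fun r => c'.W (p s) (p x₀) r (q y₀)) (q r) := fun s r =>
    rlogDeriv_comp (u := fun r => c'.W (p s) (p x₀) r (q y₀)) (hW' _ _ _ _) (hq r)
  refine eq_of_hasDerivAt_rlogDeriv (EH := EH) hI hIo hJ hJo (W := fun s r => c.W s x₀ r y₀)
    (W' := fun s r => c'.W (p s) (p x₀) (q r) (q y₀)) (fun s _ r _ => ?_) (fun s _ r _ => ?_)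
    (fun s _ r _ => h.hasDerivAt_rlogDeriv_W x₀ y₀ s r) (fun s hs r hr' => ?_) hx₀ hy₀
    (fun r _ => ?_) (fun s _ => ?_) x hxI y hyJ
  · exact (h.smooth.contMDiff_W contDiff_const contDiff_const contDiff_id
      contDiff_const).contMDiffAt
  · exact ContMDiffAt.comp (g := fun r => c'.W (p s) (p x₀) r (q y₀)) r (hW' _ _ _ _) (hqs r)
  · simp only [hr]
    have h1 := ((h'.hasDerivAt_rlogDeriv_W (p x₀) (q y₀) (p s) (q r)).scomp s (hp s)).const_smul κ
    refine h1.congr_deriv ?_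
    rw [key_f x₀ hx₀ s hs r hr', key_g x₀ hx₀ y₀ hy₀ r hr', hxy s hs r hr', map_smul]
    simp only [smul_neg, smul_smul, mul_comm]
  · rw [hr, h'.rlogDeriv_W_self, smul_zero, h.rlogDeriv_W_self]
  · rw [h.W_init_y, h'.W_init_y]

theorem SolvesProblem.unique {c' : CocycleData G H} (h : SolvesProblem C a B c)
    (h' : SolvesProblem C a B c') : c = c' := by
  obtain ⟨h1, h2, h3⟩ := h.locality h' ordConnected_univ isOpen_univ ordConnected_univ isOpen_univ
    (p := id) (q := id) (fun x => hasDerivAt_id x) (fun x => hasDerivAt_id x) (fun _ _ _ _ => by simp)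
    (fun _ _ _ _ => by simp) (fun _ _ _ _ => by simp)
  ext
  · exact h1 _ trivial _ trivial _ trivial
  · exact h2 _ trivial _ trivial _ trivial
  · exact h3 _ trivial _ trivial _ trivial _ trivial

theorem rlogDeriv_slice_fst {u : ℝ × ℝ → G} {s r : ℝ}
    (hu : ContMDiffAt 𝓘(ℝ, ℝ × ℝ) 𝓘(ℝ, EG) ∞ u (s, r)) :
    rlogDeriv (EG := EG) (fun s => u (s, r)) s = rd EG u (s, r) (1, 0) := by
  rw [rlogDeriv_eq_rd, rd_comp (c := fun s => (s, r)) hu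
    ((hasDerivAt_id s).prodMk (hasDerivAt_const s r)).hasFDerivAt]
  simp

theorem rlogDeriv_slice_snd {u : ℝ × ℝ → G} {s r : ℝ}
    (hu : ContMDiffAt 𝓘(ℝ, ℝ × ℝ) 𝓘(ℝ, EG) ∞ u (s, r)) :
    rlogDeriv (EG := EG) (fun r => u (s, r)) r = rd EG u (s, r) (0, 1) := by
  rw [rlogDeriv_eq_rd, rd_comp (c := fun r => (s, r)) hu
    ((hasDerivAt_const r s).prodMk (hasDerivAt_id r)).hasFDerivAt]
  simp

theorem rlogDeriv_mul {u v : ℝ → G} {t : ℝ} (hu : ContMDiffAt 𝓘(ℝ, ℝ) 𝓘(ℝ, EG) ∞ u t)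
    (hv : ContMDiffAt 𝓘(ℝ, ℝ) 𝓘(ℝ, EG) ∞ v t) : rlogDeriv (EG := EG) (fun s => u s * v s) t =
      rlogDeriv (EG := EG) u t + Ad EG (u t) (rlogDeriv (EG := EG) v t) := by
  simp only [rlogDeriv_eq_rd]
  rw [rd_mul hu hv]
  rfl

theorem rlogDeriv_mul_const (u : ℝ → G) (b : G) (t : ℝ) :
    rlogDeriv (EG := EG) (fun s => u s * b) t = rlogDeriv (EG := EG) u t :=
  DFunLike.congr_fun (rd_mul_const (EG := EG) u b t) 1

theorem rlogDeriv_inv {u : ℝ → G} {t : ℝ} (hu : ContMDiffAt 𝓘(ℝ, ℝ) 𝓘(ℝ, EG) ∞ u t) :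
    rlogDeriv (EG := EG) (fun s => (u s)⁻¹) t = -Ad EG (u t)⁻¹ (rlogDeriv (EG := EG) u t) := by
  simp only [rlogDeriv_eq_rd]
  rw [rd_inv hu]
  rfl

theorem LieCrossedModule.rlogDeriv_t (C : LieCrossedModule EG G EH H) {u : ℝ → H} {t : ℝ}
    (hu : ContMDiffAt 𝓘(ℝ, ℝ) 𝓘(ℝ, EH) ∞ u t) :
    rlogDeriv (EG := EG) (fun s => C.t (u s)) t = C.tDot (rlogDeriv (EG := EH) u t) := by
  simp only [rlogDeriv_eq_rd]
  rw [rd_hom C.t_smooth.contMDiffAt hu (C.t_smooth.contMDiffAt.comp t hu)]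
  rfl

theorem LieCrossedModule.rlogDeriv_m (C : LieCrossedModule EG G EH H) (b : G) {u : ℝ → H} {t : ℝ}
    (hu : ContMDiffAt 𝓘(ℝ, ℝ) 𝓘(ℝ, EH) ∞ u t) :
    rlogDeriv (EG := EH) (fun s => C.m b (u s)) t = C.mDot b (rlogDeriv (EG := EH) u t) := by
  simp only [rlogDeriv_eq_rd]
  have h := rd_hom (Θ := (C.m b).toMonoidHom) (C.contMDiff_m b).contMDiffAt hu
    ((C.contMDiff_m b).contMDiffAt.comp t hu)
  exact DFunLike.congr_fun h 1

/-- As functions of `x''` both sides solve the same equation, and they agree at `x'' = x'`. -/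
theorem SolvesProblem.f_comp (h : SolvesProblem C a B c) (x'' x' x y : ℝ) :
    c.f x'' x y = c.f x'' x' y * c.f x' x y := by
  have hs : ∀ x t, ContMDiffAt 𝓘(ℝ, ℝ) 𝓘(ℝ, EG) ∞ (fun s => c.f s x y) t := fun x t =>
    (h.smooth.contMDiff_f contDiff_id contDiff_const contDiff_const).contMDiffAt
  refine eqOn_of_rlogDeriv_eq (EG := EG) isPreconnected_univ isOpen_univ (u := fun s => c.f s x y)
    (v := fun s => c.f s x' y * c.f x' x y) (fun t _ => hs x t)
    (fun t _ => (hs x' t).mul contMDiffAt_const) (fun t _ => ?_) (mem_univ x') ?_ x'' trivial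
  · rw [rlogDeriv_mul_const (EG := EG) (fun s => c.f s x' y), h.rlogDeriv_f, h.rlogDeriv_f]
  · rw [h.f_init, one_mul]

theorem SolvesProblem.g_comp (h : SolvesProblem C a B c) (x y'' y' y : ℝ) :
    c.g x y'' y = c.g x y'' y' * c.g x y' y := by
  have hs : ∀ y t, ContMDiffAt 𝓘(ℝ, ℝ) 𝓘(ℝ, EG) ∞ (fun s => c.g x s y) t := fun y t =>
    (h.smooth.contMDiff_g contDiff_const contDiff_id contDiff_const).contMDiffAt
  refine eqOn_of_rlogDeriv_eq (EG := EG) isPreconnected_univ isOpen_univ (u := fun s => c.g x s y)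
    (v := fun s => c.g x s y' * c.g x y' y) (fun t _ => hs y t)
    (fun t _ => (hs y' t).mul contMDiffAt_const) (fun t _ => ?_) (mem_univ y') ?_ y'' trivial
  · rw [rlogDeriv_mul_const (EG := EG) (fun s => c.g x s y'), h.rlogDeriv_g, h.rlogDeriv_g]
  · rw [h.g_init, one_mul]

theorem SolvesProblem.contMDiffAt_W (h : SolvesProblem C a B c) (x' x y t : ℝ) :
    ContMDiffAt 𝓘(ℝ, ℝ) 𝓘(ℝ, EH) ∞ (fun r => c.W x' x r y) t :=
  (h.smooth.contMDiff_W contDiff_const contDiff_const contDiff_id contDiff_const).contMDiffAt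

/-- The target of the 2-cells of the cocycle. -/
theorem SolvesProblem.target (h : SolvesProblem C a B c) (hab : IsConnectionDoublet C a B)
    (x' x y' y : ℝ) : C.t (c.W x' x y' y) =
      (c.g x y' y)⁻¹ * (c.f x' x y')⁻¹ * c.g x' y' y * c.f x' x y := by
  have hA := contDiff_oneForm hab.smooth_one
  have hg : ∀ x t, ContMDiffAt 𝓘(ℝ, ℝ) 𝓘(ℝ, EG) ∞ (fun s => c.g x s y) t := fun x t =>
    (h.smooth.contMDiff_g contDiff_const contDiff_id contDiff_const).contMDiffAt
  have hf : ∀ s t, ContMDiffAt 𝓘(ℝ, ℝ) 𝓘(ℝ, EG) ∞ (fun r => c.f s x r) t := fun x t =>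
    (h.smooth.contMDiff_f contDiff_const contDiff_const contDiff_id).contMDiffAt
  have hu : ContMDiff 𝓘(ℝ, ℝ × ℝ) 𝓘(ℝ, EG) ∞ (fun z : ℝ × ℝ => c.f z.1 x z.2) :=
    h.smooth.contMDiff_f contDiff_fst contDiff_const contDiff_snd
  -- The boundary word has, up to `Ad(g⁻¹)`, the logarithmic derivative `a_y(x, r)` minus the gauge
  -- transform of `a_y(s, r)` by `f`; only the latter depends on `s`.
  have hR : ∀ s r, rlogDeriv (EG := EG)
      (fun r => (c.g x r y)⁻¹ * (c.f s x r)⁻¹ * c.g s r y * c.f s x y) r =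
      Ad EG (c.g x r y)⁻¹ (oneForm a (x, r) (0, 1) - Ad EG (c.f s x r)⁻¹
        (oneForm a (s, r) (0, 1) + rd EG (fun z : ℝ × ℝ => c.f z.1 x z.2) (s, r) (0, 1))) := by
    intro s r
    have h1 := (hg x r).inv
    have h2 := (hf s r).inv
    rw [rlogDeriv_mul_const (EG := EG) (fun r => (c.g x r y)⁻¹ * (c.f s x r)⁻¹ * c.g s r y),
      rlogDeriv_mul (u := fun r => (c.g x r y)⁻¹ * (c.f s x r)⁻¹) (v := fun r => c.g s r y)
        (h1.mul h2) (hg s r),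
      rlogDeriv_mul (u := fun r => (c.g x r y)⁻¹) (v := fun r => (c.f s x r)⁻¹) h1 h2,
      rlogDeriv_inv (u := fun r => c.g x r y) (hg x r),
      rlogDeriv_inv (u := fun r => c.f s x r) (hf s r),
      h.rlogDeriv_g, h.rlogDeriv_g, Ad_mul_apply,
      rlogDeriv_slice_snd (u := fun z : ℝ × ℝ => c.f z.1 x z.2) hu.contMDiffAt]
    simp only [map_neg, map_add, map_sub]
    abel
  refine eq_of_hasDerivAt_rlogDeriv (EH := EG) ordConnected_univ isOpen_univ ordConnected_univ
    isOpen_univ (W := fun s r => C.t (c.W s x r y))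
    (W' := fun s r => (c.g x r y)⁻¹ * (c.f s x r)⁻¹ * c.g s r y * c.f s x y)
    (d := fun s r => C.tDot (-(C.mDot ((c.g x r y)⁻¹ * (c.f s x r)⁻¹)
      (twoForm B (s, r) (1, 0) (0, 1)))))
    (fun s _ r _ => C.t_smooth.contMDiffAt.comp r (h.contMDiffAt_W _ _ _ _)) (fun s _ r _ => ?_)
    (fun s _ r _ => ?_) (fun s _ r _ => ?_) (mem_univ x) (mem_univ y) (fun r _ => ?_)
    (fun s _ => ?_) x' trivial y' trivial
  · exact (((hg x r).inv.mul (hf s r).inv).mul (hg s r)).mul contMDiffAt_const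
  · simp only [C.rlogDeriv_t (h.contMDiffAt_W _ _ _ _)]
    have h1 := C.tDot.hasFDerivAt.comp_hasDerivAt s (h.hasDerivAt_rlogDeriv_W x y s r)
    exact h1
  · simp only [hR]
    -- Since `f` is parallel in x, the derivative along x of this gauge transform is `Ad(f⁻¹)` of
    -- the curvature, and the connection equation identifies the curvature with `ṫ(B)`.
    obtain ⟨L, hL, hLX⟩ := hasFDerivAt_Ad_inv_gauge hA hu (X := (1, 0)) (Y := (0, 1))
      (fun z => by
        rw [← h.rlogDeriv_f x]
        exact (rlogDeriv_slice_fst (u := fun z : ℝ × ℝ => c.f z.1 x z.2) hu.contMDiffAt).symm)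
      (s, r)
    have h1 := (hL.comp_hasDerivAt s ((hasDerivAt_id s).prodMk (hasDerivAt_const s r))).const_sub
      (oneForm a (x, r) (0, 1))
    have h2 := (Ad EG (c.g x r y)⁻¹).hasFDerivAt.comp_hasDerivAt s h1
    refine h2.congr_deriv ?_
    have h3 : L (1, 0) = _ := hLX
    rw [h3, hab.fderiv_oneForm, map_neg, map_neg, C.mDot_mul_apply, C.tDot_mDot, C.tDot_mDot]
  · have e1 : (fun r => (c.g x r y)⁻¹ * (c.f x x r)⁻¹ * c.g x r y * c.f x x y) = fun _ => 1 := by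
      funext r
      rw [h.f_init, h.f_init]; simp
    simp only [e1, h.W_init_x, map_one]
  · simp only [h.W_init_y, h.g_init, map_one]
    simp

/-- The solution of the differential problem of a connection doublet is a cocycle. -/
theorem SolvesProblem.isCocycle (h : SolvesProblem C a B c) (hab : IsConnectionDoublet C a B) :
    IsCocycle C c where
  smooth := h.smooth
  target := h.target hab
  f_comp := h.f_comp
  g_comp := h.g_comp
  W_comp_x x'' x' x y' y := by
    have hm : ∀ s r, ContMDiffAt 𝓘(ℝ, ℝ) 𝓘(ℝ, EH) ∞
        (fun r => C.m (c.f x' x y)⁻¹ (c.W s x' r y)) r := fun s r =>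
      (C.contMDiff_m _).contMDiffAt.comp r (h.contMDiffAt_W _ _ _ _)
    -- The product rule produces `Ad` of `W(x', x; r, y)`, which is `ṁ` of its image under `t`. The
    -- target formula then moves the base point of the transported form from `x'` to `x`.
    have hR : ∀ s r, rlogDeriv (EG := EH)
        (fun r => c.W x' x r y * C.m (c.f x' x y)⁻¹ (c.W s x' r y)) r =
        rlogDeriv (EG := EH) (fun r => c.W x' x r y) r +
          C.mDot ((c.g x r y)⁻¹ * (c.f x' x r)⁻¹ * c.g x' r y)
            (rlogDeriv (EG := EH) (fun r => c.W s x' r y) r) := by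
      intro s r
      rw [rlogDeriv_mul (h.contMDiffAt_W _ _ _ _) (hm s r), C.rlogDeriv_m _ (h.contMDiffAt_W _ _ _ _),
        ← C.mDot_t, ← C.mDot_mul_apply, h.target hab, mul_inv_cancel_right]
    refine eq_of_hasDerivAt_rlogDeriv (EH := EH) ordConnected_univ isOpen_univ ordConnected_univ
      isOpen_univ (W := fun s r => c.W s x r y)
      (W' := fun s r => c.W x' x r y * C.m (c.f x' x y)⁻¹ (c.W s x' r y))
      (fun s _ r _ => h.contMDiffAt_W _ _ _ _)
      (fun s _ r _ => (h.contMDiffAt_W _ _ _ _).mul (hm s r))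
      (fun s _ r _ => h.hasDerivAt_rlogDeriv_W x y s r) (fun s _ r _ => ?_) (mem_univ x')
      (mem_univ y) (fun r _ => ?_) (fun s _ => ?_) x'' trivial y' trivial
    · simp only [hR]
      have h1 := ((C.mDot ((c.g x r y)⁻¹ * (c.f x' x r)⁻¹ * c.g x' r y)).hasFDerivAt.comp_hasDerivAt
        s (h.hasDerivAt_rlogDeriv_W x' y s r)).const_add
          (rlogDeriv (EG := EH) (fun r => c.W x' x r y) r)
      refine h1.congr_deriv ?_
      rw [map_neg, ← C.mDot_mul_apply, h.f_comp s x' x r]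
      congr 3
      group
    · rw [hR, h.rlogDeriv_W_self, map_zero, add_zero]
    · simp [h.W_init_y]
  W_comp_y x' x y'' y' y := by
    have hm : ∀ s r, ContMDiffAt 𝓘(ℝ, ℝ) 𝓘(ℝ, EH) ∞
        (fun r => C.m (c.g x y' y)⁻¹ (c.W s x r y')) r := fun s r =>
      (C.contMDiff_m _).contMDiffAt.comp r (h.contMDiffAt_W _ _ _ _)
    have hR : ∀ s r, rlogDeriv (EG := EH)
        (fun r => C.m (c.g x y' y)⁻¹ (c.W s x r y') * c.W s x y' y) r =
          C.mDot (c.g x y' y)⁻¹ (rlogDeriv (EG := EH) (fun r => c.W s x r y') r) := by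
      intro s r
      rw [rlogDeriv_mul_const (EG := EH) (fun r => C.m (c.g x y' y)⁻¹ (c.W s x r y')),
        C.rlogDeriv_m _ (h.contMDiffAt_W _ _ _ _)]
    refine eq_of_hasDerivAt_rlogDeriv (EH := EH) ordConnected_univ isOpen_univ ordConnected_univ
      isOpen_univ (W := fun s r => c.W s x r y)
      (W' := fun s r => C.m (c.g x y' y)⁻¹ (c.W s x r y') * c.W s x y' y)
      (fun s _ r _ => h.contMDiffAt_W _ _ _ _)
      (fun s _ r _ => (hm s r).mul contMDiffAt_const)
      (fun s _ r _ => h.hasDerivAt_rlogDeriv_W x y s r) (fun s _ r _ => ?_) (mem_univ x)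
      (mem_univ y') (fun r _ => ?_) (fun s _ => ?_) x' trivial y'' trivial
    · simp only [hR]
      have h1 := (C.mDot (c.g x y' y)⁻¹).hasFDerivAt.comp_hasDerivAt s
        (h.hasDerivAt_rlogDeriv_W x y' s r)
      refine h1.congr_deriv ?_
      rw [map_neg, ← C.mDot_mul_apply, h.g_comp x r y' y]
      congr 3
      group
    · rw [hR, h.rlogDeriv_W_self, h.rlogDeriv_W_self, map_zero]
    · simp [h.W_init_y]

end Cocycles

end TwoTransport

namespace TwoTransport

/-! ### Transport along curves and surfaces, and its algebraic laws. -/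

section Transport

variable {EG G EH H E M N N' : Type*}
  [NormedAddCommGroup EG] [NormedSpace ℝ EG] [FiniteDimensional ℝ EG]
  [TopologicalSpace G] [ChartedSpace EG G] [Group G] [LieGroup 𝓘(ℝ, EG) ∞ G]
  [NormedAddCommGroup EH] [NormedSpace ℝ EH] [FiniteDimensional ℝ EH]
  [TopologicalSpace H] [ChartedSpace EH H] [Group H] [LieGroup 𝓘(ℝ, EH) ∞ H]
  [NormedAddCommGroup E] [NormedSpace ℝ E]
  [TopologicalSpace M] [ChartedSpace E M] [IsManifold 𝓘(ℝ, E) ∞ M]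
  [NormedAddCommGroup N] [NormedSpace ℝ N] [NormedAddCommGroup N'] [NormedSpace ℝ N']
  {C : LieCrossedModule EG G EH H}
  {V : Type*} [NormedAddCommGroup V] [NormedSpace ℝ V] {k : ℕ}

/-- Functoriality of the pull-back. -/
theorem modelForm_pullback_comp {F : N → M} {F' : N' → M} {P : N → N'} {P' : N →L[ℝ] N'} {z : N}
    (hF : F =ᶠ[𝓝 z] fun w => F' (P w)) (hF' : ContMDiff 𝓘(ℝ, N') 𝓘(ℝ, E) ∞ F')
    (hP : HasFDerivAt P P' z) (η : DForm E M k V) (v : Fin k → N) :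
    modelForm (pullback F η : DForm N N k V) z v =
      modelForm (pullback F' η : DForm N' N' k V) (P z) (fun i => P' (v i)) := by
  have h1 : ∀ v : N, (mfderiv 𝓘(ℝ, N) 𝓘(ℝ, E) F z : N →L[ℝ] E) v =
      (mfderiv 𝓘(ℝ, N') 𝓘(ℝ, E) F' (P z) : N' →L[ℝ] E) (P' v) := by
    intro v
    have h2 := mfderiv_comp z (hF'.contMDiffAt.mdifferentiableAt (x := P z) (by simp))
      hP.differentiableAt.mdifferentiableAt
    have h3 := DFunLike.congr_fun ((hF.mfderiv_eq (I := 𝓘(ℝ, N)) (I' := 𝓘(ℝ, E))).trans h2) v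
    rw [mfderiv_eq_fderiv, hP.fderiv] at h3
    exact h3
  have h2 : ∀ m : M, F z = m → ∀ w w' : Fin k → E, w = w' →
      (η (F z) : E [⋀^Fin k]→L[ℝ] V) w = (η m : E [⋀^Fin k]→L[ℝ] V) w' := by
    rintro _ rfl _ _ rfl; rfl
  exact h2 _ hF.self_of_nhds _ _ (funext fun i => h1 (v i))

theorem oneForm_pullback_comp {F : N → M} {F' : N' → M} {P : N → N'} {P' : N →L[ℝ] N'} {z : N}
    (hF : F =ᶠ[𝓝 z] fun w => F' (P w)) (hF' : ContMDiff 𝓘(ℝ, N') 𝓘(ℝ, E) ∞ F')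
    (hP : HasFDerivAt P P' z) (η : DForm E M 1 V) (v : N) :
    oneForm (pullback F η : DForm N N 1 V) z v =
      oneForm (pullback F' η : DForm N' N' 1 V) (P z) (P' v) := by
  rw [oneForm_apply, oneForm_apply, modelForm_pullback_comp hF hF' hP]
  congr 1
  funext i
  fin_cases i; rfl

theorem twoForm_pullback_comp {F : N → M} {F' : N' → M} {P : N → N'} {P' : N →L[ℝ] N'} {z : N}
    (hF : F =ᶠ[𝓝 z] fun w => F' (P w)) (hF' : ContMDiff 𝓘(ℝ, N') 𝓘(ℝ, E) ∞ F')
    (hP : HasFDerivAt P P' z) (η : DForm E M 2 V) (v w : N) :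
    twoForm (pullback F η : DForm N N 2 V) z v w =
      twoForm (pullback F' η : DForm N' N' 2 V) (P z) (P' v) (P' w) := by
  rw [twoForm_apply, twoForm_apply, modelForm_pullback_comp hF hF' hP]
  congr 1
  funext i
  fin_cases i <;> rfl

theorem solvesProblem_cocycleOf {a : DForm (ℝ × ℝ) (ℝ × ℝ) 1 EG} {B : DForm (ℝ × ℝ) (ℝ × ℝ) 2 EH}
    (h : IsConnectionDoublet C a B) : SolvesProblem C a B (cocycleOf C a B) := by
  have h1 := exists_solvesProblem C h.smooth_one h.smooth_two
  unfold cocycleOf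
  rw [dif_pos h1]
  exact h1.choose_spec

variable {θ : DForm E M 1 EG} {Υ : DForm E M 2 EH}

/-- The cocycle of a smooth map from the plane. -/
noncomputable def planeCocycle (C : LieCrossedModule EG G EH H) (θ : DForm E M 1 EG)
    (Υ : DForm E M 2 EH) (F : ℝ × ℝ → M) : CocycleData G H :=
  cocycleOf C (pullback F θ) (pullback F Υ)

theorem planeCocycle_solves (h : IsConnectionDoublet C θ Υ) {F : ℝ × ℝ → M}
    (hF : ContMDiff 𝓘(ℝ, ℝ × ℝ) 𝓘(ℝ, E) ∞ F) :
    SolvesProblem C (pullback F θ) (pullback F Υ) (planeCocycle C θ Υ F) :=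
  solvesProblem_cocycleOf (h.pullback hF)

theorem planeCocycle_isCocycle (h : IsConnectionDoublet C θ Υ) {F : ℝ × ℝ → M}
    (hF : ContMDiff 𝓘(ℝ, ℝ × ℝ) 𝓘(ℝ, E) ∞ F) : IsCocycle C (planeCocycle C θ Υ F) :=
  (planeCocycle_solves h hF).isCocycle (h.pullback hF)

/-- Locality of the cocycle of a map. -/
theorem planeCocycle_locality (h : IsConnectionDoublet C θ Υ) {F F' : ℝ × ℝ → M}
    (hF : ContMDiff 𝓘(ℝ, ℝ × ℝ) 𝓘(ℝ, E) ∞ F) (hF' : ContMDiff 𝓘(ℝ, ℝ × ℝ) 𝓘(ℝ, E) ∞ F')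
    {I J : Set ℝ} (hI : I.OrdConnected) (hIo : IsOpen I) (hJ : J.OrdConnected) (hJo : IsOpen J)
    {p q : ℝ → ℝ} {α κ : ℝ} (hp : ∀ x, HasDerivAt p α x) (hq : ∀ y, HasDerivAt q κ y)
    (hFF : ∀ x ∈ I, ∀ y ∈ J, F (x, y) = F' (p x, q y)) :
    (∀ x₀ ∈ I, ∀ x ∈ I, ∀ y ∈ J, (planeCocycle C θ Υ F).f x x₀ y =
      (planeCocycle C θ Υ F').f (p x) (p x₀) (q y)) ∧
    (∀ x ∈ I, ∀ y₀ ∈ J, ∀ y ∈ J, (planeCocycle C θ Υ F).g x y y₀ =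
      (planeCocycle C θ Υ F').g (p x) (q y) (q y₀)) ∧
    (∀ x₀ ∈ I, ∀ x ∈ I, ∀ y₀ ∈ J, ∀ y ∈ J, (planeCocycle C θ Υ F).W x x₀ y y₀ =
      (planeCocycle C θ Υ F').W (p x) (p x₀) (q y) (q y₀)) := by
  have hP : ∀ x y, HasFDerivAt (fun z : ℝ × ℝ => (p z.1, q z.2)) _ (x, y) := fun x y =>
    ((hp x).hasFDerivAt.comp (x, y) hasFDerivAt_fst).prodMk
      ((hq y).hasFDerivAt.comp (x, y) hasFDerivAt_snd)
  have hE : ∀ x ∈ I, ∀ y ∈ J, F =ᶠ[𝓝 (x, y)] fun z => F' (p z.1, q z.2) := by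
    intro x hx y hy
    filter_upwards [(hIo.prod hJo).mem_nhds (mk_mem_prod hx hy)] with z hz
    exact hFF z.1 hz.1 z.2 hz.2
  have e1 : ((α, 0) : ℝ × ℝ) = α • (1, 0) := by simp
  have e2 : ((0, κ) : ℝ × ℝ) = κ • (0, 1) := by simp
  refine (planeCocycle_solves h hF).locality (planeCocycle_solves h hF') hI hIo hJ hJo hp hq ?_ ?_ ?_
  · intro x hx y hy
    rw [oneForm_pullback_comp (hE x hx y hy) hF' (hP x y), ← map_smul, ← e1]
    simp
  · intro x hx y hy
    rw [oneForm_pullback_comp (hE x hx y hy) hF' (hP x y), ← map_smul, ← e2]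
    simp
  · intro x hx y hy
    rw [twoForm_pullback_comp (hE x hx y hy) hF' (hP x y)]
    have e3 : twoForm (pullback F' Υ) (p x, q y) (α, 0) (0, κ) =
        (α * κ) • twoForm (pullback F' Υ) (p x, q y) (1, 0) (0, 1) := by
      rw [e1, e2, map_smul, map_smul, smul_apply, smul_smul, mul_comm]
    rw [← e3]
    simp

theorem hasDerivAt_affine (α β x : ℝ) : HasDerivAt (fun x => α * x + β) α x := by
  simpa using ((hasDerivAt_id x).const_mul α).add_const β

variable {p q r : M} {γ γ₀ γ₁ γ₂ γ₃ : Curve E p q}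

theorem transport₁_eq (C : LieCrossedModule EG G EH H) (θ : DForm E M 1 EG) (Υ : DForm E M 2 EH)
    (γ : Curve E p q) :
    transport₁ C θ Υ γ = (planeCocycle C θ Υ (Surface.unit γ).toFun).f 1 0 0 := rfl

theorem transport₂_eq (C : LieCrossedModule EG G EH H) (θ : DForm E M 1 EG) (Υ : DForm E M 2 EH)
    (S : Surface γ₀ γ₁) :
    transport₂ C θ Υ S = (planeCocycle C θ Υ S.toFun).W 0 1 1 0 := rfl

/-- A unit surface is unchanged by the constant change of variable `y ↦ 0`, to which locality
applies. -/
theorem unit_f_eq (h : IsConnectionDoublet C θ Υ) (γ : Curve E p q) (y : ℝ) :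
    (planeCocycle C θ Υ (Surface.unit γ).toFun).f 1 0 y = transport₁ C θ Υ γ :=
  (planeCocycle_locality h (Surface.unit γ).smooth (Surface.unit γ).smooth ordConnected_univ
    isOpen_univ ordConnected_univ isOpen_univ (p := id) (q := fun _ => 0)
    (fun x => hasDerivAt_id x) (fun y => hasDerivAt_const y 0) (fun _ _ _ _ => rfl)).1
    0 trivial 1 trivial y trivial

theorem surface_f_zero (h : IsConnectionDoublet C θ Υ) (S : Surface γ₀ γ₁) :
    (planeCocycle C θ Υ S.toFun).f 1 0 0 = transport₁ C θ Υ γ₀ := by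
  obtain ⟨ε, h0, h1, h2, h3, h4, h5⟩ := S.sitting
  exact (planeCocycle_locality h S.smooth (Surface.unit γ₀).smooth ordConnected_univ isOpen_univ
    (J := Iio ε) ordConnected_Iio isOpen_Iio (p := id) (q := id) (fun x => hasDerivAt_id x)
    (fun y => hasDerivAt_id y) (fun x _ y hy => h4 x y hy)).1 0 trivial 1 trivial 0 h0

theorem surface_f_one (h : IsConnectionDoublet C θ Υ) (S : Surface γ₀ γ₁) :
    (planeCocycle C θ Υ S.toFun).f 1 0 1 = transport₁ C θ Υ γ₁ := by
  obtain ⟨ε, h0, h1, h2, h3, h4, h5⟩ := S.sitting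
  refine Eq.trans ((planeCocycle_locality h S.smooth (Surface.unit γ₁).smooth ordConnected_univ
    isOpen_univ (J := Ioi (1 - ε)) ordConnected_Ioi isOpen_Ioi (p := id) (q := id)
    (fun x => hasDerivAt_id x) (fun y => hasDerivAt_id y) (fun x _ y hy => h5 x y hy)).1 0 trivial
    1 trivial 1 (by simp [h0])) (unit_f_eq h γ₁ 1)

/-- For x near 0 the surface is constant and hence factors through `y ↦ 0`, which turns `g` into its
value at equal arguments. -/
theorem surface_g_zero (h : IsConnectionDoublet C θ Υ) (S : Surface γ₀ γ₁) (y y₀ : ℝ) :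
    (planeCocycle C θ Υ S.toFun).g 0 y y₀ = 1 := by
  obtain ⟨ε, h0, h1, h2, h3, h4, h5⟩ := S.sitting
  refine Eq.trans ((planeCocycle_locality h S.smooth S.smooth (I := Iio ε) ordConnected_Iio
    isOpen_Iio ordConnected_univ isOpen_univ (p := id) (q := fun _ => 0) (fun x => hasDerivAt_id x)
    (fun y => hasDerivAt_const y 0) (fun x hx y _ => (h2 x y hx).trans (h2 x 0 hx).symm)).2.1 0 h0
    y₀ trivial y trivial) ((planeCocycle_solves h S.smooth).g_init _ _)

theorem surface_g_one (h : IsConnectionDoublet C θ Υ) (S : Surface γ₀ γ₁) (y y₀ : ℝ) :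
    (planeCocycle C θ Υ S.toFun).g 1 y y₀ = 1 := by
  obtain ⟨ε, h0, h1, h2, h3, h4, h5⟩ := S.sitting
  refine Eq.trans ((planeCocycle_locality h S.smooth S.smooth (I := Ioi (1 - ε)) ordConnected_Ioi
    isOpen_Ioi ordConnected_univ isOpen_univ (p := id) (q := fun _ => 0) (fun x => hasDerivAt_id x)
    (fun y => hasDerivAt_const y 0) (fun x hx y _ => (h3 x y hx).trans (h3 x 0 hx).symm)).2.1 1
    (by simp [h0]) y₀ trivial y trivial) ((planeCocycle_solves h S.smooth).g_init _ _)

theorem IsCocycle.f_self {c : CocycleData G H} (hc : IsCocycle C c) (x y : ℝ) : c.f x x y = 1 := by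
  simpa using hc.f_comp x x x y

theorem IsCocycle.f_inv {c : CocycleData G H} (hc : IsCocycle C c) (x' x y : ℝ) :
    c.f x' x y = (c.f x x' y)⁻¹ := by
  rw [eq_inv_iff_mul_eq_one, ← hc.f_comp, hc.f_self]

/-- In the target formula for `W(0, 1; 1, 0)` both factors `g` are trivial, and `f(0, 1; y)` is the
inverse of `f(1, 0; y)`. -/
theorem transport₁_target (h : IsConnectionDoublet C θ Υ) (S : Surface γ₀ γ₁) :
    transport₁ C θ Υ γ₁ = C.t (transport₂ C θ Υ S) * transport₁ C θ Υ γ₀ := by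
  have hc := planeCocycle_isCocycle h S.smooth
  rw [transport₂_eq, hc.target, surface_g_zero h, surface_g_one h, ← surface_f_one h S,
    ← surface_f_zero h S, hc.f_inv 0 1 1, hc.f_inv 0 1 0]
  simp

theorem transport₁_unit (h : IsConnectionDoublet C θ Υ) (p : M) :
    transport₁ C θ Υ (Curve.unit (E := E) p) = 1 := by
  have hs := (Surface.unit (Curve.unit (E := E) p)).smooth
  exact ((planeCocycle_locality h hs hs ordConnected_univ
    isOpen_univ ordConnected_univ isOpen_univ (p := fun _ => 0) (q := id)
    (fun x => hasDerivAt_const x 0) (fun y => hasDerivAt_id y) (fun _ _ _ _ => rfl)).1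
    0 trivial 1 trivial 0 trivial).trans ((planeCocycle_solves h hs).f_init _ _)

theorem transport₁_inv (h : IsConnectionDoublet C θ Υ) (γ : Curve E p q) :
    transport₁ C θ Υ γ.inv = (transport₁ C θ Υ γ)⁻¹ := by
  refine ((planeCocycle_locality h (Surface.unit γ.inv).smooth (Surface.unit γ).smooth
    ordConnected_univ isOpen_univ ordConnected_univ isOpen_univ (p := fun x => 1 - x) (q := id)
    (fun x => (hasDerivAt_id x).const_sub 1) (fun y => hasDerivAt_id y) (fun _ _ _ _ => rfl)).1
    0 trivial 1 trivial 0 trivial).trans ?_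
  simp only [sub_self, sub_zero, id]
  exact (planeCocycle_isCocycle h (Surface.unit γ).smooth).f_inv 0 1 0

/-- Sitting instants extend the description by the first piece slightly beyond the seam. This puts
1/2 inside an open interval, as locality requires; the five statements that follow are of the same
kind. -/
theorem Curve.comp_eq_left (γ₂ : Curve E q r) (γ₁ : Curve E p q) : ∃ δ > 0, ∀ x < 1 / 2 + δ,
    (γ₂.comp γ₁).toFun x = γ₁.toFun (2 * x + 0) := by
  obtain ⟨ε, h0, h1, h2, h3⟩ := γ₁.sitting
  obtain ⟨ε', h0', h1', h2', h3'⟩ := γ₂.sitting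
  refine ⟨ε' / 2, by positivity, fun x hx => ?_⟩
  change (if x ≤ 1 / 2 then γ₁.toFun (2 * x) else γ₂.toFun (2 * x - 1)) = _
  split_ifs with hc
  · rw [add_zero]
  · rw [h2' _ (by linarith), h3 _ (by linarith)]

theorem Curve.comp_eq_right (γ₂ : Curve E q r) (γ₁ : Curve E p q) : ∃ δ > 0, ∀ x > 1 / 2 - δ,
    (γ₂.comp γ₁).toFun x = γ₂.toFun (2 * x + -1) := by
  obtain ⟨ε, h0, h1, h2, h3⟩ := γ₁.sitting
  obtain ⟨ε', h0', h1', h2', h3'⟩ := γ₂.sitting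
  refine ⟨ε / 2, by positivity, fun x hx => ?_⟩
  change (if x ≤ 1 / 2 then γ₁.toFun (2 * x) else γ₂.toFun (2 * x - 1)) = _
  split_ifs with hc
  · rw [h2' _ (by linarith), h3 _ (by linarith)]
  · rw [sub_eq_add_neg]

theorem Surface.hcomp_eq_left {γ₂ γ₃ : Curve E q r} (S₂ : Surface γ₂ γ₃) (S₁ : Surface γ₀ γ₁) :
    ∃ δ > 0, ∀ x y, x < 1 / 2 + δ → (S₂.hcomp S₁).toFun (x, y) = S₁.toFun (2 * x + 0, y) := by
  obtain ⟨ε, h0, h1, h2, h3, -⟩ := S₁.sitting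
  obtain ⟨ε', h0', h1', h2', h3', -⟩ := S₂.sitting
  refine ⟨ε' / 2, by positivity, fun x y hx => ?_⟩
  change (if x ≤ 1 / 2 then S₁.toFun (2 * x, y) else S₂.toFun (2 * x - 1, y)) = _
  split_ifs with hc
  · rw [add_zero]
  · rw [h2' _ _ (by linarith), h3 _ _ (by linarith)]

theorem Surface.hcomp_eq_right {γ₂ γ₃ : Curve E q r} (S₂ : Surface γ₂ γ₃) (S₁ : Surface γ₀ γ₁) :
    ∃ δ > 0, ∀ x y, x > 1 / 2 - δ → (S₂.hcomp S₁).toFun (x, y) = S₂.toFun (2 * x + -1, y) := by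
  obtain ⟨ε, h0, h1, h2, h3, -⟩ := S₁.sitting
  obtain ⟨ε', h0', h1', h2', h3', -⟩ := S₂.sitting
  refine ⟨ε / 2, by positivity, fun x y hx => ?_⟩
  change (if x ≤ 1 / 2 then S₁.toFun (2 * x, y) else S₂.toFun (2 * x - 1, y)) = _
  split_ifs with hc
  · rw [h2' _ _ (by linarith), h3 _ _ (by linarith)]
  · rw [sub_eq_add_neg]

theorem Surface.vcomp_eq_left (S₂ : Surface γ₁ γ₂) (S₁ : Surface γ₀ γ₁) :
    ∃ δ > 0, ∀ x y, y < 1 / 2 + δ → (S₂.vcomp S₁).toFun (x, y) = S₁.toFun (x, 2 * y + 0) := by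
  obtain ⟨ε, h0, h1, -, -, h4, h5⟩ := S₁.sitting
  obtain ⟨ε', h0', h1', -, -, h4', h5'⟩ := S₂.sitting
  refine ⟨ε' / 2, by positivity, fun x y hy => ?_⟩
  change (if y ≤ 1 / 2 then S₁.toFun (x, 2 * y) else S₂.toFun (x, 2 * y - 1)) = _
  split_ifs with hc
  · rw [add_zero]
  · rw [h4' _ _ (by linarith), h5 _ _ (by linarith)]

theorem Surface.vcomp_eq_right (S₂ : Surface γ₁ γ₂) (S₁ : Surface γ₀ γ₁) :
    ∃ δ > 0, ∀ x y, y > 1 / 2 - δ → (S₂.vcomp S₁).toFun (x, y) = S₂.toFun (x, 2 * y + -1) := by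
  obtain ⟨ε, h0, h1, -, -, h4, h5⟩ := S₁.sitting
  obtain ⟨ε', h0', h1', -, -, h4', h5'⟩ := S₂.sitting
  refine ⟨ε / 2, by positivity, fun x y hy => ?_⟩
  change (if y ≤ 1 / 2 then S₁.toFun (x, 2 * y) else S₂.toFun (x, 2 * y - 1)) = _
  split_ifs with hc
  · rw [h4' _ _ (by linarith), h5 _ _ (by linarith)]
  · rw [sub_eq_add_neg]

theorem transport₁_comp (h : IsConnectionDoublet C θ Υ) (γ₁ : Curve E p q) (γ₂ : Curve E q r) :
    transport₁ C θ Υ (γ₂.comp γ₁) = transport₁ C θ Υ γ₂ * transport₁ C θ Υ γ₁ := by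
  have hs := (Surface.unit (γ₂.comp γ₁)).smooth
  obtain ⟨δ, hδ, h1⟩ := γ₂.comp_eq_left γ₁
  obtain ⟨δ', hδ', h2⟩ := γ₂.comp_eq_right γ₁
  have e1 := (planeCocycle_locality h hs (Surface.unit γ₁).smooth (I := Iio (1 / 2 + δ))
    ordConnected_Iio isOpen_Iio ordConnected_univ isOpen_univ (hasDerivAt_affine 2 0)
    (fun y => hasDerivAt_id y) (fun x hx _ _ => h1 x hx)).1 0 (by simp; linarith) (1 / 2)
    (by simp [hδ]) 0 trivial
  have e2 := (planeCocycle_locality h hs (Surface.unit γ₂).smooth (I := Ioi (1 / 2 - δ'))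
    ordConnected_Ioi isOpen_Ioi ordConnected_univ isOpen_univ (hasDerivAt_affine 2 (-1))
    (fun y => hasDerivAt_id y) (fun x hx _ _ => h2 x hx)).1 (1 / 2) (by simp [hδ']) 1
    (by simp; linarith) 0 trivial
  rw [transport₁_eq, (planeCocycle_isCocycle h hs).f_comp 1 (1 / 2) 0 0, e1, e2, transport₁_eq,
    transport₁_eq]
  norm_num

theorem transport₂_unit (h : IsConnectionDoublet C θ Υ) (γ : Curve E p q) :
    transport₂ C θ Υ (Surface.unit γ) = 1 :=
  ((planeCocycle_locality h (Surface.unit γ).smooth (Surface.unit γ).smooth ordConnected_univ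
    isOpen_univ ordConnected_univ isOpen_univ (p := id) (q := fun _ => 0)
    (fun x => hasDerivAt_id x) (fun y => hasDerivAt_const y 0) (fun _ _ _ _ => rfl)).2.2
    1 trivial 0 trivial 0 trivial 1 trivial).trans
    ((planeCocycle_solves h (Surface.unit γ).smooth).W_init_y _ _ _)

/-- The vertical cocycle law along `1 → 0 → 1` reads `1 = W(0, 1; 1, 0) W(0, 1; 0, 1)`, because `g`
is trivial at `x = 1`. -/
theorem transport₂_vinv (h : IsConnectionDoublet C θ Υ) (S : Surface γ₀ γ₁) :
    transport₂ C θ Υ S.vinv = (transport₂ C θ Υ S)⁻¹ := by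
  have e1 := (planeCocycle_locality h S.vinv.smooth S.smooth ordConnected_univ isOpen_univ
    ordConnected_univ isOpen_univ (p := id) (q := fun y => 1 - y) (fun x => hasDerivAt_id x)
    (fun y => (hasDerivAt_id y).const_sub 1) (fun _ _ _ _ => rfl)).2.2
    1 trivial 0 trivial 0 trivial 1 trivial
  have e2 := (planeCocycle_isCocycle h S.smooth).W_comp_y 0 1 1 0 1
  rw [surface_g_one h, (planeCocycle_solves h S.smooth).W_init_y, inv_one, map_one,
    MulAut.one_apply] at e2
  rw [transport₂_eq, transport₂_eq, e1, eq_inv_iff_mul_eq_one, mul_eq_one_iff_inv_eq]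
  simp only [id, sub_self, sub_zero]
  exact (eq_inv_of_mul_eq_one_right e2.symm).symm ▸ inv_inv _

theorem transport₂_vcomp (h : IsConnectionDoublet C θ Υ) (S₁ : Surface γ₀ γ₁)
    (S₂ : Surface γ₁ γ₂) :
    transport₂ C θ Υ (S₂.vcomp S₁) = transport₂ C θ Υ S₂ * transport₂ C θ Υ S₁ := by
  have hs := (S₂.vcomp S₁).smooth
  obtain ⟨δ, hδ, h1⟩ := S₂.vcomp_eq_left S₁
  obtain ⟨δ', hδ', h2⟩ := S₂.vcomp_eq_right S₁
  have e1 := (planeCocycle_locality h hs S₁.smooth ordConnected_univ isOpen_univ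
    (J := Iio (1 / 2 + δ)) ordConnected_Iio isOpen_Iio (p := id) (fun y => hasDerivAt_id y)
    (hasDerivAt_affine 2 0) (fun x _ y hy => h1 x y hy)).2.2 1 trivial 0 trivial 0
    (by simp; linarith) (1 / 2) (by simp [hδ])
  have e2 := (planeCocycle_locality h hs S₂.smooth ordConnected_univ isOpen_univ
    (J := Ioi (1 / 2 - δ')) ordConnected_Ioi isOpen_Ioi (p := id) (fun y => hasDerivAt_id y)
    (hasDerivAt_affine 2 (-1)) (fun x _ y hy => h2 x y hy)).2.2 1 trivial 0 trivial (1 / 2)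
    (by simp [hδ']) 1 (by simp; linarith)
  rw [transport₂_eq, (planeCocycle_isCocycle h hs).W_comp_y 0 1 1 (1 / 2) 0, surface_g_one h, e1, e2,
    transport₂_eq, transport₂_eq]
  norm_num

/-- The horizontal cocycle law along `0 → 1 → 0` reads `1 = W(1, 0; 1, 0) m(F(γ₀)⁻¹)(F(Σ))`, and the
first factor is the transport of the reversed surface. -/
theorem transport₂_hinv (h : IsConnectionDoublet C θ Υ) (S : Surface γ₀ γ₁) :
    transport₂ C θ Υ S.hinv = C.m (transport₁ C θ Υ γ₀)⁻¹ (transport₂ C θ Υ S)⁻¹ := by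
  have e1 := (planeCocycle_locality h S.hinv.smooth S.smooth ordConnected_univ isOpen_univ
    ordConnected_univ isOpen_univ (p := fun x => 1 - x) (q := id)
    (fun y => (hasDerivAt_id y).const_sub 1) (fun x => hasDerivAt_id x) (fun _ _ _ _ => rfl)).2.2
    1 trivial 0 trivial 0 trivial 1 trivial
  have e2 := (planeCocycle_isCocycle h S.smooth).W_comp_x 0 1 0 1 0
  rw [(planeCocycle_solves h S.smooth).W_init_x, surface_f_zero h] at e2
  rw [transport₂_eq, transport₂_eq, e1, map_inv, eq_inv_iff_mul_eq_one]
  simp only [id, sub_self, sub_zero]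
  exact e2.symm

/-- The horizontal cocycle law is split at 1/2; the element `f(1/2, 1; 0)⁻¹ = f(1, 1/2; 0)` that
acts in it is the transport along `γ₂`. -/
theorem transport₂_hcomp (h : IsConnectionDoublet C θ Υ) {γ₂ γ₃ : Curve E q r} (S₁ : Surface γ₀ γ₁)
    (S₂ : Surface γ₂ γ₃) : transport₂ C θ Υ (S₂.hcomp S₁) =
      transport₂ C θ Υ S₂ * C.m (transport₁ C θ Υ γ₂) (transport₂ C θ Υ S₁) := by
  have hs := (S₂.hcomp S₁).smooth
  have hc := planeCocycle_isCocycle h hs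
  obtain ⟨δ, hδ, h1⟩ := S₂.hcomp_eq_left S₁
  obtain ⟨δ', hδ', h2⟩ := S₂.hcomp_eq_right S₁
  have e1 := (planeCocycle_locality h hs S₁.smooth (I := Iio (1 / 2 + δ)) ordConnected_Iio
    isOpen_Iio ordConnected_univ isOpen_univ (q := id) (hasDerivAt_affine 2 0)
    (fun y => hasDerivAt_id y) (fun x hx y _ => h1 x y hx)).2.2 (1 / 2) (by simp [hδ]) 0
    (by simp; linarith) 0 trivial 1 trivial
  have e2 := (planeCocycle_locality h hs S₂.smooth (I := Ioi (1 / 2 - δ')) ordConnected_Ioi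
    isOpen_Ioi ordConnected_univ isOpen_univ (q := id) (hasDerivAt_affine 2 (-1))
    (fun y => hasDerivAt_id y) (fun x hx y _ => h2 x y hx))
  have e3 := e2.2.2 1 (by simp; linarith) (1 / 2) (by simp [hδ']) 0 trivial 1 trivial
  have e4 := e2.1 (1 / 2) (by simp [hδ']) 1 (by simp; linarith) 0 trivial
  rw [transport₂_eq, hc.W_comp_x 0 (1 / 2) 1 1 0, hc.f_inv (1 / 2) 1 0, inv_inv, e1, e3, e4,
    transport₂_eq, transport₂_eq, ← surface_f_zero h S₂]
  norm_num

end Transport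

end TwoTransport

namespace TwoTransport

/-! ### Forms pulled back along maps of low rank. -/

section Rank

variable {N E M V : Type*} [NormedAddCommGroup N] [NormedSpace ℝ N]
  [NormedAddCommGroup E] [NormedSpace ℝ E]
  [TopologicalSpace M] [ChartedSpace E M] [IsManifold 𝓘(ℝ, E) ∞ M]
  [NormedAddCommGroup V] [NormedSpace ℝ V]

theorem not_linearIndependent_of_rank_le {D : N →ₗ[ℝ] E} {n : ℕ} (h : D.rank ≤ n)
    (v : Fin (n + 1) → N) : ¬ LinearIndependent ℝ (fun i => D (v i)) := by
  intro hv
  have h1 : LinearIndependent ℝ (fun i => (⟨D (v i), ⟨v i, rfl⟩⟩ : LinearMap.range D)) :=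
    LinearIndependent.of_comp (LinearMap.range D).subtype hv
  have h2 := h1.cardinal_lift_le_rank
  have h3 : Module.rank ℝ (LinearMap.range D) ≤ n := h
  have h4 := h2.trans (Cardinal.lift_le.2 h3)
  simp only [Cardinal.mk_fin, Cardinal.lift_natCast, Nat.cast_le] at h4
  omega

/-- The differential of a map from a normed space, as a map between the model spaces. -/
noncomputable def tdiff (E : Type*) [NormedAddCommGroup E] [NormedSpace ℝ E] {M : Type*}
    [TopologicalSpace M] [ChartedSpace E M] (F : N → M) (z : N) : N →L[ℝ] E :=
  mfderiv 𝓘(ℝ, N) 𝓘(ℝ, E) F z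

/-- The differential of `F` at `z` has rank at most `n`. -/
def RankLE (E : Type*) [NormedAddCommGroup E] [NormedSpace ℝ E] {M : Type*}
    [TopologicalSpace M] [ChartedSpace E M] (F : N → M) (n : ℕ) (z : N) : Prop :=
  (tdiff E F z).toLinearMap.rank ≤ n

theorem rankLE_one {F : N → M} {z : N} : RankLE E F 1 z ↔
    (mfderiv 𝓘(ℝ, N) 𝓘(ℝ, E) F z).toLinearMap.rank ≤ 1 := by
  unfold RankLE
  rw [Nat.cast_one]
  rfl

theorem rankLE_two {F : N → M} {z : N} : RankLE E F 2 z ↔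
    (mfderiv 𝓘(ℝ, N) 𝓘(ℝ, E) F z).toLinearMap.rank ≤ 2 := by
  unfold RankLE
  rw [Nat.cast_ofNat]
  rfl

theorem modelForm_pullback_eq_zero_of_rank {F : N → M} {n : ℕ} (η : DForm E M (n + 1) V) {z : N}
    (h : RankLE E F n z) (v : Fin (n + 1) → N) :
    modelForm (pullback F η : DForm N N (n + 1) V) z v = 0 :=
  AlternatingMap.map_linearDependent (η (F z) : E [⋀^Fin (n + 1)]→L[ℝ] V).toAlternatingMap _
    (not_linearIndependent_of_rank_le (D := (tdiff E F z).toLinearMap) h v)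

/-- By naturality this is `dη` evaluated on linearly dependent vectors. The rank bound is therefore
needed only at the point `z`, not in a neighbourhood. -/
theorem modelForm_dForm_pullback_eq_zero_of_rank {F : N → M} (hF : ContMDiff 𝓘(ℝ, N) 𝓘(ℝ, E) ∞ F)
    {n : ℕ} {η : DForm E M n V} (hη : SmoothForm η) {z : N}
    (h : RankLE E F n z) (v : Fin (n + 1) → N) :
    modelForm (dForm (pullback F η : DForm N N n V)) z v = 0 :=
  (dForm_pullback hF hη z v).trans
    (AlternatingMap.map_linearDependent (dForm η (F z) : E [⋀^Fin (n + 1)]→L[ℝ] V).toAlternatingMap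
      _ (not_linearIndependent_of_rank_le (D := (tdiff E F z).toLinearMap) h v))

theorem oneForm_pullback_eq_zero {F : N → M} (η : DForm E M 1 V) {z v : N}
    (hv : tdiff E F z v = 0) :
    oneForm (pullback F η : DForm N N 1 V) z v = 0 := by
  rw [oneForm_apply]
  exact modelForm_pullback_eq_zero η (i := 0) hv

theorem twoForm_pullback_eq_zero {F : N → M} (η : DForm E M 2 V) {z v : N}
    (hv : tdiff E F z v = 0) (w : N) :
    twoForm (pullback F η : DForm N N 2 V) z v w = 0 := by
  rw [twoForm_apply]
  exact modelForm_pullback_eq_zero η (i := 0) hv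

theorem twoForm_pullback_eq_zero_of_rank {F : N → M} (η : DForm E M 2 V) {z : N}
    (h : RankLE E F 1 z) (v w : N) :
    twoForm (pullback F η : DForm N N 2 V) z v w = 0 := by
  rw [twoForm_apply]
  exact modelForm_pullback_eq_zero_of_rank (n := 1) η h _

end Rank

/-! ### Vanishing of the 3-curvature, and variation of a transported vector. -/

section Flat

variable {EG G EH H E M N : Type*}
  [NormedAddCommGroup EG] [NormedSpace ℝ EG] [FiniteDimensional ℝ EG]
  [TopologicalSpace G] [ChartedSpace EG G] [Group G] [LieGroup 𝓘(ℝ, EG) ∞ G]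
  [NormedAddCommGroup EH] [NormedSpace ℝ EH] [FiniteDimensional ℝ EH]
  [TopologicalSpace H] [ChartedSpace EH H] [Group H] [LieGroup 𝓘(ℝ, EH) ∞ H]
  [NormedAddCommGroup E] [NormedSpace ℝ E]
  [TopologicalSpace M] [ChartedSpace E M] [IsManifold 𝓘(ℝ, E) ∞ M]
  [NormedAddCommGroup N] [NormedSpace ℝ N]
  {C : LieCrossedModule EG G EH H}

/-- The 3-curvature of a pair of forms. -/
noncomputable def threeCurv (C : LieCrossedModule EG G EH H) (a : DForm N N 1 EG)
    (B : DForm N N 2 EH) (z u v w : N) : EH :=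
  (fderiv ℝ (twoForm B) z u v w + C.act (oneForm a z u) (twoForm B z v w)) -
    (fderiv ℝ (twoForm B) z v u w + C.act (oneForm a z v) (twoForm B z u w)) +
    (fderiv ℝ (twoForm B) z w u v + C.act (oneForm a z w) (twoForm B z u v))

/-- The hypotheses say that contraction with `g₀ u + g₁ v + g₂ w` kills a 1-form with values `a, b,
c` and a 2-form with values `p, q, r`. These relations make each multiple of the wedge by a
coefficient `g i` vanish, and one coefficient is invertible. -/
theorem wedge_eq_zero {V W : Type*} [NormedAddCommGroup V] [NormedSpace ℝ V]
    [NormedAddCommGroup W] [NormedSpace ℝ W] (φ : V →L[ℝ] W →L[ℝ] W) {a b c : V} {p q r : W}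
    {g : Fin 3 → ℝ} (hA : g 0 • a + g 1 • b + g 2 • c = 0) (hu : -(g 1 • r) - g 2 • q = 0)
    (hv : g 0 • r - g 2 • p = 0) (hw : g 0 • q + g 1 • p = 0) {i : Fin 3} (hi : g i ≠ 0) :
    φ a p - φ b q + φ c r = 0 := by
  have hL : ∀ (t : ℝ) x y, t • φ x y = φ (t • x) y := fun t x y => by simp
  have hR : ∀ (t : ℝ) x y, t • φ x y = φ x (t • y) := fun t x y => by simp
  have h0 : g 0 • (φ a p - φ b q + φ c r) = 0 := by
    have e1 : g 0 • a = -(g 1 • b) - g 2 • c := by rw [← sub_eq_zero, ← hA]; abel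
    have e2 : g 0 • q = -(g 1 • p) := by rw [← sub_eq_zero, ← hw]; abel
    have e3 : g 0 • r = g 2 • p := sub_eq_zero.1 hv
    rw [smul_add, smul_sub, hL, hR, hR _ c, e1, e2, e3]
    simp
    abel
  have h1 : g 1 • (φ a p - φ b q + φ c r) = 0 := by
    have e1 : g 1 • b = -(g 0 • a) - g 2 • c := by rw [← sub_eq_zero, ← hA]; abel
    have e2 : g 1 • p = -(g 0 • q) := by rw [← sub_eq_zero, ← hw]; abel
    have e3 : g 1 • r = -(g 2 • q) := by rw [← sub_eq_zero, ← neg_eq_zero, ← hu]; abel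
    rw [smul_add, smul_sub, hR, hL _ b, hR _ c, e1, e2, e3]
    simp
  have h2 : g 2 • (φ a p - φ b q + φ c r) = 0 := by
    have e1 : g 2 • c = -(g 0 • a) - g 1 • b := by rw [← sub_eq_zero, ← hA]; abel
    have e2 : g 2 • p = g 0 • r := (sub_eq_zero.1 hv).symm
    have e3 : g 2 • q = -(g 1 • r) := by rw [← sub_eq_zero, ← neg_eq_zero, ← hu]; abel
    rw [smul_add, smul_sub, hR, hR _ b, hL _ c, e1, e2, e3]
    simp
  fin_cases i
  · exact (smul_eq_zero.1 h0).resolve_left hi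
  · exact (smul_eq_zero.1 h1).resolve_left hi
  · exact (smul_eq_zero.1 h2).resolve_left hi

/-- The part `dΥ` is a 3-form on vectors with dependent images. For the part `θ ∧ Υ`, a linear
relation between these images is a vector killed by `dF`, hence by both pulled-back forms, and
`wedge_eq_zero` applies. -/
theorem threeCurv_pullback_eq_zero {θ : DForm E M 1 EG} {Υ : DForm E M 2 EH} {F : N → M}
    (hF : ContMDiff 𝓘(ℝ, N) 𝓘(ℝ, E) ∞ F) (hΥ : SmoothForm Υ) {z : N}
    (h : RankLE E F 2 z) (u v w : N) :
    threeCurv C (pullback F θ) (pullback F Υ) z u v w = 0 := by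
  have h1 := dForm_twoForm (B := (pullback F Υ : DForm N N 2 EH))
    ((smoothForm_model_iff _).2 (contDiff_pullback hF hΥ)) z u v w
  rw [modelForm_dForm_pullback_eq_zero_of_rank hF hΥ h] at h1
  obtain ⟨g, hg, i, hi⟩ := Fintype.not_linearIndependent_iff.1
    (not_linearIndependent_of_rank_le (n := 2) (D := (tdiff E F z).toLinearMap) h ![u, v, w])
  have hk : tdiff E F z (g 0 • u + g 1 • v + g 2 • w) = 0 := by
    rw [map_add, map_add, map_smul, map_smul, map_smul, ← hg]
    exact (Fin.sum_univ_three (fun i => g i • tdiff E F z (![u, v, w] i))).symm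
  have hA := oneForm_pullback_eq_zero θ hk
  have hB := fun x => twoForm_pullback_eq_zero Υ hk x
  unfold threeCurv
  set A := oneForm (pullback F θ : DForm N N 1 EG) z
  set D := fderiv ℝ (twoForm (pullback F Υ : DForm N N 2 EH)) z
  have hsw : ∀ x y, twoForm (pullback F Υ : DForm N N 2 EH) z x y =
    -twoForm (pullback F Υ : DForm N N 2 EH) z y x := twoForm_swap _ z
  have hself : ∀ x, twoForm (pullback F Υ : DForm N N 2 EH) z x x = 0 := fun x =>
    by
    have h2 := hsw x x
    rw [eq_neg_iff_add_eq_zero, ← two_smul ℝ] at h2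
    exact (smul_eq_zero.1 h2).resolve_left two_ne_zero
  set B := twoForm (pullback F Υ : DForm N N 2 EH) z
  have hu := hB u
  have hv := hB v
  have hw := hB w
  simp only [map_add, map_smul, add_apply, smul_apply, hself] at hA hu hv hw
  rw [hsw v u, hsw w u] at hu
  rw [hsw w v] at hv
  have key : C.act (A u) (B v w) - C.act (A v) (B u w) + C.act (A w) (B u v) = 0 := by
    refine wedge_eq_zero C.act (g := g) hA ?_ ?_ ?_ hi
    · rw [← hu]; simp [sub_eq_add_neg]
    · rw [← hv]; simp [sub_eq_add_neg]
    · rw [← hw]; simp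
  calc _ = (D u v w - D v u w + D w u v) +
      (C.act (A u) (B v w) - C.act (A v) (B u w) + C.act (A w) (B u v)) := by abel
    _ = 0 := by rw [← h1, key, add_zero]

/-- The variation of a pulled-back vector. -/
theorem hasFDerivAt_mDot_inv_gauge {b : N → EH} {b' : N →L[ℝ] EH} {k : N → G} {z : N}
    (hk : ContMDiff 𝓘(ℝ, N) 𝓘(ℝ, EG) ∞ k) (hb : HasFDerivAt b b' z) :
    ∃ L : N →L[ℝ] EH, HasFDerivAt (fun z => C.mDot (k z)⁻¹ (b z)) L z ∧
      ∀ (X : N) (x : EG) (β : EH), Ad EG (k z)⁻¹ (x + rd EG k z X) = -C.tDot β →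
        L X = ad EH H β (C.mDot (k z)⁻¹ (b z)) + C.mDot (k z)⁻¹ (b' X + C.act x (b z)) := by
  have h2 := (C.hasFDerivAt_mDot (hk.contMDiffAt (x := z)).inv).clm_apply hb
  refine ⟨_, h2, fun X x β h => ?_⟩
  -- The summand `ṫ(β)` acts on `𝔥` as the bracket with `β` by the infinitesimal Peiffer identity;
  -- the other summand combines with `b'` to the covariant derivative.
  have hri : rd EG (fun w => (k w)⁻¹) z X = C.tDot β + Ad EG (k z)⁻¹ x := by
    rw [rd_inv hk.contMDiffAt]
    rw [map_add] at h
    rw [← neg_eq_iff_eq_neg.2 h]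
    simp
  have hact : ∀ v w, (conjModule EH H).act v w = ad EH H v w := fun _ _ => rfl
  simp only [add_apply, ContinuousLinearMap.comp_apply, ContinuousLinearMap.flip_apply,
    ContinuousLinearMap.compL_apply, hri, map_add, C.act_tDot, C.mDot_act, hact]
  abel

end Flat

end TwoTransport

namespace TwoTransport

/-! ### Transport from the face `x = 1` and flatness. -/

section Flat

variable {EG G EH H P : Type*}
  [NormedAddCommGroup EG] [NormedSpace ℝ EG] [FiniteDimensional ℝ EG]
  [TopologicalSpace G] [ChartedSpace EG G] [Group G] [LieGroup 𝓘(ℝ, EG) ∞ G]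
  [NormedAddCommGroup EH] [NormedSpace ℝ EH] [FiniteDimensional ℝ EH]
  [TopologicalSpace H] [ChartedSpace EH H] [Group H] [LieGroup 𝓘(ℝ, EH) ∞ H]
  {C : LieCrossedModule EG G EH H}

theorem ad_skew (x y : EG) : ad EG G x y = -ad EG G y x := by
  rw [ad_apply, ad_apply]; abel

/-- The derivative of a function of several variables along the first one. -/
theorem hasDerivAt_slice_fst [NormedAddCommGroup P] [NormedSpace ℝ P] {V : Type*}
    [NormedAddCommGroup V] [NormedSpace ℝ V] {b : ℝ × P → V} {b' : ℝ × P →L[ℝ] V} {x : ℝ} {p : P}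
    (hb : HasFDerivAt b b' (x, p)) : HasDerivAt (fun s => b (s, p)) (b' (1, 0)) x :=
  hb.comp_hasDerivAt x ((hasDerivAt_id x).prodMk (hasDerivAt_const x p))

/-- Parallel transport along the first variable towards `{1} × P`. -/
theorem exists_transport_fst [NormedAddCommGroup P] [NormedSpace ℝ P] [CompleteSpace P]
    {A : ℝ × P → ℝ × P →L[ℝ] EG} (hA : ContDiff ℝ ∞ A) : ∃ k : ℝ × P → G,
    ContMDiff 𝓘(ℝ, ℝ × P) 𝓘(ℝ, EG) ∞ k ∧ (∀ p, k (1, p) = 1) ∧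
    ∀ z, rd EG k z (1, 0) = -A z (1, 0) := by
  obtain ⟨u, hu, -, hu1⟩ := exists_lieSolution G (α := fun z => -A z (1, 0))
    (hA.clm_apply contDiff_const).neg
  have hk : ContMDiff 𝓘(ℝ, ℝ × P) 𝓘(ℝ, EG) ∞ (fun z => u z * (u (1, z.2))⁻¹) :=
    hu.mul (hu.comp (f := fun z : ℝ × P => ((1 : ℝ), z.2))
      (contDiff_const.prodMk contDiff_snd).contMDiff).inv
  refine ⟨_, hk, fun p => mul_inv_cancel _, ?_⟩
  rintro ⟨x, p⟩
  rw [← hu1 x p, rlogDeriv_eq_rd, ← rd_mul_const (EG := EG) (fun s => u (s, p)) (u (1, p))⁻¹ x,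
    rd_comp (u := fun z : ℝ × P => u z * (u (1, z.2))⁻¹) (c := fun s => (s, p)) hk.contMDiffAt
      ((hasDerivAt_id x).prodMk (hasDerivAt_const x p)).hasFDerivAt]
  simp

/-- Primitives along the first variable that vanish on `{1} × P`. -/
theorem exists_primitive_fst {P : Type} [NormedAddCommGroup P] [NormedSpace ℝ P] {V : Type*}
    [NormedAddCommGroup V] [NormedSpace ℝ V] [CompleteSpace V] {h : ℝ × P → V}
    (hh : ContDiff ℝ ∞ h) : ∃ β : ℝ × P → V, ContDiff ℝ ∞ β ∧ (∀ p, β (1, p) = 0) ∧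
      ∀ z, fderiv ℝ β z (1, 0) = h z := by
  obtain ⟨K, hK, -, hK1⟩ := exists_smooth_primitive hh
  have hβ : ContDiff ℝ ∞ (fun z : ℝ × P => K z - K (1, z.2)) := hK.sub (hK.comp (by fun_prop))
  refine ⟨_, hβ, fun p => sub_self _, ?_⟩
  rintro ⟨x, p⟩
  have h1 := hasDerivAt_slice_fst (hβ.contDiffAt.differentiableAt (x := (x, p)) (by simp)).hasFDerivAt
  exact h1.unique ((hK1 x p).sub_const (K (1, p)))

theorem eq_const_of_fderiv_fst [NormedAddCommGroup P] [NormedSpace ℝ P] {V : Type*}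
    [NormedAddCommGroup V] [NormedSpace ℝ V] {u : ℝ × P → V} {v : V} {p : P}
    (h : ∀ x, ∃ L : ℝ × P →L[ℝ] V, HasFDerivAt u L (x, p) ∧ L (1, 0) = 0) {x₀ : ℝ}
    (h0 : u (x₀, p) = v) (x : ℝ) : u (x, p) = v := by
  refine eq_of_hasDerivAt_eq ordConnected_univ isOpen_univ (u := fun s => u (s, p))
    (v := fun _ => v) (d := fun _ => 0) (fun s _ => ?_) (fun s _ => hasDerivAt_const _ _)
    (mem_univ x₀) h0 x trivial
  obtain ⟨L, hL, hL0⟩ := h s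
  exact hL0 ▸ hasDerivAt_slice_fst hL

theorem fderiv_fst_const_eq_zero [NormedAddCommGroup P] [NormedSpace ℝ P] {V : Type*}
    [NormedAddCommGroup V] [NormedSpace ℝ V] {u : ℝ × P → V} {v : V} {x : ℝ}
    (h : ∀ p, u (x, p) = v) {p : P} {L : ℝ × P →L[ℝ] V} (hL : HasFDerivAt u L (x, p)) (Y : P) :
    L (0, Y) = 0 := by
  have h1 := hL.comp p (hasFDerivAt_prodMk_right (𝕜 := ℝ) x p)
  have h2 : (u ∘ fun p => (x, p)) = fun _ => v := funext h
  rw [h2] at h1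
  simpa using (DFunLike.congr_fun (h1.unique (hasFDerivAt_const v p)) Y)

theorem rd_fst_const_eq_zero [NormedAddCommGroup P] [NormedSpace ℝ P] {u : ℝ × P → G} {g : G}
    {x : ℝ} (h : ∀ p, u (x, p) = g) {p : P}
    (hu : ContMDiffAt 𝓘(ℝ, ℝ × P) 𝓘(ℝ, EG) ∞ u (x, p)) (Y : P) :
    rd EG u (x, p) (0, Y) = 0 := by
  have h1 := rd_comp (EG := EG) (c := fun p => (x, p)) hu (hasFDerivAt_prodMk_right (𝕜 := ℝ) x p)
  have h2 : (fun p => u (x, p)) = fun _ => g := funext h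
  rw [h2, rd_const] at h1
  simpa using (DFunLike.congr_fun h1 Y).symm

/-! ### The doublet in the gauge parallel along the first variable. -/

section Gauge

variable {P : Type} [NormedAddCommGroup P] [NormedSpace ℝ P] [CompleteSpace P]
  {a : DForm (ℝ × P) (ℝ × P) 1 EG} {B : DForm (ℝ × P) (ℝ × P) 2 EH} {k : ℝ × P → G}

/-- The gauge-transformed 1-form is `-ṫ` of the primitive of the transported 2-form. -/
theorem Ad_inv_gauge_eq (h : IsConnectionDoublet C a B) (hk : ContMDiff 𝓘(ℝ, ℝ × P) 𝓘(ℝ, EG) ∞ k)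
    (hk1 : ∀ p, k (1, p) = 1) (hkx : ∀ z, rd EG k z (1, 0) = -oneForm a z (1, 0))
    (ha1 : ∀ p, oneForm a (1, p) = 0) {Y : P} {β : ℝ × P → EH} (hβ : ContDiff ℝ ∞ β)
    (hβ1 : ∀ p, β (1, p) = 0)
    (hβx : ∀ z, fderiv ℝ β z (1, 0) = -C.mDot (k z)⁻¹ (twoForm B z (1, 0) (0, Y))) (z : ℝ × P) :
    Ad EG (k z)⁻¹ (oneForm a z (0, Y) + rd EG k z (0, Y)) = -C.tDot (β z) := by
  obtain ⟨x, p⟩ := z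
  rw [← add_eq_zero_iff_eq_neg]
  refine eq_const_of_fderiv_fst (u := fun z => Ad EG (k z)⁻¹ (oneForm a z (0, Y) +
    rd EG k z (0, Y)) + C.tDot (β z)) (x₀ := 1) (fun x => ?_) ?_ x
  -- The derivative along x of the gauge transform is `Ad(k⁻¹)` of the curvature, that is `ṫ` of the
  -- transported 2-form. It cancels against the derivative of `ṫ(β)`; at `x = 1` everything
  -- vanishes.
  · obtain ⟨L, hL, hLX⟩ := hasFDerivAt_Ad_inv_gauge (contDiff_oneForm h.smooth_one) hk (X := (1, 0))
      (Y := (0, Y)) hkx (x, p)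
    have h2 := C.tDot.hasFDerivAt.comp (x, p)
      (hβ.contDiffAt.differentiableAt (x := (x, p)) (by simp)).hasFDerivAt
    refine ⟨_, hL.add h2, ?_⟩
    rw [add_apply, hLX, h.fderiv_oneForm, ContinuousLinearMap.comp_apply, hβx, map_neg,
      C.tDot_mDot, add_neg_cancel]
  · simp only [ha1, rd_fst_const_eq_zero hk1 (hk.contMDiffAt), hβ1]
    simp

/-- The curvature of the primitives of the transported 2-form. -/
theorem twoForm_gauge_eq (h : IsConnectionDoublet C a B)
    (hk : ContMDiff 𝓘(ℝ, ℝ × P) 𝓘(ℝ, EG) ∞ k)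
    (hk1 : ∀ p, k (1, p) = 1) (hkx : ∀ z, rd EG k z (1, 0) = -oneForm a z (1, 0))
    (ha1 : ∀ p, oneForm a (1, p) = 0) (hB1 : ∀ p, twoForm B (1, p) = 0) {Y Z : P}
    {β ζ : ℝ × P → EH} (hβ : ContDiff ℝ ∞ β) (hβ1 : ∀ p, β (1, p) = 0)
    (hβx : ∀ z, fderiv ℝ β z (1, 0) = -C.mDot (k z)⁻¹ (twoForm B z (1, 0) (0, Y)))
    (hζ : ContDiff ℝ ∞ ζ) (hζ1 : ∀ p, ζ (1, p) = 0)
    (hζx : ∀ z, fderiv ℝ ζ z (1, 0) = -C.mDot (k z)⁻¹ (twoForm B z (1, 0) (0, Z)))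
    (hH : ∀ z, threeCurv C a B z (1, 0) (0, Y) (0, Z) = 0) (z : ℝ × P) :
    C.mDot (k z)⁻¹ (twoForm B z (0, Y) (0, Z)) =
      fderiv ℝ β z (0, Z) - fderiv ℝ ζ z (0, Y) + ad EH H (β z) (ζ z) := by
  have hgY := Ad_inv_gauge_eq h hk hk1 hkx ha1 hβ hβ1 hβx
  have hgZ := Ad_inv_gauge_eq h hk hk1 hkx ha1 hζ hζ1 hζx
  have hB := contDiff_twoForm h.smooth_two
  have hBd : ∀ z u v, HasFDerivAt (fun z => twoForm B z u v)
      ((ContinuousLinearMap.apply ℝ EH v ∘L ContinuousLinearMap.apply ℝ _ u) ∘L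
        fderiv ℝ (twoForm B) z) z := by
    intro z u v
    let Λ : ((ℝ × P) →L[ℝ] (ℝ × P) →L[ℝ] EH) →L[ℝ] EH :=
      ContinuousLinearMap.apply ℝ EH v ∘L ContinuousLinearMap.apply ℝ _ u
    exact Λ.hasFDerivAt.comp z (hB.contDiffAt.differentiableAt (x := z) (by simp)).hasFDerivAt
  -- Mixed second derivatives commute, so the known x-derivative `-c` of a primitive determines the
  -- x-derivative of its derivative along `V`.
  have hsym : ∀ {b : ℝ × P → EH}, ContDiff ℝ ∞ b → ∀ {V : ℝ × P}, ∀ z,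
      ∃ L : ℝ × P →L[ℝ] EH, HasFDerivAt (fun z => fderiv ℝ b z V) L z ∧
      ∀ {c : ℝ × P → EH}, (∀ z, fderiv ℝ b z (1, 0) = -c z) → ∀ c' : ℝ × P →L[ℝ] EH,
        HasFDerivAt c c' z → L (1, 0) = -c' V := by
    intro b hb V z
    have h1 := ((hb.fderiv_right (m := ∞) (by simp)).contDiffAt.differentiableAt (x := z)
      (by simp)).hasFDerivAt
    refine ⟨_, h1.clm_apply (hasFDerivAt_const V z), fun {c} hc c' hc' => ?_⟩
    have h2 := h1.clm_apply (hasFDerivAt_const ((1, 0) : ℝ × P) z)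
    have h3 : (fun z => fderiv ℝ b z (1, 0)) = fun z => -c z := funext hc
    rw [h3] at h2
    have h4 := DFunLike.congr_fun (h2.unique hc'.neg) V
    have h5 := (hb.contDiffAt (x := z)).isSymmSndFDerivAt
      (by simp only [minSmoothness_of_isRCLikeNormedField]; exact ENat.LEInfty.out)
    have h6 := h5.eq (1, 0) V
    simp only [add_apply, ContinuousLinearMap.comp_apply, ContinuousLinearMap.flip_apply,
      zero_apply, map_zero, zero_add, neg_apply] at h4 ⊢
    rw [h6, h4]
  obtain ⟨x, p⟩ := z
  -- The difference of the two sides vanishes at `x = 1`, and its derivative along x turns out to be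
  -- `ṁ(k⁻¹)` of the 3-curvature.
  rw [← sub_eq_zero]
  refine eq_const_of_fderiv_fst (u := fun z => C.mDot (k z)⁻¹ (twoForm B z (0, Y) (0, Z)) -
      (fderiv ℝ β z (0, Z) - fderiv ℝ ζ z (0, Y) + ad EH H (β z) (ζ z))) (x₀ := 1) (fun x => ?_) ?_ x
  · obtain ⟨L₁, h1, e1⟩ := hasFDerivAt_mDot_inv_gauge (C := C) hk (hBd (x, p) (0, Y) (0, Z))
    obtain ⟨L₂, h2, e2⟩ := hasFDerivAt_mDot_inv_gauge (C := C) hk (hBd (x, p) (1, 0) (0, Y))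
    obtain ⟨L₃, h3, e3⟩ := hasFDerivAt_mDot_inv_gauge (C := C) hk (hBd (x, p) (1, 0) (0, Z))
    obtain ⟨L₄, h4, e4⟩ := hsym hβ (V := (0, Z)) (x, p)
    obtain ⟨L₅, h5, e5⟩ := hsym hζ (V := (0, Y)) (x, p)
    have hβd := (hβ.contDiffAt.differentiableAt (x := (x, p)) (by simp)).hasFDerivAt
    have hζd := (hζ.contDiffAt.differentiableAt (x := (x, p)) (by simp)).hasFDerivAt
    have h6 := ((ad EH H).hasFDerivAt.comp (x, p) hβd).clm_apply hζd
    refine ⟨_, h1.sub ((h4.sub h5).add h6), ?_⟩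
    have hx0 : Ad EG (k (x, p))⁻¹ (oneForm a (x, p) (1, 0) + rd EG k (x, p) (1, 0)) =
        -C.tDot 0 := by rw [hkx]; simp
    have hH' := hH (x, p)
    simp only [sub_apply, add_apply, ContinuousLinearMap.comp_apply,
      ContinuousLinearMap.flip_apply]
    rw [e1 (1, 0) _ 0 hx0, e4 hβx _ h2, e5 hζx _ h3, e2 _ _ _ (hgZ _), e3 _ _ _ (hgY _), hβx, hζx,
      ad_skew (-C.mDot (k (x, p))⁻¹ _) (ζ (x, p))]
    unfold threeCurv at hH'
    have h7 := congrArg (C.mDot (k (x, p))⁻¹) hH'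
    rw [map_add, map_sub, map_zero] at h7
    simp only [ContinuousLinearMap.comp_apply, ContinuousLinearMap.apply_apply, map_neg,
      map_zero, zero_apply, Function.comp] at h7 ⊢
    refine Eq.trans ?_ h7
    abel
  · simp only [hB1, hβ1, fderiv_fst_const_eq_zero hβ1
        (hβ.contDiffAt.differentiableAt (x := (1, p)) (by simp)).hasFDerivAt,
      fderiv_fst_const_eq_zero hζ1
        (hζ.contDiffAt.differentiableAt (x := (1, p)) (by simp)).hasFDerivAt]
    simp

end Gauge

/-- If `∂ᵧV V⁻¹ = β` and `∂_zβ - ∂ᵧζ + [β, ζ] = 0` then `∂_zV V⁻¹ = ζ`, provided this holds at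
`y = 0`. -/
theorem rd_eq_of_flat {V : ℝ × ℝ → H} (hV : ContMDiff 𝓘(ℝ, ℝ × ℝ) 𝓘(ℝ, EH) ∞ V)
    {β ζ : ℝ × ℝ → EH} (hV1 : ∀ z, rd EH V z (1, 0) = β z) (hβ : ContDiff ℝ ∞ β)
    (hζ : ContDiff ℝ ∞ ζ)
    (hf : ∀ z, fderiv ℝ β z (0, 1) - fderiv ℝ ζ z (1, 0) + ad EH H (β z) (ζ z) = 0)
    (h0 : ∀ z, rd EH V (0, z) (0, 1) = ζ (0, z)) (z : ℝ × ℝ) : rd EH V z (0, 1) = ζ z := by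
  have hr : ContDiff ℝ ∞ (rd EH V) := contDiff_iff_contDiffAt.2 fun z =>
    contDiffAt_rd (Eventually.of_forall fun w => hV w)
  -- The defect `∂_z V V⁻¹ - ζ` satisfies a linear equation in y by the Maurer-Cartan equation and
  -- the flatness hypothesis; the factor `Ad(V⁻¹)` makes it constant in y.
  have key : ∀ y z, Ad EH (V (y, z))⁻¹ (rd EH V (y, z) (0, 1) - ζ (y, z)) = 0 := by
    intro y z
    refine eq_const_of_fderiv_fst (u := fun z => Ad EH (V z)⁻¹ (rd EH V z (0, 1) - ζ z)) (x₀ := 0)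
      (fun y => ?_) (by simp [h0]) y
    have hr' := (hr.contDiffAt.differentiableAt (x := (y, z)) (by simp)).hasFDerivAt
    have hζ' := (hζ.contDiffAt.differentiableAt (x := (y, z)) (by simp)).hasFDerivAt
    have hβ' := (hβ.contDiffAt.differentiableAt (x := (y, z)) (by simp)).hasFDerivAt
    obtain ⟨L, hL, hL1⟩ := hasFDerivAt_mDot_inv_gauge (C := conjModule EH H) hV
      ((hr'.clm_apply (hasFDerivAt_const (0, 1) (y, z))).sub hζ')
    refine ⟨L, hL, ?_⟩
    rw [hL1 (1, 0) (-rd EH V (y, z) (1, 0)) 0 (by simp)]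
    have hmc := fderiv_rd_sub (z := (y, z)) (Eventually.of_forall fun w => hV w) (1, 0) (0, 1)
    have e1 : fderiv ℝ (rd EH V) (y, z) (0, 1) (1, 0) = fderiv ℝ β (y, z) (0, 1) := by
      have h2 := hr'.clm_apply (hasFDerivAt_const ((1, 0) : ℝ × ℝ) (y, z))
      have h3 : (fun w => rd EH V w (1, 0)) = β := funext hV1
      rw [h3] at h2
      have := DFunLike.congr_fun (h2.unique hβ') (0, 1)
      simpa using this
    have hact : ∀ v w, (conjModule EH H).act v w = ad EH H v w := fun _ _ => rfl
    rw [e1, hV1] at hmc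
    have hf' := hf (y, z)
    simp only [map_zero, zero_apply, zero_add, sub_apply, add_apply,
      ContinuousLinearMap.comp_apply, ContinuousLinearMap.flip_apply, hact, hV1, map_neg, neg_apply, Pi.sub_apply]
    rw [sub_eq_iff_eq_add.1 hmc, map_sub, eq_neg_of_add_eq_zero_right hf']
    rw [← map_zero ((conjModule EH H).mDot (V (y, z))⁻¹)]
    congr 1
    abel
  have h2 := congrArg (Ad EH (V z)) (key z.1 z.2)
  rw [Ad_Ad_inv, map_zero] at h2
  exact sub_eq_zero.1 h2

end Flat

end TwoTransport

namespace TwoTransport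

/-! ### Invariance of the transport under thin homotopy. -/

section Thin

variable {EG G EH H E M : Type*}
  [NormedAddCommGroup EG] [NormedSpace ℝ EG] [FiniteDimensional ℝ EG]
  [TopologicalSpace G] [ChartedSpace EG G] [Group G] [LieGroup 𝓘(ℝ, EG) ∞ G]
  [NormedAddCommGroup EH] [NormedSpace ℝ EH] [FiniteDimensional ℝ EH]
  [TopologicalSpace H] [ChartedSpace EH H] [Group H] [LieGroup 𝓘(ℝ, EH) ∞ H]
  [NormedAddCommGroup E] [NormedSpace ℝ E]
  [TopologicalSpace M] [ChartedSpace E M] [IsManifold 𝓘(ℝ, E) ∞ M]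
  {C : LieCrossedModule EG G EH H} {θ : DForm E M 1 EG} {Υ : DForm E M 2 EH}
  {p q : M} {γ₀ γ₁ γ₂ γ₃ : Curve E p q}

theorem tdiff_eq_zero_of_eventually_const {N : Type*} [NormedAddCommGroup N] [NormedSpace ℝ N]
    {F : N → M} {z : N} {m : M} (h : F =ᶠ[𝓝 z] fun _ => m) : tdiff E F z = 0 :=
  (h.mfderiv_eq (I := 𝓘(ℝ, N)) (I' := 𝓘(ℝ, E))).trans mfderiv_const

/-- The 2-transport along a surface of rank at most one is trivial. -/
theorem transport₂_of_rank_le_one (h : IsConnectionDoublet C θ Υ) (S : Surface γ₀ γ₁)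
    (hS : ∀ z, RankLE E S.toFun 1 z) : transport₂ C θ Υ S = 1 := by
  have hs := planeCocycle_solves h S.smooth
  refine eq_of_hasDerivAt_rlogDeriv (EH := EH) ordConnected_univ isOpen_univ ordConnected_univ
    isOpen_univ (W := fun s r => (planeCocycle C θ Υ S.toFun).W s 1 r 0) (W' := fun _ _ => 1)
    (d := fun _ _ => 0) (fun s _ r _ => hs.contMDiffAt_W _ _ _ _) (fun s _ r _ => contMDiffAt_const)
    (fun s _ r _ => ?_) (fun s _ r _ => ?_) (mem_univ 1) (mem_univ 0) (fun r _ => ?_)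
    (fun s _ => hs.W_init_y _ _ _) 0 trivial 1 trivial
  · have h1 := hs.hasDerivAt_rlogDeriv_W 1 0 s r
    rwa [twoForm_pullback_eq_zero_of_rank Υ (hS _), map_zero, neg_zero] at h1
  · simp only [rlogDeriv_one]
    exact hasDerivAt_const _ _
  · rw [hs.rlogDeriv_W_self, rlogDeriv_one]

theorem ThinHomotopic₁.exists_surface (h : ThinHomotopic₁ γ₀ γ₁) :
    ∃ S : Surface γ₀ γ₁, ∀ z, RankLE E S.toFun 1 z := by
  obtain ⟨h, hs, hsit, hr⟩ := h
  exact ⟨⟨h, hs, hsit⟩, fun z => rankLE_one.2 (hr z)⟩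

theorem Surface.thinHomotopic₁ (S : Surface γ₀ γ₁) (hS : ∀ z, RankLE E S.toFun 1 z) :
    ThinHomotopic₁ γ₀ γ₁ :=
  ⟨S.toFun, S.smooth, S.sitting, fun z => rankLE_one.1 (hS z)⟩

/-- A thin homotopy is itself a surface, and its 2-transport is trivial because the pulled-back
2-form vanishes; the target relation then gives equality. -/
theorem transport₁_thin (hθ : IsConnectionDoublet C θ Υ) (h : ThinHomotopic₁ γ₀ γ₁) :
    transport₁ C θ Υ γ₀ = transport₁ C θ Υ γ₁ := by
  obtain ⟨S, hS⟩ := h.exists_surface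
  rw [transport₁_target hθ S, transport₂_of_rank_le_one hθ S hS, map_one, one_mul]

/-- The 2-transport along a slice of a map of three variables. -/
theorem transport₂_slice (hθ : IsConnectionDoublet C θ Υ) {K : ℝ × ℝ × ℝ → M}
    (hK : ContMDiff 𝓘(ℝ, ℝ × ℝ × ℝ) 𝓘(ℝ, E) ∞ K) {k : ℝ × ℝ × ℝ → G}
    (hk : ContMDiff 𝓘(ℝ, ℝ × ℝ × ℝ) 𝓘(ℝ, EG) ∞ k) (hk1 : ∀ p, k (1, p) = 1)
    (hkx : ∀ z, rd EG k z (1, 0) = -oneForm (pullback K θ) z (1, 0)) {β : ℝ × ℝ × ℝ → EH}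
    (hβ : ContDiff ℝ ∞ β) (hβ1 : ∀ p, β (1, p) = 0)
    (hβx : ∀ z, fderiv ℝ β z (1, 0) = -C.mDot (k z)⁻¹ (twoForm (pullback K Υ) z (1, 0) (0, 1, 0)))
    {V : ℝ × ℝ → H} (hV : ContMDiff 𝓘(ℝ, ℝ × ℝ) 𝓘(ℝ, EH) ∞ V) (hV0 : ∀ z, V (0, z) = 1)
    (hVy : ∀ w, rd EH V w (1, 0) = β (0, w)) (S : Surface γ₀ γ₁) {c : ℝ}
    (hS : ∀ x y, K (x, y, c) = S.toFun (x, y)) : transport₂ C θ Υ S = V (1, c) := by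
  have hs := planeCocycle_solves hθ S.smooth
  have hP : ∀ z : ℝ × ℝ, HasFDerivAt (fun z : ℝ × ℝ => (z.1, z.2, c))
      ((ContinuousLinearMap.fst ℝ ℝ ℝ).prod ((ContinuousLinearMap.snd ℝ ℝ ℝ).prod 0)) z := fun z =>
    HasFDerivAt.prodMk (f₁ := Prod.fst) hasFDerivAt_fst
      (HasFDerivAt.prodMk (f₁ := Prod.snd) hasFDerivAt_snd (hasFDerivAt_const c z))
  have hE : ∀ z : ℝ × ℝ, S.toFun =ᶠ[𝓝 z] fun w => K (w.1, w.2, c) := fun z =>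
    Eventually.of_forall fun w => (hS w.1 w.2).symm
  have hkx' : ∀ x w, rlogDeriv (EG := EG) (fun s => k (s, w)) x = rd EG k (x, w) (1, 0) := by
    intro x w
    rw [rlogDeriv_eq_rd, rd_comp (c := fun s => (s, w)) hk.contMDiffAt
      ((hasDerivAt_id x).prodMk (hasDerivAt_const x w)).hasFDerivAt]
    simp
  have hf : ∀ x y, (planeCocycle C θ Υ S.toFun).f x 1 y = k (x, y, c) := by
    intro x y
    refine eqOn_of_rlogDeriv_eq (EG := EG) isPreconnected_univ isOpen_univ
      (u := fun s => (planeCocycle C θ Υ S.toFun).f s 1 y) (v := fun s => k (s, y, c))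
      (fun t _ => (hs.smooth.contMDiff_f contDiff_id contDiff_const contDiff_const).contMDiffAt)
      (fun t _ => contMDiffAt_slice (hk.contMDiffAt (x := (t, y, c)))) (fun t _ => ?_)
      (mem_univ 1) (by rw [hs.f_init, hk1]) x trivial
    rw [hs.rlogDeriv_f, hkx', hkx, oneForm_pullback_comp (hE _) hK (hP _)]
    simp
    rfl
  have hβ' : ∀ x y, HasDerivAt (fun s => β (s, y, c)) (-C.mDot (k (x, y, c))⁻¹
      (twoForm (pullback K Υ) (x, y, c) (1, 0) (0, 1, 0))) x := by
    intro x y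
    rw [← hβx]
    exact hasDerivAt_slice_fst (hβ.contDiffAt.differentiableAt (by simp)).hasFDerivAt
  -- On the edge `x = 1` the factor `g` is trivial, so the equation for `W` involves only `f = k`
  -- and is the one that defines `β`.
  have hW : ∀ x y, rlogDeriv (EG := EH) (fun r => (planeCocycle C θ Υ S.toFun).W x 1 r 0) y =
      β (x, y, c) := by
    intro x y
    refine eq_of_hasDerivAt_eq ordConnected_univ isOpen_univ
      (u := fun x => rlogDeriv (EG := EH) (fun r => (planeCocycle C θ Υ S.toFun).W x 1 r 0) y)
      (fun s _ => hs.hasDerivAt_rlogDeriv_W 1 0 s y) (v := fun x => β (x, y, c)) (fun s _ => ?_)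
      (mem_univ 1) (by rw [hs.rlogDeriv_W_self, hβ1]) x trivial
    refine (hβ' s y).congr_deriv ?_
    rw [surface_g_one hθ, hf, inv_one, one_mul, twoForm_pullback_comp (hE _) hK (hP _)]
    simp
    rfl
  refine eqOn_of_rlogDeriv_eq (EG := EH) isPreconnected_univ isOpen_univ
    (u := fun r => (planeCocycle C θ Υ S.toFun).W 0 1 r 0) (v := fun r => V (r, c))
    (fun t _ => hs.contMDiffAt_W _ _ _ _) (fun t _ => contMDiffAt_slice hV.contMDiffAt)
    (fun t _ => ?_) (mem_univ 0) (by rw [hs.W_init_y, hV0]) 1 trivial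
  rw [hW, rlogDeriv_slice_fst hV.contMDiffAt, hVy]

/-- The 2-transport is invariant under thin homotopy. -/
theorem transport₂_thin (hθ : IsConnectionDoublet C θ Υ) {S₀ : Surface γ₀ γ₁}
    {S₁ : Surface γ₂ γ₃} (h : ThinHomotopic₂ S₀ S₁) :
    transport₂ C θ Υ S₀ = transport₂ C θ Υ S₁ := by
  obtain ⟨K, hK, ⟨ε, hε, hε', h0, h1, h2, h3, h4, h5⟩, hr0, hr1, hr⟩ := h
  have : CompleteSpace EH := FiniteDimensional.complete ℝ EH
  have hd := hθ.pullback hK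
  have hA := contDiff_oneForm hd.smooth_one
  have hB := contDiff_twoForm hd.smooth_two
  obtain ⟨k, hk, hk1, hkx⟩ := exists_transport_fst (G := G) hA
  have hm : ∀ Y : ℝ × ℝ, ContDiff ℝ ∞ (fun z => -C.mDot (k z)⁻¹
      (twoForm (pullback K Υ : DForm (ℝ × ℝ × ℝ) (ℝ × ℝ × ℝ) 2 EH) z (1, 0) (0, Y))) := fun Y =>
    ((contDiff_iff_contDiffAt.2 fun z => C.contDiffAt_mDot (hk.contMDiffAt).inv).clm_apply
      ((hB.clm_apply contDiff_const).clm_apply contDiff_const)).neg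
  obtain ⟨β, hβ, hβ1, hβx⟩ := exists_primitive_fst (hm (1, 0))
  obtain ⟨ζ, hζ, hζ1, hζx⟩ := exists_primitive_fst (hm (0, 1))
  have ht0 : ∀ w, tdiff E K (0, w) = 0 := fun w => tdiff_eq_zero_of_eventually_const (m := p) (by
    filter_upwards [continuousAt_fst.eventually_lt continuousAt_const (show (0, w).1 < ε from hε)]
      with z hz
    exact h0 _ _ _ hz)
  have ht1 : ∀ w, tdiff E K (1, w) = 0 := fun w => tdiff_eq_zero_of_eventually_const (m := q) (by
    filter_upwards [continuousAt_const.eventually_lt continuousAt_fst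
      (show 1 - ε < (1, w).1 by simp [hε])] with z hz
    exact h1 _ _ _ hz)
  have ha1 : ∀ w, oneForm (pullback K θ : DForm (ℝ × ℝ × ℝ) (ℝ × ℝ × ℝ) 1 EG) (1, w) = 0 :=
    fun w => ContinuousLinearMap.ext fun v => oneForm_pullback_eq_zero θ (by rw [ht1]; rfl)
  have hB1 : ∀ w, twoForm (pullback K Υ : DForm (ℝ × ℝ × ℝ) (ℝ × ℝ × ℝ) 2 EH) (1, w) = 0 :=
    fun w => ContinuousLinearMap.ext fun v => ContinuousLinearMap.ext fun v' =>
      twoForm_pullback_eq_zero Υ (by rw [ht1]; rfl) v'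
  have hcurv := twoForm_gauge_eq hd hk hk1 hkx ha1 hB1 hβ hβ1 hβx hζ hζ1 hζx
    (fun z => threeCurv_pullback_eq_zero hK hθ.smooth_two (rankLE_two.2 (hr z)) _ _ _)
  -- Along a line on which the rank is at most one the integrand of `ζ` vanishes. This is applied on
  -- `y = 0` and `y = 1` only.
  have hζ0 : ∀ y z, (∀ x, RankLE E K 1 (x, y, z)) → ζ (0, y, z) = 0 := by
    intro y z hyz
    refine eq_const_of_fderiv_fst (fun x => ⟨_,
      (hζ.contDiffAt.differentiableAt (x := (x, y, z)) (by simp)).hasFDerivAt, ?_⟩) (hζ1 (y, z)) 0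
    rw [hζx, twoForm_pullback_eq_zero_of_rank Υ (hyz x), map_zero, neg_zero]
  obtain ⟨V, hV, hV0, hVy⟩ := exists_lieSolution H (α := fun w : ℝ × ℝ => β (0, w))
    (hβ.comp (contDiff_const.prodMk contDiff_id))
  have hVy' : ∀ w, rd EH V w (1, 0) = β (0, w) := by
    rintro ⟨y, z⟩
    rw [← rlogDeriv_slice_fst hV.contMDiffAt, hVy]
  have hsl : ∀ {b : ℝ × ℝ × ℝ → EH}, ContDiff ℝ ∞ b → ∀ w Y : ℝ × ℝ,
      fderiv ℝ (fun w => b (0, w)) w Y = fderiv ℝ b (0, w) (0, Y) := by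
    intro b hb w Y
    have e1 := (hb.contDiffAt.differentiableAt (x := (0, w)) (by simp)).hasFDerivAt.comp w
      (hasFDerivAt_prodMk_right (𝕜 := ℝ) (0 : ℝ) w)
    exact DFunLike.congr_fun e1.fderiv Y
  -- On the face `x = 0` the homotopy is locally constant, so the 2-form on the left of `hcurv` is
  -- zero there. At `y = 0` both `∂_z V V⁻¹` and `ζ` vanish.
  have hflat := rd_eq_of_flat (β := fun w => β (0, w)) (ζ := fun w => ζ (0, w)) hV hVy'
    (hβ.comp (contDiff_const.prodMk contDiff_id)) (hζ.comp (contDiff_const.prodMk contDiff_id))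
    (fun w => by
      rw [hsl hβ, hsl hζ, ← hcurv, twoForm_pullback_eq_zero Υ (by rw [ht0]; rfl), map_zero])
    (fun z => by
      rw [rd_fst_const_eq_zero hV0 hV.contMDiffAt, hζ0 0 z fun x => rankLE_one.2 (hr0 x z)])
  have hV1 : V (1, 0) = V (1, 1) := by
    refine eqOn_of_rlogDeriv_eq (EG := EH) isPreconnected_univ isOpen_univ (u := fun z => V (1, z))
      (v := fun _ => V (1, 1)) (fun t _ => contMDiffAt_slice_right hV.contMDiffAt)
      (fun t _ => contMDiffAt_const) (fun t _ => ?_) (mem_univ 1) rfl 0 trivial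
    rw [rlogDeriv_slice_snd hV.contMDiffAt, hflat, hζ0 1 t fun x => rankLE_one.2 (hr1 x t),
      rlogDeriv_eq_rd, rd_const]
    rfl
  rw [transport₂_slice hθ hK hk hk1 hkx hβ hβ1 hβx hV hV0 hVy' S₀ (c := 0) (fun x y => h4 x y 0 hε),
    transport₂_slice hθ hK hk hk1 hkx hβ hβ1 hβx hV hV0 hVy' S₁ (c := 1)
      (fun x y => h5 x y 1 (by linarith)), hV1]

end Thin

end TwoTransport

namespace TwoTransport

/-! ### Rank bounds under composition and gluing. -/

section RankTools

variable {N N' E M : Type*} [NormedAddCommGroup N] [NormedSpace ℝ N]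
  [NormedAddCommGroup N'] [NormedSpace ℝ N'] [NormedAddCommGroup E] [NormedSpace ℝ E]
  [TopologicalSpace M] [ChartedSpace E M]

theorem tdiff_congr {F F' : N → M} {z : N} (h : F =ᶠ[𝓝 z] F') : tdiff E F z = tdiff E F' z :=
  h.mfderiv_eq (I := 𝓘(ℝ, N)) (I' := 𝓘(ℝ, E))

theorem RankLE.congr {F F' : N → M} {z : N} {n : ℕ} (h : F =ᶠ[𝓝 z] F') (hF : RankLE E F' n z) :
    RankLE E F n z := by
  unfold RankLE
  rwa [tdiff_congr h]

theorem tdiff_comp {F : N' → M} {P : N → N'} {z : N} (hF : ContMDiff 𝓘(ℝ, N') 𝓘(ℝ, E) ∞ F)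
    (hP : DifferentiableAt ℝ P z) :
    tdiff E (fun w => F (P w)) z = tdiff E F (P z) ∘L fderiv ℝ P z := by
  have h := mfderiv_comp z (hF.contMDiffAt.mdifferentiableAt (x := P z) (by simp))
    hP.mdifferentiableAt
  rw [mfderiv_eq_fderiv] at h
  exact h

theorem RankLE.comp {F : N' → M} {P : N → N'} {z : N} {n : ℕ} (h : RankLE E F n (P z))
    (hF : ContMDiff 𝓘(ℝ, N') 𝓘(ℝ, E) ∞ F) (hP : DifferentiableAt ℝ P z) :
    RankLE E (fun w => F (P w)) n z := by
  unfold RankLE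
  rw [tdiff_comp hF hP]
  exact (LinearMap.rank_comp_le_left _ _).trans h

theorem rankLE_of_finrank [FiniteDimensional ℝ N] (F : N → M) {n : ℕ}
    (hn : Module.finrank ℝ N ≤ n) (z : N) : RankLE E F n z := by
  have h := LinearMap.finrank_range_le (tdiff E F z).toLinearMap
  unfold RankLE LinearMap.rank
  rw [← Module.finrank_eq_rank]
  exact_mod_cast h.trans hn

theorem rankLE_plane (F : ℝ × ℝ → M) (z : ℝ × ℝ) : RankLE E F 2 z :=
  rankLE_of_finrank F (by simp) z

theorem rankLE_line (F : ℝ → M) (z : ℝ) : RankLE E F 1 z := rankLE_of_finrank F (by simp) z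

/-- A glued map coincides near each point with one of the two maps. -/
theorem glue_eventuallyEq {f g : N → M} {φ : N → ℝ} (hφ : Continuous φ) {c δ : ℝ} (hδ : 0 < δ)
    (h : ∀ n, |φ n - c| < δ → f n = g n) (n : N) :
    (fun n => if φ n ≤ c then f n else g n) =ᶠ[𝓝 n] f ∨
      (fun n => if φ n ≤ c then f n else g n) =ᶠ[𝓝 n] g := by
  rcases le_or_gt (φ n) c with hn | hn
  · left
    filter_upwards [hφ.continuousAt.eventually_lt (x₀ := n) continuousAt_const
      (show φ n < c + δ by linarith)] with z hz
    split_ifs with hc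
    · rfl
    · exact (h z (by rw [abs_lt]; constructor <;> linarith)).symm
  · right
    filter_upwards [continuousAt_const.eventually_lt hφ.continuousAt hn] with z hz
    rw [if_neg (not_le.2 hz)]

theorem RankLE.glue {f g : N → M} {φ : N → ℝ} (hφ : Continuous φ) {c δ : ℝ} (hδ : 0 < δ)
    (h : ∀ n, |φ n - c| < δ → f n = g n) {k : ℕ} (hf : ∀ n, RankLE E f k n)
    (hg : ∀ n, RankLE E g k n) (n : N) : RankLE E (fun n => if φ n ≤ c then f n else g n) k n := by
  rcases glue_eventuallyEq hφ hδ h n with h1 | h1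
  · exact (hf n).congr h1
  · exact (hg n).congr h1

end RankTools

/-! ### Concatenation and smooth reparametrizations of the line. -/

section Cat

/-- Concatenation of two maps of a real variable. -/
noncomputable def cat {X : Type*} (a b : ℝ → X) (t : ℝ) : X :=
  if t ≤ 1 / 2 then a (2 * t) else b (2 * t - 1)

variable {X : Type*} {a b c : ℝ → X}

theorem cat_left {t : ℝ} (h : t ≤ 1 / 2) : cat a b t = a (2 * t) := if_pos h

theorem cat_right {t : ℝ} (h : 1 / 2 < t) : cat a b t = b (2 * t - 1) := if_neg (not_le.2 h)

theorem cat_right' {ε t : ℝ} {u : X} (ha : ∀ t, 1 - ε < t → a t = u) (hb : ∀ t, t < ε → b t = u)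
    (h : 1 / 2 - ε / 2 < t) (hε : 0 < ε) : cat a b t = b (2 * t - 1) := by
  rcases le_or_gt t (1 / 2) with h1 | h1
  · rw [cat_left h1, ha _ (by linarith), hb _ (by linarith)]
  · exact cat_right h1

/-- A smooth approximation of `t ↦ max t 0`. -/
noncomputable def hinge (δ t : ℝ) : ℝ := t * Real.smoothTransition (t / δ)

theorem contDiff_hinge (δ : ℝ) : ContDiff ℝ ∞ (hinge δ) :=
  contDiff_id.mul (Real.smoothTransition.contDiff.comp (contDiff_id.div_const δ))

theorem hinge_of_nonpos {δ t : ℝ} (hδ : 0 < δ) (h : t ≤ 0) : hinge δ t = 0 := by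
  rw [hinge, Real.smoothTransition.zero_of_nonpos (div_nonpos_of_nonpos_of_nonneg h hδ.le),
    mul_zero]

theorem hinge_of_le {δ t : ℝ} (hδ : 0 < δ) (h : δ ≤ t) : hinge δ t = t := by
  rw [hinge, Real.smoothTransition.one_of_one_le ((one_le_div hδ).2 h), mul_one]

theorem hinge_nonneg {δ t : ℝ} (hδ : 0 < δ) : 0 ≤ hinge δ t := by
  rcases le_or_gt t 0 with h | h
  · rw [hinge_of_nonpos hδ h]
  · exact mul_nonneg h.le (Real.smoothTransition.nonneg _)

theorem hinge_le {δ t : ℝ} (h : 0 ≤ t) : hinge δ t ≤ t :=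
  mul_le_of_le_one_right h (Real.smoothTransition.le_one _)

/-- The smoothed tent map. -/
noncomputable def tent (δ t : ℝ) : ℝ := 2 * t - 4 * hinge δ (t - 1 / 2)

theorem contDiff_tent (δ : ℝ) : ContDiff ℝ ∞ (tent δ) :=
  (contDiff_const.mul contDiff_id).sub
    (contDiff_const.mul ((contDiff_hinge δ).comp (contDiff_id.sub contDiff_const)))

/-- The smoothed tent differs from the exact one only for `t - 1/2` between 0 and `ε / 4`; there it
stays above `1 - ε`, where `a` already has its final value. -/
theorem cat_reverse {ε : ℝ} (hε : 0 < ε) {u : X} (ha : ∀ t, 1 - ε < t → a t = u) (t : ℝ) :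
    cat a (fun t => a (1 - t)) t = a (tent (ε / 4) t) := by
  unfold tent
  rcases le_or_gt t (1 / 2) with h | h
  · rw [cat_left h, hinge_of_nonpos (by positivity) (by linarith)]
    ring_nf
  · rw [cat_right h]
    rcases le_or_gt (ε / 4) (t - 1 / 2) with h2 | h2
    · rw [hinge_of_le (by positivity) h2]
      ring_nf
    · have := hinge_le (δ := ε / 4) (show 0 ≤ t - 1 / 2 by linarith)
      rw [ha _ (by linarith), ha _ (by linarith)]

theorem tent_lt {ε t : ℝ} (hε : 0 < ε) (hε' : ε < 1 / 2) (h : t < ε / 2 ∨ 1 - ε / 2 < t) :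
    tent (ε / 4) t < ε := by
  unfold tent
  rcases h with h | h
  · have := hinge_nonneg (δ := ε / 4) (t := t - 1 / 2) (by positivity)
    linarith
  · rw [hinge_of_le (by positivity) (by linarith)]
    linarith

/-- The reparametrization that changes the bracketing of a triple concatenation. -/
noncomputable def rebracket (δ t : ℝ) : ℝ := 2 * t - hinge δ (t - 1 / 4) - 1 / 2 * hinge δ (t - 1 / 2)

theorem contDiff_rebracket (δ : ℝ) : ContDiff ℝ ∞ (rebracket δ) :=
  ((contDiff_const.mul contDiff_id).sub
    ((contDiff_hinge δ).comp (contDiff_id.sub contDiff_const))).sub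
    (contDiff_const.mul ((contDiff_hinge δ).comp (contDiff_id.sub contDiff_const)))

/-- Apart from the smoothing, `rebracket` has slopes 2, 1 and 1/2 on the three pieces and maps the
seams 1/4, 1/2 to 1/2, 3/4. The corners are smoothed over a length `ε / 8`, and there both sides
take the common value `u` or `v` of the adjacent pieces. -/
theorem cat_assoc {ε : ℝ} (hε : 0 < ε) (hε' : ε < 1 / 2) {u v : X} (ha : ∀ t, 1 - ε < t → a t = u)
    (hb : ∀ t, t < ε → b t = u) (hb' : ∀ t, 1 - ε < t → b t = v) (hc : ∀ t, t < ε → c t = v)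
    (t : ℝ) : cat (cat a b) c t = cat a (cat b c) (rebracket (ε / 8) t) := by
  have hδ : 0 < ε / 8 := by positivity
  have hbc : ∀ t, t < ε / 2 → cat b c t = u := fun t ht => by
    rw [cat_left (by linarith), hb _ (by linarith)]
  have key : ∀ s, cat a (cat b c) s = if s < 1 / 2 then a (2 * s) else
      if s < 3 / 4 then b (4 * s - 2) else c (4 * s - 3) := by
    intro s
    split_ifs with h1 h2
    · rw [cat_left h1.le]
    · rw [cat_right' (ε := ε / 2) (fun t ht => ha t (by linarith)) hbc (by linarith)
        (by linarith), cat_left (by linarith)]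
      ring_nf
    · rw [cat_right (by linarith), cat_right' hb' hc (by linarith) hε]
      ring_nf
  rw [key]
  unfold rebracket
  rcases le_or_gt t (1 / 4) with h1 | h1
  · rw [hinge_of_nonpos hδ (by linarith), hinge_of_nonpos hδ (by linarith),
      cat_left (by linarith), cat_left (by linarith)]
    split_ifs with h2 h3
    · ring_nf
    · rw [ha _ (by linarith), hb _ (by linarith)]
    · linarith
  rcases lt_or_ge (t - 1 / 4) (ε / 8) with h2 | h2
  · have e1 := hinge_le (δ := ε / 8) (show 0 ≤ t - 1 / 4 by linarith)
    have e2 := hinge_nonneg (t := t - 1 / 4) hδ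
    rw [hinge_of_nonpos (t := t - 1 / 2) hδ (by linarith), cat_left (by linarith),
      cat_right (by linarith), hb _ (by linarith)]
    split_ifs with h2 h3
    · rw [ha _ (by linarith)]
    · rw [hb _ (by linarith)]
    · linarith
  rw [hinge_of_le hδ h2]
  rcases le_or_gt t (1 / 2) with h3 | h3
  · rw [hinge_of_nonpos hδ (by linarith), cat_left h3, cat_right (by linarith), if_neg (by linarith)]
    split_ifs with h4
    · ring_nf
    · rw [hb' _ (by linarith), hc _ (by linarith)]
  rw [cat_right h3, if_neg (by
    have := hinge_le (δ := ε / 8) (show 0 ≤ t - 1 / 2 by linarith); linarith)]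
  rcases lt_or_ge (t - 1 / 2) (ε / 8) with h4 | h4
  · have e1 := hinge_le (δ := ε / 8) (show 0 ≤ t - 1 / 2 by linarith)
    have e2 := hinge_nonneg (t := t - 1 / 2) hδ
    rw [hc _ (by linarith)]
    split_ifs with h5
    · rw [hb' _ (by linarith)]
    · rw [hc _ (by linarith)]
  · rw [hinge_of_le hδ h4, if_neg (by linarith)]
    ring_nf

theorem rebracket_lt {ε t : ℝ} (hε : 0 < ε) (h : t < ε) : rebracket (ε / 8) t < 2 * ε := by
  have e1 := hinge_nonneg (t := t - 1 / 4) (show 0 < ε / 8 by positivity)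
  have e2 := hinge_nonneg (t := t - 1 / 2) (show 0 < ε / 8 by positivity)
  unfold rebracket
  linarith

theorem lt_rebracket {ε t : ℝ} (hε : 0 < ε) (hε' : ε < 1 / 4) (h : 1 - ε < t) :
    1 - ε < rebracket (ε / 8) t := by
  unfold rebracket
  rw [hinge_of_le (by positivity) (by linarith), hinge_of_le (by positivity) (by linarith)]
  linarith

/-- A smooth map onto the unit interval which moves only points near the end points. -/
theorem exists_clamp {ε : ℝ} (hε : 0 < ε) (hε' : ε < 1 / 2) : ∃ c : ℝ → ℝ, ContDiff ℝ ∞ c ∧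
    (∀ t, t < ε / 3 → c t = 0) ∧ (∀ t, 1 - ε / 3 < t → c t = 1) ∧ (∀ t, 0 ≤ c t ∧ c t ≤ 1) ∧
    (∀ t, t < ε → c t < ε) ∧ (∀ t, 1 - ε < t → 1 - ε < c t) ∧
    ∀ t, ε ≤ t → t ≤ 1 - ε → c t = t := by
  have hδ : 0 < ε / 3 := by positivity
  let σ : ℝ → ℝ := fun t => Real.smoothTransition ((t - ε / 3) / (ε / 3))
  have hσ : ContDiff ℝ ∞ σ := Real.smoothTransition.contDiff.comp (by fun_prop)
  have h0 : ∀ t, t ≤ ε / 3 → σ t = 0 := fun t ht => Real.smoothTransition.zero_of_nonpos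
    (div_nonpos_of_nonpos_of_nonneg (by linarith) hδ.le)
  have h1 : ∀ t, 2 * ε / 3 ≤ t → σ t = 1 := fun t ht => Real.smoothTransition.one_of_one_le
    ((one_le_div hδ).2 (by linarith))
  have h2 : ∀ t, 0 ≤ σ t := fun t => Real.smoothTransition.nonneg _
  have h3 : ∀ t, σ t ≤ 1 := fun t => Real.smoothTransition.le_one _
  -- Away from the right end the formula is `σ(t) t`, and away from the left end it is the mirror
  -- image of this; the two ranges cover the line.
  have hlo : ∀ t, t < 1 - 2 * ε / 3 → σ t * (1 - (1 - t) * σ (1 - t)) = σ t * t := fun t ht => by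
    rw [h1 (1 - t) (by linarith)]; ring
  have hhi : ∀ t, 2 * ε / 3 < t → σ t * (1 - (1 - t) * σ (1 - t)) = 1 - (1 - t) * σ (1 - t) :=
    fun t ht => by rw [h1 t ht.le]; ring
  refine ⟨fun t => σ t * (1 - (1 - t) * σ (1 - t)), ?_, fun t ht => ?_, fun t ht => ?_,
    fun t => ?_, fun t ht => ?_, fun t ht => ?_, fun t ht ht' => ?_⟩
  · exact hσ.mul (contDiff_const.sub ((contDiff_const.sub contDiff_id).mul
      (hσ.comp (contDiff_const.sub contDiff_id))))
  · simp [h0 t ht.le]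
  · dsimp only
    rw [hhi t (by linarith), h0 (1 - t) (by linarith)]; ring
  · dsimp only
    rcases lt_or_ge t (1 / 2) with h | h
    · rw [hlo t (by linarith)]
      rcases le_or_gt t 0 with h4 | h4
      · rw [h0 t (by linarith)]; simp
      · exact ⟨mul_nonneg (h2 t) h4.le, by nlinarith [h2 t, h3 t]⟩
    · rw [hhi t (by linarith)]
      rcases le_or_gt (1 - t) 0 with h4 | h4
      · rw [h0 (1 - t) (by linarith)]; simp
      · exact ⟨by nlinarith [h2 (1 - t), h3 (1 - t)], by nlinarith [h2 (1 - t), h3 (1 - t)]⟩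
  · dsimp only
    rw [hlo t (by linarith)]
    rcases le_or_gt t 0 with h4 | h4
    · rw [h0 t (by linarith)]; simpa using hε
    · nlinarith [h2 t, h3 t]
  · dsimp only
    rw [hhi t (by linarith)]
    rcases le_or_gt (1 - t) 0 with h4 | h4
    · rw [h0 (1 - t) (by linarith)]; simpa using hε
    · nlinarith [h2 (1 - t), h3 (1 - t)]
  · dsimp only
    rw [hlo t (by linarith), h1 t (by linarith), one_mul]

end Cat

end TwoTransport

namespace TwoTransport

/-! ### Homotopies of rank at most two with prescribed boundary movement. -/

section Homotopy

variable {E M : Type*} [NormedAddCommGroup E] [NormedSpace ℝ E]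
  [TopologicalSpace M] [ChartedSpace E M] [IsManifold 𝓘(ℝ, E) ∞ M] {p q r : M}

variable (E) in
/-- `F₀` and `F₁` are homotopic through maps of rank at most two with constant values `p` and `q`
near `x = 0` and `x = 1`, and such that the boundary curves at `y = 0` and `y = 1` move along
`b₀` and `b₁`. -/
def ThinHtpy (p q : M) (b₀ b₁ F₀ F₁ : ℝ × ℝ → M) : Prop :=
  ∃ K : ℝ × ℝ × ℝ → M, ContMDiff 𝓘(ℝ, ℝ × ℝ × ℝ) 𝓘(ℝ, E) ∞ K ∧
    (∃ ε : ℝ, 0 < ε ∧ ε < 1 / 2 ∧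
      (∀ x y z, x < ε → K (x, y, z) = p) ∧ (∀ x y z, 1 - ε < x → K (x, y, z) = q) ∧
      (∀ x y z, y < ε → K (x, y, z) = b₀ (x, z)) ∧
      (∀ x y z, 1 - ε < y → K (x, y, z) = b₁ (x, z)) ∧
      (∀ x y z, z < ε → K (x, y, z) = F₀ (x, y)) ∧
      (∀ x y z, 1 - ε < z → K (x, y, z) = F₁ (x, y))) ∧
    ∀ w, RankLE E K 2 w

/-- Vertical concatenation of maps from the plane. -/
noncomputable def vcat (F F' : ℝ × ℝ → M) (w : ℝ × ℝ) : M :=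
  if w.2 ≤ 1 / 2 then F (w.1, 2 * w.2) else F' (w.1, 2 * w.2 - 1)

/-- Horizontal concatenation of maps from the plane. -/
noncomputable def hcat (F F' : ℝ × ℝ → M) (w : ℝ × ℝ) : M :=
  if w.1 ≤ 1 / 2 then F (2 * w.1, w.2) else F' (2 * w.1 - 1, w.2)

variable {b₀ b₁ b₂ c₀ c₁ F₀ F₁ F₂ F₀' F₁' : ℝ × ℝ → M}

/-- The definition treats y and z alike. The exchange of the two turns vertical composition into
composition of homotopies. -/
theorem ThinHtpy.swap (h : ThinHtpy E p q b₀ b₁ F₀ F₁) : ThinHtpy E p q F₀ F₁ b₀ b₁ := by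
  obtain ⟨K, hK, ⟨ε, h0, h1, h2, h3, h4, h5, h6, h7⟩, hr⟩ := h
  refine ⟨fun w => K (w.1, w.2.2, w.2.1), hK.comp (ContDiff.contMDiff (by fun_prop)),
    ⟨ε, h0, h1, fun x y z => h2 x z y, fun x y z => h3 x z y, fun x y z => h6 x z y,
      fun x y z => h7 x z y, fun x y z => h4 x z y, fun x y z => h5 x z y⟩, fun w => ?_⟩
  exact (hr _).comp hK (P := fun w : ℝ × ℝ × ℝ => (w.1, w.2.2, w.2.1)) (by fun_prop)

theorem ThinHtpy.symm (h : ThinHtpy E p q b₀ b₁ F₀ F₁) :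
    ThinHtpy E p q (fun w => b₀ (w.1, 1 - w.2)) (fun w => b₁ (w.1, 1 - w.2)) F₁ F₀ := by
  obtain ⟨K, hK, ⟨ε, h0, h1, h2, h3, h4, h5, h6, h7⟩, hr⟩ := h
  refine ⟨fun w => K (w.1, w.2.1, 1 - w.2.2), hK.comp (ContDiff.contMDiff (by fun_prop)),
    ⟨ε, h0, h1, fun x y z => h2 x y _, fun x y z => h3 x y _, fun x y z => h4 x y _,
      fun x y z => h5 x y _, fun x y z hz => h7 x y _ (by dsimp only; linarith),
      fun x y z hz => h6 x y _ (by dsimp only; linarith)⟩, fun w => ?_⟩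
  exact (hr _).comp hK (P := fun w : ℝ × ℝ × ℝ => (w.1, w.2.1, 1 - w.2.2)) (by fun_prop)

theorem ThinHtpy.trans (h : ThinHtpy E p q b₀ b₁ F₀ F₁) (h' : ThinHtpy E p q c₀ c₁ F₁ F₂) :
    ThinHtpy E p q (vcat b₀ c₀) (vcat b₁ c₁) F₀ F₂ := by
  obtain ⟨K, hK, ⟨ε, h0, h1, h2, h3, h4, h5, h6, h7⟩, hr⟩ := h
  obtain ⟨K', hK', ⟨ε', h0', h1', h2', h3', h4', h5', h6', h7'⟩, hr'⟩ := h'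
  have ha := min_le_left ε ε'
  have hb := min_le_right ε ε'
  have hp := lt_min h0 h0'
  have hs := hK.comp (f := fun w : ℝ × ℝ × ℝ => (w.1, w.2.1, 2 * w.2.2))
    (ContDiff.contMDiff (by fun_prop))
  have hs' := hK'.comp (f := fun w : ℝ × ℝ × ℝ => (w.1, w.2.1, 2 * w.2.2 - 1))
    (ContDiff.contMDiff (by fun_prop))
  have hg : ∀ w : ℝ × ℝ × ℝ, |w.2.2 - 1 / 2| < min ε ε' / 2 →
      K (w.1, w.2.1, 2 * w.2.2) = K' (w.1, w.2.1, 2 * w.2.2 - 1) := by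
    rintro ⟨x, y, z⟩ hw
    rw [abs_lt] at hw
    dsimp only at hw ⊢
    rw [h7 _ _ _ (by linarith), h6' _ _ _ (by linarith)]
  refine ⟨fun w => if w.2.2 ≤ 1 / 2 then K (w.1, w.2.1, 2 * w.2.2) else
    K' (w.1, w.2.1, 2 * w.2.2 - 1), glue_smooth hs hs' (by fun_prop) (half_pos hp) hg,
    ⟨min ε ε' / 2, half_pos hp, by linarith, fun x y z hx => ?_, fun x y z hx => ?_,
      fun x y z hy => ?_, fun x y z hy => ?_, fun x y z hz => ?_, fun x y z hz => ?_⟩,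
    RankLE.glue (by fun_prop) (half_pos hp) hg
      (fun w => (hr _).comp hK (P := fun w : ℝ × ℝ × ℝ => (w.1, w.2.1, 2 * w.2.2)) (by fun_prop))
      (fun w => (hr' _).comp hK' (P := fun w : ℝ × ℝ × ℝ => (w.1, w.2.1, 2 * w.2.2 - 1))
        (by fun_prop))⟩
  · dsimp only
    split_ifs
    · exact h2 _ _ _ (by linarith)
    · exact h2' _ _ _ (by linarith)
  · dsimp only
    split_ifs
    · exact h3 _ _ _ (by linarith)
    · exact h3' _ _ _ (by linarith)
  · dsimp only [vcat]
    split_ifs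
    · exact h4 _ _ _ (by linarith)
    · exact h4' _ _ _ (by linarith)
  · dsimp only [vcat]
    split_ifs
    · exact h5 _ _ _ (by linarith)
    · exact h5' _ _ _ (by linarith)
  · dsimp only
    rw [if_pos (by linarith)]
    exact h6 _ _ _ (by linarith)
  · dsimp only
    rw [if_neg (by linarith)]
    exact h7' _ _ _ (by linarith)

theorem ThinHtpy.vcat (h : ThinHtpy E p q b₀ b₁ F₀ F₁) (h' : ThinHtpy E p q b₁ b₂ F₀' F₁') :
    ThinHtpy E p q b₀ b₂ (vcat F₀ F₀') (vcat F₁ F₁') :=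
  (h.swap.trans h'.swap).swap

theorem ThinHtpy.hcat (h : ThinHtpy E p q b₀ b₁ F₀ F₁) (h' : ThinHtpy E q r c₀ c₁ F₀' F₁') :
    ThinHtpy E p r (hcat b₀ c₀) (hcat b₁ c₁) (hcat F₀ F₀') (hcat F₁ F₁') := by
  obtain ⟨K, hK, ⟨ε, h0, h1, h2, h3, h4, h5, h6, h7⟩, hr⟩ := h
  obtain ⟨K', hK', ⟨ε', h0', h1', h2', h3', h4', h5', h6', h7'⟩, hr'⟩ := h'
  have ha := min_le_left ε ε'
  have hb := min_le_right ε ε'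
  have hp := lt_min h0 h0'
  have hs := hK.comp (f := fun w : ℝ × ℝ × ℝ => (2 * w.1, w.2.1, w.2.2))
    (ContDiff.contMDiff (by fun_prop))
  have hs' := hK'.comp (f := fun w : ℝ × ℝ × ℝ => (2 * w.1 - 1, w.2.1, w.2.2))
    (ContDiff.contMDiff (by fun_prop))
  have hg : ∀ w : ℝ × ℝ × ℝ, |w.1 - 1 / 2| < min ε ε' / 2 →
      K (2 * w.1, w.2.1, w.2.2) = K' (2 * w.1 - 1, w.2.1, w.2.2) := by
    rintro ⟨x, y, z⟩ hw
    rw [abs_lt] at hw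
    dsimp only at hw ⊢
    rw [h3 _ _ _ (by linarith), h2' _ _ _ (by linarith)]
  refine ⟨fun w => if w.1 ≤ 1 / 2 then K (2 * w.1, w.2.1, w.2.2) else
    K' (2 * w.1 - 1, w.2.1, w.2.2), glue_smooth hs hs' (by fun_prop) (half_pos hp) hg,
    ⟨min ε ε' / 2, half_pos hp, by linarith, fun x y z hx => ?_, fun x y z hx => ?_,
      fun x y z hy => ?_, fun x y z hy => ?_, fun x y z hz => ?_, fun x y z hz => ?_⟩,
    RankLE.glue (by fun_prop) (half_pos hp) hg
      (fun w => (hr _).comp hK (P := fun w : ℝ × ℝ × ℝ => (2 * w.1, w.2.1, w.2.2)) (by fun_prop))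
      (fun w => (hr' _).comp hK' (P := fun w : ℝ × ℝ × ℝ => (2 * w.1 - 1, w.2.1, w.2.2))
        (by fun_prop))⟩
  · dsimp only
    rw [if_pos (by linarith)]
    exact h2 _ _ _ (by linarith)
  · dsimp only
    rw [if_neg (by linarith)]
    exact h3' _ _ _ (by linarith)
  · dsimp only [TwoTransport.hcat]
    rw [h4 _ _ _ (by linarith), h4' _ _ _ (by linarith)]
  · dsimp only [TwoTransport.hcat]
    rw [h5 _ _ _ (by linarith), h5' _ _ _ (by linarith)]
  · dsimp only [TwoTransport.hcat]
    rw [h6 _ _ _ (by linarith), h6' _ _ _ (by linarith)]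
  · dsimp only [TwoTransport.hcat]
    rw [h7 _ _ _ (by linarith), h7' _ _ _ (by linarith)]

theorem ThinHtpy.hinv (h : ThinHtpy E p q b₀ b₁ F₀ F₁) :
    ThinHtpy E q p (fun w => b₀ (1 - w.1, w.2)) (fun w => b₁ (1 - w.1, w.2))
      (fun w => F₀ (1 - w.1, w.2)) (fun w => F₁ (1 - w.1, w.2)) := by
  obtain ⟨K, hK, ⟨ε, h0, h1, h2, h3, h4, h5, h6, h7⟩, hr⟩ := h
  refine ⟨fun w => K (1 - w.1, w.2.1, w.2.2), hK.comp (ContDiff.contMDiff (by fun_prop)),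
    ⟨ε, h0, h1, fun x y z hx => h3 _ y z (by dsimp only; linarith),
      fun x y z hx => h2 _ y z (by dsimp only; linarith), fun x y z => h4 _ y z,
      fun x y z => h5 _ y z, fun x y z => h6 _ y z, fun x y z => h7 _ y z⟩, fun w => ?_⟩
  exact (hr _).comp hK (P := fun w : ℝ × ℝ × ℝ => (1 - w.1, w.2.1, w.2.2)) (by fun_prop)

/-- A smooth step function, constant near the end points. -/
theorem exists_step : ∃ w : ℝ → ℝ, ContDiff ℝ ∞ w ∧ (∀ z, z < 1 / 3 → w z = 0) ∧
    (∀ z, 1 - 1 / 3 < z → w z = 1) ∧ ∀ z, 0 ≤ w z ∧ w z ≤ 1 := by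
  refine ⟨fun z => Real.smoothTransition (3 * z - 1),
    Real.smoothTransition.contDiff.comp (by fun_prop), fun z hz => ?_, fun z hz => ?_,
    fun z => ⟨Real.smoothTransition.nonneg _, Real.smoothTransition.le_one _⟩⟩
  · exact Real.smoothTransition.zero_of_nonpos (by linarith)
  · exact Real.smoothTransition.one_of_one_le (by linarith)

/-- Maps that factor through homotopic maps into a space with a map of rank at most two. -/
theorem thinHtpy_of_homotopy {N : Type*} [NormedAddCommGroup N] [NormedSpace ℝ N] {Γ : N → M}
    (hΓ : ContMDiff 𝓘(ℝ, N) 𝓘(ℝ, E) ∞ Γ) (hr : ∀ n, RankLE E Γ 2 n) {A : ℝ × ℝ × ℝ → N}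
    (hA : ContDiff ℝ ∞ A) {ε : ℝ} (hε : 0 < ε) (hε' : ε < 1 / 2)
    (h0 : ∀ x y t, 0 ≤ t → t ≤ 1 → x < ε → Γ (A (x, y, t)) = p)
    (h1 : ∀ x y t, 0 ≤ t → t ≤ 1 → 1 - ε < x → Γ (A (x, y, t)) = q) {c₀ c₁ : ℝ × ℝ → M}
    (h2 : ∀ x y t, 0 ≤ t → t ≤ 1 → y < ε → Γ (A (x, y, t)) = c₀ (x, t))
    (h3 : ∀ x y t, 0 ≤ t → t ≤ 1 → 1 - ε < y → Γ (A (x, y, t)) = c₁ (x, t)) :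
    ∃ w : ℝ → ℝ, ContDiff ℝ ∞ w ∧ ThinHtpy E p q (fun v => c₀ (v.1, w v.2))
      (fun v => c₁ (v.1, w v.2)) (fun v => Γ (A (v.1, v.2, 0))) (fun v => Γ (A (v.1, v.2, 1))) := by
  -- The step function supplies the sitting instants in z and keeps the parameter in `[0, 1]`, the
  -- only range where the boundary conditions are assumed.
  obtain ⟨w, hw, hw0, hw1, hw2⟩ := exists_step
  have hP : ContDiff ℝ ∞ (fun v : ℝ × ℝ × ℝ => A (v.1, v.2.1, w v.2.2)) := hA.comp (by fun_prop)
  have hm : min ε (1 / 3) ≤ ε := min_le_left _ _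
  have hm' : min ε (1 / 3) ≤ 1 / 3 := min_le_right _ _
  refine ⟨w, hw, fun v => Γ (A (v.1, v.2.1, w v.2.2)), hΓ.comp hP.contMDiff,
    ⟨min ε (1 / 3), by positivity, by linarith, fun x y z hx => ?_, fun x y z hx => ?_,
      fun x y z hy => ?_, fun x y z hy => ?_, fun x y z hz => ?_, fun x y z hz => ?_⟩, fun v => ?_⟩
  · exact h0 _ _ _ (hw2 z).1 (hw2 z).2 (by linarith)
  · exact h1 _ _ _ (hw2 z).1 (hw2 z).2 (by linarith)
  · exact h2 _ _ _ (hw2 z).1 (hw2 z).2 (by linarith)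
  · exact h3 _ _ _ (hw2 z).1 (hw2 z).2 (by linarith)
  · dsimp only; rw [hw0 z (by linarith)]
  · dsimp only; rw [hw1 z (by linarith)]
  · exact (hr _).comp hΓ (hP.contDiffAt.differentiableAt (by simp))

end Homotopy

/-! ### Thin homotopy as an equivalence relation. -/

section Surfaces

variable {E M : Type*} [NormedAddCommGroup E] [NormedSpace ℝ E]
  [TopologicalSpace M] [ChartedSpace E M] [IsManifold 𝓘(ℝ, E) ∞ M] {p q r : M}
  {γ₀ γ₁ γ₂ γ₃ γ : Curve E p q}

/-- Near `y = 0` and `y = 1` the homotopy depends on `(x, z)` only, through `b₀` and `b₁`, and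
inherits their rank bound. -/
theorem thinHomotopic₂_of_thinHtpy {S₀ : Surface γ₀ γ₁} {S₁ : Surface γ₂ γ₃} {b₀ b₁ : ℝ × ℝ → M}
    (h : ThinHtpy E p q b₀ b₁ S₀.toFun S₁.toFun) (h0 : ∀ w, RankLE E b₀ 1 w)
    (h1 : ∀ w, RankLE E b₁ 1 w) : ThinHomotopic₂ S₀ S₁ := by
  obtain ⟨K, hK, ⟨ε, hε, hε', hx, hx', hy, hy', hz, hz'⟩, hr⟩ := h
  have hb₀ : ContMDiff 𝓘(ℝ, ℝ × ℝ) 𝓘(ℝ, E) ∞ b₀ := by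
    have : b₀ = fun w => K (w.1, 0, w.2) := funext fun w => (hy _ _ _ hε).symm
    rw [this]
    exact hK.comp (ContDiff.contMDiff (by fun_prop))
  have hb₁ : ContMDiff 𝓘(ℝ, ℝ × ℝ) 𝓘(ℝ, E) ∞ b₁ := by
    have : b₁ = fun w => K (w.1, 1, w.2) := funext fun w => (hy' _ _ _ (by linarith)).symm
    rw [this]
    exact hK.comp (ContDiff.contMDiff (by fun_prop))
  refine ⟨K, hK, ⟨ε, hε, hε', hx, hx', fun x y z h => ?_, fun x y z h => ?_, hz, hz'⟩,
    fun x z => ?_, fun x z => ?_, fun w => rankLE_two.1 (hr w)⟩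
  · rw [hy _ _ _ h, hy _ _ _ hε]
  · rw [hy' _ _ _ h, hy' _ _ _ (by linarith)]
  · refine rankLE_one.1 (((h0 (x, z)).comp (P := fun w : ℝ × ℝ × ℝ => (w.1, w.2.2))
      (z := (x, 0, z)) hb₀ (by fun_prop)).congr ?_)
    filter_upwards [(continuous_fst.comp continuous_snd).continuousAt.eventually_lt
      continuousAt_const (show ((x, 0, z) : ℝ × ℝ × ℝ).2.1 < ε from hε)] with w hw
    exact hy _ _ _ hw
  · refine rankLE_one.1 (((h1 (x, z)).comp (P := fun w : ℝ × ℝ × ℝ => (w.1, w.2.2))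
      (z := (x, 1, z)) hb₁ (by fun_prop)).congr ?_)
    filter_upwards [continuousAt_const.eventually_lt
      (continuous_fst.comp continuous_snd).continuousAt
      (show 1 - ε < ((x, 1, z) : ℝ × ℝ × ℝ).2.1 by simp [hε])] with w hw
    exact hy' _ _ _ hw

/-- The faces `y = 0` and `y = 1` of the homotopy are themselves surfaces of rank at most one,
between the sources and between the targets. -/
theorem ThinHomotopic₂.exists_thinHtpy {S₀ : Surface γ₀ γ₁} {S₁ : Surface γ₂ γ₃}
    (h : ThinHomotopic₂ S₀ S₁) : ∃ (h₀ : Surface γ₀ γ₂) (h₁ : Surface γ₁ γ₃),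
    ThinHtpy E p q h₀.toFun h₁.toFun S₀.toFun S₁.toFun ∧ (∀ w, RankLE E h₀.toFun 1 w) ∧
      ∀ w, RankLE E h₁.toFun 1 w := by
  obtain ⟨K, hK, ⟨ε, hε, hε', hx, hx', hy, hy', hz, hz'⟩, hr0, hr1, hr⟩ := h
  obtain ⟨ε₀, s0, s1, s2, s3, s4, s5⟩ := S₀.sitting
  obtain ⟨ε₁, t0, t1, t2, t3, t4, t5⟩ := S₁.sitting
  refine ⟨⟨fun w => K (w.1, 0, w.2), hK.comp (ContDiff.contMDiff (by fun_prop)), ε, hε, hε',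
      fun x y h => hx _ _ _ h, fun x y h => hx' _ _ _ h, fun x y h => ?_, fun x y h => ?_⟩,
    ⟨fun w => K (w.1, 1, w.2), hK.comp (ContDiff.contMDiff (by fun_prop)), ε, hε, hε',
      fun x y h => hx _ _ _ h, fun x y h => hx' _ _ _ h, fun x y h => ?_, fun x y h => ?_⟩,
    ⟨K, hK, ⟨ε, hε, hε', hx, hx', hy, hy', hz, hz'⟩, fun w => rankLE_two.2 (hr w)⟩,
    fun w => ?_, fun w => ?_⟩
  · exact (hz _ _ _ h).trans (s4 _ _ s0)
  · exact (hz' _ _ _ h).trans (t4 _ _ t0)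
  · exact (hz _ _ _ h).trans (s5 _ _ (by linarith))
  · exact (hz' _ _ _ h).trans (t5 _ _ (by linarith))
  · exact (rankLE_one.2 (hr0 w.1 w.2)).comp (F := K) (P := fun w : ℝ × ℝ => (w.1, 0, w.2)) hK
      (by fun_prop)
  · exact (rankLE_one.2 (hr1 w.1 w.2)).comp (F := K) (P := fun w : ℝ × ℝ => (w.1, 1, w.2)) hK
      (by fun_prop)

theorem Surface.rankLE_unit (γ : Curve E p q) (w : ℝ × ℝ) :
    RankLE E (fun v : ℝ × ℝ => γ.toFun v.1) 1 w :=
  (rankLE_line _ _).comp (P := fun w : ℝ × ℝ => w.1) γ.smooth (by fun_prop)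

/-- Homotopy of surfaces of rank at most two, relative to the boundary. -/
def Surface.Rel (S T : Surface γ₀ γ₁) : Prop :=
  ThinHtpy E p q (fun w => γ₀.toFun w.1) (fun w => γ₁.toFun w.1) S.toFun T.toFun

theorem Surface.Rel.thinHomotopic₂ {S T : Surface γ₀ γ₁} (h : S.Rel T) : ThinHomotopic₂ S T :=
  thinHomotopic₂_of_thinHtpy h (Surface.rankLE_unit γ₀) (Surface.rankLE_unit γ₁)

theorem Surface.thinHtpy_refl (S : Surface γ₀ γ₁) : ThinHtpy E p q (fun w => γ₀.toFun w.1)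
    (fun w => γ₁.toFun w.1) S.toFun S.toFun := by
  obtain ⟨ε, s0, s1, s2, s3, s4, s5⟩ := S.sitting
  exact ⟨fun w => S.toFun (w.1, w.2.1), S.smooth.comp (ContDiff.contMDiff (by fun_prop)),
    ⟨ε, s0, s1, fun x y _ => s2 x y, fun x y _ => s3 x y, fun x y _ => s4 x y, fun x y _ => s5 x y,
      fun _ _ _ _ => rfl, fun _ _ _ _ => rfl⟩, fun w => (rankLE_plane _ _).comp
        (P := fun w : ℝ × ℝ × ℝ => (w.1, w.2.1)) S.smooth (by fun_prop)⟩

theorem Surface.Rel.refl (S : Surface γ₀ γ₁) : S.Rel S := S.thinHtpy_refl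

theorem Surface.Rel.symm {S T : Surface γ₀ γ₁} (h : S.Rel T) : T.Rel S := ThinHtpy.symm h

theorem vcat_fst (γ : ℝ → M) : vcat (fun w => γ w.1) (fun w => γ w.1) = fun w => γ w.1 := by
  funext w
  simp [vcat]

theorem Surface.Rel.trans {S T U : Surface γ₀ γ₁} (h : S.Rel T) (h' : T.Rel U) : S.Rel U := by
  have h1 := ThinHtpy.trans h h'
  rwa [vcat_fst, vcat_fst] at h1

theorem Surface.Rel.vcomp {S S' : Surface γ₀ γ₁} {T T' : Surface γ₁ γ₂} (h : S.Rel S')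
    (h' : T.Rel T') : (T.vcomp S).Rel (T'.vcomp S') := ThinHtpy.vcat h h'

theorem ThinHomotopic₂.symm {S₀ : Surface γ₀ γ₁} {S₁ : Surface γ₂ γ₃} (h : ThinHomotopic₂ S₀ S₁) :
    ThinHomotopic₂ S₁ S₀ := by
  obtain ⟨h₀, h₁, h, hr0, hr1⟩ := h.exists_thinHtpy
  exact thinHomotopic₂_of_thinHtpy h.symm
    (fun w => (hr0 _).comp (P := fun w : ℝ × ℝ => (w.1, 1 - w.2)) h₀.smooth (by fun_prop))
    (fun w => (hr1 _).comp (P := fun w : ℝ × ℝ => (w.1, 1 - w.2)) h₁.smooth (by fun_prop))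

theorem Surface.rankLE_vcomp {S : Surface γ₀ γ₁} {T : Surface γ₁ γ₂} (hS : ∀ w, RankLE E S.toFun 1 w)
    (hT : ∀ w, RankLE E T.toFun 1 w) (w : ℝ × ℝ) : RankLE E (T.vcomp S).toFun 1 w := by
  obtain ⟨ε, s0, s1, s2, s3, s4, s5⟩ := S.sitting
  obtain ⟨ε', t0, t1, t2, t3, t4, t5⟩ := T.sitting
  have ha := min_le_left ε ε'
  have hb := min_le_right ε ε'
  refine RankLE.glue (φ := fun w : ℝ × ℝ => w.2) (by fun_prop) (half_pos (lt_min s0 t0)) ?_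
    (fun w => (hS _).comp (P := fun w : ℝ × ℝ => (w.1, 2 * w.2)) S.smooth (by fun_prop))
    (fun w => (hT _).comp (P := fun w : ℝ × ℝ => (w.1, 2 * w.2 - 1)) T.smooth (by fun_prop)) w
  rintro ⟨x, y⟩ hw
  rw [abs_lt] at hw
  dsimp only at hw ⊢
  rw [s5 _ _ (by linarith), t4 _ _ (by linarith)]

theorem Surface.rankLE_hcomp {γ₂ γ₃ : Curve E q r} {S : Surface γ₀ γ₁} {T : Surface γ₂ γ₃}
    (hS : ∀ w, RankLE E S.toFun 1 w) (hT : ∀ w, RankLE E T.toFun 1 w) (w : ℝ × ℝ) :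
    RankLE E (T.hcomp S).toFun 1 w := by
  obtain ⟨ε, s0, s1, s2, s3, s4, s5⟩ := S.sitting
  obtain ⟨ε', t0, t1, t2, t3, t4, t5⟩ := T.sitting
  have ha := min_le_left ε ε'
  have hb := min_le_right ε ε'
  refine RankLE.glue (φ := fun w : ℝ × ℝ => w.1) (by fun_prop) (half_pos (lt_min s0 t0)) ?_
    (fun w => (hS _).comp (P := fun w : ℝ × ℝ => (2 * w.1, w.2)) S.smooth (by fun_prop))
    (fun w => (hT _).comp (P := fun w : ℝ × ℝ => (2 * w.1 - 1, w.2)) T.smooth (by fun_prop)) w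
  rintro ⟨x, y⟩ hw
  rw [abs_lt] at hw
  dsimp only at hw ⊢
  rw [s3 _ _ (by linarith), t2 _ _ (by linarith)]

theorem Surface.rankLE_vinv {S : Surface γ₀ γ₁} (hS : ∀ w, RankLE E S.toFun 1 w) (w : ℝ × ℝ) :
    RankLE E S.vinv.toFun 1 w :=
  (hS _).comp (P := fun w : ℝ × ℝ => (w.1, 1 - w.2)) S.smooth (by fun_prop)

theorem Surface.rankLE_hinv {S : Surface γ₀ γ₁} (hS : ∀ w, RankLE E S.toFun 1 w) (w : ℝ × ℝ) :
    RankLE E S.hinv.toFun 1 w :=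
  (hS _).comp (P := fun w : ℝ × ℝ => (1 - w.1, w.2)) S.smooth (by fun_prop)

theorem ThinHomotopic₂.trans {γ₄ γ₅ : Curve E p q} {S₀ : Surface γ₀ γ₁} {S₁ : Surface γ₂ γ₃}
    {S₂ : Surface γ₄ γ₅} (h : ThinHomotopic₂ S₀ S₁) (h' : ThinHomotopic₂ S₁ S₂) :
    ThinHomotopic₂ S₀ S₂ := by
  obtain ⟨h₀, h₁, h, hr0, hr1⟩ := h.exists_thinHtpy
  obtain ⟨k₀, k₁, k, kr0, kr1⟩ := h'.exists_thinHtpy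
  exact thinHomotopic₂_of_thinHtpy (h.trans k) (Surface.rankLE_vcomp (S := h₀) (T := k₀) hr0 kr0)
    (Surface.rankLE_vcomp (S := h₁) (T := k₁) hr1 kr1)

theorem ThinHomotopic₁.refl (γ : Curve E p q) : ThinHomotopic₁ γ γ :=
  (Surface.unit γ).thinHomotopic₁ (Surface.rankLE_unit γ)

theorem ThinHomotopic₁.symm (h : ThinHomotopic₁ γ₀ γ₁) : ThinHomotopic₁ γ₁ γ₀ := by
  obtain ⟨S, hS⟩ := h.exists_surface
  exact S.vinv.thinHomotopic₁ (Surface.rankLE_vinv hS)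

theorem ThinHomotopic₁.trans (h : ThinHomotopic₁ γ₀ γ₁) (h' : ThinHomotopic₁ γ₁ γ₂) :
    ThinHomotopic₁ γ₀ γ₂ := by
  obtain ⟨S, hS⟩ := h.exists_surface
  obtain ⟨T, hT⟩ := h'.exists_surface
  exact (T.vcomp S).thinHomotopic₁ (Surface.rankLE_vcomp hS hT)

theorem Curve.cls_eq_iff : γ₀.cls = γ₁.cls ↔ ThinHomotopic₁ γ₀ γ₁ :=
  Quot.eq.trans (Equivalence.eqvGen_iff
    ⟨ThinHomotopic₁.refl, ThinHomotopic₁.symm, ThinHomotopic₁.trans⟩)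

theorem Surface.cls_eq_iff {S₀ : Surface γ₀ γ₁} {S₁ : Surface γ₂ γ₃} :
    S₀.cls = S₁.cls ↔ ThinHomotopic₂ S₀ S₁ :=
  Quot.eq.trans (Equivalence.eqvGen_iff (r := fun S T : AnySurface E p q => ThinHomotopic₂ S.2 T.2)
    ⟨fun S => (Surface.Rel.refl S.2).thinHomotopic₂, ThinHomotopic₂.symm, ThinHomotopic₂.trans⟩)

end Surfaces

end TwoTransport

namespace TwoTransport

/-! ### Global smooth flows of bounded vector fields. -/

section Flow

variable {E : Type*} [NormedAddCommGroup E] [NormedSpace ℝ E] [FiniteDimensional ℝ E]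
  {F : E → E}

theorem exists_lipschitzOnWith_closedBall (hF : ContDiff ℝ ∞ F) (e : E) (a : ℝ) :
    ∃ K : NNReal, LipschitzOnWith K F (Metric.closedBall e a) := by
  have : ProperSpace E := FiniteDimensional.proper ℝ E
  obtain ⟨C, hC⟩ := (isCompact_closedBall e a).exists_bound_of_continuousOn
    (hF.continuous_fderiv (by simp)).continuousOn
  refine ⟨C.toNNReal, (convex_closedBall e a).lipschitzOnWith_of_nnnorm_fderiv_le
    (fun x _ => (hF.contDiffAt).differentiableAt (by simp)) fun x hx => ?_⟩
  rw [← norm_toNNReal]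
  exact Real.toNNReal_le_toNNReal (hC x hx)

/-- Integral curves of a smooth vector field on an interval are unique. -/
theorem integralCurve_unique (hF : ContDiff ℝ ∞ F) {I : Set ℝ} (hI : IsPreconnected I)
    (hIo : IsOpen I) {α β : ℝ → E} (hα : ∀ t ∈ I, HasDerivAt α (F (α t)) t)
    (hβ : ∀ t ∈ I, HasDerivAt β (F (β t)) t) {t₀ : ℝ} (ht₀ : t₀ ∈ I) (h0 : α t₀ = β t₀) {t : ℝ}
    (ht : t ∈ I) : α t = β t := by
  have key : ∀ t ∈ I, α t = β t → α =ᶠ[𝓝 t] β := fun t ht he => by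
    obtain ⟨K, hK⟩ := exists_lipschitzOnWith_closedBall hF (α t) 1
    have hb : Metric.closedBall (α t) 1 ∈ 𝓝 (α t) := Metric.closedBall_mem_nhds _ one_pos
    refine ODE_solution_unique_of_eventually (v := fun _ => F)
      (s := fun _ => Metric.closedBall (α t) 1) (Eventually.of_forall fun _ => hK) ?_ ?_ he
    · filter_upwards [hIo.mem_nhds ht, (hα t ht).continuousAt.preimage_mem_nhds hb] with s h1 h2
      exact ⟨hα s h1, h2⟩
    · filter_upwards [hIo.mem_nhds ht, (hβ t ht).continuousAt.preimage_mem_nhds (he ▸ hb)]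
        with s h1 h2
      exact ⟨hβ s h1, he ▸ h2⟩
  -- The truth value of `α = β` is locally constant: equality persists by local uniqueness,
  -- inequality by continuity.
  have h1 : ∀ t ∈ I, ∀ᶠ s in 𝓝 t, (α s = β s) = (α t = β t) := fun t ht => by
    by_cases he : α t = β t
    · filter_upwards [key t ht he] with s hs
      simp [hs, he]
    · filter_upwards [((hα t ht).continuousAt.sub (hβ t ht).continuousAt).eventually_ne
        (sub_ne_zero.2 he)] with s hs
      simp [he, sub_ne_zero.1 hs]
  have h2 := eqOn_of_eventually_eq hI h1 ht₀ ht
  exact h2 ▸ h0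

/-- With speed at most `C`, a solution cannot leave the ball of radius `C * T` within time `T`, so
the Picard-Lindelöf theorem applies on the whole interval. -/
theorem exists_integralCurve_Icc (hF : ContDiff ℝ ∞ F) {C : ℝ} (hC : ∀ e, ‖F e‖ ≤ C) (e : E)
    {T : ℝ} (hT : 0 < T) : ∃ α : ℝ → E, α 0 = e ∧ ∀ t ∈ Ioo (-T) T, HasDerivAt α (F (α t)) t := by
  have hC0 : 0 ≤ C := (norm_nonneg _).trans (hC e)
  obtain ⟨K, hK⟩ := exists_lipschitzOnWith_closedBall hF e (C * T)
  have h0 : (0 : ℝ) ∈ Icc (-T) T := ⟨by linarith, hT.le⟩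
  have hP : IsPicardLindelof (fun _ => F) (⟨0, h0⟩ : Icc (-T) T) e
      ⟨C * T, mul_nonneg hC0 hT.le⟩ 0 ⟨C, hC0⟩ K :=
    IsPicardLindelof.of_time_independent (fun x _ => hC x) hK (by
      simp only [sub_zero, zero_sub, neg_neg, max_self, NNReal.coe_zero]; exact le_rfl)
  obtain ⟨α, h1, h2⟩ := hP.exists_eq_forall_mem_Icc_hasDerivWithinAt₀
  exact ⟨α, h1, fun t ht => (h2 t (Ioo_subset_Icc_self ht)).hasDerivAt (Icc_mem_nhds ht.1 ht.2)⟩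

theorem exists_integralCurve (hF : ContDiff ℝ ∞ F) {C : ℝ} (hC : ∀ e, ‖F e‖ ≤ C) (e : E) :
    ∃ α : ℝ → E, α 0 = e ∧ ∀ t, HasDerivAt α (F (α t)) t := by
  have h := fun n : ℕ => exists_integralCurve_Icc hF hC e (T := n + 1) (by positivity)
  choose α h0 h1 using h
  have hu : ∀ (m n : ℕ) (t : ℝ), |t| < m + 1 → |t| < n + 1 → α m t = α n t := by
    have hw : ∀ (m n : ℕ) (t : ℝ), m ≤ n → |t| < m + 1 → α m t = α n t := fun m n t hmn hm => by
      have hmn' : (m : ℝ) ≤ n := by exact_mod_cast hmn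
      refine integralCurve_unique hF (isPreconnected_Ioo (a := -((m : ℝ) + 1)) (b := m + 1))
        isOpen_Ioo (h1 m) (fun s hs => h1 n s ⟨by linarith [hs.1], by linarith [hs.2]⟩)
        (t₀ := 0) ⟨by linarith [m.cast_nonneg (α := ℝ)], by positivity⟩ (by rw [h0, h0])
        (abs_lt.1 hm)
    intro m n t hm hn
    rcases le_total m n with h | h
    · exact hw m n t h hm
    · exact (hw n m t h hn).symm
  refine ⟨fun t => α ⌈|t|⌉₊ t, by simpa using h0 0, fun t => ?_⟩
  set n := ⌈|t|⌉₊ + 1 with hn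
  have hlt : |t| < (n : ℝ) := (Nat.le_ceil _).trans_lt (by rw [hn]; push_cast; linarith)
  have he : (fun t => α ⌈|t|⌉₊ t) =ᶠ[𝓝 t] α n := by
    filter_upwards [continuous_abs.continuousAt.eventually_lt continuousAt_const hlt] with s hs
    exact hu _ _ _ ((Nat.le_ceil _).trans_lt (by linarith)) (by linarith)
  have h2 : HasDerivAt (α n) (F (α n t)) t := h1 n t (abs_lt.1 (by linarith))
  have h3 : α ⌈|t|⌉₊ t = α n t := he.eq_of_nhds
  exact HasDerivAt.congr_of_eventuallyEq (by simpa only [h3] using h2) he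

/-- A bounded smooth vector field has a smooth global flow. -/
theorem exists_smooth_flow (hF : ContDiff ℝ ∞ F) {C : ℝ} (hC : ∀ e, ‖F e‖ ≤ C) :
    ∃ Φ : ℝ × E → E, ContDiff ℝ ∞ Φ ∧ (∀ e, Φ (0, e) = e) ∧
      ∀ t e, HasDerivAt (fun s => Φ (s, e)) (F (Φ (t, e))) t := by
  have : CompleteSpace E := FiniteDimensional.complete ℝ E
  choose α h0 h1 using exists_integralCurve hF hC
  -- Near `t₀` the flow is the flow up to time `t` followed by the smooth local flow around `α e₀
  -- t₀`. Smoothness in the initial value thus passes from one nearby time to all others, and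
  -- smoothness at a time becomes an open and closed condition.
  have step : ∀ (e₀ : E) (t₀ : ℝ), ∃ δ > 0, ∀ t t', |t - t₀| < δ → |t' - t₀| < δ →
      ContDiffAt ℝ ∞ (fun e => α e t) e₀ →
      ContDiffAt ℝ ∞ (fun w : ℝ × E => α w.2 w.1) (t', e₀) := by
    intro e₀ t₀
    obtain ⟨δ, hδ, φ, hφ⟩ := exists_smooth_local_flow hF (α e₀ t₀)
    obtain ⟨δ', hδ', hc⟩ := Metric.continuousAt_iff.1 (h1 e₀ t₀).continuousAt δ hδ
    refine ⟨min δ' (δ / 2), by positivity, fun t t' ht ht' hs => ?_⟩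
    have ht1 := lt_of_lt_of_le ht (min_le_left _ _)
    have ht2 := abs_lt.1 (lt_of_lt_of_le ht (min_le_right _ _))
    have ht3 := abs_lt.1 (lt_of_lt_of_le ht' (min_le_right _ _))
    have hn : ‖α e₀ t - α e₀ t₀‖ < δ := by
      have := hc (x := t) (by rwa [Real.dist_eq]); rwa [dist_eq_norm] at this
    have htt : |t' - t| < δ := abs_lt.2 ⟨by linarith, by linarith⟩
    have he : (fun w : ℝ × E => α w.2 w.1) =ᶠ[𝓝 (t', e₀)] fun w => φ (w.1 - t, α w.2 t) := by
      have hc1 : ContinuousAt (fun w : ℝ × E => ‖α w.2 t - α e₀ t₀‖) (t', e₀) :=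
        ((ContinuousAt.comp (f := fun w : ℝ × E => w.2) (x := (t', e₀)) hs.continuousAt
          continuousAt_snd).sub continuousAt_const).norm
      have hc2 : ContinuousAt (fun w : ℝ × E => |w.1 - t|) (t', e₀) := by fun_prop
      filter_upwards [hc1.eventually_lt continuousAt_const hn,
        hc2.eventually_lt continuousAt_const htt] with w hw1 hw2
      have hd : ∀ s ∈ Ioo (t - δ) (t + δ), HasDerivAt (fun s => φ (s - t, α w.2 t))
          (F (φ (s - t, α w.2 t))) s := fun s hs => by
        have h3 := ((hφ _ hw1).2 (s - t) (abs_lt.2 ⟨by linarith [hs.1], by linarith [hs.2]⟩)).2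
        simpa using HasDerivAt.comp_sub_const s t h3
      refine integralCurve_unique hF isPreconnected_Ioo isOpen_Ioo (fun s _ => h1 w.2 s) hd
        (t₀ := t) ⟨by linarith, by linarith⟩ ?_ (t := w.1) ?_
      · rw [sub_self, (hφ _ hw1).1]
      · have := abs_lt.1 hw2
        exact ⟨by linarith, by linarith⟩
    refine ContDiffAt.congr_of_eventuallyEq ?_ he
    exact ContDiffAt.comp (f := fun w : ℝ × E => (w.1 - t, α w.2 t)) (t', e₀)
      ((hφ _ hn).2 (t' - t) htt).1 ((contDiffAt_fst.sub contDiffAt_const).prodMk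
        (ContDiffAt.comp (f := fun w : ℝ × E => w.2) (t', e₀) hs contDiffAt_snd))
  have hsl : ∀ (e₀ : E) (t : ℝ), ContDiffAt ℝ ∞ (fun w : ℝ × E => α w.2 w.1) (t, e₀) →
      ContDiffAt ℝ ∞ (fun e => α e t) e₀ := fun e₀ t h =>
    ContDiffAt.comp (g := fun w : ℝ × E => α w.2 w.1) (f := fun e => (t, e)) e₀ h
      (contDiffAt_const.prodMk contDiffAt_id)
  have hall : ∀ e₀ t, ContDiffAt ℝ ∞ (fun w : ℝ × E => α w.2 w.1) (t, e₀) := by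
    intro e₀ t
    have hcl : ∀ t ∈ (univ : Set ℝ), ∀ᶠ s in 𝓝 t,
        (ContDiffAt ℝ ∞ (fun w : ℝ × E => α w.2 w.1) (s, e₀)) =
        (ContDiffAt ℝ ∞ (fun w : ℝ × E => α w.2 w.1) (t, e₀)) := fun t _ => by
      obtain ⟨δ, hδ, h⟩ := step e₀ t
      filter_upwards [Metric.ball_mem_nhds t hδ] with s hs
      rw [Metric.mem_ball, Real.dist_eq] at hs
      exact propext ⟨fun h' => h s t hs (by simpa using hδ) (hsl _ _ h'),
        fun h' => h t s (by simpa using hδ) hs (hsl _ _ h')⟩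
    rw [eqOn_of_eventually_eq isPreconnected_univ hcl (mem_univ 0) (mem_univ t)]
    obtain ⟨δ, hδ, h⟩ := step e₀ 0
    refine h 0 0 (by simpa using hδ) (by simpa using hδ) ?_
    simp only [h0]
    exact contDiffAt_id
  exact ⟨fun w => α w.2 w.1, contDiff_iff_contDiffAt.2 fun w => hall w.2 w.1, h0, fun t e => h1 e t⟩

end Flow

end TwoTransport

namespace TwoTransport

/-! ### Patching of smooth local factorizations. -/

section Extension

variable {E M X Z : Type*} [NormedAddCommGroup E] [NormedSpace ℝ E]
  [TopologicalSpace M] [ChartedSpace E M] [IsManifold 𝓘(ℝ, E) ∞ M]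
  [NormedAddCommGroup X] [NormedSpace ℝ X] [FiniteDimensional ℝ X]

theorem exists_smooth_cutoff {A W : Set X} (hA : IsClosed A) (hW : IsOpen W) (hAW : A ⊆ W) :
    ∃ χ : X → ℝ, ContDiff ℝ ∞ χ ∧ (∀ v, v ∉ W → ∀ᶠ w in 𝓝 v, χ w = 0) ∧
      (∀ v ∈ A, ∀ᶠ w in 𝓝 v, χ w = 1) ∧ ∀ v, 0 ≤ χ v ∧ χ v ≤ 1 := by
  have : ProperSpace X := FiniteDimensional.proper ℝ X
  obtain ⟨f, h0, h1, h2⟩ := exists_contMDiffMap_zero_one_nhds_of_isClosed (n := ⊤) 𝓘(ℝ, X)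
    hW.isClosed_compl hA (disjoint_left.2 fun v hv hv' => hv (hAW hv'))
  exact ⟨f, f.contMDiff.contDiff, fun v hv => eventually_nhdsSet_iff_forall.1 h0 v hv,
    fun v hv => eventually_nhdsSet_iff_forall.1 h1 v hv, h2⟩

/-- `r` is smooth at `v` and compatible there with the factorization `r ∘ u = ℓ`. -/
def FactorsAt (E : Type*) [NormedAddCommGroup E] [NormedSpace ℝ E] [ChartedSpace E M] (u : Z → X)
    (ℓ : Z → M) (r : X → M) (v : X) : Prop :=
  ContMDiffAt 𝓘(ℝ, X) 𝓘(ℝ, E) ∞ r v ∧ ∀ z, u z = v → r v = ℓ z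

/-- Maps that factor smoothly near two sets, on one of them through a convex part of a chart,
factor smoothly near the union. -/
theorem exists_factorsAt_union {u : Z → X} {ℓ : Z → M} {A₁ A₂ : Set X} (hA₁ : IsCompact A₁)
    (hu : A₂ ⊆ range u) {r₁ : X → M} (h₁ : ∀ a ∈ A₁, ∀ᶠ v in 𝓝 a, FactorsAt E u ℓ r₁ v) (m : M)
    {B : Set E} (hB : IsOpen B) (hBc : Convex ℝ B) (hBt : B ⊆ (extChartAt 𝓘(ℝ, E) m).target)
    {W₂ : Set X} (hW₂ : IsOpen W₂) (hAW : A₂ ⊆ W₂) {k : X → E}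
    (hk : ∀ v ∈ W₂, ContDiffAt ℝ ∞ k v ∧ k v ∈ B)
    (hkl : ∀ z, u z ∈ W₂ → ℓ z ∈ (extChartAt 𝓘(ℝ, E) m).source ∧
      extChartAt 𝓘(ℝ, E) m (ℓ z) = k (u z)) :
    ∃ r : X → M, ∀ a ∈ A₁ ∪ A₂, ∀ᶠ v in 𝓝 a, FactorsAt E u ℓ r v := by
  classical
  set φ := extChartAt 𝓘(ℝ, E) m with hφ
  have hsym : ∀ e ∈ φ.target, ContMDiffAt 𝓘(ℝ, E) 𝓘(ℝ, E) ∞ φ.symm e := fun e he =>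
    (contMDiffOn_extChartAt_symm m).contMDiffAt ((isOpen_extChartAt_target m).mem_nhds he)
  obtain ⟨χ, hχ, h0, h1, h2⟩ := exists_smooth_cutoff (W := interior {v | FactorsAt E u ℓ r₁ v})
    hA₁.isClosed isOpen_interior fun a ha => mem_interior_iff_mem_nhds.2 (h₁ a ha)
  have hk₂ : ∀ v ∈ W₂, FactorsAt E u ℓ (fun v => φ.symm (k v)) v := fun v hv =>
    ⟨ContMDiffAt.comp v (hsym _ (hBt (hk v hv).2)) (hk v hv).1.contMDiffAt, by
      rintro z rfl
      obtain ⟨h3, h4⟩ := hkl z hv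
      dsimp only
      rw [← h4, φ.left_inv h3]⟩
  -- Interpolation inside the convex set `B`. Over the image of `u` both ends equal `φ ∘ ℓ`, so the
  -- factorization survives.
  let a : X → E := fun v => χ v • φ (r₁ v) + (1 - χ v) • k v
  let r : X → M := fun v => if χ v = 1 then r₁ v else if χ v = 0 then φ.symm (k v) else φ.symm (a v)
  have hcongr : ∀ {r' : X → M} {v : X}, r =ᶠ[𝓝 v] r' → FactorsAt E u ℓ r' v →
      FactorsAt E u ℓ r v := fun he h =>
    ⟨h.1.congr_of_eventuallyEq he, fun z hz => he.eq_of_nhds.trans (h.2 z hz)⟩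
  refine ⟨r, fun v hv => ?_⟩
  rcases hv with hv | hv
  · filter_upwards [(h1 v hv).eventually_nhds, h₁ v hv] with w hw hw'
    exact hcongr (by filter_upwards [hw] with s hs; exact if_pos hs) hw'
  · by_cases hv' : v ∈ interior {v | FactorsAt E u ℓ r₁ v}
    · obtain ⟨z, rfl⟩ := hu hv
      have hin : ∀ᶠ w in 𝓝 (u z), FactorsAt E u ℓ r₁ w := mem_interior_iff_mem_nhds.1 hv'
      have hf := interior_subset hv'
      have hsrc : r₁ (u z) ∈ φ.source := by
        rw [hf.2 z rfl]; exact (hkl z (hAW hv)).1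
      have hφr : ContDiffAt ℝ ∞ (fun v => φ (r₁ v)) (u z) := by
        rw [← contMDiffAt_iff_contDiffAt]
        exact ContMDiffAt.comp (u z) (contMDiffAt_extChartAt' (by simpa [hφ] using hsrc)) hf.1
      have hev : ∀ᶠ w in 𝓝 (u z), w ∈ W₂ ∧ FactorsAt E u ℓ r₁ w ∧ r₁ w ∈ φ.source ∧
          φ (r₁ w) ∈ B := by
        refine (hW₂.eventually_mem (hAW hv)).and (hin.and ?_)
        refine (hf.1.continuousAt.eventually_mem ((isOpen_extChartAt_source m).mem_nhds hsrc)).and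
          (hφr.continuousAt.eventually_mem (hB.mem_nhds ?_))
        rw [hf.2 z rfl, (hkl z (hAW hv)).2]
        exact (hk _ (hAW hv)).2
      filter_upwards [hev.eventually_nhds] with w hw
      obtain ⟨w1, w2, w3, w4⟩ := hw.self_of_nhds
      have hav : a w ∈ B := hBc w4 (hk w w1).2 (h2 w).1 (by linarith [(h2 w).2]) (by ring)
      refine hcongr (r' := fun v => φ.symm (a v)) ?_ ⟨?_, ?_⟩
      · filter_upwards [hw] with s hs
        dsimp only [r, a]
        split_ifs with c1 c2
        · rw [c1]
          simp [φ.left_inv hs.2.2.1]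
        · rw [c2]
          simp
        · rfl
      · have hφw : ContDiffAt ℝ ∞ (fun v => φ (r₁ v)) w := by
          rw [← contMDiffAt_iff_contDiffAt]
          exact ContMDiffAt.comp w (contMDiffAt_extChartAt' (by simpa [hφ] using w3)) w2.1
        exact ContMDiffAt.comp w (hsym _ (hBt hav)) (((hχ.contDiffAt.smul hφw).add
          ((contDiffAt_const.sub hχ.contDiffAt).smul (hk w w1).1)).contMDiffAt)
      · rintro z' rfl
        dsimp only [a]
        obtain ⟨h3, h4⟩ := hkl z' w1
        rw [w2.2 z' rfl, ← h4, ← add_smul, add_sub_cancel, one_smul, φ.left_inv h3]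
    · filter_upwards [(h0 v hv').eventually_nhds, hW₂.eventually_mem (hAW hv)] with w hw hw'
      refine hcongr (r' := fun v => φ.symm (k v)) ?_ (hk₂ w hw')
      filter_upwards [hw] with s hs
      simp [r, hs]

/-- A map that factors through finitely many convex charts, factors smoothly. -/
theorem exists_factorsAt_iUnion [Nonempty Z] {u : Z → X} {ℓ : Z → M} {ι : Type*} (s : Finset ι)
    {A : ι → Set X} (hA : ∀ i, IsCompact (A i)) (hu : ∀ i, A i ⊆ range u)
    (h : ∀ i, ∃ (m : M) (B : Set E) (W : Set X) (k : X → E), IsOpen B ∧ Convex ℝ B ∧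
      B ⊆ (extChartAt 𝓘(ℝ, E) m).target ∧ IsOpen W ∧ A i ⊆ W ∧
      (∀ v ∈ W, ContDiffAt ℝ ∞ k v ∧ k v ∈ B) ∧
      ∀ z, u z ∈ W → ℓ z ∈ (extChartAt 𝓘(ℝ, E) m).source ∧
        extChartAt 𝓘(ℝ, E) m (ℓ z) = k (u z)) :
    ∃ r : X → M, ∀ a ∈ ⋃ i ∈ s, A i, ∀ᶠ v in 𝓝 a, FactorsAt E u ℓ r v := by
  classical
  induction s using Finset.induction_on with
  | empty => exact ⟨fun _ => ℓ (Classical.arbitrary Z), by simp⟩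
  | insert i s hi ih =>
    obtain ⟨r, hr⟩ := ih
    obtain ⟨m, B, W, k, h1, h2, h3, h4, h5, h6, h7⟩ := h i
    rw [Finset.set_biUnion_insert, union_comm]
    exact exists_factorsAt_union (s.isCompact_biUnion fun i _ => hA i) (hu i) hr m h1 h2 h3 h4 h5 h6
      h7

end Extension

end TwoTransport

namespace TwoTransport

/-! ### Factorization of a thin loop of curves through a vector space. -/

section Factorization

variable {E M : Type*} [NormedAddCommGroup E] [NormedSpace ℝ E] [FiniteDimensional ℝ E]
  [TopologicalSpace M] [ChartedSpace E M] [IsManifold 𝓘(ℝ, E) ∞ M]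

/-- The closed unit square. -/
abbrev unitSquare : Set (ℝ × ℝ) := Icc 0 1 ×ˢ Icc 0 1

theorem continuousAt_chart_comp {Z : Type*} [TopologicalSpace Z] {ℓ : Z → M} {m : M} {z : Z}
    (hℓ : ContinuousAt ℓ z) (h : ℓ z ∈ (extChartAt 𝓘(ℝ, E) m).source) :
    ContinuousAt (fun w => extChartAt 𝓘(ℝ, E) m (ℓ w)) z :=
  ContinuousAt.comp (g := extChartAt 𝓘(ℝ, E) m) (continuousAt_extChartAt' h) hℓ

/-- Bump functions on the square that are compatible with a map into `M`. -/
theorem exists_compatible_bump {ℓ : ℝ × ℝ → M} (hℓ : Continuous ℓ) (hp : ∀ x, ℓ (x, 0) = ℓ (x, 1))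
    {z₀ : ℝ × ℝ} (hz₀ : z₀ ∈ unitSquare) : ∃ (b : E → ℝ) (ρ : ℝ × ℝ → ℝ) (B : Set E),
      ContDiff ℝ ∞ b ∧ IsOpen B ∧ Convex ℝ B ∧ B ⊆ (extChartAt 𝓘(ℝ, E) (ℓ z₀)).target ∧
      (∀ z ∈ unitSquare, ρ =ᶠ[𝓝 z] 0 ∨ (ℓ z ∈ (extChartAt 𝓘(ℝ, E) (ℓ z₀)).source ∧
        ρ =ᶠ[𝓝 z] fun w => b (extChartAt 𝓘(ℝ, E) (ℓ z₀) (ℓ w)))) ∧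
      (∀ z ∈ unitSquare, ρ z ≠ 0 → ℓ z ∈ (extChartAt 𝓘(ℝ, E) (ℓ z₀)).source ∧
        extChartAt 𝓘(ℝ, E) (ℓ z₀) (ℓ z) ∈ B) ∧ ρ z₀ = 1 ∧
      ∀ x ∈ Icc (0 : ℝ) 1, ρ (x, 0) = ρ (x, 1) := by
  classical
  -- Without the Hausdorff property a bump function of a chart need not extend by zero to `M`; the
  -- extension is made on the square, and closedness of points is enough for it.
  have : T1Space M := ChartedSpace.t1Space E M
  set m := ℓ z₀ with hm
  set φ := extChartAt 𝓘(ℝ, E) m with hφ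
  have hmem : m ∈ φ.source := mem_extChartAt_source _
  obtain ⟨R, hR, hRt⟩ := Metric.isOpen_iff.1 (isOpen_extChartAt_target (I := 𝓘(ℝ, E)) m) (φ m)
    (mem_extChartAt_target _)
  let Z₁ : Set (ℝ × ℝ) := Icc (-1) 2 ×ˢ Icc (-1) 2
  have hZ₁ : IsCompact Z₁ := isCompact_Icc.prod isCompact_Icc
  have hZZ : unitSquare ⊆ Z₁ := prod_mono (Icc_subset_Icc (by norm_num) (by norm_num))
    (Icc_subset_Icc (by norm_num) (by norm_num))
  have hF : IsCompact (Z₁ ∩ ℓ ⁻¹' {m}) := hZ₁.inter_right (isClosed_singleton.preimage hℓ)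
  obtain ⟨L, hL, hFL, hLs⟩ := exists_compact_between hF
    ((isOpen_extChartAt_source (I := 𝓘(ℝ, E)) m).preimage hℓ) (by
      rintro z ⟨-, hz⟩
      change ℓ z ∈ φ.source
      rw [show ℓ z = m from hz]
      exact hmem)
  -- The points of `L` where the bump has to vanish: those not interior to `L`, and those on the
  -- edges `y = 0`, `y = 1` whose counterpart on the opposite edge is not interior to `L`. None of
  -- them is sent to `m`, so a bump of small support around `φ m` vanishes on all.
  let C : Set (ℝ × ℝ) := (Z₁ ∩ L) ∩ ((interior L)ᶜ ∪
    ({z | z.2 = 0} ∩ (fun z : ℝ × ℝ => (z.1, (1 : ℝ))) ⁻¹' (interior L)ᶜ) ∪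
    ({z | z.2 = 1} ∩ (fun z : ℝ × ℝ => (z.1, (0 : ℝ))) ⁻¹' (interior L)ᶜ))
  have hO : IsClosed (interior L)ᶜ := isOpen_interior.isClosed_compl
  have hC : IsCompact C := (hZ₁.inter hL).inter_right (((hO.union
    ((isClosed_eq continuous_snd continuous_const).inter (hO.preimage (by fun_prop)))).union
    ((isClosed_eq continuous_snd continuous_const).inter (hO.preimage (by fun_prop)))))
  have hCm : ∀ z ∈ C, ℓ z ≠ m := by
    rintro ⟨x, y⟩ ⟨⟨h1, h2⟩, (h3 | ⟨h3, h4⟩) | ⟨h3, h4⟩⟩ he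
    · exact h3 (hFL ⟨h1, he⟩)
    · obtain rfl : y = 0 := h3
      exact h4 (hFL ⟨⟨h1.1, by norm_num⟩, by rw [← he]; exact (hp x).symm⟩)
    · obtain rfl : y = 1 := h3
      exact h4 (hFL ⟨⟨h1.1, by norm_num⟩, by rw [← he]; exact hp x⟩)
  have hφℓ : ∀ z ∈ L, ContinuousAt (fun w => φ (ℓ w)) z := fun z hz =>
    continuousAt_chart_comp hℓ.continuousAt (hLs hz)
  have hI : IsClosed ((fun w => φ (ℓ w)) '' C) := (hC.image_of_continuousOn
    fun z hz => (hφℓ z hz.1.2).continuousWithinAt).isClosed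
  have hmI : φ m ∈ ((fun w => φ (ℓ w)) '' C)ᶜ := by
    rintro ⟨z, hz, he⟩
    exact hCm z hz (φ.injOn (hLs hz.1.2) hmem he)
  obtain ⟨δ, hδ, hδC⟩ := Metric.isOpen_iff.1 hI.isOpen_compl _ hmI
  have hδC' : ∀ z ∈ C, δ ≤ dist (φ (ℓ z)) (φ m) := fun z hz => by
    by_contra hlt
    exact hδC (Metric.mem_ball.2 (not_le.1 hlt)) ⟨z, hz, rfl⟩
  have hs : 0 < min δ R := lt_min hδ hR
  have h1 := min_le_left δ R
  have h2 := min_le_right δ R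
  let b : ContDiffBump (φ m) := ⟨min δ R / 4, min δ R / 2, by positivity, by linarith⟩
  have hb0 : ∀ e, min δ R / 2 ≤ dist e (φ m) → b e = 0 := fun e he => b.zero_of_le_dist he
  have hCb : ∀ z ∈ C, b (φ (ℓ z)) = 0 := fun z hz => hb0 _ (by linarith [hδC' z hz])
  refine ⟨b, fun z => if z ∈ L then b (φ (ℓ z)) else 0, Metric.ball (φ m) R, b.contDiff,
    Metric.isOpen_ball, convex_ball _ _, hRt, fun z hz => ?_, fun z hz hne => ?_, ?_, fun x hx => ?_⟩
  · by_cases hzL : z ∈ L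
    · by_cases hzO : z ∈ interior L
      · refine Or.inr ⟨hLs hzL, ?_⟩
        filter_upwards [isOpen_interior.mem_nhds hzO] with w hw
        exact if_pos (interior_subset hw)
      · left
        have hd : min δ R / 2 < dist (φ (ℓ z)) (φ m) := by
          linarith [hδC' z ⟨⟨hZZ hz, hzL⟩, Or.inl (Or.inl hzO)⟩]
        filter_upwards [continuousAt_const.eventually_lt ((hφℓ z hzL).dist continuousAt_const) hd]
          with w hw
        simp [hb0 _ hw.le]
    · left
      filter_upwards [hL.isClosed.isOpen_compl.mem_nhds hzL] with w hw
      exact if_neg hw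
  · have hzL : z ∈ L := by
      by_contra h
      exact hne (if_neg h)
    dsimp only at hne
    rw [if_pos hzL] at hne
    refine ⟨hLs hzL, Metric.mem_ball.2 ?_⟩
    by_contra h
    exact hne (hb0 _ (by linarith))
  · have hzL : z₀ ∈ L := interior_subset (hFL ⟨hZZ hz₀, rfl⟩)
    dsimp only
    rw [if_pos hzL]
    exact b.one_of_mem_closedBall (Metric.mem_closedBall_self b.rIn_pos.le)
  · have h01 : ((x, 0) : ℝ × ℝ) ∈ Z₁ := hZZ ⟨hx, by norm_num⟩
    have h11 : ((x, 1) : ℝ × ℝ) ∈ Z₁ := hZZ ⟨hx, by norm_num⟩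
    by_cases h0 : ((x, 0) : ℝ × ℝ) ∈ L <;> by_cases h1 : ((x, 1) : ℝ × ℝ) ∈ L <;>
      simp only [h0, h1, if_true, if_false]
    · rw [hp x]
    · exact hCb _ ⟨⟨h01, h0⟩, Or.inl (Or.inr ⟨rfl, fun h => h1 (interior_subset h)⟩)⟩
    · exact (hCb _ ⟨⟨h11, h1⟩, Or.inr ⟨rfl, fun h => h0 (interior_subset h)⟩⟩).symm

/-- The clamp moves points only inside the sitting ranges and keeps them there, so the surface is
recovered from its restriction to the compact unit square. -/
theorem Surface.exists_clamp {p q : M} {γ₀ γ₁ : Curve E p q} (S : Surface γ₀ γ₁) :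
    ∃ (c : ℝ → ℝ) (δ : ℝ), 0 < δ ∧ δ < 1 / 2 ∧ ContDiff ℝ ∞ c ∧ (∀ t, t < δ → c t = 0) ∧
      (∀ t, 1 - δ < t → c t = 1) ∧ (∀ t, c t ∈ Icc (0 : ℝ) 1) ∧
      (∀ x y, x < δ → S.toFun (x, y) = p) ∧ (∀ x y, 1 - δ < x → S.toFun (x, y) = q) ∧
      ∀ x y, S.toFun (c x, c y) = S.toFun (x, y) := by
  obtain ⟨ε, s0, s1, s2, s3, s4, s5⟩ := S.sitting
  obtain ⟨c, h1, h2, h3, h4, h5, h6, h7⟩ := TwoTransport.exists_clamp s0 s1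
  refine ⟨c, ε / 3, by linarith, by linarith, h1, h2, h3, h4, fun x y hx => s2 _ _ (by linarith),
    fun x y hx => s3 _ _ (by linarith), fun x y => ?_⟩
  rcases lt_or_ge x ε with hx | hx
  · rw [s2 _ _ hx, s2 _ _ (h5 _ hx)]
  rcases lt_or_ge (1 - ε) x with hx' | hx'
  · rw [s3 _ _ hx', s3 _ _ (h6 _ hx')]
  rw [h7 x hx hx']
  rcases lt_or_ge y ε with hy | hy
  · rw [s4 _ _ hy, s4 _ _ (h5 _ hy)]
  rcases lt_or_ge (1 - ε) y with hy' | hy'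
  · rw [s5 _ _ hy', s5 _ _ (h6 _ hy')]
  rw [h7 y hy hy']

theorem RankLE.exists_ker {F : ℝ × ℝ → M} {z : ℝ × ℝ} (h : RankLE E F 1 z) :
    ∃ n : ℝ × ℝ, n ≠ 0 ∧ tdiff E F z n = 0 := by
  by_contra! hc
  have hinj : Function.Injective (tdiff E F z).toLinearMap := by
    rw [← LinearMap.ker_eq_bot, LinearMap.ker_eq_bot']
    intro n hn
    by_contra hne
    exact hc n hne hn
  refine not_linearIndependent_of_rank_le (n := 1) h ![(1, 0), (0, 1)]
    (LinearIndependent.map_injOn (v := ![((1, 0) : ℝ × ℝ), (0, 1)]) ?_ _ hinj.injOn)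
  rw [LinearIndependent.pair_iff]
  intro s t hst
  simpa using hst

/-- A thin loop of curves factors smoothly through a vector space. -/
theorem Surface.exists_factorization {p q : M} {γ : Curve E p q} (S : Surface γ γ)
    (hS : ∀ z, RankLE E S.toFun 1 z) : ∃ (t : Finset unitSquare) (u : ℝ × ℝ → (t → ℝ × E))
      (r : (t → ℝ × E) → M) (χ : (t → ℝ × E) → ℝ) (δ : ℝ), 0 < δ ∧ δ < 1 / 2 ∧ ContDiff ℝ ∞ u ∧
      (∀ z, ∃ n ≠ 0, fderiv ℝ u z n = 0) ∧
      (∀ x y, x < δ → u (x, y) = u (0, 0)) ∧ (∀ x y, 1 - δ < x → u (x, y) = u (1, 0)) ∧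
      (∀ x y, y < δ → u (x, y) = u (x, 0)) ∧ (∀ x y, 1 - δ < y → u (x, y) = u (x, 0)) ∧
      (∀ z, r (u z) = S.toFun z) ∧ ContDiff ℝ ∞ χ ∧ (∀ z, χ (u z) = 1) ∧
      (∀ v, 0 ≤ χ v ∧ χ v ≤ 1) ∧
      ∀ v, χ v ≠ 0 → ContMDiffAt 𝓘(ℝ, t → ℝ × E) 𝓘(ℝ, E) ∞ r v := by
  obtain ⟨c, δ, hδ, hδ', hc, hc0, hc1, hcI, hp, hq, hcl⟩ := S.exists_clamp
  have hper : ∀ x, S.toFun (x, 0) = S.toFun (x, 1) := fun x => by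
    obtain ⟨ε, s0, s1, s2, s3, s4, s5⟩ := S.sitting
    rw [s4 _ _ s0, s5 _ _ (by linarith)]
  choose b ρ B hb hB hBc hBt hloc hsupp hone hρp using fun z₀ : unitSquare =>
    exists_compatible_bump (E := E) S.smooth.continuous hper z₀.2
  let φ := fun z₀ : unitSquare => extChartAt 𝓘(ℝ, E) (S.toFun z₀)
  have hρc : ∀ j : unitSquare, ∀ z : unitSquare, ContinuousAt (ρ j) z := fun j z => by
    rcases hloc j z z.2 with h | ⟨h1, h2⟩
    · exact continuousAt_const.congr h.symm
    · exact ((hb j).continuous.continuousAt.comp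
        (continuousAt_chart_comp S.smooth.continuous.continuousAt h1)).congr h2.symm
  have hsq : IsCompact unitSquare := isCompact_Icc.prod isCompact_Icc
  have : CompactSpace unitSquare := isCompact_iff_compactSpace.1 hsq
  have : Nonempty unitSquare := ⟨⟨(0, 0), by simp⟩⟩
  obtain ⟨t, ht⟩ := CompactSpace.elim_nhds_subcover (X := unitSquare)
    (fun j => {z | 1 / 2 < ρ j z}) fun j => by
      have : ContinuousAt (fun z : unitSquare => ρ j z) j :=
        ContinuousAt.comp (hρc j j) continuousAt_subtype_val
      exact continuousAt_const.eventually_lt this (by rw [hone]; norm_num)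
  -- As in Whitney's embedding, where `ρ j ≠ 0` the quotient of the two components recovers `φ j ∘
  -- S`, hence `S`; the covering makes some `ρ j` exceed 1/2 at every point of the square.
  let u₀ : ℝ × ℝ → (t → ℝ × E) := fun z j => (ρ j z, ρ j z • φ j (S.toFun z))
  let κ : ℝ × ℝ → ℝ × ℝ := fun z => (c z.1, c z.2)
  have hκ : ContDiff ℝ ∞ κ := (hc.comp contDiff_fst).prodMk (hc.comp contDiff_snd)
  have hκS : ∀ z, κ z ∈ unitSquare := fun z => ⟨hcI _, hcI _⟩
  have hκℓ : ∀ z, S.toFun (κ z) = S.toFun z := fun z => hcl _ _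
  let k : unitSquare → E → ℝ × E := fun j e => (b j e, b j e • e)
  have hk : ∀ j, ContDiff ℝ ∞ (k j) := fun j => (hb j).prodMk ((hb j).smul contDiff_id)
  let u : ℝ × ℝ → (t → ℝ × E) := fun z => u₀ (κ z)
  -- Each component is locally zero or a smooth function of `S`. Hence `u` is smooth, is constant on
  -- connected open sets where `S` is constant, and its differential is killed by the kernel of that
  -- of `S`.
  have hlu : ∀ (j : t) (z : ℝ × ℝ), (fun w => u w j) =ᶠ[𝓝 z] (fun _ => 0) ∨
      (S.toFun z ∈ (φ j).source ∧ (fun w => u w j) =ᶠ[𝓝 z] fun w => k j (φ j (S.toFun w))) := by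
    intro j z
    rcases hloc j (κ z) (hκS z) with h | ⟨h1, h2⟩
    · left
      filter_upwards [hκ.continuous.continuousAt.eventually h] with w hw
      simp only [Pi.zero_apply] at hw
      simp [u, u₀, hw]
    · right
      rw [hκℓ] at h1
      refine ⟨h1, ?_⟩
      filter_upwards [hκ.continuous.continuousAt.eventually h2] with w hw
      rw [hκℓ] at hw
      simp [u, u₀, k, hw, hκℓ, φ]
  have hφs : ∀ (j : t) (z : ℝ × ℝ), S.toFun z ∈ (φ j).source →
      ContDiffAt ℝ ∞ (fun w => φ j (S.toFun w)) z := fun j z hz => by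
    rw [← contMDiffAt_iff_contDiffAt]
    exact ContMDiffAt.comp z (contMDiffAt_extChartAt' (by simpa [φ] using hz)) (S.smooth z)
  have hu : ContDiff ℝ ∞ u := contDiff_pi.2 fun j => contDiff_iff_contDiffAt.2 fun z => by
    rcases hlu j z with h | ⟨h1, h2⟩
    · exact contDiffAt_const.congr_of_eventuallyEq h
    · exact ((hk j).contDiffAt.comp z (hφs j z h1)).congr_of_eventuallyEq h2
  have hconst : ∀ {U : Set (ℝ × ℝ)} {m : M}, IsOpen U → IsPreconnected U →
      (∀ z ∈ U, S.toFun z = m) → ∀ z ∈ U, ∀ w ∈ U, u w = u z := by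
    intro U m hUo hU hm z hz w hw
    refine eqOn_of_eventually_eq hU (fun z hz => ?_) hz hw
    have : ∀ j : t, ∀ᶠ w in 𝓝 z, u w j = u z j := fun j => by
      rcases hlu j z with h | ⟨h1, h2⟩
      · filter_upwards [h] with w hw
        rw [hw]
        exact h.eq_of_nhds.symm
      · filter_upwards [h2, hUo.mem_nhds hz] with w hw hw'
        rw [hw, hm w hw', ← hm z hz]
        exact h2.eq_of_nhds.symm
    filter_upwards [eventually_all.2 this] with w hw
    exact funext hw
  have hcx : ∀ x, u₀ (c x, 0) = u₀ (c x, 1) := fun x => funext fun j => by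
    simp only [u₀, hρp j _ (hcI x), hper]
  have hA : ∀ j : t, IsCompact ((fun z : unitSquare => u₀ z) '' {z | 1 / 2 ≤ ρ j z}) := fun j => by
    have hcl : IsClosed {z : unitSquare | 1 / 2 ≤ ρ j z} := isClosed_le continuous_const
      (continuous_iff_continuousAt.2 fun z => (hρc j z).comp continuousAt_subtype_val)
    refine hcl.isCompact.image (continuous_pi fun j => continuous_iff_continuousAt.2 fun z => ?_)
    have hkz : ContinuousAt (fun z => (ρ j z, ρ j z • φ j (S.toFun z))) (z : ℝ × ℝ) := by
      rcases hloc j z z.2 with h | ⟨h1, h2⟩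
      · refine (continuousAt_const (y := (0 : ℝ × E))).congr ?_
        filter_upwards [h] with w hw
        simp only [Pi.zero_apply] at hw
        simp only [hw, zero_smul]
        rfl
      · refine ((hk j).continuous.continuousAt.comp
          (continuousAt_chart_comp S.smooth.continuous.continuousAt h1)).congr ?_
        filter_upwards [h2] with w hw
        simp [hw, k, φ]
    exact ContinuousAt.comp hkz continuousAt_subtype_val
  obtain ⟨r, hr⟩ := exists_factorsAt_iUnion (E := E) (Z := unitSquare) (u := fun z => u₀ z)
    (ℓ := fun z => S.toFun z) (Finset.univ : Finset t) hA (fun j => image_subset_range _ _)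
    fun j => ⟨S.toFun j, B j, {v | (v j).1 ≠ 0 ∧ ((v j).1)⁻¹ • (v j).2 ∈ B j},
      fun v => ((v j).1)⁻¹ • (v j).2, hB j, hBc j, hBt j, by
        rw [isOpen_iff_mem_nhds]
        rintro v ⟨h1, h2⟩
        have hc1 : ContinuousAt (fun v : t → ℝ × E => (v j).1) v :=
          (continuous_apply j).fst.continuousAt
        have hc2 : ContinuousAt (fun v : t → ℝ × E => (v j).2) v :=
          (continuous_apply j).snd.continuousAt
        filter_upwards [hc1.eventually_ne h1, ((hc1.inv₀ h1).smul hc2).eventually_mem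
          ((hB j).mem_nhds h2)] with w hw hw'
        exact ⟨hw, hw'⟩, by
        rintro _ ⟨z, hz, rfl⟩
        have hne : ρ j z ≠ 0 := by
          have : 1 / 2 ≤ ρ j z := hz
          linarith
        refine ⟨hne, ?_⟩
        simp only [u₀, smul_smul, inv_mul_cancel₀ hne, one_smul]
        exact (hsupp j z z.2 hne).2, fun v hv => ⟨by
          have hc1 : ContDiffAt ℝ ∞ (fun v : t → ℝ × E => (v j).1) v :=
            (contDiff_apply ℝ (ℝ × E) j).fst.contDiffAt
          have hc2 : ContDiffAt ℝ ∞ (fun v : t → ℝ × E => (v j).2) v :=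
            (contDiff_apply ℝ (ℝ × E) j).snd.contDiffAt
          exact (hc1.inv hv.1).smul hc2, hv.2⟩, fun z hz => by
        have hne : ρ j z ≠ 0 := hz.1
        refine ⟨(hsupp j z z.2 hne).1, ?_⟩
        simp only [u₀, smul_smul, inv_mul_cancel₀ hne, one_smul]
        rfl⟩
  have hmem : ∀ z : unitSquare, u₀ z ∈ ⋃ j ∈ (Finset.univ : Finset t),
      (fun z : unitSquare => u₀ z) '' {z | 1 / 2 ≤ ρ j z} := fun z => by
    have hz : z ∈ ⋃ j ∈ t, {z : unitSquare | 1 / 2 < ρ j z} := by rw [ht]; trivial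
    simp only [mem_iUnion] at hz
    obtain ⟨j, hj, hz⟩ := hz
    simp only [mem_iUnion]
    exact ⟨⟨j, hj⟩, Finset.mem_univ _, z, (show 1 / 2 < ρ j z from hz).le, rfl⟩
  obtain ⟨χ, hχ, hχ0, hχ1, hχ2⟩ := exists_smooth_cutoff
    (W := interior {v | FactorsAt E (fun z : unitSquare => u₀ z) (fun z => S.toFun z) r v})
    ((Finset.univ : Finset t).isCompact_biUnion fun j _ => hA j).isClosed isOpen_interior
    fun a ha => mem_interior_iff_mem_nhds.2 (hr a ha)
  refine ⟨t, u, r, χ, δ, hδ, hδ', hu, fun z => ?_, fun x y hx => ?_, fun x y hx => ?_,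
    fun x y hy => ?_, fun x y hy => ?_, fun z => ?_, hχ, fun z => ?_, hχ2, fun v hv => ?_⟩
  · obtain ⟨n, hn, hn'⟩ := (hS z).exists_ker
    refine ⟨n, hn, funext fun j => ?_⟩
    have hud : DifferentiableAt ℝ u z := hu.contDiffAt.differentiableAt (by simp)
    have h0 : fderiv ℝ (fun w => u w j) z n = (fderiv ℝ u z n) j := by
      rw [fderiv_apply hud]; rfl
    rw [← h0]
    rcases hlu j z with h | ⟨h1, h2⟩
    · rw [h.fderiv_eq]; simp
    · rw [h2.fderiv_eq]
      have hd := (hφs j z h1).differentiableAt (by simp)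
      have hφ0 : fderiv ℝ (fun w => φ j (S.toFun w)) z n = 0 := by
        have hm1 : MDifferentiableAt 𝓘(ℝ, E) 𝓘(ℝ, E) (φ j) (S.toFun z) :=
          (contMDiffAt_extChartAt' (n := ∞) (by simpa [φ] using h1)).mdifferentiableAt (by simp)
        have hm2 := mfderiv_comp z hm1 ((S.smooth z).mdifferentiableAt (by simp))
        rw [← mfderiv_eq_fderiv]
        refine (congrArg (fun D : ℝ × ℝ →L[ℝ] E => D n) hm2).trans ?_
        change (mfderiv 𝓘(ℝ, E) 𝓘(ℝ, E) (φ j) (S.toFun z) : E →L[ℝ] E) (tdiff E S.toFun z n) = 0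
        rw [hn']
        exact map_zero (mfderiv 𝓘(ℝ, E) 𝓘(ℝ, E) (φ j) (S.toFun z) : E →L[ℝ] E)
      have hcomp : fderiv ℝ (fun w => k j (φ j (S.toFun w))) z n =
          fderiv ℝ (k j) (φ j (S.toFun z)) (fderiv ℝ (fun w => φ j (S.toFun w)) z n) := by
        rw [show (fun w => k j (φ j (S.toFun w))) = k j ∘ fun w => φ j (S.toFun w) from rfl,
          fderiv_comp z ((hk j).contDiffAt.differentiableAt (by simp)) hd]
        rfl
      rw [hcomp, hφ0, map_zero]
      rfl
  · exact hconst (isOpen_Iio.prod isOpen_univ) (isPreconnected_Iio.prod isPreconnected_univ)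
      (fun z hz => hp z.1 z.2 hz.1) (0, 0) ⟨hδ, trivial⟩ (x, y) ⟨hx, trivial⟩
  · exact hconst (isOpen_Ioi.prod isOpen_univ) (isPreconnected_Ioi.prod isPreconnected_univ)
      (fun z hz => hq z.1 z.2 hz.1) (1, 0) ⟨by simp [hδ], trivial⟩ (x, y) ⟨hx, trivial⟩
  · simp only [u, κ, hc0 y hy, hc0 0 hδ]
  · simp only [u, κ, hc1 y hy, hc0 0 hδ, hcx]
  · have hf := (hr (u z) (hmem ⟨κ z, hκS z⟩)).self_of_nhds
    exact (hf.2 ⟨κ z, hκS z⟩ rfl).trans (hκℓ z)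
  · exact (hχ1 (u z) (hmem ⟨κ z, hκS z⟩)).self_of_nhds
  · by_contra h
    refine hv (hχ0 v (fun hv' => h ?_)).self_of_nhds
    exact (interior_subset hv').1

end Factorization

end TwoTransport

namespace TwoTransport

/-! ### Contraction of a family of curves with parallel partial derivatives. -/

section Development

variable {X : Type*} [NormedAddCommGroup X] [NormedSpace ℝ X] [FiniteDimensional ℝ X]

theorem hasDerivAt_mk_left (x y : ℝ) : HasDerivAt (fun s : ℝ => ((s, y) : ℝ × ℝ)) (1, 0) x :=
  (hasDerivAt_id x).prodMk (hasDerivAt_const x y)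

theorem hasDerivAt_mk_right (x y : ℝ) : HasDerivAt (fun s : ℝ => ((x, s) : ℝ × ℝ)) (0, 1) y :=
  (hasDerivAt_const y x).prodMk (hasDerivAt_id y)

theorem hasDerivAt_fst_slice {Y : Type*} [NormedAddCommGroup Y] [NormedSpace ℝ Y] {f : ℝ × ℝ → Y}
    (hf : ContDiff ℝ ∞ f) (x y : ℝ) :
    HasDerivAt (fun s => f (s, y)) (fderiv ℝ f (x, y) (1, 0)) x :=
  HasFDerivAt.comp_hasDerivAt (f := fun s : ℝ => ((s, y) : ℝ × ℝ)) x
    (hf.contDiffAt.differentiableAt (by simp)).hasFDerivAt (hasDerivAt_mk_left x y)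

theorem hasDerivAt_snd_slice {Y : Type*} [NormedAddCommGroup Y] [NormedSpace ℝ Y] {f : ℝ × ℝ → Y}
    (hf : ContDiff ℝ ∞ f) (x y : ℝ) :
    HasDerivAt (fun s => f (x, s)) (fderiv ℝ f (x, y) (0, 1)) y :=
  HasFDerivAt.comp_hasDerivAt (f := fun s : ℝ => ((x, s) : ℝ × ℝ)) y
    (hf.contDiffAt.differentiableAt (by simp)).hasFDerivAt (hasDerivAt_mk_right x y)

/-- If `u` has parallel partial derivatives and `∂ₓV = g(V) ∂ₓu`, with `V` and `u` constant on
`x = 0`, then `∂_y V = g(V) ∂_y u`. -/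
theorem fderiv_snd_of_fderiv_fst {u V : ℝ × ℝ → X} {g : X → ℝ} (hu : ContDiff ℝ ∞ u)
    (hV : ContDiff ℝ ∞ V) (hg : ContDiff ℝ ∞ g) (hpar : ∀ z, ∃ n ≠ 0, fderiv ℝ u z n = 0)
    (hd : ∀ z, fderiv ℝ V z (1, 0) = g (V z) • fderiv ℝ u z (1, 0))
    (hV0 : ∀ y, V (0, y) = V (0, 0)) (hu0 : ∀ y, u (0, y) = u (0, 0)) (z : ℝ × ℝ) :
    fderiv ℝ V z (0, 1) = g (V z) • fderiv ℝ u z (0, 1) := by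
  obtain ⟨x, y⟩ := z
  have hu' : ContDiff ℝ ∞ (fderiv ℝ u) := hu.fderiv_right (by simp)
  have hV' : ContDiff ℝ ∞ (fderiv ℝ V) := hV.fderiv_right (by simp)
  have hg' : ContDiff ℝ ∞ (fderiv ℝ g) := hg.fderiv_right (by simp)
  have hgV : ContDiff ℝ ∞ (fun z => g (V z)) := hg.comp hV
  have hsymm : ∀ {f : ℝ × ℝ → X}, ContDiff ℝ ∞ f → ∀ z, fderiv ℝ (fderiv ℝ f) z (1, 0) (0, 1) =
      fderiv ℝ (fderiv ℝ f) z (0, 1) (1, 0) := fun hf z =>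
    (hf.contDiffAt.isSymmSndFDerivAt (by
      simp only [minSmoothness_of_isRCLikeNormedField]; exact ENat.LEInfty.out)).eq _ _
  have happly : ∀ {f : ℝ × ℝ → X}, ContDiff ℝ ∞ f → ∀ (e : ℝ × ℝ) (z : ℝ × ℝ), HasFDerivAt
      (fun z => fderiv ℝ f z e) ((ContinuousLinearMap.apply ℝ X e).comp
        (fderiv ℝ (fderiv ℝ f) z)) z := fun hf e z =>
    (ContinuousLinearMap.apply ℝ X e).hasFDerivAt.comp z
      ((hf.fderiv_right (m := ∞) (by simp)).contDiffAt.differentiableAt (by simp)).hasFDerivAt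
  have hgVd : ∀ z, HasFDerivAt (fun z => g (V z)) ((fderiv ℝ g (V z)).comp (fderiv ℝ V z)) z :=
    fun z => (hg.contDiffAt.differentiableAt (by simp)).hasFDerivAt.comp z
      (hV.contDiffAt.differentiableAt (by simp)).hasFDerivAt
  have hmixed : ∀ z, fderiv ℝ (fderiv ℝ V) z (0, 1) (1, 0) =
      g (V z) • fderiv ℝ (fderiv ℝ u) z (0, 1) (1, 0) +
        fderiv ℝ g (V z) (fderiv ℝ V z (0, 1)) • fderiv ℝ u z (1, 0) := fun z => by
    have h1 := happly hV (1, 0) z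
    have h2 : HasFDerivAt (fun z => fderiv ℝ V z (1, 0)) _ z :=
      ((hgVd z).smul (happly hu (1, 0) z)).congr_of_eventuallyEq (Eventually.of_forall hd)
    have h3 := congrArg (fun D : ℝ × ℝ →L[ℝ] X => D (0, 1)) (h1.unique h2)
    simpa using h3
  -- The expression `L(b) a - L(a) b` is alternating in `a, b`, so it vanishes on the two parallel
  -- partial derivatives.
  have hcross : ∀ (z : ℝ × ℝ) (L : X →L[ℝ] ℝ),
      L (fderiv ℝ u z (0, 1)) • fderiv ℝ u z (1, 0) =
        L (fderiv ℝ u z (1, 0)) • fderiv ℝ u z (0, 1) := fun z L => by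
    obtain ⟨⟨a, b⟩, hn, h0⟩ := hpar z
    have h1 : a • fderiv ℝ u z (1, 0) + b • fderiv ℝ u z (0, 1) = 0 := by
      rw [← h0, ← map_smul, ← map_smul, ← map_add]
      congr 1
      ext <;> simp
    by_cases ha : a = 0
    · have hb : b ≠ 0 := fun hb => hn (by rw [ha, hb]; rfl)
      rw [ha, zero_smul, zero_add, smul_eq_zero, or_iff_right hb] at h1
      simp [h1]
    · have h2 : fderiv ℝ u z (1, 0) = (-(a⁻¹ * b)) • fderiv ℝ u z (0, 1) := by
        rw [neg_smul, mul_smul, ← smul_neg, ← eq_neg_of_add_eq_zero_left h1, smul_smul,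
          inv_mul_cancel₀ ha, one_smul]
      rw [h2, map_smul, smul_comm, smul_assoc]
  -- The defect satisfies the homogeneous linear equation `w' = dg(w) ∂ₓu` and vanishes at `x = 0`.
  -- It is compared with the zero solution after `x` has been added to the state.
  let w : ℝ → X := fun x => fderiv ℝ V (x, y) (0, 1) - g (V (x, y)) • fderiv ℝ u (x, y) (0, 1)
  let F : X × ℝ → X × ℝ := fun v =>
    (fderiv ℝ g (V (v.2, y)) v.1 • fderiv ℝ u (v.2, y) (1, 0), 1)
  have hF : ContDiff ℝ ∞ F := by
    have hl : ContDiff ℝ ∞ (fun v : X × ℝ => ((v.2, y) : ℝ × ℝ)) := by fun_prop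
    exact (((hg'.comp (hV.comp hl)).clm_apply contDiff_fst).smul
      ((hu'.comp hl).clm_apply contDiff_const)).prodMk contDiff_const
  have hw : ∀ x, HasDerivAt w (fderiv ℝ g (V (x, y)) (w x) • fderiv ℝ u (x, y) (1, 0)) x :=
    fun x => by
    have e1 : HasDerivAt (fun x => fderiv ℝ V (x, y) (0, 1))
        (fderiv ℝ (fderiv ℝ V) (x, y) (1, 0) (0, 1)) x :=
      (happly hV (0, 1) (x, y)).comp_hasDerivAt (f := fun s : ℝ => ((s, y) : ℝ × ℝ)) x
        (hasDerivAt_mk_left x y)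
    have e2 : HasDerivAt (fun x => fderiv ℝ u (x, y) (0, 1))
        (fderiv ℝ (fderiv ℝ u) (x, y) (1, 0) (0, 1)) x :=
      (happly hu (0, 1) (x, y)).comp_hasDerivAt (f := fun s : ℝ => ((s, y) : ℝ × ℝ)) x
        (hasDerivAt_mk_left x y)
    have e3 : HasDerivAt (fun x => g (V (x, y)))
        (fderiv ℝ g (V (x, y)) (fderiv ℝ V (x, y) (1, 0))) x :=
      (hgVd (x, y)).comp_hasDerivAt (f := fun s : ℝ => ((s, y) : ℝ × ℝ)) x (hasDerivAt_mk_left x y)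
    have e4 : HasDerivAt w _ x := e1.sub (e3.smul e2)
    convert e4 using 1
    rw [hsymm hV, hsymm hu, hmixed, hd]
    simp only [w, map_sub, map_smul, sub_smul, smul_eq_mul, mul_smul]
    rw [hcross (x, y) (fderiv ℝ g (V (x, y)))]
    abel
  have hw0 : w 0 = 0 := by
    have e1 := hasDerivAt_snd_slice hV 0 y
    have e2 := hasDerivAt_snd_slice hu 0 y
    simp only [hV0] at e1
    simp only [hu0] at e2
    simp only [w]
    rw [e1.unique (hasDerivAt_const _ _), e2.unique (hasDerivAt_const _ _)]
    simp
  have key := integralCurve_unique hF isPreconnected_univ isOpen_univ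
    (α := fun x => (w x, x)) (β := fun x => (0, x))
    (fun x _ => (hw x).prodMk (hasDerivAt_id x))
    (fun x _ => by simpa [F] using (hasDerivAt_const x (0 : X)).prodMk (hasDerivAt_id x))
    (mem_univ 0) (by rw [hw0]) (mem_univ x)
  exact sub_eq_zero.1 (congrArg Prod.fst key)

/-- Compactness gives the bound on the unit square. For y outside `[0, 1]` the values are those on
`y = 0`, and for x outside `[0, 1]` the derivative is zero. -/
theorem exists_bound_fderiv_fst {u : ℝ × ℝ → X} (hu : ContDiff ℝ ∞ u) {δ : ℝ} (hδ : 0 < δ)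
    (hx0 : ∀ x y, x < δ → u (x, y) = u (0, 0)) (hx1 : ∀ x y, 1 - δ < x → u (x, y) = u (1, 0))
    (hy0 : ∀ x y, y < δ → u (x, y) = u (x, 0)) (hy1 : ∀ x y, 1 - δ < y → u (x, y) = u (x, 0)) :
    ∃ C, ∀ z, ‖fderiv ℝ u z (1, 0)‖ ≤ C := by
  have hu' : ContDiff ℝ ∞ (fderiv ℝ u) := hu.fderiv_right (by simp)
  obtain ⟨C, hC⟩ := (isCompact_Icc.prod isCompact_Icc : IsCompact unitSquare).exists_bound_of_continuousOn
    (hu'.continuous.clm_apply (continuous_const (y := ((1, 0) : ℝ × ℝ)))).continuousOn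
  have hred : ∀ x y, y ∉ Icc (0 : ℝ) 1 →
      fderiv ℝ u (x, y) (1, 0) = fderiv ℝ u (x, 0) (1, 0) := fun x y hy => by
    have e : ∀ x, u (x, y) = u (x, 0) := fun x => by
      rcases lt_or_ge y 0 with h | h
      · exact hy0 x y (by linarith)
      · refine hy1 x y ?_
        by_contra h'
        exact hy ⟨h, by linarith⟩
    have e1 := hasDerivAt_fst_slice hu x y
    simp only [e] at e1
    exact e1.unique (hasDerivAt_fst_slice hu x 0)
  have hC0 : 0 ≤ C := (norm_nonneg _).trans (hC (0, 0) (by simp))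
  have key : ∀ x, ∀ y ∈ Icc (0 : ℝ) 1, ‖fderiv ℝ u (x, y) (1, 0)‖ ≤ C := fun x y hy => by
    by_cases hx : x ∈ Icc (0 : ℝ) 1
    · exact hC _ ⟨hx, hy⟩
    · have e : ∃ v, ∀ᶠ s in 𝓝 x, u (s, y) = v := by
        rcases lt_or_ge x 0 with h | h
        · exact ⟨_, by filter_upwards [gt_mem_nhds (show x < δ by linarith)] with s hs
                       exact hx0 s y hs⟩
        · have h1 : 1 - δ < x := by
            by_contra h'
            exact hx ⟨h, by linarith⟩
          exact ⟨_, by filter_upwards [lt_mem_nhds h1] with s hs; exact hx1 s y hs⟩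
      obtain ⟨v, hv⟩ := e
      rw [(hasDerivAt_fst_slice hu x y).unique ((hasDerivAt_const x v).congr_of_eventuallyEq hv),
        norm_zero]
      exact hC0
  refine ⟨C, fun ⟨x, y⟩ => ?_⟩
  by_cases hy : y ∈ Icc (0 : ℝ) 1
  · exact key x y hy
  · rw [hred x y hy]
    exact key x 0 (by simp)

/-- A family of curves with parallel partial derivatives can be contracted, staying in the domain
where `χ ≠ 0`, in such a way that the end points only depend on the parameter of the contraction. -/
theorem exists_contraction {u : ℝ × ℝ → X} (hu : ContDiff ℝ ∞ u) {δ : ℝ} (hδ : 0 < δ)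
    (hpar : ∀ z, ∃ n ≠ 0, fderiv ℝ u z n = 0)
    (hx0 : ∀ x y, x < δ → u (x, y) = u (0, 0)) (hx1 : ∀ x y, 1 - δ < x → u (x, y) = u (1, 0))
    (hy0 : ∀ x y, y < δ → u (x, y) = u (x, 0)) (hy1 : ∀ x y, 1 - δ < y → u (x, y) = u (x, 0))
    {χ : X → ℝ} (hχ : ContDiff ℝ ∞ χ) (hχu : ∀ z, χ (u z) = 1) (hχ1 : ∀ v, 0 ≤ χ v ∧ χ v ≤ 1) :
    ∃ V : ℝ × ℝ × ℝ → X, ContDiff ℝ ∞ V ∧ (∀ w, ∃ n ≠ 0, fderiv ℝ V w n = 0) ∧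
      (∀ w, χ (V w) ≠ 0) ∧ (∀ x y, V (x, y, 1) = u (x, y)) ∧ (∀ x y, V (x, y, 0) = u (0, 0)) ∧
      (∀ x y s, x < δ → V (x, y, s) = u (0, 0)) ∧
      (∀ x y s, 1 - δ < x → V (x, y, s) = V (1, 0, s)) ∧
      (∀ x y s, y < δ → V (x, y, s) = V (x, 0, s)) ∧
      (∀ x y s, 1 - δ < y → V (x, y, s) = V (x, 0, s)) := by
  obtain ⟨c, hc, hc0, hc1, hc2⟩ := exists_step
  obtain ⟨C, hC⟩ := exists_bound_fderiv_fst hu hδ hx0 hx1 hy0 hy1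
  have hu' : ContDiff ℝ ∞ (fderiv ℝ u) := hu.fderiv_right (by simp)
  -- The equation `∂ₓV = χ(V) c(s) ∂ₓu` with `x, y, s` as state variables. The factor `c(s)` shrinks
  -- the curves from `u` to a point, and `χ(V)` keeps them where the factorization is defined.
  let F : X × ℝ × ℝ × ℝ → X × ℝ × ℝ × ℝ := fun v =>
    ((χ v.1 * c v.2.2.2) • fderiv ℝ u (v.2.1, v.2.2.1) (1, 0), 1, 0, 0)
  have hF : ContDiff ℝ ∞ F := by
    have hl : ContDiff ℝ ∞ (fun v : X × ℝ × ℝ × ℝ => ((v.2.1, v.2.2.1) : ℝ × ℝ)) := by fun_prop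
    have hl' : ContDiff ℝ ∞ (fun v : X × ℝ × ℝ × ℝ => v.2.2.2) := by fun_prop
    exact (((hχ.comp contDiff_fst).mul (hc.comp hl')).smul
      ((hu'.comp hl).clm_apply contDiff_const)).prodMk contDiff_const
  have hFb : ∀ v, ‖F v‖ ≤ max C 1 := fun v => by
    have h1 : ‖(χ v.1 * c v.2.2.2) • fderiv ℝ u (v.2.1, v.2.2.1) (1, 0)‖ ≤ C := by
      rw [norm_smul, Real.norm_of_nonneg (mul_nonneg (hχ1 _).1 (hc2 _).1)]
      refine (mul_le_of_le_one_left (norm_nonneg _) ?_).trans (hC _)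
      exact mul_le_one₀ (hχ1 _).2 (hc2 _).1 (hc2 _).2
    exact (Prod.norm_def _).le.trans (max_le_max h1 (by simp [F, Prod.norm_def]))
  obtain ⟨Φ, hΦ, hΦ0, hΦd⟩ := exists_smooth_flow hF hFb
  let V : ℝ × ℝ × ℝ → X := fun w => (Φ (w.1, u (0, 0), 0, w.2.1, w.2.2)).1
  have hV : ContDiff ℝ ∞ V := (hΦ.comp (by fun_prop)).fst
  -- the other components of the flow
  have hsnd : ∀ x y s, (Φ (x, u (0, 0), 0, y, s)).2 = (x, y, s) := fun x y s => by
    have h1 : ∀ t, HasDerivAt (fun t => (Φ (t, u (0, 0), 0, y, s)).2 - (t, y, s)) 0 t := fun t => by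
      have h2 := (hΦd t (u (0, 0), 0, y, s)).snd
      have h3 : HasDerivAt (fun t : ℝ => ((t, y, s) : ℝ × ℝ × ℝ)) (1, 0, 0) t :=
        (hasDerivAt_id t).prodMk (hasDerivAt_const t _)
      exact HasDerivAt.congr_deriv (HasDerivAt.sub h2 h3) (sub_self _)
    have h4 := is_const_of_deriv_eq_zero (fun t => (h1 t).differentiableAt)
      (fun t => (h1 t).deriv) x 0
    simp only [hΦ0, sub_self] at h4
    exact sub_eq_zero.1 h4
  have hV0 : ∀ y s, V (0, y, s) = u (0, 0) := fun y s => by simp [V, hΦ0]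
  have hpair : ∀ x y s, Φ (x, u (0, 0), 0, y, s) = (V (x, y, s), x, y, s) := fun x y s =>
    Prod.ext rfl (hsnd x y s)
  have hVd : ∀ x y s, HasDerivAt (fun x => V (x, y, s))
      ((χ (V (x, y, s)) * c s) • fderiv ℝ u (x, y) (1, 0)) x := fun x y s => by
    have h2 := (hΦd x (u (0, 0), 0, y, s)).fst
    rwa [hpair] at h2
  have huniq : ∀ {I : Set ℝ}, IsPreconnected I → IsOpen I → ∀ (w : ℝ → X) (y s : ℝ),
      (∀ x ∈ I, HasDerivAt w ((χ (w x) * c s) • fderiv ℝ u (x, y) (1, 0)) x) →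
      ∀ x₀ ∈ I, w x₀ = V (x₀, y, s) → ∀ x ∈ I, w x = V (x, y, s) := by
    intro I hI hIo w y s hw x₀ hx₀ h0 x hx
    have key := integralCurve_unique hF hI hIo
      (α := fun x => (w x, x, y, s)) (β := fun x => (V (x, y, s), x, y, s))
      (fun x hx => (hw x hx).prodMk ((hasDerivAt_id x).prodMk (hasDerivAt_const x _)))
      (fun x _ => (hVd x y s).prodMk ((hasDerivAt_id x).prodMk (hasDerivAt_const x _)))
      hx₀ (by rw [h0]) hx
    exact congrArg Prod.fst key
  have hux : ∀ x y, x < δ → fderiv ℝ u (x, y) (1, 0) = 0 := fun x y hx =>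
    (hasDerivAt_fst_slice hu x y).unique ((hasDerivAt_const x (u (0, 0))).congr_of_eventuallyEq
      (by filter_upwards [gt_mem_nhds hx] with s hs; exact hx0 s y hs))
  have hux1 : ∀ x y, 1 - δ < x → fderiv ℝ u (x, y) (1, 0) = 0 := fun x y hx =>
    (hasDerivAt_fst_slice hu x y).unique ((hasDerivAt_const x (u (1, 0))).congr_of_eventuallyEq
      (by filter_upwards [lt_mem_nhds hx] with s hs; exact hx1 s y hs))
  have huy1 : ∀ x y, 1 - δ < x → fderiv ℝ u (x, y) (0, 1) = 0 := fun x y hx => by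
    have e1 := hasDerivAt_snd_slice hu x y
    simp only [hx1 x _ hx] at e1
    exact e1.unique (hasDerivAt_const _ _)
  have hyeq : ∀ y, (∀ x, u (x, y) = u (x, 0)) → ∀ x s, V (x, y, s) = V (x, 0, s) := by
    intro y hy x s
    refine huniq isPreconnected_univ isOpen_univ (fun x => V (x, y, s)) 0 s (fun x _ => ?_) 0
      (mem_univ _) (by simp only [hV0]) x (mem_univ x)
    have e1 := hasDerivAt_fst_slice hu x y
    simp only [hy] at e1
    rw [← e1.unique (hasDerivAt_fst_slice hu x 0)]
    have e2 := hVd x y s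
    exact e2
  have hdx : ∀ x y s, fderiv ℝ V (x, y, s) (1, 0, 0) =
      (χ (V (x, y, s)) * c s) • fderiv ℝ u (x, y) (1, 0) := fun x y s => by
    have h1 : HasDerivAt (fun t : ℝ => ((t, y, s) : ℝ × ℝ × ℝ)) (1, 0, 0) x :=
      (hasDerivAt_id x).prodMk (hasDerivAt_const x _)
    exact (HasFDerivAt.comp_hasDerivAt (f := fun t : ℝ => ((t, y, s) : ℝ × ℝ × ℝ)) x
      (hV.contDiffAt.differentiableAt (by simp)).hasFDerivAt h1).unique (hVd x y s)
  have hsl : ∀ s, ContDiff ℝ ∞ (fun z : ℝ × ℝ => V (z.1, z.2, s)) := fun s =>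
    hV.comp (by fun_prop)
  -- The equation carries over to the y-direction because the partial derivatives of `u` are
  -- parallel. A kernel vector `(a, b)` of the differential of `u` therefore gives the kernel vector
  -- `(a, b, 0)` of that of `V`.
  have hdy : ∀ x y s, HasDerivAt (fun y => V (x, y, s))
      ((χ (V (x, y, s)) * c s) • fderiv ℝ u (x, y) (0, 1)) y := fun x y s => by
    have h1 := hasDerivAt_snd_slice (hsl s) x y
    rwa [fderiv_snd_of_fderiv_fst (g := fun v => χ v * c s) hu (hsl s) (hχ.mul contDiff_const) hpar
      (fun z => (hasDerivAt_fst_slice (hsl s) z.1 z.2).unique (hVd z.1 z.2 s))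
      (fun y => by simp only [hV0]) (fun y => hx0 0 y hδ)] at h1
  have hdy' : ∀ x y s, fderiv ℝ V (x, y, s) (0, 1, 0) =
      (χ (V (x, y, s)) * c s) • fderiv ℝ u (x, y) (0, 1) := fun x y s => by
    have h1 : HasDerivAt (fun t : ℝ => ((x, t, s) : ℝ × ℝ × ℝ)) (0, 1, 0) y :=
      (hasDerivAt_const y x).prodMk ((hasDerivAt_id y).prodMk (hasDerivAt_const y s))
    exact (HasFDerivAt.comp_hasDerivAt (f := fun t : ℝ => ((x, t, s) : ℝ × ℝ × ℝ)) y
      (hV.contDiffAt.differentiableAt (by simp)).hasFDerivAt h1).unique (hdy x y s)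
  refine ⟨V, hV, fun w => ?_, fun w => ?_, fun x y => ?_, fun x y => ?_, fun x y s hx => ?_,
    fun x y s hx => ?_, fun x y s hy => hyeq y (fun x => hy0 x y hy) x s,
    fun x y s hy => hyeq y (fun x => hy1 x y hy) x s⟩
  · obtain ⟨x, y, s⟩ := w
    obtain ⟨⟨a, b⟩, hn, h0⟩ := hpar (x, y)
    refine ⟨(a, b, 0), fun h => hn (by simp only [Prod.mk_eq_zero] at h ⊢; exact ⟨h.1, h.2.1⟩), ?_⟩
    have e1 : ((a, b, 0) : ℝ × ℝ × ℝ) = a • (1, 0, 0) + b • (0, 1, 0) := by ext <;> simp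
    have e2 : ((a, b) : ℝ × ℝ) = a • (1, 0) + b • (0, 1) := by ext <;> simp
    rw [e2, map_add, map_smul, map_smul] at h0
    rw [e1, map_add, map_smul, map_smul, hdx, hdy', smul_comm a, smul_comm b, ← smul_add, h0,
      smul_zero]
  · obtain ⟨x, y, s⟩ := w
    intro h0
    -- A zero of `χ` is stationary for the equation, so a solution that starts where `χ = 1` never
    -- reaches it.
    have h1 := huniq isPreconnected_univ isOpen_univ (fun _ => V (x, y, s)) y s (fun t _ => by
      rw [h0, zero_mul, zero_smul]; exact hasDerivAt_const _ _) x (mem_univ _) rfl 0 (mem_univ _)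
    rw [h1, hV0, hχu] at h0
    exact one_ne_zero h0
  · refine (huniq isPreconnected_univ isOpen_univ (fun x => u (x, y)) y 1 (fun t _ => ?_) 0
      (mem_univ _) (by rw [hV0, hx0 0 y hδ]) x (mem_univ _)).symm
    rw [hχu, hc1 1 (by norm_num), mul_one, one_smul]
    exact hasDerivAt_fst_slice hu t y
  · refine (huniq isPreconnected_univ isOpen_univ (fun _ => u (0, 0)) y 0 (fun t _ => ?_) 0
      (mem_univ _) (by rw [hV0]) x (mem_univ _)).symm
    rw [hc0 0 (by norm_num), mul_zero, zero_smul]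
    exact hasDerivAt_const _ _
  · refine (huniq isPreconnected_Iio isOpen_Iio (fun _ => u (0, 0)) y s (fun t ht => ?_) 0
      (mem_Iio.2 hδ) (by rw [hV0]) x hx).symm
    rw [hux t y ht, smul_zero]
    exact hasDerivAt_const _ _
  · have h1 : V (1, 0, s) = V (x, 0, s) :=
      huniq isPreconnected_Ioi isOpen_Ioi (fun _ => V (1, 0, s)) 0 s (fun t ht => by
        rw [hux1 t 0 ht, smul_zero]
        exact hasDerivAt_const _ _) 1 (mem_Ioi.2 (by linarith)) rfl x hx
    -- Near `x = 1` also `∂_y u = 0`, so the end points of the shrunk curves are independent of y.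
    have h2 : ∀ t, HasDerivAt (fun y => V (x, y, s)) 0 t := fun t => by
      have := hdy x t s
      rwa [huy1 x t hx, smul_zero] at this
    rw [h1]
    exact is_const_of_deriv_eq_zero (fun t => (h2 t).differentiableAt) (fun t => (h2 t).deriv) y 0

end Development

end TwoTransport

namespace TwoTransport

/-! ### Thin loops are trivial relative to the boundary. -/

section Filling

variable {E M : Type*} [NormedAddCommGroup E] [NormedSpace ℝ E] [FiniteDimensional ℝ E]
  [TopologicalSpace M] [ChartedSpace E M] [IsManifold 𝓘(ℝ, E) ∞ M]

/-- Rank-nullity in dimension three. -/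
theorem rankLE_two_of_ker {F : ℝ × ℝ × ℝ → M} {z n : ℝ × ℝ × ℝ} (hn : n ≠ 0)
    (h : tdiff E F z n = 0) : RankLE E F 2 z := by
  unfold RankLE
  set D := (tdiff E F z).toLinearMap with hD
  have h1 := D.finrank_range_add_finrank_ker
  have h2 : 0 < Module.finrank ℝ (LinearMap.ker D) := by
    rw [Module.finrank_pos_iff_exists_ne_zero]
    exact ⟨⟨n, h⟩, fun h0 => hn (congrArg Subtype.val h0)⟩
  have h3 : Module.finrank ℝ (ℝ × ℝ × ℝ) = 3 := by simp
  rw [LinearMap.rank, ← Module.finrank_eq_rank]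
  exact_mod_cast (by omega : Module.finrank ℝ (LinearMap.range D) ≤ 2)

/-- A smooth function with values `1` on `[1/3, 2/3]` that vanishes outside `[1/6, 5/6]`. -/
noncomputable def plateau (y : ℝ) : ℝ :=
  Real.smoothTransition (6 * y - 1) * Real.smoothTransition (5 - 6 * y)

theorem contDiff_plateau : ContDiff ℝ ∞ plateau :=
  (Real.smoothTransition.contDiff.comp (by fun_prop)).mul
    (Real.smoothTransition.contDiff.comp (by fun_prop))

theorem plateau_mem (y : ℝ) : 0 ≤ plateau y ∧ plateau y ≤ 1 :=
  ⟨mul_nonneg (Real.smoothTransition.nonneg _) (Real.smoothTransition.nonneg _),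
    mul_le_one₀ (Real.smoothTransition.le_one _) (Real.smoothTransition.nonneg _)
      (Real.smoothTransition.le_one _)⟩

theorem plateau_left {y : ℝ} (h : y ≤ 1 / 6) : plateau y = 0 := by
  rw [plateau, Real.smoothTransition.zero_of_nonpos (by linarith), zero_mul]

theorem plateau_right {y : ℝ} (h : 5 / 6 ≤ y) : plateau y = 0 := by
  rw [plateau, Real.smoothTransition.zero_of_nonpos (x := 5 - 6 * y) (by linarith), mul_zero]

theorem plateau_mid {y : ℝ} (h : 1 / 3 ≤ y) (h' : y ≤ 2 / 3) : plateau y = 1 := by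
  rw [plateau, Real.smoothTransition.one_of_one_le (by linarith),
    Real.smoothTransition.one_of_one_le (by linarith), mul_one]

/-- A smooth step function with step between `1/3` and `2/3`. -/
noncomputable def ramp (y : ℝ) : ℝ := Real.smoothTransition (3 * y - 1)

theorem contDiff_ramp : ContDiff ℝ ∞ ramp := Real.smoothTransition.contDiff.comp (by fun_prop)

theorem ramp_left {y : ℝ} (h : y ≤ 1 / 3) : ramp y = 0 :=
  Real.smoothTransition.zero_of_nonpos (by linarith)

theorem ramp_right {y : ℝ} (h : 2 / 3 ≤ y) : ramp y = 1 :=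
  Real.smoothTransition.one_of_one_le (by linarith)

theorem contDiff_slide {N : Type*} [NormedAddCommGroup N] [NormedSpace ℝ N] {a t : N → ℝ}
    (ha : ContDiff ℝ ∞ a) (ht : ContDiff ℝ ∞ t) :
    ContDiff ℝ ∞ fun w => (1 - t w) * a w + t w * ramp (a w) :=
  ((contDiff_const.sub ht).mul ha).add (ht.mul (contDiff_ramp.comp ha))

theorem slide_lt {a t ε : ℝ} (hε : 0 < ε) (hε' : ε ≤ 1 / 3) (ht : 0 ≤ t) (ht' : t ≤ 1)
    (h : a < ε) : (1 - t) * a + t * ramp a < ε := by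
  rw [ramp_left (by linarith)]
  rcases le_or_gt a 0 with h0 | h0 <;> nlinarith

theorem lt_slide {a t ε : ℝ} (hε : 0 < ε) (hε' : ε ≤ 1 / 3) (ht : 0 ≤ t) (ht' : t ≤ 1)
    (h : 1 - ε < a) : 1 - ε < (1 - t) * a + t * ramp a := by
  rw [ramp_right (by linarith)]
  rcases le_or_gt 1 a with h0 | h0 <;> nlinarith

/-- Thin loops of curves are homotopic to the unit surface, relative to the boundary and through
maps of rank at most two. -/
theorem Surface.rel_unit_of_rankLE {p q : M} {γ : Curve E p q} (S : Surface γ γ)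
    (hS : ∀ z, RankLE E S.toFun 1 z) : S.Rel (Surface.unit γ) := by
  obtain ⟨t, u, r, χ, δ, hδ, hδ', hu, hpar, hx0, hx1, hy0, hy1, hru, hχ, hχu, hχ1, hr⟩ :=
    S.exists_factorization hS
  obtain ⟨V, hV, hVker, hVχ, hV1, hV0, hVx0, hVx1, hVy0, hVy1⟩ :=
    exists_contraction hu hδ hpar hx0 hx1 hy0 hy1 hχ hχu hχ1
  obtain ⟨ε₀, s0, s1, s2, s3, s4, s5⟩ := S.sitting
  let Γ : ℝ × ℝ × ℝ → M := fun w => r (V w)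
  have hΓ : ContMDiff 𝓘(ℝ, ℝ × ℝ × ℝ) 𝓘(ℝ, E) ∞ Γ := fun w =>
    ContMDiffAt.comp w (hr _ (hVχ w)) hV.contMDiff.contMDiffAt
  have hΓr : ∀ w, RankLE E Γ 2 w := fun w => by
    obtain ⟨n, hn, h0⟩ := hVker w
    refine rankLE_two_of_ker hn ?_
    have h1 := mfderiv_comp w ((hr _ (hVχ w)).mdifferentiableAt (by simp))
      (hV.contMDiff.contMDiffAt.mdifferentiableAt (by simp))
    refine (congrArg (fun D : ℝ × ℝ × ℝ →L[ℝ] E => D n) h1).trans ?_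
    have h2 : (mfderiv 𝓘(ℝ, ℝ × ℝ × ℝ) 𝓘(ℝ, t → ℝ × E) V w :
        ℝ × ℝ × ℝ →L[ℝ] (t → ℝ × E)) n = 0 := by
      rw [mfderiv_eq_fderiv]; exact h0
    change (mfderiv 𝓘(ℝ, t → ℝ × E) 𝓘(ℝ, E) r (V w) : (t → ℝ × E) →L[ℝ] E)
      ((mfderiv 𝓘(ℝ, ℝ × ℝ × ℝ) 𝓘(ℝ, t → ℝ × E) V w : ℝ × ℝ × ℝ →L[ℝ] (t → ℝ × E)) n) = 0
    rw [h2]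
    exact map_zero (mfderiv 𝓘(ℝ, t → ℝ × E) 𝓘(ℝ, E) r (V w) : (t → ℝ × E) →L[ℝ] E)
  have hΓ1 : ∀ x y, Γ (x, y, 1) = S.toFun (x, y) := fun x y => by simp only [Γ, hV1, hru]
  have hp : r (u (0, 0)) = p := by rw [hru, s2 _ _ s0]
  have hq : ∀ x y, 1 - ε₀ < x → Γ (x, y, 1) = q := fun x y hx => by rw [hΓ1, s3 _ _ hx]
  set ε := min (min δ ε₀) (1 / 6) with hε
  have e1 : ε ≤ δ := (min_le_left _ _).trans (min_le_left _ _)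
  have e2 : ε ≤ ε₀ := (min_le_left _ _).trans (min_le_right _ _)
  have e3 : ε ≤ 1 / 6 := min_le_right _ _
  have e0 : 0 < ε := by positivity
  have hb : ∀ t y, 0 ≤ t → t ≤ 1 → 0 ≤ t * plateau y ∧ t * plateau y ≤ 1 := fun t y h h' =>
    ⟨mul_nonneg h (plateau_mem y).1, mul_le_one₀ h' (plateau_mem y).1 (plateau_mem y).2⟩
  -- At time 0 this is the face `s = 1`. At time 1, for y between 1/3 and 2/3, the x-interval is
  -- spread over the faces `x = 0`, `s = 0`, `x = 1`, and all movement of the second coordinate is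
  -- confined to these y.
  let A : ℝ × ℝ × ℝ → ℝ × ℝ × ℝ := fun w =>
    ((1 - w.2.2 * plateau w.2.1) * w.1 + w.2.2 * plateau w.2.1 * ramp w.1,
      (1 - w.2.2) * w.2.1 + w.2.2 * ramp w.2.1, 1 - w.2.2 * plateau w.2.1 * plateau w.1)
  -- The same deformation run backwards with second coordinate 0; it ends at `Γ(x, 0, 1) = γ(x)`.
  let A' : ℝ × ℝ × ℝ → ℝ × ℝ × ℝ := fun w =>
    ((1 - (1 - w.2.2) * plateau w.2.1) * w.1 + (1 - w.2.2) * plateau w.2.1 * ramp w.1,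
      0, 1 - (1 - w.2.2) * plateau w.2.1 * plateau w.1)
  have hz : ContDiff ℝ ∞ fun w : ℝ × ℝ × ℝ => w.2.2 := by fun_prop
  have hy : ContDiff ℝ ∞ fun w : ℝ × ℝ × ℝ => w.2.1 := by fun_prop
  have hx : ContDiff ℝ ∞ fun w : ℝ × ℝ × ℝ => w.1 := by fun_prop
  have hA : ContDiff ℝ ∞ A := (contDiff_slide hx (hz.mul (contDiff_plateau.comp hy))).prodMk
    ((contDiff_slide hy hz).prodMk (contDiff_const.sub
      ((hz.mul (contDiff_plateau.comp hy)).mul (contDiff_plateau.comp hx))))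
  have hA' : ContDiff ℝ ∞ A' := (contDiff_slide hx ((contDiff_const.sub hz).mul
    (contDiff_plateau.comp hy))).prodMk (contDiff_const.prodMk (contDiff_const.sub
      (((contDiff_const.sub hz).mul (contDiff_plateau.comp hy)).mul (contDiff_plateau.comp hx))))
  have hlo : ∀ x y s, x < δ → Γ (x, y, s) = p := fun x y s h => by
    simp only [Γ, hVx0 x y s h, hp]
  obtain ⟨w₁, -, H₁⟩ := thinHtpy_of_homotopy hΓ hΓr hA e0 (by linarith) (p := p) (q := q)
    (c₀ := fun w => γ.toFun w.1) (c₁ := fun w => γ.toFun w.1)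
    (fun x y t h h' hx => hlo _ _ _ ((slide_lt e0 (by linarith) (hb t y h h').1 (hb t y h h').2
      hx).trans_le e1))
    (fun x y t h h' hx => by
      have := lt_slide e0 (by linarith) (hb t y h h').1 (hb t y h h').2 hx
      dsimp only [A]
      rw [plateau_right (y := x) (by linarith), mul_zero, sub_zero]
      exact hq _ _ (by linarith))
    (fun x y t h h' hy => by
      have := slide_lt e0 (by linarith) h h' hy
      dsimp only [A]
      rw [plateau_left (y := y) (by linarith)]
      simp only [mul_zero, zero_mul, sub_zero, one_mul, add_zero]
      rw [hΓ1, s4 _ _ (by linarith)])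
    (fun x y t h h' hy => by
      have := lt_slide e0 (by linarith) h h' hy
      dsimp only [A]
      rw [plateau_right (y := y) (by linarith)]
      simp only [mul_zero, zero_mul, sub_zero, one_mul, add_zero]
      rw [hΓ1, s5 _ _ (by linarith)])
  obtain ⟨w₂, -, H₂⟩ := thinHtpy_of_homotopy hΓ hΓr hA' e0 (by linarith) (p := p) (q := q)
    (c₀ := fun w => γ.toFun w.1) (c₁ := fun w => γ.toFun w.1)
    (fun x y t h h' hx => hlo _ _ _ ((slide_lt e0 (by linarith) (hb (1 - t) y (by linarith)
      (by linarith)).1 (hb (1 - t) y (by linarith) (by linarith)).2 hx).trans_le e1))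
    (fun x y t h h' hx => by
      have := lt_slide e0 (by linarith) (hb (1 - t) y (by linarith)
        (by linarith)).1 (hb (1 - t) y (by linarith) (by linarith)).2 hx
      dsimp only [A']
      rw [plateau_right (y := x) (by linarith), mul_zero, sub_zero]
      exact hq _ _ (by linarith))
    (fun x y t h h' hy => by
      dsimp only [A']
      rw [plateau_left (y := y) (by linarith)]
      simp only [mul_zero, zero_mul, sub_zero, one_mul, add_zero]
      rw [hΓ1, s4 _ _ s0])
    (fun x y t h h' hy => by
      dsimp only [A']
      rw [plateau_right (y := y) (by linarith)]
      simp only [mul_zero, zero_mul, sub_zero, one_mul, add_zero]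
      rw [hΓ1, s4 _ _ s0])
  have h0 : (fun v : ℝ × ℝ => Γ (A (v.1, v.2, 0))) = S.toFun := by
    funext v
    simp only [A, zero_mul, sub_zero, one_mul, add_zero, hΓ1]
  -- The two maps differ only in the second coordinate. That coordinate is 0 for small y, and 1 for
  -- large y, where `V` has the same values as at 0. In between the image lies on the three faces,
  -- where `Γ` does not depend on it.
  have h1 : (fun v : ℝ × ℝ => Γ (A (v.1, v.2, 1))) = fun v => Γ (A' (v.1, v.2, 0)) := by
    funext ⟨x, y⟩
    simp only [A, A', sub_self, zero_mul, one_mul, zero_add, sub_zero]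
    rcases le_total y (1 / 3) with h | h
    · rw [ramp_left h]
    rcases le_total (2 / 3) y with h' | h'
    · rw [ramp_right h']
      simp only [Γ]
      rw [hVy1 _ 1 _ (by linarith)]
    · rw [plateau_mid h h']
      simp only [sub_self, zero_mul, one_mul, zero_add]
      rcases le_total x (1 / 3) with k | k
      · rw [ramp_left k, hlo _ _ _ hδ, hlo _ _ _ hδ]
      rcases le_total (2 / 3) x with k' | k'
      · rw [ramp_right k']
        simp only [Γ]
        rw [hVx1 1 (ramp y) _ (by linarith)]
      · rw [plateau_mid k k', sub_self]
        simp only [Γ, hV0]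
  have h2 : (fun v : ℝ × ℝ => Γ (A' (v.1, v.2, 1))) = fun v => γ.toFun v.1 := by
    funext v
    simp only [A', sub_self, zero_mul, sub_zero, one_mul, add_zero, hΓ1, s4 _ _ s0]
  rw [h0, h1] at H₁
  rw [h2] at H₂
  have H := H₁.trans H₂
  rwa [vcat_fst] at H

end Filling

end TwoTransport

namespace TwoTransport

/-! ### The laws of the path 2-groupoid up to thin homotopy. -/

section Laws

variable {E M : Type*} [NormedAddCommGroup E] [NormedSpace ℝ E]
  [TopologicalSpace M] [ChartedSpace E M] [IsManifold 𝓘(ℝ, E) ∞ M] {p q r o : M}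

theorem Surface.eq_of_toFun {γ₀ γ₁ : Curve E p q} {S T : Surface γ₀ γ₁} (h : S.toFun = T.toFun) :
    S = T := by
  cases S; cases T; cases h; rfl

/-- Surfaces that differ by a reparametrization in the vertical direction. -/
theorem Surface.rel_of_reparam {γ₀ γ₁ : Curve E p q} {S T : Surface γ₀ γ₁} {G : ℝ × ℝ → M}
    (hG : ContMDiff 𝓘(ℝ, ℝ × ℝ) 𝓘(ℝ, E) ∞ G) {φ ψ : ℝ → ℝ} (hφ : ContDiff ℝ ∞ φ)
    (hψ : ContDiff ℝ ∞ ψ) (hS : ∀ x y, S.toFun (x, y) = G (x, φ y))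
    (hT : ∀ x y, T.toFun (x, y) = G (x, ψ y)) {ε : ℝ} (hε : 0 < ε) (hε' : ε < 1 / 2)
    (hp : ∀ x y, x < ε → G (x, y) = p) (hq : ∀ x y, 1 - ε < x → G (x, y) = q) {I J : Set ℝ}
    (hI : Convex ℝ I) (hJ : Convex ℝ J) (hIG : ∀ x, ∀ y ∈ I, G (x, y) = γ₀.toFun x)
    (hJG : ∀ x, ∀ y ∈ J, G (x, y) = γ₁.toFun x) (hI' : ∀ y < ε, φ y ∈ I ∧ ψ y ∈ I)
    (hJ' : ∀ y, 1 - ε < y → φ y ∈ J ∧ ψ y ∈ J) : S.Rel T := by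
  -- The affine homotopy between `φ` and `ψ`: convexity of `I` and `J` preserves the boundary
  -- values, and the rank is at most two because `G` has two variables.
  obtain ⟨w, -, H⟩ := thinHtpy_of_homotopy hG (fun z => rankLE_plane G z)
    (A := fun w => (w.1, (1 - w.2.2) * φ w.2.1 + w.2.2 * ψ w.2.1))
    (by fun_prop) hε hε' (fun x y t _ _ hx => hp _ _ hx) (fun x y t _ _ hx => hq _ _ hx)
    (c₀ := fun w => γ₀.toFun w.1) (c₁ := fun w => γ₁.toFun w.1)
    (fun x y t h h' hy => hIG _ _ (hI (hI' y hy).1 (hI' y hy).2 (by linarith) h (by ring)))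
    (fun x y t h h' hy => hJG _ _ (hJ (hJ' y hy).1 (hJ' y hy).2 (by linarith) h (by ring)))
  have h0 : (fun v : ℝ × ℝ => G (v.1, (1 - 0) * φ v.2 + 0 * ψ v.2)) = S.toFun := by
    funext ⟨x, y⟩
    simp [hS]
  have h1 : (fun v : ℝ × ℝ => G (v.1, (1 - 1) * φ v.2 + 1 * ψ v.2)) = T.toFun := by
    funext ⟨x, y⟩
    simp [hT]
  rw [h0, h1] at H
  exact H

/-- Surfaces that differ by a reparametrization in the horizontal direction. -/
theorem thinHomotopic₂_of_reparam {γ₀ γ₁ γ₂ γ₃ : Curve E p q} {S : Surface γ₀ γ₁}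
    {T : Surface γ₂ γ₃} {G : ℝ × ℝ → M}
    (hG : ContMDiff 𝓘(ℝ, ℝ × ℝ) 𝓘(ℝ, E) ∞ G) {φ ψ : ℝ → ℝ} (hφ : ContDiff ℝ ∞ φ)
    (hψ : ContDiff ℝ ∞ ψ) (hS : ∀ x y, S.toFun (x, y) = G (φ x, y))
    (hT : ∀ x y, T.toFun (x, y) = G (ψ x, y)) {ε : ℝ} (hε : 0 < ε) (hε' : ε < 1 / 2)
    (hG0 : ∀ x y, y < ε → G (x, y) = G (x, 0)) (hG1 : ∀ x y, 1 - ε < y → G (x, y) = G (x, 1))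
    {I J : Set ℝ} (hI : Convex ℝ I) (hJ : Convex ℝ J) (hIG : ∀ x ∈ I, ∀ y, G (x, y) = p)
    (hJG : ∀ x ∈ J, ∀ y, G (x, y) = q) (hI' : ∀ x < ε, φ x ∈ I ∧ ψ x ∈ I)
    (hJ' : ∀ x, 1 - ε < x → φ x ∈ J ∧ ψ x ∈ J) : ThinHomotopic₂ S T := by
  obtain ⟨w, hw, H⟩ := thinHtpy_of_homotopy hG (fun z => rankLE_plane G z)
    (A := fun w => ((1 - w.2.2) * φ w.1 + w.2.2 * ψ w.1, w.2.1))
    (by fun_prop) hε hε' (p := p) (q := q)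
    (fun x y t h h' hx => hIG _ (hI (hI' x hx).1 (hI' x hx).2 (by linarith) h (by ring)) _)
    (fun x y t h h' hx => hJG _ (hJ (hJ' x hx).1 (hJ' x hx).2 (by linarith) h (by ring)) _)
    (c₀ := fun w => G ((1 - w.2) * φ w.1 + w.2 * ψ w.1, 0))
    (c₁ := fun w => G ((1 - w.2) * φ w.1 + w.2 * ψ w.1, 1))
    (fun x y t _ _ hy => hG0 _ _ hy) (fun x y t _ _ hy => hG1 _ _ hy)
  have h0 : (fun v : ℝ × ℝ => G ((1 - 0) * φ v.1 + 0 * ψ v.1, v.2)) = S.toFun := by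
    funext ⟨x, y⟩
    simp [hS]
  have h1 : (fun v : ℝ × ℝ => G ((1 - 1) * φ v.1 + 1 * ψ v.1, v.2)) = T.toFun := by
    funext ⟨x, y⟩
    simp [hT]
  rw [h0, h1] at H
  have hd : ContDiff ℝ ∞ fun v : ℝ × ℝ => (1 - w v.2) * φ v.1 + w v.2 * ψ v.1 := by fun_prop
  -- The boundary curves do move, but along a map that factors through a line.
  have hr : ∀ (y : ℝ) (v : ℝ × ℝ), RankLE E
      (fun v : ℝ × ℝ => G ((1 - w v.2) * φ v.1 + w v.2 * ψ v.1, y)) 1 v := fun y v =>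
    (rankLE_line (fun x => G (x, y)) _).comp
      (P := fun v : ℝ × ℝ => (1 - w v.2) * φ v.1 + w v.2 * ψ v.1)
      (hG.comp (ContDiff.contMDiff (by fun_prop))) (hd.contDiffAt.differentiableAt (by simp))
  exact thinHomotopic₂_of_thinHtpy H (hr 0) (hr 1)

/-! ### Vertical composition. -/

section Vertical

variable {γ₀ γ₁ γ₂ γ₃ : Curve E p q}

/-- Surfaces are defined on the whole plane and equal `γ₀` for negative y, so the composite is
simply `S` at the height `2 y - 1`. -/
theorem Surface.vcomp_unit_rel (S : Surface γ₀ γ₁) : (S.vcomp (Surface.unit γ₀)).Rel S := by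
  obtain ⟨ε, s0, s1, s2, s3, s4, s5⟩ := S.sitting
  refine Surface.rel_of_reparam S.smooth (φ := fun y => 2 * y - 1) (ψ := fun y => y) (by fun_prop)
    contDiff_id (fun x y => ?_) (fun x y => rfl) (half_pos s0) (by linarith)
    (fun x y h => s2 _ _ (by linarith)) (fun x y h => s3 _ _ (by linarith)) (convex_Iio ε)
    (convex_Ioi (1 - ε)) (fun x y h => s4 _ _ h) (fun x y h => s5 _ _ h)
    (fun y h => ⟨mem_Iio.2 (by linarith), mem_Iio.2 (by linarith)⟩)
    (fun y h => ⟨mem_Ioi.2 (by linarith), mem_Ioi.2 (by linarith)⟩)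
  dsimp only [Surface.vcomp, Surface.unit]
  split_ifs with h
  · exact (s4 _ _ (by linarith)).symm
  · rfl

theorem Surface.unit_vcomp_rel (S : Surface γ₀ γ₁) : ((Surface.unit γ₁).vcomp S).Rel S := by
  obtain ⟨ε, s0, s1, s2, s3, s4, s5⟩ := S.sitting
  refine Surface.rel_of_reparam S.smooth (φ := fun y => 2 * y) (ψ := fun y => y) (by fun_prop)
    contDiff_id (fun x y => ?_) (fun x y => rfl) (half_pos s0) (by linarith)
    (fun x y h => s2 _ _ (by linarith)) (fun x y h => s3 _ _ (by linarith)) (convex_Iio ε)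
    (convex_Ioi (1 - ε)) (fun x y h => s4 _ _ h) (fun x y h => s5 _ _ h)
    (fun y h => ⟨mem_Iio.2 (by linarith), mem_Iio.2 (by linarith)⟩)
    (fun y h => ⟨mem_Ioi.2 (by linarith), mem_Ioi.2 (by linarith)⟩)
  dsimp only [Surface.vcomp, Surface.unit]
  split_ifs with h
  · rfl
  · exact (s5 _ _ (by linarith)).symm

theorem Surface.vinv_vcomp_rel (S : Surface γ₀ γ₁) : (S.vinv.vcomp S).Rel (Surface.unit γ₀) := by
  obtain ⟨ε, s0, s1, s2, s3, s4, s5⟩ := S.sitting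
  exact Surface.rel_of_reparam S.smooth (φ := tent (ε / 4)) (ψ := fun _ => 0) (contDiff_tent _)
    contDiff_const (fun x y => cat_reverse s0 (a := fun t => S.toFun (x, t))
      (fun t ht => s5 x t ht) y) (fun x y => (s4 _ _ s0).symm) (half_pos s0) (by linarith)
    (fun x y h => s2 _ _ (by linarith)) (fun x y h => s3 _ _ (by linarith)) (convex_Iio ε)
    (convex_Iio ε) (fun x y h => s4 _ _ h) (fun x y h => s4 _ _ h)
    (fun y h => ⟨tent_lt s0 s1 (Or.inl h), s0⟩) (fun y h => ⟨tent_lt s0 s1 (Or.inr h), s0⟩)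

theorem Surface.vinv_vinv (S : Surface γ₀ γ₁) : S.vinv.vinv = S :=
  Surface.eq_of_toFun (by funext z; simp [Surface.vinv])

theorem Surface.vcomp_vinv_rel (S : Surface γ₀ γ₁) : (S.vcomp S.vinv).Rel (Surface.unit γ₁) := by
  simpa only [S.vinv_vinv] using S.vinv.vinv_vcomp_rel

theorem Surface.vcomp_assoc_rel (U : Surface γ₂ γ₃) (T : Surface γ₁ γ₂) (S : Surface γ₀ γ₁) :
    (U.vcomp (T.vcomp S)).Rel ((U.vcomp T).vcomp S) := by
  obtain ⟨ε₁, s0, s1, s2, s3, s4, s5⟩ := S.sitting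
  obtain ⟨ε₂, t0, t1, t2, t3, t4, t5⟩ := T.sitting
  obtain ⟨ε₃, u0, u1, u2, u3, u4, u5⟩ := U.sitting
  obtain ⟨ε₄, v0, v1, v2, v3, v4, v5⟩ := ((U.vcomp T).vcomp S).sitting
  let ε := min (min ε₁ ε₂) (min ε₃ ε₄) / 2
  have e0 : 0 < ε := by positivity
  have e1 : 2 * ε ≤ ε₁ := by
    have := (min_le_left (min ε₁ ε₂) (min ε₃ ε₄)).trans (min_le_left _ _); simp only [ε]; linarith
  have e2 : 2 * ε ≤ ε₂ := by
    have := (min_le_left (min ε₁ ε₂) (min ε₃ ε₄)).trans (min_le_right _ _); simp only [ε]; linarith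
  have e3 : 2 * ε ≤ ε₃ := by
    have := (min_le_right (min ε₁ ε₂) (min ε₃ ε₄)).trans (min_le_left _ _); simp only [ε]; linarith
  have e4 : 2 * ε ≤ ε₄ := by
    have := (min_le_right (min ε₁ ε₂) (min ε₃ ε₄)).trans (min_le_right _ _); simp only [ε]; linarith
  exact Surface.rel_of_reparam ((U.vcomp T).vcomp S).smooth (φ := rebracket (ε / 8))
    (ψ := fun y => y) (contDiff_rebracket _) contDiff_id
    (fun x y => cat_assoc e0 (by linarith) (a := fun t => S.toFun (x, t))
      (b := fun t => T.toFun (x, t)) (c := fun t => U.toFun (x, t)) (fun t ht => s5 x t (by linarith))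
      (fun t ht => t4 x t (by linarith)) (fun t ht => t5 x t (by linarith))
      (fun t ht => u4 x t (by linarith)) y) (fun x y => rfl) e0 (by linarith)
    (fun x y h => v2 _ _ (by linarith)) (fun x y h => v3 _ _ (by linarith)) (convex_Iio ε₄)
    (convex_Ioi (1 - ε₄)) (fun x y h => v4 _ _ h) (fun x y h => v5 _ _ h)
    (fun y h => ⟨(rebracket_lt e0 h).trans_le e4, mem_Iio.2 (by linarith)⟩)
    (fun y h => ⟨mem_Ioi.2 (by linarith [lt_rebracket e0 (by linarith) h]),
      mem_Ioi.2 (by linarith)⟩)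

/-- Any two thin homotopies between two curves are homotopic. -/
theorem Surface.rel_of_rankLE [FiniteDimensional ℝ E] {S T : Surface γ₀ γ₁}
    (hS : ∀ w, RankLE E S.toFun 1 w) (hT : ∀ w, RankLE E T.toFun 1 w) : S.Rel T := by
  -- The composite of `S` with the inverse of `T` is a thin loop, hence trivial; composing with `T`
  -- recovers `S` on one side and `T` on the other.
  have h1 := (T.vinv.vcomp S).rel_unit_of_rankLE
    (Surface.rankLE_vcomp hS (Surface.rankLE_vinv hT))
  have h2 : (T.vcomp (T.vinv.vcomp S)).Rel T :=
    (Surface.Rel.vcomp h1 (Surface.Rel.refl T)).trans T.vcomp_unit_rel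
  have h3 : (T.vcomp (T.vinv.vcomp S)).Rel S :=
    (Surface.vcomp_assoc_rel T T.vinv S).trans
      ((Surface.Rel.vcomp (Surface.Rel.refl S) T.vcomp_vinv_rel).trans S.unit_vcomp_rel)
  exact h3.symm.trans h2

/-- Vertical composition is compatible with thin homotopy. -/
theorem ThinHomotopic₂.vcomp [FiniteDimensional ℝ E] {γ₀' γ₁' γ₂' : Curve E p q}
    {S : Surface γ₀ γ₁} {T : Surface γ₁ γ₂} {S' : Surface γ₀' γ₁'} {T' : Surface γ₁' γ₂'}
    (h : ThinHomotopic₂ S S') (k : ThinHomotopic₂ T T') :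
    ThinHomotopic₂ (T.vcomp S) (T'.vcomp S') := by
  obtain ⟨h₀, h₁, h, hr0, hr1⟩ := h.exists_thinHtpy
  obtain ⟨k₀, k₁, k, kr0, kr1⟩ := k.exists_thinHtpy
  -- The two given homotopies move `γ₁` to `γ₁'` along possibly different thin homotopies `h₁` and
  -- `k₀`. A homotopy between these, with y and z exchanged, fits between the two and interpolates
  -- unit surfaces.
  have hk : ThinHtpy E p q h₁.toFun k₀.toFun (Surface.unit γ₁).toFun (Surface.unit γ₁').toFun :=
    ThinHtpy.swap (Surface.rel_of_rankLE hr1 kr0)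
  have key : ThinHomotopic₂ ((T.vcomp (Surface.unit γ₁)).vcomp S)
      ((T'.vcomp (Surface.unit γ₁')).vcomp S') :=
    thinHomotopic₂_of_thinHtpy (ThinHtpy.vcat h (ThinHtpy.vcat hk k)) hr0 kr1
  exact ((Surface.Rel.vcomp (Surface.Rel.refl S) T.vcomp_unit_rel).thinHomotopic₂.symm.trans
    key).trans (Surface.Rel.vcomp (Surface.Rel.refl S') T'.vcomp_unit_rel).thinHomotopic₂

theorem ThinHomotopic₂.vinv {γ₀' γ₁' : Curve E p q} {S : Surface γ₀ γ₁} {S' : Surface γ₀' γ₁'}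
    (h : ThinHomotopic₂ S S') : ThinHomotopic₂ S.vinv S'.vinv := by
  obtain ⟨h₀, h₁, h, hr0, hr1⟩ := h.exists_thinHtpy
  exact thinHomotopic₂_of_thinHtpy h.swap.symm.swap hr1 hr0

theorem ThinHomotopic₂.src {γ₀' γ₁' : Curve E p q} {S : Surface γ₀ γ₁} {S' : Surface γ₀' γ₁'}
    (h : ThinHomotopic₂ S S') : ThinHomotopic₁ γ₀ γ₀' := by
  obtain ⟨h₀, h₁, h, hr0, hr1⟩ := h.exists_thinHtpy
  exact h₀.thinHomotopic₁ hr0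

theorem ThinHomotopic₂.tgt {γ₀' γ₁' : Curve E p q} {S : Surface γ₀ γ₁} {S' : Surface γ₀' γ₁'}
    (h : ThinHomotopic₂ S S') : ThinHomotopic₁ γ₁ γ₁' := by
  obtain ⟨h₀, h₁, h, hr0, hr1⟩ := h.exists_thinHtpy
  exact h₁.thinHomotopic₁ hr1

theorem ThinHomotopic₁.unit (h : ThinHomotopic₁ γ₀ γ₁) :
    ThinHomotopic₂ (Surface.unit γ₀) (Surface.unit γ₁) := by
  obtain ⟨S, hS⟩ := h.exists_surface
  exact thinHomotopic₂_of_thinHtpy S.thinHtpy_refl.swap hS hS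

/-- A thin homotopy of the source may be prepended to a surface. -/
theorem Surface.vcomp_thinHomotopic₂ [FiniteDimensional ℝ E] (h : Surface γ₀ γ₁)
    (hr : ∀ w, RankLE E h.toFun 1 w) (T : Surface γ₁ γ₂) : ThinHomotopic₂ (T.vcomp h) T := by
  obtain ⟨c, δ, hδ, hδ', hc, hc0, hc1, hcI, hp, hq, hcl⟩ := h.exists_clamp
  have hu : ∀ x, h.toFun (c x, 1) = γ₁.toFun x := fun x => by
    obtain ⟨ε, s0, s1, s2, s3, s4, s5⟩ := h.sitting
    have := hcl x 1
    rwa [hc1 1 (by linarith), s5 x 1 (by linarith)] at this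
  -- The square is retracted to its edge `y = 1`; the moving source curve sweeps out `h` itself,
  -- which has rank at most one.
  obtain ⟨w, hw, H⟩ := thinHtpy_of_homotopy h.smooth (fun z => rankLE_plane h.toFun z)
    (A := fun w => (c w.1, (1 - w.2.2) * c w.2.1 + w.2.2)) (by fun_prop) hδ hδ' (p := p) (q := q)
    (fun x y t _ _ hx => hp _ _ (by dsimp only; rw [hc0 x hx]; exact hδ))
    (fun x y t _ _ hx => hq _ _ (by dsimp only; rw [hc1 x hx]; linarith))
    (c₀ := fun w => h.toFun (c w.1, w.2)) (c₁ := fun w => γ₁.toFun w.1)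
    (fun x y t _ _ hy => by simp [hc0 y hy]) (fun x y t _ _ hy => by simp [hc1 y hy, hu])
  have h0 : (fun v : ℝ × ℝ => h.toFun (c v.1, (1 - 0) * c v.2 + 0)) = h.toFun := by
    funext ⟨x, y⟩
    simp [hcl]
  have h1 : (fun v : ℝ × ℝ => h.toFun (c v.1, (1 - 1) * c v.2 + 1)) = (Surface.unit γ₁).toFun := by
    funext ⟨x, y⟩
    simp [hu, Surface.unit]
  rw [h0, h1] at H
  have hP : ContDiff ℝ ∞ fun v : ℝ × ℝ => (c v.1, w v.2) := by fun_prop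
  have key : ThinHomotopic₂ (T.vcomp h) (T.vcomp (Surface.unit γ₁)) :=
    thinHomotopic₂_of_thinHtpy (H.vcat T.thinHtpy_refl)
      (fun v => (hr _).comp (P := fun v : ℝ × ℝ => (c v.1, w v.2)) h.smooth
        (hP.contDiffAt.differentiableAt (by simp))) (Surface.rankLE_unit γ₂)
  exact key.trans T.vcomp_unit_rel.thinHomotopic₂

end Vertical

/-! ### Horizontal composition and the exchange law. -/

section Horizontal

theorem ThinHomotopic₂.hcomp {γ₀ γ₁ γ₀' γ₁' : Curve E p q} {γ₂ γ₃ γ₂' γ₃' : Curve E q r}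
    {S : Surface γ₀ γ₁} {S' : Surface γ₀' γ₁'} {T : Surface γ₂ γ₃} {T' : Surface γ₂' γ₃'}
    (h : ThinHomotopic₂ S S') (k : ThinHomotopic₂ T T') :
    ThinHomotopic₂ (T.hcomp S) (T'.hcomp S') := by
  obtain ⟨h₀, h₁, h, hr0, hr1⟩ := h.exists_thinHtpy
  obtain ⟨k₀, k₁, k, kr0, kr1⟩ := k.exists_thinHtpy
  exact thinHomotopic₂_of_thinHtpy (h.hcat k) (Surface.rankLE_hcomp (S := h₀) (T := k₀) hr0 kr0)
    (Surface.rankLE_hcomp (S := h₁) (T := k₁) hr1 kr1)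

theorem ThinHomotopic₂.hinv {γ₀ γ₁ γ₀' γ₁' : Curve E p q} {S : Surface γ₀ γ₁}
    {S' : Surface γ₀' γ₁'} (h : ThinHomotopic₂ S S') : ThinHomotopic₂ S.hinv S'.hinv := by
  obtain ⟨h₀, h₁, h, hr0, hr1⟩ := h.exists_thinHtpy
  exact thinHomotopic₂_of_thinHtpy h.hinv (Surface.rankLE_hinv (S := h₀) hr0)
    (Surface.rankLE_hinv (S := h₁) hr1)

/-- Statements for curves are read off as the sources of those for unit surfaces. -/
theorem ThinHomotopic₁.comp {γ₀ γ₁ : Curve E p q} {γ₂ γ₃ : Curve E q r}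
    (h : ThinHomotopic₁ γ₀ γ₁) (k : ThinHomotopic₁ γ₂ γ₃) :
    ThinHomotopic₁ (γ₂.comp γ₀) (γ₃.comp γ₁) := (h.unit.hcomp k.unit).src

theorem ThinHomotopic₁.inv {γ₀ γ₁ : Curve E p q} (h : ThinHomotopic₁ γ₀ γ₁) :
    ThinHomotopic₁ γ₀.inv γ₁.inv := h.unit.hinv.src

variable {γ₀ γ₁ : Curve E p q}

theorem Surface.hcomp_unit_thin (S : Surface γ₀ γ₁) :
    ThinHomotopic₂ (S.hcomp (Surface.unit (Curve.unit p))) S := by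
  obtain ⟨ε, s0, s1, s2, s3, s4, s5⟩ := S.sitting
  refine thinHomotopic₂_of_reparam S.smooth (φ := fun y => 2 * y - 1) (ψ := fun y => y)
    (by fun_prop) contDiff_id (fun x y => ?_) (fun x y => rfl) (half_pos s0) (by linarith)
    (fun x y h => by rw [s4 _ _ (by linarith), s4 _ _ s0])
    (fun x y h => by rw [s5 _ _ (by linarith), s5 _ _ (by linarith)]) (convex_Iio ε)
    (convex_Ioi (1 - ε)) (fun x h y => s2 _ _ h) (fun x h y => s3 _ _ h)
    (fun y h => ⟨mem_Iio.2 (by linarith), mem_Iio.2 (by linarith)⟩)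
    (fun y h => ⟨mem_Ioi.2 (by linarith), mem_Ioi.2 (by linarith)⟩)
  dsimp only [Surface.hcomp, Surface.unit, Curve.unit]
  split_ifs with h
  · exact (s2 _ _ (by linarith)).symm
  · rfl

theorem Surface.unit_hcomp_thin (S : Surface γ₀ γ₁) :
    ThinHomotopic₂ ((Surface.unit (Curve.unit q)).hcomp S) S := by
  obtain ⟨ε, s0, s1, s2, s3, s4, s5⟩ := S.sitting
  refine thinHomotopic₂_of_reparam S.smooth (φ := fun y => 2 * y) (ψ := fun y => y)
    (by fun_prop) contDiff_id (fun x y => ?_) (fun x y => rfl) (half_pos s0) (by linarith)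
    (fun x y h => by rw [s4 _ _ (by linarith), s4 _ _ s0])
    (fun x y h => by rw [s5 _ _ (by linarith), s5 _ _ (by linarith)]) (convex_Iio ε)
    (convex_Ioi (1 - ε)) (fun x h y => s2 _ _ h) (fun x h y => s3 _ _ h)
    (fun y h => ⟨mem_Iio.2 (by linarith), mem_Iio.2 (by linarith)⟩)
    (fun y h => ⟨mem_Ioi.2 (by linarith), mem_Ioi.2 (by linarith)⟩)
  dsimp only [Surface.hcomp, Surface.unit, Curve.unit]
  split_ifs with h
  · rfl
  · exact (s3 _ _ (by linarith)).symm

theorem Surface.hinv_hcomp_thin (S : Surface γ₀ γ₁) :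
    ThinHomotopic₂ (S.hinv.hcomp S) (Surface.unit (Curve.unit (E := E) p)) := by
  obtain ⟨ε, s0, s1, s2, s3, s4, s5⟩ := S.sitting
  exact thinHomotopic₂_of_reparam S.smooth (φ := tent (ε / 4)) (ψ := fun _ => 0) (contDiff_tent _)
    contDiff_const (fun x y => cat_reverse s0 (a := fun t => S.toFun (t, y))
      (fun t ht => s3 t y ht) x) (fun x y => (s2 _ _ s0).symm) (half_pos s0) (by linarith)
    (fun x y h => by rw [s4 _ _ (by linarith), s4 _ _ s0])
    (fun x y h => by rw [s5 _ _ (by linarith), s5 _ _ (by linarith)]) (convex_Iio ε)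
    (convex_Iio ε) (fun x h y => s2 _ _ h) (fun x h y => s2 _ _ h)
    (fun y h => ⟨tent_lt s0 s1 (Or.inl h), s0⟩) (fun y h => ⟨tent_lt s0 s1 (Or.inr h), s0⟩)

theorem Surface.hcomp_hinv_thin (S : Surface γ₀ γ₁) :
    ThinHomotopic₂ (S.hcomp S.hinv) (Surface.unit (Curve.unit (E := E) q)) := by
  have h := S.hinv.hinv_hcomp_thin
  -- The double inverse of a curve is not definitionally the curve, so the two surfaces have
  -- different types and only their underlying maps are compared.
  have he : (S.hinv.hinv.hcomp S.hinv).toFun = (S.hcomp S.hinv).toFun := by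
    funext z
    simp [Surface.hcomp, Surface.hinv]
  obtain ⟨K, h1, h2, h3⟩ := h
  rw [he] at h2
  exact ⟨K, h1, h2, h3⟩

theorem Surface.hcomp_assoc_thin {γ₂ γ₃ : Curve E q r} {γ₄ γ₅ : Curve E r o} (U : Surface γ₄ γ₅)
    (T : Surface γ₂ γ₃) (S : Surface γ₀ γ₁) :
    ThinHomotopic₂ (U.hcomp (T.hcomp S)) ((U.hcomp T).hcomp S) := by
  obtain ⟨ε₁, s0, s1, s2, s3, s4, s5⟩ := S.sitting
  obtain ⟨ε₂, t0, t1, t2, t3, t4, t5⟩ := T.sitting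
  obtain ⟨ε₃, u0, u1, u2, u3, u4, u5⟩ := U.sitting
  obtain ⟨ε₄, v0, v1, v2, v3, v4, v5⟩ := ((U.hcomp T).hcomp S).sitting
  let ε := min (min ε₁ ε₂) (min ε₃ ε₄) / 2
  have e0 : 0 < ε := by positivity
  have e1 : 2 * ε ≤ ε₁ := by
    have := (min_le_left (min ε₁ ε₂) (min ε₃ ε₄)).trans (min_le_left _ _); simp only [ε]; linarith
  have e2 : 2 * ε ≤ ε₂ := by
    have := (min_le_left (min ε₁ ε₂) (min ε₃ ε₄)).trans (min_le_right _ _); simp only [ε]; linarith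
  have e3 : 2 * ε ≤ ε₃ := by
    have := (min_le_right (min ε₁ ε₂) (min ε₃ ε₄)).trans (min_le_left _ _); simp only [ε]; linarith
  have e4 : 2 * ε ≤ ε₄ := by
    have := (min_le_right (min ε₁ ε₂) (min ε₃ ε₄)).trans (min_le_right _ _); simp only [ε]; linarith
  exact thinHomotopic₂_of_reparam ((U.hcomp T).hcomp S).smooth (φ := rebracket (ε / 8))
    (ψ := fun y => y) (contDiff_rebracket _) contDiff_id
    (fun x y => cat_assoc e0 (by linarith) (a := fun t => S.toFun (t, y))
      (b := fun t => T.toFun (t, y)) (c := fun t => U.toFun (t, y)) (fun t ht => s3 t y (by linarith))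
      (fun t ht => t2 t y (by linarith)) (fun t ht => t3 t y (by linarith))
      (fun t ht => u2 t y (by linarith)) x) (fun x y => rfl) e0 (by linarith)
    (fun x y h => by rw [v4 _ _ (by linarith), v4 _ _ v0])
    (fun x y h => by rw [v5 _ _ (by linarith), v5 _ _ (by linarith)]) (convex_Iio ε₄)
    (convex_Ioi (1 - ε₄)) (fun x h y => v2 _ _ h) (fun x h y => v3 _ _ h)
    (fun y h => ⟨(rebracket_lt e0 h).trans_le e4, mem_Iio.2 (by linarith)⟩)
    (fun y h => ⟨mem_Ioi.2 (by linarith [lt_rebracket e0 (by linarith) h]),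
      mem_Ioi.2 (by linarith)⟩)

/-- Gluing in x and gluing in y are independent case distinctions, so equality holds before passing
to classes. -/
theorem Surface.exchange {γ₂ : Curve E p q} {β₀ β₁ β₂ : Curve E q r} (T' : Surface β₁ β₂)
    (T : Surface β₀ β₁) (S' : Surface γ₁ γ₂) (S : Surface γ₀ γ₁) :
    (T'.vcomp T).hcomp (S'.vcomp S) = (T'.hcomp S').vcomp (T.hcomp S) := by
  refine Surface.eq_of_toFun ?_
  funext z
  dsimp only [Surface.hcomp, Surface.vcomp]
  split_ifs <;> rfl

end Horizontal

end Laws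

end TwoTransport

namespace TwoTransport

/-! ### The path 2-groupoid and its uniqueness. -/

section PathGroupoid

variable {E M : Type*} [NormedAddCommGroup E] [NormedSpace ℝ E]
  [TopologicalSpace M] [ChartedSpace E M] [IsManifold 𝓘(ℝ, E) ∞ M] {p q r s : M}

theorem P₁.exists_cls (a : P₁ E p q) : ∃ γ : Curve E p q, a = γ.cls := by
  obtain ⟨γ, h⟩ := Quot.exists_rep a
  exact ⟨γ, h.symm⟩

theorem P₂.exists_cls (σ : P₂ E p q) :
    ∃ (γ₀ γ₁ : Curve E p q) (S : Surface γ₀ γ₁), σ = S.cls := by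
  obtain ⟨⟨⟨γ₀, γ₁⟩, S⟩, h⟩ := Quot.exists_rep σ
  exact ⟨γ₀, γ₁, S, h.symm⟩

/-- The source of a class of surfaces. -/
def P₂.src : P₂ E p q → P₁ E p q :=
  Quot.lift (fun S => S.1.1.cls) fun _ _ h => Curve.cls_eq_iff.2 h.src

/-- The target of a class of surfaces. -/
def P₂.tgt : P₂ E p q → P₁ E p q :=
  Quot.lift (fun S => S.1.2.cls) fun _ _ h => Curve.cls_eq_iff.2 h.tgt

/-- The composite of classes of curves. -/
noncomputable def P₁.comp : P₁ E q r → P₁ E p q → P₁ E p r :=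
  Quot.lift₂ (fun b a => (b.comp a).cls)
    (fun b _ _ h => Curve.cls_eq_iff.2 (ThinHomotopic₁.comp h (ThinHomotopic₁.refl b)))
    (fun _ _ a h => Curve.cls_eq_iff.2 (ThinHomotopic₁.comp (ThinHomotopic₁.refl a) h))

/-- The inverse of a class of curves. -/
def P₁.inv : P₁ E p q → P₁ E q p :=
  Quot.lift (fun a => a.inv.cls) fun _ _ h => Curve.cls_eq_iff.2 h.inv

/-- The class of the unit surface. -/
def P₁.unit : P₁ E p q → P₂ E p q :=
  Quot.lift (fun a => (Surface.unit a).cls) fun _ _ h => Surface.cls_eq_iff.2 h.unit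

/-- The vertical inverse of a class of surfaces. -/
def P₂.vinv : P₂ E p q → P₂ E p q :=
  Quot.lift (fun S => S.2.vinv.cls) fun _ _ h => Surface.cls_eq_iff.2 h.vinv

/-- The horizontal composite of classes of surfaces. -/
noncomputable def P₂.hcomp : P₂ E q r → P₂ E p q → P₂ E p r :=
  Quot.lift₂ (fun T S => (T.2.hcomp S.2).cls)
    (fun T _ _ h => Surface.cls_eq_iff.2
      (ThinHomotopic₂.hcomp h (Surface.Rel.refl T.2).thinHomotopic₂))
    (fun _ _ S h => Surface.cls_eq_iff.2
      (ThinHomotopic₂.hcomp (Surface.Rel.refl S.2).thinHomotopic₂ h))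

/-- The horizontal inverse of a class of surfaces. -/
def P₂.hinv : P₂ E p q → P₂ E q p :=
  Quot.lift (fun S => S.2.hinv.cls) fun _ _ h => Surface.cls_eq_iff.2 h.hinv

variable [FiniteDimensional ℝ E]

/-- A class of surfaces has a representative with a given source. -/
theorem P₂.exists_cls_of_src (γ₁ : Curve E p q) (τ : P₂ E p q) (h : γ₁.cls = τ.src) :
    ∃ (γ₂ : Curve E p q) (T : Surface γ₁ γ₂), τ = T.cls := by
  obtain ⟨γ₁', γ₂, T, rfl⟩ := τ.exists_cls
  obtain ⟨k, hk⟩ := (Curve.cls_eq_iff.1 h).exists_surface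
  exact ⟨γ₂, T.vcomp k, (Surface.cls_eq_iff.2 (Surface.vcomp_thinHomotopic₂ k hk T)).symm⟩

theorem P₂.exists_composable (τ σ : P₂ E p q) (h : σ.tgt = τ.src) :
    ∃ (γ₀ γ₁ γ₂ : Curve E p q) (T : Surface γ₁ γ₂) (S : Surface γ₀ γ₁), τ = T.cls ∧ σ = S.cls := by
  obtain ⟨γ₀, γ₁, S, rfl⟩ := σ.exists_cls
  obtain ⟨γ₂, T, rfl⟩ := P₂.exists_cls_of_src γ₁ τ h
  exact ⟨γ₀, γ₁, γ₂, T, S, rfl, rfl⟩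

/-- Arbitrary representatives match only up to thin homotopy, so the vertical composite cannot be a
lift to the quotient. Composable representatives are chosen instead; independence of the choice is
`ThinHomotopic₂.vcomp`. -/
theorem P₂.exists_vcomp (τ σ : P₂ E p q) (h : σ.tgt = τ.src) :
    ∃ (ρ : P₂ E p q) (γ₀ γ₁ γ₂ : Curve E p q) (T : Surface γ₁ γ₂) (S : Surface γ₀ γ₁),
      τ = T.cls ∧ σ = S.cls ∧ ρ = (T.vcomp S).cls := by
  obtain ⟨γ₀, γ₁, γ₂, T, S, hT, hS⟩ := P₂.exists_composable τ σ h
  exact ⟨_, γ₀, γ₁, γ₂, T, S, hT, hS, rfl⟩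

/-- The vertical composite of classes of surfaces. -/
noncomputable def P₂.vcomp (τ σ : P₂ E p q) (h : σ.tgt = τ.src) : P₂ E p q :=
  (P₂.exists_vcomp τ σ h).choose

theorem P₂.vcomp_cls {γ₀ γ₁ γ₂ : Curve E p q} (T : Surface γ₁ γ₂) (S : Surface γ₀ γ₁)
    (h : P₂.tgt S.cls = P₂.src T.cls) : P₂.vcomp T.cls S.cls h = (T.vcomp S).cls := by
  obtain ⟨γ₀', γ₁', γ₂', T', S', hT, hS, hρ⟩ := (P₂.exists_vcomp T.cls S.cls h).choose_spec
  exact hρ.trans (Surface.cls_eq_iff.2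
    ((Surface.cls_eq_iff.1 hS).vcomp (Surface.cls_eq_iff.1 hT))).symm

/-- The vertical composite may be computed from classes that are equal to classes of composable
surfaces. -/
theorem P₂.vcomp_eq {γ₀ γ₁ γ₂ : Curve E p q} {T : Surface γ₁ γ₂} {S : Surface γ₀ γ₁}
    {τ σ : P₂ E p q} (h : σ.tgt = τ.src) (hτ : τ = T.cls) (hσ : σ = S.cls) :
    P₂.vcomp τ σ h = (T.vcomp S).cls := by
  subst hτ hσ
  exact P₂.vcomp_cls T S h

theorem Surface.Rel.cls_eq {γ₀ γ₁ : Curve E p q} {S T : Surface γ₀ γ₁} (h : S.Rel T) :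
    S.cls = T.cls :=
  Surface.cls_eq_iff.2 h.thinHomotopic₂

variable (E M) in
/-- The path 2-groupoid. -/
noncomputable def pathTwoGroupoid : StrictTwoGroupoid M (P₁ E) (P₂ E) where
  src := P₂.src
  tgt := P₂.tgt
  id₁ p := (Curve.unit p).cls
  comp₁ := P₁.comp
  inv₁ := P₁.inv
  id₂ := P₁.unit
  vcomp := P₂.vcomp
  vinv := P₂.vinv
  hcomp := P₂.hcomp
  hinv := P₂.hinv
  comp₁_assoc c b a := by
    obtain ⟨a, rfl⟩ := a.exists_cls
    obtain ⟨b, rfl⟩ := b.exists_cls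
    obtain ⟨c, rfl⟩ := c.exists_cls
    exact Curve.cls_eq_iff.2 (Surface.hcomp_assoc_thin (Surface.unit c) (Surface.unit b)
      (Surface.unit a)).symm.src
  comp₁_id₁ a := by
    obtain ⟨a, rfl⟩ := a.exists_cls
    exact Curve.cls_eq_iff.2 (Surface.unit a).hcomp_unit_thin.src
  id₁_comp₁ a := by
    obtain ⟨a, rfl⟩ := a.exists_cls
    exact Curve.cls_eq_iff.2 (Surface.unit a).unit_hcomp_thin.src
  inv₁_comp₁ a := by
    obtain ⟨a, rfl⟩ := a.exists_cls
    exact Curve.cls_eq_iff.2 (Surface.unit a).hinv_hcomp_thin.src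
  comp₁_inv₁ a := by
    obtain ⟨a, rfl⟩ := a.exists_cls
    exact Curve.cls_eq_iff.2 (Surface.unit a).hcomp_hinv_thin.src
  src_id₂ a := by
    obtain ⟨a, rfl⟩ := a.exists_cls
    rfl
  tgt_id₂ a := by
    obtain ⟨a, rfl⟩ := a.exists_cls
    rfl
  src_vcomp τ σ h := by
    obtain ⟨γ₀, γ₁, γ₂, T, S, rfl, rfl⟩ := P₂.exists_composable τ σ h
    rw [P₂.vcomp_cls]
    rfl
  tgt_vcomp τ σ h := by
    obtain ⟨γ₀, γ₁, γ₂, T, S, rfl, rfl⟩ := P₂.exists_composable τ σ h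
    rw [P₂.vcomp_cls]
    rfl
  src_vinv σ := by
    obtain ⟨γ₀, γ₁, S, rfl⟩ := σ.exists_cls
    rfl
  tgt_vinv σ := by
    obtain ⟨γ₀, γ₁, S, rfl⟩ := σ.exists_cls
    rfl
  src_hcomp τ σ := by
    obtain ⟨γ₀, γ₁, S, rfl⟩ := σ.exists_cls
    obtain ⟨γ₂, γ₃, T, rfl⟩ := τ.exists_cls
    rfl
  tgt_hcomp τ σ := by
    obtain ⟨γ₀, γ₁, S, rfl⟩ := σ.exists_cls
    obtain ⟨γ₂, γ₃, T, rfl⟩ := τ.exists_cls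
    rfl
  src_hinv σ := by
    obtain ⟨γ₀, γ₁, S, rfl⟩ := σ.exists_cls
    rfl
  tgt_hinv σ := by
    obtain ⟨γ₀, γ₁, S, rfl⟩ := σ.exists_cls
    rfl
  vcomp_assoc υ τ σ h₁ h₂ := by
    obtain ⟨γ₀, γ₁, γ₂, T, S, rfl, rfl⟩ := P₂.exists_composable τ σ h₁
    obtain ⟨γ₃, U, rfl⟩ := P₂.exists_cls_of_src γ₂ υ h₂
    rw [P₂.vcomp_eq _ (P₂.vcomp_cls U T _) rfl, P₂.vcomp_eq _ rfl (P₂.vcomp_cls T S _)]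
    exact (Surface.vcomp_assoc_rel U T S).symm.cls_eq
  vcomp_id₂ σ := by
    obtain ⟨γ₀, γ₁, S, rfl⟩ := σ.exists_cls
    exact (P₂.vcomp_cls S (Surface.unit γ₀) rfl).trans S.vcomp_unit_rel.cls_eq
  id₂_vcomp σ := by
    obtain ⟨γ₀, γ₁, S, rfl⟩ := σ.exists_cls
    exact (P₂.vcomp_cls (Surface.unit γ₁) S rfl).trans S.unit_vcomp_rel.cls_eq
  vinv_vcomp σ := by
    obtain ⟨γ₀, γ₁, S, rfl⟩ := σ.exists_cls
    exact (P₂.vcomp_cls S.vinv S rfl).trans S.vinv_vcomp_rel.cls_eq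
  vcomp_vinv σ := by
    obtain ⟨γ₀, γ₁, S, rfl⟩ := σ.exists_cls
    exact (P₂.vcomp_cls S S.vinv rfl).trans S.vcomp_vinv_rel.cls_eq
  hcomp_assoc υ τ σ := by
    obtain ⟨γ₀, γ₁, S, rfl⟩ := σ.exists_cls
    obtain ⟨γ₂, γ₃, T, rfl⟩ := τ.exists_cls
    obtain ⟨γ₄, γ₅, U, rfl⟩ := υ.exists_cls
    exact Surface.cls_eq_iff.2 (Surface.hcomp_assoc_thin U T S).symm
  hcomp_id₂ σ := by
    obtain ⟨γ₀, γ₁, S, rfl⟩ := σ.exists_cls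
    exact Surface.cls_eq_iff.2 S.hcomp_unit_thin
  id₂_hcomp σ := by
    obtain ⟨γ₀, γ₁, S, rfl⟩ := σ.exists_cls
    exact Surface.cls_eq_iff.2 S.unit_hcomp_thin
  hinv_hcomp σ := by
    obtain ⟨γ₀, γ₁, S, rfl⟩ := σ.exists_cls
    exact Surface.cls_eq_iff.2 S.hinv_hcomp_thin
  hcomp_hinv σ := by
    obtain ⟨γ₀, γ₁, S, rfl⟩ := σ.exists_cls
    exact Surface.cls_eq_iff.2 S.hcomp_hinv_thin
  hcomp_id₂_id₂ b a := by
    obtain ⟨a, rfl⟩ := a.exists_cls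
    obtain ⟨b, rfl⟩ := b.exists_cls
    rfl
  exchange τ' τ σ' σ hτ hσ := by
    obtain ⟨β₀, β₁, β₂, T', T, rfl, rfl⟩ := P₂.exists_composable τ' τ hτ
    obtain ⟨γ₀, γ₁, γ₂, S', S, rfl, rfl⟩ := P₂.exists_composable σ' σ hσ
    rw [P₂.vcomp_cls, P₂.vcomp_cls]
    refine Eq.trans ?_ (P₂.vcomp_cls (T'.hcomp S') (T.hcomp S) rfl).symm
    rw [← Surface.exchange]
    rfl

theorem isPathTwoGroupoid_pathTwoGroupoid : IsPathTwoGroupoid (pathTwoGroupoid E M) where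
  src_cls _ := rfl
  tgt_cls _ := rfl
  id₁_eq _ := rfl
  comp₁_cls _ _ := rfl
  inv₁_cls _ := rfl
  id₂_cls _ := rfl
  vcomp_cls S₂ S₁ := P₂.vcomp_cls S₂ S₁ rfl
  vinv_cls _ := rfl
  hcomp_cls _ _ := rfl
  hinv_cls _ := rfl

theorem IsPathTwoGroupoid.src_eq {P : StrictTwoGroupoid M (P₁ E) (P₂ E)}
    (hP : IsPathTwoGroupoid P) (σ : P₂ E p q) : P.src σ = σ.src := by
  obtain ⟨γ₀, γ₁, S, rfl⟩ := σ.exists_cls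
  exact hP.src_cls S

theorem IsPathTwoGroupoid.tgt_eq {P : StrictTwoGroupoid M (P₁ E) (P₂ E)}
    (hP : IsPathTwoGroupoid P) (σ : P₂ E p q) : P.tgt σ = σ.tgt := by
  obtain ⟨γ₀, γ₁, S, rfl⟩ := σ.exists_cls
  exact hP.tgt_cls S

theorem IsPathTwoGroupoid.exists_composable {P : StrictTwoGroupoid M (P₁ E) (P₂ E)}
    (hP : IsPathTwoGroupoid P) (τ σ : P₂ E p q) (h : P.tgt σ = P.src τ) :
    ∃ (γ₀ γ₁ γ₂ : Curve E p q) (T : Surface γ₁ γ₂) (S : Surface γ₀ γ₁), τ = T.cls ∧ σ = S.cls :=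
  P₂.exists_composable τ σ ((hP.tgt_eq σ).symm.trans (h.trans (hP.src_eq τ)))

theorem IsPathTwoGroupoid.unique {P Q : StrictTwoGroupoid M (P₁ E) (P₂ E)}
    (hP : IsPathTwoGroupoid P) (hQ : IsPathTwoGroupoid Q) : P = Q := by
  have h1 : @P.src = @Q.src := by
    funext p q σ
    rw [hP.src_eq, hQ.src_eq]
  have h2 : @P.tgt = @Q.tgt := by
    funext p q σ
    rw [hP.tgt_eq, hQ.tgt_eq]
  have h3 : P.id₁ = Q.id₁ := by
    funext p
    rw [hP.id₁_eq, hQ.id₁_eq]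
  have h4 : @P.comp₁ = @Q.comp₁ := by
    funext p q r b a
    obtain ⟨a, rfl⟩ := a.exists_cls
    obtain ⟨b, rfl⟩ := b.exists_cls
    rw [hP.comp₁_cls, hQ.comp₁_cls]
  have h5 : @P.inv₁ = @Q.inv₁ := by
    funext p q a
    obtain ⟨a, rfl⟩ := a.exists_cls
    rw [hP.inv₁_cls, hQ.inv₁_cls]
  have h6 : @P.id₂ = @Q.id₂ := by
    funext p q a
    obtain ⟨a, rfl⟩ := a.exists_cls
    rw [hP.id₂_cls, hQ.id₂_cls]
  -- The vertical composite has a hypothesis in terms of `src` and `tgt`, so it is compared with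
  -- separate hypotheses for `P` and `Q` until these operations have been identified.
  have h7 : ∀ {p q : M} (τ σ : P₂ E p q) (h : P.tgt σ = P.src τ) (h' : Q.tgt σ = Q.src τ),
      P.vcomp τ σ h = Q.vcomp τ σ h' := by
    intro p q τ σ h h'
    obtain ⟨γ₀, γ₁, γ₂, T, S, rfl, rfl⟩ := hP.exists_composable τ σ h
    rw [hP.vcomp_cls, hQ.vcomp_cls]
  have h8 : @P.vinv = @Q.vinv := by
    funext p q σ
    obtain ⟨γ₀, γ₁, S, rfl⟩ := σ.exists_cls
    rw [hP.vinv_cls, hQ.vinv_cls]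
  have h9 : @P.hcomp = @Q.hcomp := by
    funext p q r τ σ
    obtain ⟨γ₀, γ₁, S, rfl⟩ := σ.exists_cls
    obtain ⟨γ₂, γ₃, T, rfl⟩ := τ.exists_cls
    rw [hP.hcomp_cls, hQ.hcomp_cls]
  have h10 : @P.hinv = @Q.hinv := by
    funext p q σ
    obtain ⟨γ₀, γ₁, S, rfl⟩ := σ.exists_cls
    rw [hP.hinv_cls, hQ.hinv_cls]
  clear hP hQ
  cases P
  cases Q
  dsimp only at h1 h2 h3 h4 h5 h6 h7 h8 h9 h10
  subst h1 h2 h3 h4 h5 h6 h8 h9 h10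
  congr 1
  funext p q τ σ h
  exact h7 τ σ h h

end PathGroupoid

/-! ### The 2-functor of parallel transport. -/

section Functor

variable {EG G EH H E M : Type*}
  [NormedAddCommGroup EG] [NormedSpace ℝ EG] [FiniteDimensional ℝ EG]
  [TopologicalSpace G] [ChartedSpace EG G] [Group G] [LieGroup 𝓘(ℝ, EG) ∞ G]
  [NormedAddCommGroup EH] [NormedSpace ℝ EH] [FiniteDimensional ℝ EH]
  [TopologicalSpace H] [ChartedSpace EH H] [Group H] [LieGroup 𝓘(ℝ, EH) ∞ H]
  [NormedAddCommGroup E] [NormedSpace ℝ E] [FiniteDimensional ℝ E]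
  [TopologicalSpace M] [ChartedSpace E M] [IsManifold 𝓘(ℝ, E) ∞ M]
  {C : LieCrossedModule EG G EH H} {θ : DForm E M 1 EG} {Υ : DForm E M 2 EH}

/-- The transport of a class of curves. -/
noncomputable def IsConnectionDoublet.map₁ (h : IsConnectionDoublet C θ Υ) {p q : M} :
    P₁ E p q → G :=
  Quot.lift (transport₁ C θ Υ) fun _ _ k => transport₁_thin h k

/-- The transport of a class of surfaces. -/
noncomputable def IsConnectionDoublet.map₂ (h : IsConnectionDoublet C θ Υ) {p q : M} :
    P₂ E p q → G × H :=
  Quot.lift (fun S => (transport₁ C θ Υ S.1.1, transport₂ C θ Υ S.2)) fun _ _ k =>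
    Prod.ext (transport₁_thin h k.src) (transport₂_thin h k)

/-- The 2-functor of parallel transport. -/
noncomputable def IsConnectionDoublet.functor (h : IsConnectionDoublet C θ Υ)
    {P : StrictTwoGroupoid M (P₁ E) (P₂ E)} (hP : IsPathTwoGroupoid P) :
    StrictTwoFunctor P C.delooping where
  obj _ := ()
  map₁ := h.map₁
  map₂ := h.map₂
  map_src σ := by
    obtain ⟨γ₀, γ₁, S, rfl⟩ := σ.exists_cls
    rw [hP.src_cls]
    rfl
  map_tgt σ := by
    obtain ⟨γ₀, γ₁, S, rfl⟩ := σ.exists_cls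
    rw [hP.tgt_cls]
    exact (transport₁_target h S).symm
  map_id₁ p := by
    rw [hP.id₁_eq]
    exact transport₁_unit h p
  map_comp₁ b a := by
    obtain ⟨a, rfl⟩ := a.exists_cls
    obtain ⟨b, rfl⟩ := b.exists_cls
    rw [hP.comp₁_cls]
    exact transport₁_comp h a b
  map_inv₁ a := by
    obtain ⟨a, rfl⟩ := a.exists_cls
    rw [hP.inv₁_cls]
    exact transport₁_inv h a
  map_id₂ a := by
    obtain ⟨a, rfl⟩ := a.exists_cls
    rw [hP.id₂_cls]
    exact Prod.ext rfl (transport₂_unit h a)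
  map_vcomp τ σ k := by
    obtain ⟨γ₀, γ₁, γ₂, T, S, rfl, rfl⟩ := hP.exists_composable τ σ k
    rw [hP.vcomp_cls]
    exact Prod.ext rfl (transport₂_vcomp h S T)
  map_vinv σ := by
    obtain ⟨γ₀, γ₁, S, rfl⟩ := σ.exists_cls
    rw [hP.vinv_cls]
    exact Prod.ext (transport₁_target h S) (transport₂_vinv h S)
  map_hcomp τ σ := by
    obtain ⟨γ₀, γ₁, S, rfl⟩ := σ.exists_cls
    obtain ⟨γ₂, γ₃, T, rfl⟩ := τ.exists_cls
    rw [hP.hcomp_cls]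
    exact Prod.ext (transport₁_comp h γ₀ γ₂) (transport₂_hcomp h S T)
  map_hinv σ := by
    obtain ⟨γ₀, γ₁, S, rfl⟩ := σ.exists_cls
    rw [hP.hinv_cls]
    exact Prod.ext (transport₁_inv h γ₀) (transport₂_hinv h S)

theorem IsConnectionDoublet.existsUnique_functor (h : IsConnectionDoublet C θ Υ)
    {P : StrictTwoGroupoid M (P₁ E) (P₂ E)} (hP : IsPathTwoGroupoid P) :
    ∃! F : StrictTwoFunctor P C.delooping,
      (∀ {p q : M} (γ : Curve E p q), F.map₁ γ.cls = transport₁ C θ Υ γ) ∧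
      (∀ {p q : M} {γ₀ γ₁ : Curve E p q} (S : Surface γ₀ γ₁),
        F.map₂ S.cls = (transport₁ C θ Υ γ₀, transport₂ C θ Υ S)) := by
  refine ⟨h.functor hP, ⟨fun γ => rfl, fun S => rfl⟩, fun F hF => ?_⟩
  obtain ⟨h1, h2⟩ := hF
  refine StrictTwoFunctor.ext rfl (heq_of_eq ?_) (heq_of_eq ?_)
  · funext p q a
    obtain ⟨a, rfl⟩ := a.exists_cls
    exact h1 a
  · funext p q σ
    obtain ⟨γ₀, γ₁, S, rfl⟩ := σ.exists_cls
    exact h2 S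

end Functor

end TwoTransport

theorem mainTheorem4
    {EG G EH H E M : Type*}
    [NormedAddCommGroup EG] [NormedSpace ℝ EG] [FiniteDimensional ℝ EG]
    [TopologicalSpace G] [ChartedSpace EG G] [Group G] [LieGroup 𝓘(ℝ, EG) ∞ G]
    [NormedAddCommGroup EH] [NormedSpace ℝ EH] [FiniteDimensional ℝ EH]
    [TopologicalSpace H] [ChartedSpace EH H] [Group H] [LieGroup 𝓘(ℝ, EH) ∞ H]
    [NormedAddCommGroup E] [NormedSpace ℝ E] [FiniteDimensional ℝ E]
    [TopologicalSpace M] [ChartedSpace E M] [IsManifold 𝓘(ℝ, E) ∞ M]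
    (C : LieCrossedModule EG G EH H) (θ : DForm E M 1 EG) (Υ : DForm E M 2 EH)
    (hθΥ : IsConnectionDoublet C θ Υ) :
    -- the pulled-back forms are a connection doublet, with a unique associated cocycle
    (∀ {p q : M} {γ₀ γ₁ : Curve E p q} (S : Surface γ₀ γ₁),
      IsConnectionDoublet C (pullback S.toFun θ : DForm (ℝ × ℝ) (ℝ × ℝ) 1 EG)
        (pullback S.toFun Υ : DForm (ℝ × ℝ) (ℝ × ℝ) 2 EH) ∧
      (∃! c : CocycleData G H, SolvesProblem C (pullback S.toFun θ) (pullback S.toFun Υ) c) ∧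
      SolvesProblem C (pullback S.toFun θ) (pullback S.toFun Υ) (surfaceCocycle C θ Υ S) ∧
      IsCocycle C (surfaceCocycle C θ Υ S)) ∧
    -- the 1-parallel transport along a curve does not depend on the surface used to compute it
    (∀ {p q : M} (γ : Curve E p q) (y : ℝ),
      (surfaceCocycle C θ Υ (Surface.unit γ)).f 1 0 y = transport₁ C θ Υ γ) ∧
    (∀ {p q : M} {γ₀ γ₁ : Curve E p q} (S : Surface γ₀ γ₁),
      (surfaceCocycle C θ Υ S).f 1 0 0 = transport₁ C θ Υ γ₀ ∧
      (surfaceCocycle C θ Υ S).f 1 0 1 = transport₁ C θ Υ γ₁ ∧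
      transport₁ C θ Υ γ₁ = C.t (transport₂ C θ Υ S) * transport₁ C θ Υ γ₀) ∧
    -- the laws for curves
    (∀ p : M, transport₁ C θ Υ (Curve.unit (E := E) p) = 1) ∧
    (∀ {p q : M} (γ : Curve E p q), transport₁ C θ Υ γ.inv = (transport₁ C θ Υ γ)⁻¹) ∧
    (∀ {p q r : M} (γ₁ : Curve E p q) (γ₂ : Curve E q r),
      transport₁ C θ Υ (γ₂.comp γ₁) = transport₁ C θ Υ γ₂ * transport₁ C θ Υ γ₁) ∧
    -- the laws for surfaces
    (∀ {p q : M} (γ : Curve E p q), transport₂ C θ Υ (Surface.unit γ) = 1) ∧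
    (∀ {p q : M} {γ₀ γ₁ : Curve E p q} (S : Surface γ₀ γ₁),
      transport₂ C θ Υ S.vinv = (transport₂ C θ Υ S)⁻¹) ∧
    (∀ {p q : M} {γ₀ γ₁ γ₂ : Curve E p q} (S₁ : Surface γ₀ γ₁) (S₂ : Surface γ₁ γ₂),
      transport₂ C θ Υ (S₂.vcomp S₁) = transport₂ C θ Υ S₂ * transport₂ C θ Υ S₁) ∧
    (∀ {p q : M} {γ₀ γ₁ : Curve E p q} (S : Surface γ₀ γ₁),
      transport₂ C θ Υ S.hinv = C.m (transport₁ C θ Υ γ₀)⁻¹ (transport₂ C θ Υ S)⁻¹) ∧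
    (∀ {p q r : M} {γ₀ γ₁ : Curve E p q} {γ₂ γ₃ : Curve E q r}
      (S₁ : Surface γ₀ γ₁) (S₂ : Surface γ₂ γ₃),
      transport₂ C θ Υ (S₂.hcomp S₁) =
        transport₂ C θ Υ S₂ * C.m (transport₁ C θ Υ γ₂) (transport₂ C θ Υ S₁)) ∧
    -- the path 2-groupoid, and the induced strict 2-functor to `B₀(G, H)`
    (∃! P : StrictTwoGroupoid M (P₁ E) (P₂ E), IsPathTwoGroupoid P) ∧
    (∀ P : StrictTwoGroupoid M (P₁ E) (P₂ E), IsPathTwoGroupoid P →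
      ∃! F : StrictTwoFunctor P C.delooping,
        (∀ {p q : M} (γ : Curve E p q), F.map₁ γ.cls = transport₁ C θ Υ γ) ∧
        (∀ {p q : M} {γ₀ γ₁ : Curve E p q} (S : Surface γ₀ γ₁),
          F.map₂ S.cls = (transport₁ C θ Υ γ₀, transport₂ C θ Υ S))) := by
  exact ⟨fun S => ⟨hθΥ.pullback S.smooth, ⟨_, planeCocycle_solves hθΥ S.smooth,
        fun _ hc => hc.unique (planeCocycle_solves hθΥ S.smooth)⟩,
      planeCocycle_solves hθΥ S.smooth, planeCocycle_isCocycle hθΥ S.smooth⟩,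
    fun γ y => unit_f_eq hθΥ γ y,
    fun S => ⟨surface_f_zero hθΥ S, surface_f_one hθΥ S, transport₁_target hθΥ S⟩,
    fun p => transport₁_unit hθΥ p,
    fun γ => transport₁_inv hθΥ γ,
    fun γ₁ γ₂ => transport₁_comp hθΥ γ₁ γ₂,
    fun γ => transport₂_unit hθΥ γ,
    fun S => transport₂_vinv hθΥ S,
    fun S₁ S₂ => transport₂_vcomp hθΥ S₁ S₂,
    fun S => transport₂_hinv hθΥ S,
    fun S₁ S₂ => transport₂_hcomp hθΥ S₁ S₂,
    ⟨pathTwoGroupoid E M, isPathTwoGroupoid_pathTwoGroupoid,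
      fun _ hP => hP.unique isPathTwoGroupoid_pathTwoGroupoid⟩,
    fun _ hP => hθΥ.existsUnique_functor hP⟩
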